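/- Let $X\subset\mathbb{P}^1\times\mathbb{P}^1\times\mathbb{P}^2$ be the smooth Fano threefold over $\mathbb{C}$ (family 3.17) given by $$x_0y_0z_2+x_1y_1z_0=x_0y_1z_1+x_1y_0z_1,$$ with coordinates $([x_0:x_1],[y_0:y_1],[z_0:z_1:z_2])$. Let $E_1,E_2\subset X$ be the surfaces contracted by the projections $\pi_1,\pi_2\colon X\to\mathbb{P}^1\times\mathbb{P}^2$ to $([x_0:x_1],[z_0:z_1:z_2])$ and $([y_0:y_1],[z_0:z_1:z_2])$, that is $E_1=\{x_0z_2=x_1z_1,\ x_1z_0=x_0z_1\}$ and $E_2=\{y_0z_2=y_1z_1,\ y_1z_0=y_0z_1\}$. Let $C=E_1\cap E_2$ and let $R=\{x_0y_1=x_1y_0\}\subset X$ be the preimage of the diagonal of $\mathbb{P}^1\times\mathbb{P}^1$. Let $f\colon\widetilde X\to X$ be the blow-up of $C$, let $E$ be its exceptional surface, and let $\widetilde R$ be the proper transform of $R$. The group $\mathrm{Aut}(X)$ acts on $\widetilde X$; let $C'\subset E$ be the $\mathrm{Aut}(X)$-invariant irreducible curve different from $E\cap\widetilde R$. Let $g\colon\widehat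 X\to\widetilde X$ be the blow-up of $C'$, let $R'$ be its exceptional surface, and let $\widehat E$ be the proper transform of $E$ on $\widehat X$. Let $a,b$ be positive integers, let $\nu\colon Y\to\widehat X$ be the weighted blow-up of the curve $\widehat E\cap R'$ for which the local equation of $R'$ has weight $a$ and the local equation of $\widehat E$ has weight $b$, and let $F$ be the exceptional surface of $\nu$. For a prime divisor $D$ on a normal variety $V$ with a birational morphism $\eta\colon V\to X$, put $$A_X(D)=1+\mathrm{ord}_D\big(K_V-\eta^*K_X\big),\qquad S_X(D)=\frac{1}{(-K_X)^3}\int_0^\infty\mathrm{vol}\big(\eta^*(-K_X)-xD\big)\,dx,\qquad \beta(D)=A_X(D)-S_X(D).$$ Then $$S_X(F)\leqslant(2a+b)\,S_X(E)\qquad\text{and}\qquad\beta(F)>0.$$ -/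

import Mathlib

open CategoryTheory CategoryTheory.Limits AlgebraicGeometry TopologicalSpace
open scoped ENNReal

namespace Family317

noncomputable section

/-! ### Complex schemes, rational functions and rational three-forms -/

/-- The base `Spec ℂ`. -/
abbrev SpecC : Scheme.{0} := Spec (CommRingCat.of ℂ)

/-- The function field of an integral scheme over `ℂ` is a `ℂ`-algebra. -/
instance functionFieldAlgebra (Y : Scheme.{0}) [IsIntegral Y] [Y.Over SpecC] :
    Algebra ℂ Y.functionField :=
  ((Y.presheaf.germ ⊤ (genericPoint Y) trivial).hom.comp
    ((Y ↘ SpecC).appTop.hom.comp (Scheme.ΓSpecIso (CommRingCat.of ℂ)).inv.hom)).toAlgebra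

/-- Rational 3-forms: the third exterior power over `K(Y)` of the Kähler differentials of
`K(Y)` over `ℂ`. -/
abbrev RationalForms (Y : Scheme.{0}) [IsIntegral Y] [Y.Over SpecC] : Type :=
  ⋀[Y.functionField]^3 Ω[Y.functionField⁄ℂ]

/-- The local ring of `Y` at `P`, as a subring of the function field. -/
def localRing (Y : Scheme.{0}) [IsIntegral Y] (P : Y) : Subring Y.functionField :=
  (algebraMap (Y.presheaf.stalk P) Y.functionField).range

/-- For `η : Y ⟶ X`, the image in the rational 3-forms on `Y` of the stalk at `P` of the pulled
back sheaf `η^* Ω³_X`: the `𝒪_{Y,P}`-module generated by the forms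
`η^*(dg₀ ∧ dg₁ ∧ dg₂)` with `g₀, g₁, g₂ ∈ 𝒪_{X,η(P)}`. -/
def pulledBackForms {Y X : Scheme.{0}} [IsIntegral Y] [Y.Over SpecC] (η : Y ⟶ X) (P : Y) :
    Submodule (localRing Y P) (RationalForms Y) :=
  Submodule.span (localRing Y P)
    (Set.range fun g : Fin 3 → X.presheaf.stalk (η P) =>
      exteriorPower.ιMulti Y.functionField 3 fun l =>
        KaehlerDifferential.D ℂ Y.functionField
          (algebraMap (Y.presheaf.stalk P) Y.functionField ((η.stalkMap P).hom (g l))))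

/-- The coefficient at the prime divisor with generic point `P` of the divisor `η^* K_X`, where
`K_X` is represented by the divisor of a nonzero rational 3-form `ω`: the order along `P` of `ω`
with respect to a local generator of `η^* Ω³_X`.
For `η = 𝟙 Y` this is the coefficient of `K_Y = div ω`. -/
def canonicalCoeff {Y X : Scheme.{0}} [IsIntegral Y] [IsLocallyNoetherian Y] [Y.Over SpecC]
    (η : Y ⟶ X) (ω : RationalForms Y) (P : Y) : ℤ :=
  sSup {n : ℤ | ∃ (h : Y.functionField) (μ : RationalForms Y),
    h ≠ 0 ∧ μ ∈ pulledBackForms η P ∧ ω = h • μ ∧ Scheme.ord h P = n}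

/-- A nonzero rational 3-form on `Y` (when there is one). Nothing below depends on the choice, as
any two of them differ by a rational function. -/
def someForm (Y : Scheme.{0}) [IsIntegral Y] [Y.Over SpecC] : RationalForms Y :=
  Classical.epsilon fun ω => ω ≠ 0

/-! ### Volumes, log discrepancies and the invariants `S` and `β` -/

/-- The dimension of `H⁰(Y, 𝒪_Y(⌊D⌋))` for a Weil `ℝ`-divisor `D` on a normal variety, given by
its coefficients at the points of codimension one: the space of rational functions `f` with
`f = 0` or `div f + D ≥ 0`. -/
def h0 (Y : Scheme.{0}) [IsIntegral Y] [IsLocallyNoetherian Y] [Y.Over SpecC] (D : Y → ℝ) : ℕ :=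
  Set.finrank ℂ {f : Y.functionField |
    f ≠ 0 → ∀ P : Y, Order.coheight P = 1 → 0 ≤ (Scheme.ord f P : ℝ) + D P}

/-- The volume of an `ℝ`-divisor on a threefold: `limsup h⁰(⌊m D⌋) / (m³ / 3!)`. -/
def vol (Y : Scheme.{0}) [IsIntegral Y] [IsLocallyNoetherian Y] [Y.Over SpecC]
    (D : Y → ℝ) : ℝ≥0∞ :=
  Filter.limsup (fun m : ℕ => (h0 Y (fun P => (m : ℝ) * D P) : ℝ≥0∞) / ((m : ℝ≥0∞) ^ 3 / 6))
    Filter.atTop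

/-- The divisor `η^*(-K_X)` on `Y`. -/
def antiCan {Y X : Scheme.{0}} [IsIntegral Y] [IsLocallyNoetherian Y] [Y.Over SpecC]
    (η : Y ⟶ X) : Y → ℝ :=
  fun P => -(canonicalCoeff η (someForm Y) P : ℝ)

/-- The prime divisor on `Y` with generic point `ξ`. -/
def primeDiv {Y : Scheme.{0}} (ξ : Y) : Y → ℝ :=
  Set.indicator {ξ} fun _ => 1

/-- `S_X(F) = (1 / (-K_X)³) ∫₀^∞ vol(η^*(-K_X) - x F) dx`, where `F` is the prime divisor on `Y`
with generic point `ξ`. The degree `(-K_X)³` of the Fano threefold `X` is the volume of `-K_X`. -/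
def SInv {Y X : Scheme.{0}} [IsIntegral Y] [IsLocallyNoetherian Y] [Y.Over SpecC]
    [IsIntegral X] [IsLocallyNoetherian X] [X.Over SpecC] (η : Y ⟶ X) (ξ : Y) : ℝ≥0∞ :=
  (∫⁻ x in Set.Ioi (0 : ℝ), vol Y (antiCan η - x • primeDiv ξ)) / vol X (antiCan (𝟙 X))

/-- The log discrepancy `A_X(F) = 1 + ord_F(K_Y - η^* K_X)`, where `F` is the prime divisor on `Y`
with generic point `ξ`. -/
def logDiscrepancy {Y X : Scheme.{0}} [IsIntegral Y] [IsLocallyNoetherian Y] [Y.Over SpecC]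
    (η : Y ⟶ X) (ξ : Y) : ℤ :=
  1 + (canonicalCoeff (𝟙 Y) (someForm Y) ξ - canonicalCoeff η (someForm Y) ξ)

/-- `β(F) = A_X(F) - S_X(F)`. It takes values in the extended reals, so that it would be `-∞` if
`S_X(F)` were infinite. -/
def betaInv {Y X : Scheme.{0}} [IsIntegral Y] [IsLocallyNoetherian Y] [Y.Over SpecC]
    [IsIntegral X] [IsLocallyNoetherian X] [X.Over SpecC] (η : Y ⟶ X) (ξ : Y) : EReal :=
  ((logDiscrepancy η ξ : ℝ) : EReal) - (SInv η ξ : EReal)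

/-! ### Blow-ups -/

/-- An ideal sheaf is invertible if it is locally generated by one regular element. -/
def IsInvertibleIdeal {T : Scheme.{0}} (I : T.IdealSheafData) : Prop :=
  ∀ t : T, ∃ U : T.affineOpens, t ∈ U.1 ∧
    ∃ s ∈ nonZeroDivisors Γ(T, U.1), I.ideal U = Ideal.span {s}

/-- `f` is the blow-up of the ideal sheaf `I`: the inverse image of `I` is invertible, and `f` is
universal with this property. -/
def IsBlowup {T' T : Scheme.{0}} (f : T' ⟶ T) (I : T.IdealSheafData) : Prop :=
  IsInvertibleIdeal (I.comap f) ∧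
    ∀ (W : Scheme.{0}) (g : W ⟶ T), IsInvertibleIdeal (I.comap g) → ∃! h : W ⟶ T', h ≫ f = g

/-- For effective divisors with ideal sheaves `I_A`, `I_B` and positive weights `a`, `b`, the
ideal sheaf generated by the `I_A^i I_B^j` with `a i + b j ≥ n`. -/
def weightedIdeal {T : Scheme.{0}} (IA IB : T.IdealSheafData) (a b n : ℕ) : T.IdealSheafData :=
  ⨆ p : {p : ℕ × ℕ // n ≤ a * p.1 + b * p.2}, IA ^ p.1.1 * IB ^ p.1.2

/-- `θ` is the weighted blow-up of `A ∩ B` for which the equation of `A` has weight `a` and the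
equation of `B` has weight `b`, that is `Proj` of the algebra `⨁ₙ 𝔞ₙ`, where `𝔞ₙ` is the weighted
ideal above. The Veronese subalgebra `⨁ₖ 𝔞_{abk}` is generated by its part with `k = 1`, so this is
the blow-up of `𝔞_{ab}`. -/
def IsWeightedBlowup {T' T : Scheme.{0}} (θ : T' ⟶ T) (IA IB : T.IdealSheafData) (a b : ℕ) :
    Prop :=
  IsBlowup θ (weightedIdeal IA IB a b (a * b))

/-- The proper transform under `f` of a closed subset `A`, where `f` is a blow-up with centre
`Z`. -/
def properTransform {T' T : Scheme.{0}} (f : T' ⟶ T) (Z A : Closeds T) : Closeds T' :=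
  Closeds.closure (f ⁻¹' ((A : Set T) \ (Z : Set T)))

/-- For `f : T' ⟶ X`, a subset of `T'` is invariant under (the lift to `T'` of) the group
`Aut(X)` of automorphisms of `X` over `ℂ`. -/
def IsAutInvariant {T' X : Scheme.{0}} [X.Over SpecC] (f : T' ⟶ X) (A : Set T') : Prop :=
  ∀ (σ : X ≅ X) (τ : T' ≅ T'), σ.hom.IsOver SpecC → τ.hom ≫ f = f ≫ σ.hom →
    τ.hom ⁻¹' A = A

/-! ### The product `ℙ¹ × ℙ¹ × ℙ²` and loci given by multihomogeneous equations -/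

/-- The grading of `ℂ[x₀, …, xₙ]` by degree. -/
abbrev grading (n : ℕ) : ℕ → Submodule ℂ (MvPolynomial (Fin (n + 1)) ℂ) :=
  MvPolynomial.homogeneousSubmodule (Fin (n + 1)) ℂ

instance (n : ℕ) : GradedAlgebra (grading n) := MvPolynomial.gradedAlgebra

/-- Complex projective space of dimension `n`. -/
abbrev PP (n : ℕ) : Scheme.{0} := Proj (grading n)

/-- The structure morphism of projective space. -/
def PPstr (n : ℕ) : PP n ⟶ SpecC :=
  Proj.toSpecZero (grading n) ≫ Spec.map (CommRingCat.ofHom (algebraMap ℂ (grading n 0)))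

/-- The standard affine chart `x_i ≠ 0`. -/
def PPchart (n : ℕ) (i : Fin (n + 1)) : (PP n).Opens :=
  Proj.basicOpen (grading n) (MvPolynomial.X i)

/-- The affine coordinate `x_j / x_i` on the chart `x_i ≠ 0`. -/
def PPcoord (n : ℕ) (i j : Fin (n + 1)) : Γ(PP n, PPchart n i) :=
  (Proj.awayToSection (grading n) (MvPolynomial.X i)).hom
    (HomogeneousLocalization.Away.mk (grading n)
      (MvPolynomial.isHomogeneous_X ℂ i : MvPolynomial.X i ∈ grading n 1) 1 (MvPolynomial.X j)
      (MvPolynomial.isHomogeneous_X ℂ j))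

/-- `ℙ¹ × (ℙ¹ × ℙ²)` over `ℂ`. -/
def PPP : Scheme.{0} :=
  pullback (PPstr 1) (pullback.fst (PPstr 1) (PPstr 2) ≫ PPstr 1)

/-- Three morphisms to `ℙ¹`, `ℙ¹` and `ℙ²`. -/
structure Coords (T : Scheme.{0}) where
  p : T ⟶ PP 1
  q : T ⟶ PP 1
  r : T ⟶ PP 2

/-- The three projections of `ℙ¹ × ℙ¹ × ℙ²`. -/
def PPPcoords : Coords PPP where
  p := pullback.fst _ _
  q := pullback.snd _ _ ≫ pullback.fst _ _
  r := pullback.snd _ _ ≫ pullback.snd _ _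

instance : PPP.Over SpecC := ⟨PPPcoords.p ≫ PPstr 1⟩

/-- Composition with a morphism `g`. -/
def Coords.comp {T' T : Scheme.{0}} (g : T' ⟶ T) (c : Coords T) : Coords T' where
  p := g ≫ c.p
  q := g ≫ c.q
  r := g ≫ c.r

/-- The open subset of `T` on which `x_i`, `y_j` and `z_k` do not vanish. -/
def Coords.chart {T : Scheme.{0}} (c : Coords T) (i j : Fin 2) (k : Fin 3) : T.Opens :=
  c.p ⁻¹ᵁ PPchart 1 i ⊓ c.q ⁻¹ᵁ PPchart 1 j ⊓ c.r ⁻¹ᵁ PPchart 2 k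

/-- The homogeneous coordinates: `x_l`, `y_l` and `z_l`. -/
abbrev HomCoord : Type := Fin 2 ⊕ Fin 2 ⊕ Fin 3

/-- The functions `x_l / x_i`, `y_l / y_j`, `z_l / z_k` on the chart with indices `i, j, k`. -/
def Coords.ratio {T : Scheme.{0}} (c : Coords T) (i j : Fin 2) (k : Fin 3) :
    HomCoord → Γ(T, c.chart i j k)
  | Sum.inl l => (T.presheaf.map (homOfLE (inf_le_left.trans inf_le_left)).op).hom
      ((c.p.app (PPchart 1 i)).hom (PPcoord 1 i l))
  | Sum.inr (Sum.inl l) => (T.presheaf.map (homOfLE (inf_le_left.trans inf_le_right)).op).hom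
      ((c.q.app (PPchart 1 j)).hom (PPcoord 1 j l))
  | Sum.inr (Sum.inr l) => (T.presheaf.map (homOfLE inf_le_right).op).hom
      ((c.r.app (PPchart 2 k)).hom (PPcoord 2 k l))

/-- The multihomogeneous form `G`, dehomogenized on the chart with indices `i, j, k`. -/
def Coords.dehom {T : Scheme.{0}} (c : Coords T) (G : MvPolynomial HomCoord ℤ)
    (i j : Fin 2) (k : Fin 3) : Γ(T, c.chart i j k) :=
  MvPolynomial.aeval (c.ratio i j k) G

/-- The ideal sheaf on `T` of the closed subscheme `G = 0`, for a multihomogeneous form `G`: its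
sections over `U` are the functions that on each `U ∩ {x_i y_j z_k ≠ 0}` are multiples of the
dehomogenization of `G`. -/
def Coords.ideal {T : Scheme.{0}} (c : Coords T) (G : MvPolynomial HomCoord ℤ) :
    T.IdealSheafData :=
  Scheme.IdealSheafData.ofIdeals fun U =>
    ⨅ (i : Fin 2) (j : Fin 2) (k : Fin 3),
      Ideal.comap
        (T.presheaf.map (homOfLE (inf_le_left : U.1 ⊓ c.chart i j k ≤ U.1)).op).hom
        (Ideal.span {(T.presheaf.map
          (homOfLE (inf_le_right : U.1 ⊓ c.chart i j k ≤ c.chart i j k)).op).hom (c.dehom G i j k)})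

/-! ### The threefold and its subvarieties -/

/-- The coordinates on the first projective line. -/
abbrev cx (l : Fin 2) : MvPolynomial HomCoord ℤ := MvPolynomial.X (Sum.inl l)
/-- The coordinates on the second projective line. -/
abbrev cy (l : Fin 2) : MvPolynomial HomCoord ℤ := MvPolynomial.X (Sum.inr (Sum.inl l))
/-- The coordinates on the projective plane. -/
abbrev cz (l : Fin 3) : MvPolynomial HomCoord ℤ := MvPolynomial.X (Sum.inr (Sum.inr l))

/-- The ideal sheaf of the divisor `x₀ y₀ z₂ + x₁ y₁ z₀ = x₀ y₁ z₁ + x₁ y₀ z₁`. -/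
def idealX : PPP.IdealSheafData :=
  PPPcoords.ideal (cx 0 * cy 0 * cz 2 + cx 1 * cy 1 * cz 0 - cx 0 * cy 1 * cz 1 - cx 1 * cy 0 * cz 1)

section

variable {X : Scheme.{0}} (i : X ⟶ PPP)

/-- The ideal sheaf on `X` of the surface `E₁` contracted by `π₁ : X ⟶ ℙ¹ × ℙ²`, `(x, y, z) ↦ (x, z)`.
The equation of `X` is `y₀ (x₀ z₂ - x₁ z₁) + y₁ (x₁ z₀ - x₀ z₁) = 0`, so the positive-dimensional
fibres of `π₁` are those over the curve `x₀ z₂ - x₁ z₁ = x₁ z₀ - x₀ z₁ = 0`. -/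
def idealE₁ : X.IdealSheafData :=
  (PPPcoords.comp i).ideal (cx 0 * cz 2 - cx 1 * cz 1) ⊔
    (PPPcoords.comp i).ideal (cx 1 * cz 0 - cx 0 * cz 1)

/-- The ideal sheaf on `X` of the surface `E₂` contracted by `π₂ : X ⟶ ℙ¹ × ℙ²`, `(x, y, z) ↦ (y, z)`. -/
def idealE₂ : X.IdealSheafData :=
  (PPPcoords.comp i).ideal (cy 0 * cz 2 - cy 1 * cz 1) ⊔
    (PPPcoords.comp i).ideal (cy 1 * cz 0 - cy 0 * cz 1)

/-- The ideal sheaf of the curve `C = E₁ ∩ E₂`. -/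
def idealC : X.IdealSheafData := idealE₁ i ⊔ idealE₂ i

/-- The curve `C`. -/
def curveC : Closeds X := (idealC i).support

/-- The surface `R`, the preimage of the diagonal of `ℙ¹ × ℙ¹`. -/
def surfaceR : Closeds X := ((PPPcoords.comp i).ideal (cx 0 * cy 1 - cx 1 * cy 0)).support

variable {X₁ : Scheme.{0}} (f : X₁ ⟶ X)

/-- The exceptional surface `E` of the blow-up `f` of `C`. -/
def surfaceE : Closeds X₁ := ((idealC i).comap f).support

/-- The proper transform of `R` under the blow-up `f` of `C`. -/
def surfaceRtilde : Closeds X₁ := properTransform f (curveC i) (surfaceR i)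

/-- `C'` is an irreducible curve in `E` that is invariant under `Aut(X)` and is different from
`E ∩ R̃`. -/
def IsCurveC' [X.Over SpecC] (C' : Closeds X₁) : Prop :=
  C' ≤ surfaceE i f ∧ IsIrreducible (C' : Set X₁) ∧ topologicalKrullDim (C' : Set X₁) = 1 ∧
    IsAutInvariant f (C' : Set X₁) ∧ C' ≠ surfaceE i f ⊓ surfaceRtilde i f

variable (C' : Closeds X₁) {X₂ : Scheme.{0}} (g : X₂ ⟶ X₁)

/-- The ideal sheaf of the reduced curve `C'`. -/
def idealC' : X₁.IdealSheafData := Scheme.IdealSheafData.vanishingIdeal C'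

/-- The ideal sheaf of the exceptional surface `R'` of the blow-up `g` of `C'`. -/
def idealR' : X₂.IdealSheafData := (idealC' C').comap g

/-- The ideal sheaf of the proper transform `Ê` of `E` under the blow-up `g` of `C'`. -/
def idealEhat : X₂.IdealSheafData :=
  Scheme.IdealSheafData.vanishingIdeal (properTransform g C' (surfaceE i f))

end

end

end Family317

open Family317

namespace Family317

noncomputable section

section

/-! ### Pulling back ideal sheaves to affine schemes -/

/-- The ideal of `B` defining the pull-back of the ideal sheaf `I` along `u : Spec B ⟶ T`. -/
def pullbackIdeal {T : Scheme.{0}} {B : CommRingCat.{0}} (I : T.IdealSheafData) (u : Spec B ⟶ T) :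
    Ideal B :=
  ((I.comap u).ideal ⟨⊤, isAffineOpen_top _⟩).comap (Scheme.ΓSpecIso B).inv.hom

lemma pullbackIdeal_comap {T T' : Scheme.{0}} {B : CommRingCat.{0}} (I : T.IdealSheafData)
    (f : T' ⟶ T) (u : Spec B ⟶ T') :
    pullbackIdeal (I.comap f) u = pullbackIdeal I (u ≫ f) := by
  simp only [pullbackIdeal, Scheme.IdealSheafData.comap_comp]

/-- The ideal sheaf on `Spec B` defined by an ideal of `B`. -/
def idealSheafOf {B : CommRingCat.{0}} (a : Ideal B) : (Spec B).IdealSheafData :=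
  Scheme.IdealSheafData.ofIdealTop (a.comap (Scheme.ΓSpecIso B).hom.hom)

lemma comap_iso_comap {A B : CommRingCat.{0}} (e : A ≅ B) (I : Ideal A) :
    (I.comap e.inv.hom).comap e.hom.hom = I := by
  rw [Ideal.comap_comap, ← CommRingCat.hom_comp, e.hom_inv_id]
  exact Ideal.comap_id I

lemma pullbackIdeal_id_idealSheafOf {B : CommRingCat.{0}} (a : Ideal B) :
    pullbackIdeal (idealSheafOf a) (𝟙 _) = a := by
  simp only [pullbackIdeal, idealSheafOf, Scheme.IdealSheafData.comap_id]
  have := Scheme.IdealSheafData.equivOfIsAffine.apply_symm_apply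
    (a.comap (Scheme.ΓSpecIso B).hom.hom)
  simp only [Scheme.IdealSheafData.equivOfIsAffine_apply,
    Scheme.IdealSheafData.equivOfIsAffine_symm_apply] at this
  rw [this]
  exact comap_iso_comap (Scheme.ΓSpecIso B).symm a

lemma idealSheafOf_pullbackIdeal_id {B : CommRingCat.{0}} (J : (Spec B).IdealSheafData) :
    idealSheafOf (pullbackIdeal J (𝟙 _)) = J := by
  apply Scheme.IdealSheafData.ext_of_isAffine
  have := Scheme.IdealSheafData.equivOfIsAffine.apply_symm_apply
    ((pullbackIdeal J (𝟙 _)).comap (Scheme.ΓSpecIso B).hom.hom)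
  simp only [Scheme.IdealSheafData.equivOfIsAffine_apply,
    Scheme.IdealSheafData.equivOfIsAffine_symm_apply] at this
  rw [idealSheafOf, this, pullbackIdeal, Scheme.IdealSheafData.comap_id]
  exact comap_iso_comap (Scheme.ΓSpecIso B) _

lemma idealSheafOf_ideal_top {B : CommRingCat.{0}} (a : Ideal B) :
    (idealSheafOf a).ideal ⟨⊤, isAffineOpen_top _⟩ = a.comap (Scheme.ΓSpecIso B).hom.hom :=
  Scheme.IdealSheafData.equivOfIsAffine.apply_symm_apply
    (a.comap (Scheme.ΓSpecIso B).hom.hom)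

lemma comap_eq_idealSheafOf {T : Scheme.{0}} {B : CommRingCat.{0}} (I : T.IdealSheafData)
    (u : Spec B ⟶ T) : I.comap u = idealSheafOf (pullbackIdeal I u) := by
  conv_rhs => rw [← Category.id_comp u, ← pullbackIdeal_comap, idealSheafOf_pullbackIdeal_id]

lemma idealSheafOf_le_iff {B : CommRingCat.{0}} (a b : Ideal B) :
    idealSheafOf a ≤ idealSheafOf b ↔ a ≤ b := by
  constructor
  · intro h
    rw [← pullbackIdeal_id_idealSheafOf a, ← pullbackIdeal_id_idealSheafOf b]
    simp only [pullbackIdeal, Scheme.IdealSheafData.comap_id]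
    exact Ideal.comap_mono (h _)
  · intro h
    apply Scheme.IdealSheafData.le_of_isAffine
    rw [idealSheafOf_ideal_top, idealSheafOf_ideal_top]
    exact Ideal.comap_mono h

lemma idealSheafOf_map {B B' : CommRingCat.{0}} (φ : B ⟶ B') (b : Ideal B') :
    (idealSheafOf b).map (Spec.map φ) = idealSheafOf (b.comap φ.hom) := by
  apply Scheme.IdealSheafData.ext_of_isAffine
  rw [Scheme.IdealSheafData.ideal_map_of_isAffineHom, idealSheafOf_ideal_top]
  refine (congrArg (Ideal.comap _) (idealSheafOf_ideal_top b)).trans ?_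
  ext x
  simp only [Ideal.mem_comap]
  have := congrArg (fun ψ => ψ.hom x) (Scheme.ΓSpecIso_naturality φ)
  simp only [CommRingCat.hom_comp, RingHom.comp_apply] at this
  rw [← this]
  rfl

lemma pullbackIdeal_map {T : Scheme.{0}} {B B' : CommRingCat.{0}} (I : T.IdealSheafData)
    (u : Spec B ⟶ T) (φ : B ⟶ B') :
    pullbackIdeal I (Spec.map φ ≫ u) = (pullbackIdeal I u).map φ.hom := by
  have key : ∀ b : Ideal B', pullbackIdeal I (Spec.map φ ≫ u) ≤ b ↔
      (pullbackIdeal I u).map φ.hom ≤ b := by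
    intro b
    rw [← idealSheafOf_le_iff, ← comap_eq_idealSheafOf, Scheme.IdealSheafData.comap_comp,
      ← Scheme.IdealSheafData.le_map_iff_comap_le, idealSheafOf_map, comap_eq_idealSheafOf,
      idealSheafOf_le_iff, Ideal.map_le_iff_le_comap]
  exact le_antisymm ((key _).2 le_rfl) ((key _).1 le_rfl)

lemma fromSpec_appLE_top {T : Scheme.{0}} {U : T.Opens} (hU : IsAffineOpen U)
    (e : ⊤ ≤ hU.fromSpec ⁻¹ᵁ U) :
    hU.fromSpec.appLE U ⊤ e = (Scheme.ΓSpecIso Γ(T, U)).inv := by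
  rw [Scheme.Hom.appLE, hU.fromSpec_app_self, Category.assoc, ← Functor.map_comp]
  exact (congrArg _ ((Spec Γ(T, U)).presheaf.map_id _)).trans (Category.comp_id _)

lemma pullbackIdeal_fromSpec {T : Scheme.{0}} (I : T.IdealSheafData) (U : T.affineOpens) :
    pullbackIdeal I (IsAffineOpen.fromSpec U.2) = I.ideal U := by
  have hU : IsAffineOpen U.1 := U.2
  have hVU : hU.fromSpec ''ᵁ ⊤ = U.1 := by
    rw [Scheme.Hom.image_top_eq_opensRange, hU.opensRange_fromSpec]
  have h3 : (Scheme.ΓSpecIso Γ(T, U.1)).inv ≫ (hU.fromSpec.appIso ⊤).inv =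
      T.presheaf.map (homOfLE hVU.le).op := by
    rw [← fromSpec_appLE_top hU hU.fromSpec_preimage_self.ge, Scheme.Hom.appLE_appIso_inv]
  have h4 : (Scheme.ΓSpecIso Γ(T, U.1)).inv ≫ (hU.fromSpec.appIso ⊤).inv ≫
      T.presheaf.map (homOfLE hVU.ge).op = 𝟙 _ := by
    rw [← Category.assoc, h3, ← Functor.map_comp]
    exact T.presheaf.map_id _
  set V : T.affineOpens := ⟨hU.fromSpec ''ᵁ ⊤, (isAffineOpen_top _).image_of_isOpenImmersion _⟩
  have hmem : ∀ x : Γ(T, U.1), x ∈ pullbackIdeal I hU.fromSpec ↔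
      (hU.fromSpec.appIso ⊤).inv.hom ((Scheme.ΓSpecIso Γ(T, U.1)).inv.hom x) ∈ I.ideal V := by
    intro x
    rw [pullbackIdeal, Ideal.mem_comap]
    have := Scheme.IdealSheafData.ideal_comap_of_isOpenImmersion I hU.fromSpec
      ⟨⊤, isAffineOpen_top _⟩
    exact (Ideal.ext_iff.1 this _).trans Ideal.mem_comap
  ext x
  refine (hmem x).trans ⟨fun h => ?_, fun h => ?_⟩
  · have h2 := I.ideal_le_comap_ideal (U := U) (V := V) hVU.ge h
    rw [Ideal.mem_comap] at h2
    have h5 := congrArg (fun ψ => ψ.hom x) h4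
    simp only [CommRingCat.hom_comp, RingHom.comp_apply, CommRingCat.hom_id,
      RingHom.id_apply] at h5
    rw [← h5]
    exact h2
  · have h2 := I.ideal_le_comap_ideal (U := V) (V := U) hVU.le h
    rw [Ideal.mem_comap] at h2
    have h5 := congrArg (fun ψ => ψ.hom x) h3
    simp only [CommRingCat.hom_comp, RingHom.comp_apply] at h5
    rw [h5]
    exact h2

/-- The ring homomorphism `Γ(T, U) ⟶ B` given by a morphism `Spec B ⟶ T` with image in `U`. -/
def evalOn {T : Scheme.{0}} {B : CommRingCat.{0}} (u : Spec B ⟶ T) (U : T.Opens)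
    (h : ⊤ ≤ u ⁻¹ᵁ U) : Γ(T, U) ⟶ B :=
  u.appLE U ⊤ h ≫ (Scheme.ΓSpecIso B).hom

lemma SpecMap_evalOn_fromSpec {T : Scheme.{0}} {B : CommRingCat.{0}} (u : Spec B ⟶ T)
    {U : T.Opens} (hU : IsAffineOpen U) (h : ⊤ ≤ u ⁻¹ᵁ U) :
    Spec.map (evalOn u U h) ≫ hU.fromSpec = u := by
  have := IsAffineOpen.SpecMap_appLE_fromSpec u hU (isAffineOpen_top _) h
  rw [IsAffineOpen.fromSpec_top, Iso.eq_inv_comp, Scheme.isoSpec_Spec_hom] at this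
  rw [evalOn, Spec.map_comp, Category.assoc, this]

lemma pullbackIdeal_eq_map {T : Scheme.{0}} {B : CommRingCat.{0}} (I : T.IdealSheafData)
    (u : Spec B ⟶ T) (U : T.affineOpens) (h : ⊤ ≤ u ⁻¹ᵁ U.1) :
    pullbackIdeal I u = (I.ideal U).map (evalOn u U.1 h).hom := by
  conv_lhs => rw [← SpecMap_evalOn_fromSpec u U.2 h]
  rw [pullbackIdeal_map, pullbackIdeal_fromSpec]

lemma exists_affine_of_isLocalRing {T : Scheme.{0}} {B : CommRingCat.{0}} [IsLocalRing B]
    (u : Spec B ⟶ T) (W : T.Opens) (hW : u (IsLocalRing.closedPoint B) ∈ W) :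
    ∃ U : T.affineOpens, U.1 ≤ W ∧ ⊤ ≤ u ⁻¹ᵁ U.1 := by
  obtain ⟨_, ⟨U, hU, rfl⟩, hxU, hle⟩ := T.isBasis_affineOpens.exists_subset_of_mem_open
    hW W.isOpen
  exact ⟨⟨U, hU⟩, hle, (Scheme.preimage_eq_top_of_closedPoint_mem u hxU).ge⟩

lemma mem_support_iff_pullbackIdeal_le {T : Scheme.{0}} {B : CommRingCat.{0}}
    (I : T.IdealSheafData) (u : Spec B ⟶ T) (x : Spec B) :
    u x ∈ I.support ↔ pullbackIdeal I u ≤ x.asIdeal := by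
  have h1 : u x ∈ I.support ↔ x ∈ (I.comap u).support := by
    rw [Scheme.IdealSheafData.support_comap]; rfl
  rw [h1, comap_eq_idealSheafOf, Scheme.IdealSheafData.mem_support_iff_of_mem
    (U := ⟨⊤, isAffineOpen_top _⟩) (by trivial), idealSheafOf_ideal_top, Scheme.mem_zeroLocus_iff]
  constructor
  · intro h b hb
    by_contra hbx
    refine h ((Scheme.ΓSpecIso B).inv.hom b) ?_ ?_
    · have h2 : (Scheme.ΓSpecIso B).hom.hom ((Scheme.ΓSpecIso B).inv.hom b) = b := by
        rw [← RingHom.comp_apply, ← CommRingCat.hom_comp, Iso.inv_hom_id]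
        rfl
      exact Ideal.mem_comap.2 (h2.symm ▸ hb)
    · exact (SetLike.ext_iff.1 (basicOpen_eq_of_affine b) x).2 hbx
  · intro h f hf hx
    rw [basicOpen_eq_of_affine'] at hx
    exact hx (h hf)

lemma closedPoint_mem_support_iff {T : Scheme.{0}} {B : CommRingCat.{0}} [IsLocalRing B]
    (I : T.IdealSheafData) (u : Spec B ⟶ T) :
    u (IsLocalRing.closedPoint B) ∈ I.support ↔
      pullbackIdeal I u ≤ IsLocalRing.maximalIdeal B :=
  mem_support_iff_pullbackIdeal_le I u _

lemma pullbackIdeal_sup {T : Scheme.{0}} {B : CommRingCat.{0}} [IsLocalRing B]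
    (I J : T.IdealSheafData) (u : Spec B ⟶ T) :
    pullbackIdeal (I ⊔ J) u = pullbackIdeal I u ⊔ pullbackIdeal J u := by
  obtain ⟨U, -, hU⟩ := exists_affine_of_isLocalRing u ⊤ trivial
  simp only [pullbackIdeal_eq_map _ u U hU, ← Ideal.map_sup]
  rfl

lemma pullbackIdeal_weightedIdeal {T : Scheme.{0}} {B : CommRingCat.{0}} [IsLocalRing B]
    (I J : T.IdealSheafData) (a b n : ℕ) (u : Spec B ⟶ T) :
    pullbackIdeal (weightedIdeal I J a b n) u =
      ⨆ p : {p : ℕ × ℕ // n ≤ a * p.1 + b * p.2},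
        pullbackIdeal I u ^ p.1.1 * pullbackIdeal J u ^ p.1.2 := by
  obtain ⟨U, -, hU⟩ := exists_affine_of_isLocalRing u ⊤ trivial
  simp only [pullbackIdeal_eq_map _ u U hU, ← Ideal.map_pow, ← Ideal.map_mul, ← Ideal.map_iSup]
  congr 1
  rw [weightedIdeal, Scheme.IdealSheafData.ideal_iSup, iSup_apply]
  rfl

/-! ### Invertible ideal sheaves and blow-ups -/

lemma isInvertibleIdeal_comap {T : Scheme.{0}} {B : CommRingCat.{0}} [IsDomain B]
    (I : T.IdealSheafData) (u : Spec B ⟶ T) (s : B) (hs : s ≠ 0)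
    (h : pullbackIdeal I u = Ideal.span {s}) : IsInvertibleIdeal (I.comap u) := by
  intro t
  refine ⟨⟨⊤, isAffineOpen_top _⟩, trivial, (Scheme.ΓSpecIso B).inv.hom s, ?_, ?_⟩
  · have : IsDomain Γ(Spec B, ⊤) := MulEquiv.isDomain B
      (Scheme.ΓSpecIso B).commRingCatIsoToRingEquiv.toMulEquiv
    refine mem_nonZeroDivisors_of_ne_zero fun h0 => hs ?_
    exact (Scheme.ΓSpecIso B).symm.commRingCatIsoToRingEquiv.injective (h0.trans (map_zero _).symm)
  · rw [comap_eq_idealSheafOf, idealSheafOf_ideal_top, h]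
    have h1 : Ideal.span {(Scheme.ΓSpecIso B).inv.hom s} =
        (Ideal.span {s}).map (Scheme.ΓSpecIso B).commRingCatIsoToRingEquiv.symm := by
      rw [Ideal.map_span, Set.image_singleton]; rfl
    exact (Ideal.comap_symm (Scheme.ΓSpecIso B).commRingCatIsoToRingEquiv.symm).trans h1.symm

lemma IsInvertibleIdeal.exists_pullbackIdeal_eq {T : Scheme.{0}} {J : T.IdealSheafData}
    (hJ : IsInvertibleIdeal J) {B : CommRingCat.{0}} [IsLocalRing B] (v : Spec B ⟶ T) :
    ∃ s, pullbackIdeal J v = Ideal.span {s} := by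
  obtain ⟨U, hU, s, -, hs⟩ := hJ (v (IsLocalRing.closedPoint B))
  have h := (Scheme.preimage_eq_top_of_closedPoint_mem v hU).ge
  exact ⟨(evalOn v U.1 h).hom s, by
    rw [pullbackIdeal_eq_map J v U h, hs, Ideal.map_span, Set.image_singleton]⟩

lemma le_preimage_fromSpecStalk {T : Scheme.{0}} {x : T} {U : T.Opens} (hx : x ∈ U) :
    ⊤ ≤ (T.fromSpecStalk x) ⁻¹ᵁ U :=
  (Scheme.preimage_eq_top_of_closedPoint_mem _ (by rwa [Scheme.fromSpecStalk_closedPoint])).ge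

lemma evalOn_fromSpecStalk {T : Scheme.{0}} (x : T) (U : T.Opens) (hx : x ∈ U) :
    evalOn (T.fromSpecStalk x) U (le_preimage_fromSpecStalk hx) = T.presheaf.germ U x hx := by
  rw [evalOn, Scheme.Hom.appLE, Scheme.fromSpecStalk_app hx]
  simp only [Category.assoc]
  rw [← Functor.map_comp_assoc]
  have h : (Spec (T.presheaf.stalk x)).presheaf.map ((homOfLE
    (le_top : (T.fromSpecStalk x) ⁻¹ᵁ U ≤ ⊤)).op ≫ (homOfLE (le_preimage_fromSpecStalk hx)).op) =
      𝟙 _ := (Spec (T.presheaf.stalk x)).presheaf.map_id _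
  rw [h]
  exact (congrArg _ (Category.id_comp _)).trans
    ((congrArg _ (Iso.inv_hom_id _)).trans (Category.comp_id _))

lemma evalOn_SpecMap {T : Scheme.{0}} {B B' : CommRingCat.{0}} (u : Spec B ⟶ T) (φ : B ⟶ B')
    (U : T.Opens) (h : ⊤ ≤ u ⁻¹ᵁ U) (h' : ⊤ ≤ (Spec.map φ ≫ u) ⁻¹ᵁ U) :
    evalOn (Spec.map φ ≫ u) U h' = evalOn u U h ≫ φ := by
  have h1 : (Spec.map φ ≫ u).appLE U ⊤ h' = u.appLE U ⊤ h ≫ (Spec.map φ).appTop := by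
    rw [Scheme.Hom.appTop, Scheme.Hom.app_eq_appLE]
    exact (Scheme.Hom.appLE_comp_appLE _ _ _ _ _ _ _).symm
  rw [evalOn, evalOn, h1, Category.assoc, Category.assoc, Scheme.ΓSpecIso_naturality]

lemma pullbackIdeal_fromSpecStalk {T : Scheme.{0}} (I : T.IdealSheafData) (x : T)
    (U : T.affineOpens) (hx : x ∈ U.1) :
    pullbackIdeal I (T.fromSpecStalk x) = (I.ideal U).map (T.presheaf.germ U.1 x hx).hom := by
  rw [pullbackIdeal_eq_map I _ U (le_preimage_fromSpecStalk hx), evalOn_fromSpecStalk x U.1 hx]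

lemma exists_mul_mem_of_germ_mem {T : Scheme.{0}} (I : T.IdealSheafData) (x : T)
    (U : T.affineOpens) (hx : x ∈ U.1) (a : Γ(T, U.1))
    (ha : (T.presheaf.germ U.1 x hx).hom a ∈ pullbackIdeal I (T.fromSpecStalk x)) :
    ∃ c : Γ(T, U.1), x ∈ T.basicOpen c ∧ c * a ∈ I.ideal U := by
  rw [pullbackIdeal_fromSpecStalk I x U hx] at ha
  let := T.presheaf.algebra_section_stalk (⟨x, hx⟩ : U.1)
  have hloc := U.2.isLocalization_stalk ⟨x, hx⟩
  obtain ⟨⟨⟨j, hj⟩, d⟩, h⟩ := (IsLocalization.mem_map_algebraMap_iff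
    (U.2.primeIdealOf ⟨x, hx⟩).asIdeal.primeCompl (T.presheaf.stalk x)).1 ha
  obtain ⟨c, hc⟩ := (IsLocalization.eq_iff_exists (U.2.primeIdealOf ⟨x, hx⟩).asIdeal.primeCompl
    (T.presheaf.stalk x)).1 ((map_mul _ _ _).trans h)
  refine ⟨c * d, ?_, ?_⟩
  · rw [Scheme.mem_basicOpen _ _ _ hx]
    exact IsLocalization.map_units (T.presheaf.stalk x) (c * d)
  · have : (c : Γ(T, U.1)) * d * a = c * j := by rw [← hc]; ring
    rw [this]
    exact Ideal.mul_mem_left _ _ hj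

lemma le_of_pullbackIdeal_le {T : Scheme.{0}} {I J : T.IdealSheafData}
    (h : ∀ x : T, pullbackIdeal I (T.fromSpecStalk x) ≤ pullbackIdeal J (T.fromSpecStalk x)) :
    I ≤ J := by
  intro U a ha
  have hU : IsAffineOpen U.1 := U.2
  let 𝔮 : Ideal Γ(T, U.1) := (J.ideal U).colon {a}
  by_contra hcon
  have hne : 𝔮 ≠ ⊤ := by
    intro h1
    have := (Ideal.eq_top_iff_one _).1 h1
    simp [𝔮, Submodule.mem_colon_singleton] at this
    exact hcon this
  obtain ⟨𝔪, hm, hle⟩ := Ideal.exists_le_maximal 𝔮 hne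
  let y : Spec Γ(T, U.1) := ⟨𝔪, hm.isPrime⟩
  have hy : hU.fromSpec y ∈ U.1 := by
    have := Set.mem_range_self (f := hU.fromSpec) y
    rwa [hU.range_fromSpec] at this
  obtain ⟨c, hc, hcm⟩ := exists_mul_mem_of_germ_mem J (hU.fromSpec y) U hy a
    (h _ (by rw [pullbackIdeal_fromSpecStalk I _ U hy]; exact Ideal.mem_map_of_mem _ ha))
  have h2 : c ∈ 𝔪 := hle (by
    rw [Submodule.mem_colon_singleton]; exact hcm)
  have h3 : y ∈ hU.fromSpec ⁻¹ᵁ T.basicOpen c := hc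
  rw [hU.fromSpec_preimage_basicOpen] at h3
  exact h3 h2

lemma eq_of_pullbackIdeal_eq {T : Scheme.{0}} {I J : T.IdealSheafData}
    (h : ∀ x : T, pullbackIdeal I (T.fromSpecStalk x) = pullbackIdeal J (T.fromSpecStalk x)) :
    I = J :=
  le_antisymm (le_of_pullbackIdeal_le fun x => (h x).le) (le_of_pullbackIdeal_le fun x => (h x).ge)

/-- An element of the stalk of an ideal sheaf extends to a section vanishing on the support. -/
lemma exists_section_of_mem_pullbackIdeal {T : Scheme.{0}} (J : T.IdealSheafData) (x : T)
    (a : T.presheaf.stalk x) (ha : a ∈ pullbackIdeal J (T.fromSpecStalk x)) :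
    ∃ (W : T.Opens) (hx : x ∈ W) (e : Γ(T, W)), (T.presheaf.germ W x hx).hom e = a ∧
      ∀ y ∈ W, y ∈ J.support → y ∉ T.basicOpen e := by
  obtain ⟨W, hxW, e, rfl⟩ := T.presheaf.exists_germ_eq a
  obtain ⟨_, ⟨U, hU, rfl⟩, hxU, hUW⟩ := T.isBasis_affineOpens.exists_subset_of_mem_open
    hxW W.isOpen
  let e' : Γ(T, U) := (T.presheaf.map (homOfLE hUW).op).hom e
  have he' : (T.presheaf.germ U x hxU).hom e' = (T.presheaf.germ W x hxW).hom e :=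
    T.presheaf.germ_res_apply (homOfLE hUW) x hxU e
  obtain ⟨c, hc, hce⟩ := exists_mul_mem_of_germ_mem J x ⟨U, hU⟩ hxU e' (he' ▸ ha)
  refine ⟨T.basicOpen c, hc, (T.presheaf.map (homOfLE (T.basicOpen_le c)).op).hom e', ?_, ?_⟩
  · rw [← he']
    exact T.presheaf.germ_res_apply _ x hc e'
  · intro y hy hyJ hye
    rw [Scheme.mem_basicOpen _ _ _ hy] at hye
    have hyU : y ∈ U := T.basicOpen_le c hy
    have h1 : (T.presheaf.germ _ y hy).hom ((T.presheaf.map (homOfLE (T.basicOpen_le c)).op).hom e')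
        = (T.presheaf.germ U y hyU).hom e' := T.presheaf.germ_res_apply _ y hy e'
    have h2 := (Scheme.IdealSheafData.mem_support_iff_of_mem (U := ⟨U, hU⟩) hyU).1 hyJ
    rw [Scheme.mem_zeroLocus_iff] at h2
    refine h2 _ hce ?_
    rw [Scheme.mem_basicOpen _ _ _ hyU, map_mul]
    rw [Scheme.mem_basicOpen _ _ _ hyU] at hy
    exact hy.mul (h1 ▸ hye)

lemma germ_mem_pullbackIdeal_vanishingIdeal {T : Scheme.{0}} (S : Set T) (x : T) (W : T.Opens)
    (hx : x ∈ W) (e : Γ(T, W)) (he : ∀ y ∈ W, y ∈ S → y ∉ T.basicOpen e) :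
    (T.presheaf.germ W x hx).hom e ∈ pullbackIdeal
      (Scheme.IdealSheafData.vanishingIdeal (Closeds.closure S)) (T.fromSpecStalk x) := by
  obtain ⟨_, ⟨U, hU, rfl⟩, hxU, hUW⟩ := T.isBasis_affineOpens.exists_subset_of_mem_open
    hx W.isOpen
  let e' : Γ(T, U) := (T.presheaf.map (homOfLE hUW).op).hom e
  have he' : (T.presheaf.germ U x hxU).hom e' = (T.presheaf.germ W x hx).hom e :=
    T.presheaf.germ_res_apply (homOfLE hUW) x hxU e
  rw [← he', pullbackIdeal_fromSpecStalk _ x ⟨U, hU⟩ hxU]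
  refine Ideal.mem_map_of_mem _ ?_
  rw [Scheme.IdealSheafData.vanishingIdeal_ideal]
  refine (PrimeSpectrum.mem_vanishingIdeal _ _).2 fun p hp => ?_
  by_contra hcon
  have h1 : p ∈ PrimeSpectrum.basicOpen e' := hcon
  rw [← hU.fromSpec_preimage_basicOpen] at h1
  have h2 : hU.fromSpec p ∈ T.basicOpen e := by
    have := T.basicOpen_res e (homOfLE hUW).op
    have h3 : hU.fromSpec p ∈ T.basicOpen e' := h1
    rw [this] at h3
    exact h3.2
  have h3 : hU.fromSpec p ∈ closure S := hp
  obtain ⟨y, hy1, hy2⟩ := mem_closure_iff.1 h3 _ (T.basicOpen e).isOpen h2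
  exact he y (T.basicOpen_le e hy1) hy2 hy1

lemma pullbackIdeal_vanishingIdeal_closure_singleton {T : Scheme.{0}} (x : T) :
    pullbackIdeal (Scheme.IdealSheafData.vanishingIdeal (Closeds.closure {x}))
      (T.fromSpecStalk x) = IsLocalRing.maximalIdeal (T.presheaf.stalk x) := by
  apply le_antisymm
  · rw [← closedPoint_mem_support_iff, Scheme.fromSpecStalk_closedPoint]
    have : x ∈ ((Scheme.IdealSheafData.vanishingIdeal (Closeds.closure {x})).support : Set T) := by
      rw [Scheme.IdealSheafData.coe_support_vanishingIdeal]
      exact subset_closure rfl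
    exact this
  · intro a ha
    obtain ⟨W, hxW, e, rfl⟩ := T.presheaf.exists_germ_eq a
    refine germ_mem_pullbackIdeal_vanishingIdeal {x} x W hxW e ?_
    rintro y hy rfl hye
    rw [Scheme.mem_basicOpen _ _ _ hy] at hye
    exact ha hye

end

section

/-! ### Points of projective space in homogeneous coordinates -/

lemma isHomogeneous_eval₂_mul {σ R S : Type*} [CommSemiring R] [CommSemiring S] (f : R →+* S)
    {p : MvPolynomial σ R} {d : ℕ} (hp : p.IsHomogeneous d) (c : S) (g : σ → S) :
    p.eval₂ f (fun j => c * g j) = c ^ d * p.eval₂ f g := by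
  rw [MvPolynomial.eval₂_eq, MvPolynomial.eval₂_eq, Finset.mul_sum]
  refine Finset.sum_congr rfl fun e he => ?_
  have h1 : ∑ j ∈ e.support, e j = d := by
    have := hp (MvPolynomial.mem_support_iff.1 he)
    rw [← this, Finsupp.weight_apply, Finsupp.sum]
    simp
  simp only [mul_pow, Finset.prod_mul_distrib, Finset.prod_pow_eq_pow_sum, h1]
  ring

variable {n : ℕ}

lemma X_mem_grading (i : Fin (n + 1)) : (MvPolynomial.X i : MvPolynomial (Fin (n + 1)) ℂ) ∈
    grading n 1 :=
  (MvPolynomial.mem_homogeneousSubmodule 1 _).2 (MvPolynomial.isHomogeneous_X ℂ i)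

lemma isAffineOpen_PPchart (i : Fin (n + 1)) : IsAffineOpen (PPchart n i) :=
  Proj.isAffineOpen_basicOpen (grading n) _ (X_mem_grading i) one_pos

/-- The homogeneous localization as the coordinate ring of a standard chart. -/
def PPsec (n : ℕ) (i : Fin (n + 1)) :
    CommRingCat.of (HomogeneousLocalization.Away (grading n) (MvPolynomial.X i)) ⟶
      Γ(PP n, PPchart n i) :=
  Proj.awayToSection (grading n) (MvPolynomial.X i)

/-- The constants in the coordinate ring of a standard chart. -/
def PPconst (n : ℕ) (i : Fin (n + 1)) : CommRingCat.of ℂ ⟶ Γ(PP n, PPchart n i) :=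
  CommRingCat.ofHom (algebraMap ℂ (grading n 0)) ≫
    CommRingCat.ofHom (HomogeneousLocalization.fromZeroRingHom (grading n) _) ≫ PPsec n i

/-- The inclusion of a standard chart. -/
def PPι (n : ℕ) (i : Fin (n + 1)) :
    Spec (CommRingCat.of (HomogeneousLocalization.Away (grading n) (MvPolynomial.X i))) ⟶ PP n :=
  Proj.awayι (grading n) (MvPolynomial.X i) (X_mem_grading i) one_pos

lemma PPι_PPstr (i : Fin (n + 1)) : PPι n i ≫ PPstr n =
    Spec.map (CommRingCat.ofHom (algebraMap ℂ (grading n 0)) ≫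
      CommRingCat.ofHom (HomogeneousLocalization.fromZeroRingHom (grading n) _)) := by
  rw [PPι, PPstr, Proj.awayι_toSpecZero_assoc, ← Spec.map_comp]

lemma fromSpec_eq_PPι (i : Fin (n + 1)) :
    (isAffineOpen_PPchart i).fromSpec = Spec.map (PPsec n i) ≫ PPι n i := by
  have h1 : (Proj.basicOpen (grading n) (MvPolynomial.X i)).ι =
      (Proj.basicOpenToSpec (grading n) (MvPolynomial.X i)) ≫
        Proj.awayι (grading n) (MvPolynomial.X i) (X_mem_grading i)
          one_pos := by
    unfold Proj.awayι
    rw [← Proj.basicOpenIsoSpec_hom _ _ (X_mem_grading i) one_pos,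
      Iso.hom_inv_id_assoc]
  have h2 : (isAffineOpen_PPchart i).isoSpec.hom ≫ (isAffineOpen_PPchart i).fromSpec =
    (PPchart n i).ι := by rw [IsAffineOpen.isoSpec_hom, IsAffineOpen.toSpecΓ_fromSpec]
  refine (cancel_epi (isAffineOpen_PPchart i).isoSpec.hom).1 (h2.trans ?_)
  rw [IsAffineOpen.isoSpec_hom, ← Category.assoc]
  exact h1

lemma fromSpec_PPstr (i : Fin (n + 1)) :
    (isAffineOpen_PPchart i).fromSpec ≫ PPstr n = Spec.map (PPconst n i) := by
  rw [fromSpec_eq_PPι, Category.assoc, PPι_PPstr, ← Spec.map_comp, Category.assoc]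
  rfl

instance isIso_PPsec (i : Fin (n + 1)) : IsIso (PPsec n i) :=
  (Proj.basicOpenIsoAway (grading n) _ (X_mem_grading i) one_pos).isIso_hom

/-- The affine coordinates in `Away`. -/
def awayCoord (n : ℕ) (i j : Fin (n + 1)) :
    HomogeneousLocalization.Away (grading n) (MvPolynomial.X i) :=
  HomogeneousLocalization.Away.mk (grading n) (X_mem_grading i) 1 (MvPolynomial.X j)
    (X_mem_grading j)

lemma away_mk_eq_eval₂ (i : Fin (n + 1)) (d : ℕ) (p : MvPolynomial (Fin (n + 1)) ℂ)
    (hp : p ∈ grading n (d • 1)) :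
    HomogeneousLocalization.Away.mk (grading n) (X_mem_grading i) d p hp =
    p.eval₂ ((HomogeneousLocalization.fromZeroRingHom (grading n)
      (.powers (MvPolynomial.X i))).comp (algebraMap ℂ (grading n 0))) (awayCoord n i) := by
  apply HomogeneousLocalization.val_injective
  let L := Localization.Away (MvPolynomial.X i : MvPolynomial (Fin (n + 1)) ℂ)
  let v : HomogeneousLocalization.Away (grading n) (MvPolynomial.X i) →+* L := algebraMap _ _
  let al : MvPolynomial (Fin (n + 1)) ℂ →+* L := algebraMap _ _
  have hu : IsUnit (al (MvPolynomial.X i)) := IsLocalization.Away.algebraMap_isUnit _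
  have hv : ∀ z, v z = z.val := fun z => rfl
  have hmk : ∀ (k : ℕ) q hq, al (MvPolynomial.X i) ^ k *
      v (HomogeneousLocalization.Away.mk (grading n) (X_mem_grading i) k q hq) = al q := by
    intro k q hq
    rw [hv, HomogeneousLocalization.Away.val_mk, Localization.mk_eq_mk', ← map_pow]
    exact IsLocalization.mk'_spec' (M := .powers (MvPolynomial.X i)) L q _
  have h2 : ∀ c, v (((HomogeneousLocalization.fromZeroRingHom (grading n)
      (.powers (MvPolynomial.X i))).comp (algebraMap ℂ (grading n 0))) c) =
      al (MvPolynomial.C c) := fun c => Localization.mk_one_eq_algebraMap _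
  have h3 : ∀ j, al (MvPolynomial.X i) * v (awayCoord n i j) = al (MvPolynomial.X j) := by
    intro j
    have := hmk 1 (MvPolynomial.X j) (X_mem_grading j)
    rwa [pow_one] at this
  refine (hu.pow d).mul_left_cancel ((hmk d p hp).trans ?_)
  refine Eq.trans ?_ (congrArg _ (MvPolynomial.hom_eval₂ p _ v _).symm)
  rw [← isHomogeneous_eval₂_mul _ (d := d) (by simpa using hp)]
  simp only [h3]
  have h4 : v.comp ((HomogeneousLocalization.fromZeroRingHom (grading n)
      (.powers (MvPolynomial.X i))).comp (algebraMap ℂ (grading n 0))) =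
      al.comp MvPolynomial.C := RingHom.ext h2
  rw [h4]
  have h5 := MvPolynomial.hom_eval₂ p (MvPolynomial.C) al MvPolynomial.X
  rw [MvPolynomial.eval₂_eta] at h5
  exact h5

lemma PP_eval_eq (i : Fin (n + 1)) {B : CommRingCat.{0}} (ε : Γ(PP n, PPchart n i) ⟶ B) (d : ℕ)
    (p : MvPolynomial (Fin (n + 1)) ℂ) (hp : p ∈ grading n (d • 1)) :
    ε.hom ((PPsec n i).hom
      (HomogeneousLocalization.Away.mk (grading n) (X_mem_grading i) d p hp)) =
    p.eval₂ (PPconst n i ≫ ε).hom (fun j => ε.hom (PPcoord n i j)) := by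
  rw [away_mk_eq_eval₂]
  exact (MvPolynomial.hom_eval₂ p _ (PPsec n i ≫ ε).hom _)

lemma PP_hom_ext (i : Fin (n + 1)) {B : CommRingCat.{0}} {ε ε' : Γ(PP n, PPchart n i) ⟶ B}
    (hc : PPconst n i ≫ ε = PPconst n i ≫ ε')
    (h : ∀ j, ε.hom (PPcoord n i j) = ε'.hom (PPcoord n i j)) : ε = ε' := by
  refine (cancel_epi (PPsec n i)).1 ?_
  ext z
  obtain ⟨d, p, hp, rfl⟩ := HomogeneousLocalization.Away.mk_surjective (grading n)
    (X_mem_grading i) z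
  refine (PP_eval_eq i ε d p hp).trans (Eq.trans ?_ (PP_eval_eq i ε' d p hp).symm)
  rw [hc]
  congr 1
  exact funext h

lemma PPcoord_self (i : Fin (n + 1)) : PPcoord n i i = 1 := by
  refine (congrArg (PPsec n i).hom ?_).trans (map_one _)
  refine (away_mk_eq_eval₂ i 1 (MvPolynomial.X i) (X_mem_grading i)).trans ?_
  apply HomogeneousLocalization.val_injective
  rw [MvPolynomial.eval₂_X, awayCoord, HomogeneousLocalization.Away.val_mk,
    HomogeneousLocalization.val_one]
  exact (congrArg _ (Subtype.ext (pow_one _))).trans (Localization.mk_self (⟨MvPolynomial.X i, ⟨1, pow_one _⟩⟩ : Submonoid.powers (MvPolynomial.X i : MvPolynomial (Fin (n + 1)) ℂ)))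

/-- The ring homomorphism on a standard chart with prescribed values of the coordinates. -/
lemma exists_PP_hom (i : Fin (n + 1)) {B : CommRingCat.{0}} (φ : CommRingCat.of ℂ ⟶ B)
    (b : Fin (n + 1) → B) (hb : IsUnit (b i)) :
    ∃ ε : Γ(PP n, PPchart n i) ⟶ B, PPconst n i ≫ ε = φ ∧
      ∀ j, b j = b i * ε.hom (PPcoord n i j) := by
  let L := Localization.Away (MvPolynomial.X i : MvPolynomial (Fin (n + 1)) ℂ)
  let ev : MvPolynomial (Fin (n + 1)) ℂ →+* B := MvPolynomial.eval₂Hom φ.hom b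
  have hev : IsUnit (ev (MvPolynomial.X i)) := by simpa [ev] using hb
  let l : L →+* B := IsLocalization.Away.lift (MvPolynomial.X i) hev
  have hl : ∀ p, l (algebraMap _ L p) = ev p := IsLocalization.Away.lift_eq _ hev
  let v : HomogeneousLocalization.Away (grading n) (MvPolynomial.X i) →+* L := algebraMap _ _
  let ψ : CommRingCat.of (HomogeneousLocalization.Away (grading n) (MvPolynomial.X i)) ⟶ B :=
    CommRingCat.ofHom (l.comp v)
  have hψ : PPsec n i ≫
      inv (PPsec n i) ≫ ψ = ψ :=
    IsIso.hom_inv_id_assoc _ _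
  refine ⟨inv (PPsec n i) ≫ ψ, ?_, fun j => ?_⟩
  · rw [PPconst, Category.assoc, Category.assoc, hψ]
    ext c
    have h0 : (Localization.mk (MvPolynomial.C c) 1 : L) = algebraMap _ L (MvPolynomial.C c) :=
      Localization.mk_one_eq_algebraMap _
    exact (congrArg l h0).trans ((hl _).trans
      (MvPolynomial.eval₂Hom_C φ.hom b c))
  · have h1 : (inv (PPsec n i) ≫ ψ).hom (PPcoord n i j) =
        l (v (awayCoord n i j)) := congrArg (fun χ => χ.hom (awayCoord n i j)) hψ
    have h2 : b i = l (algebraMap (MvPolynomial (Fin (n + 1)) ℂ) L (MvPolynomial.X i)) :=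
      ((hl _).trans (MvPolynomial.eval₂Hom_X' φ.hom b i)).symm
    have h3 : b j = l (algebraMap (MvPolynomial (Fin (n + 1)) ℂ) L (MvPolynomial.X j)) :=
      ((hl _).trans (MvPolynomial.eval₂Hom_X' φ.hom b j)).symm
    rw [h1, h2, h3, ← map_mul]
    congr 1
    have : v (awayCoord n i j) = Localization.mk (MvPolynomial.X j)
      ⟨MvPolynomial.X i ^ 1, by use 1⟩ := rfl
    rw [this, Localization.mk_eq_mk', mul_comm]
    have h4 := IsLocalization.mk'_spec (M := .powers (MvPolynomial.X i)) L (MvPolynomial.X j :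
      MvPolynomial (Fin (n + 1)) ℂ) ⟨MvPolynomial.X i ^ 1, by use 1⟩
    simp only [pow_one] at h4 ⊢
    exact h4.symm

lemma PPcoord_map_mul (i j k : Fin (n + 1)) :
    ((PP n).presheaf.map (homOfLE (inf_le_left : PPchart n i ⊓ PPchart n j ≤ PPchart n i)).op).hom
      (PPcoord n i k) =
    ((PP n).presheaf.map (homOfLE (inf_le_left : PPchart n i ⊓ PPchart n j ≤ PPchart n i)).op).hom
      (PPcoord n i j) *
    ((PP n).presheaf.map (homOfLE (inf_le_right : PPchart n i ⊓ PPchart n j ≤ PPchart n j)).op).hom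
      (PPcoord n j k) := by
  apply Subtype.ext
  funext x
  apply HomogeneousLocalization.val_injective
  change (Localization.mk (MvPolynomial.X k) _ : Localization _) =
    HomogeneousLocalization.val (HomogeneousLocalization.mapId _ _ (awayCoord n i j) *
      HomogeneousLocalization.mapId _ _ (awayCoord n j k))
  rw [HomogeneousLocalization.val_mul]
  change _ = (Localization.mk (MvPolynomial.X j) _ : Localization _) *
    (Localization.mk (MvPolynomial.X k) _ : Localization _)
  rw [Localization.mk_mul, Localization.mk_eq_mk_iff, Localization.r_iff_exists]
  refine ⟨1, ?_⟩
  simp only [OneMemClass.coe_one, one_mul, Submonoid.coe_mul]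
  change (MvPolynomial.X i ^ 1 * MvPolynomial.X j ^ 1) * _ = MvPolynomial.X i ^ 1 * _
  ring


lemma evalOn_map {T : Scheme.{0}} {B : CommRingCat.{0}} (u : Spec B ⟶ T) {U V : T.Opens}
    (hVU : V ≤ U) (hV : ⊤ ≤ u ⁻¹ᵁ V) (x : Γ(T, U)) :
    (evalOn u V hV).hom ((T.presheaf.map (homOfLE hVU).op).hom x) =
      (evalOn u U (hV.trans (fun _ h => hVU h))).hom x := by
  have := Scheme.Hom.map_appLE u hV (homOfLE hVU).op
  exact congrArg (fun χ => (Scheme.ΓSpecIso B).hom.hom (χ.hom x)) this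

lemma evalOn_app {T T' : Scheme.{0}} {B : CommRingCat.{0}} (u : Spec B ⟶ T) (f : T ⟶ T')
    (U : T'.Opens) (h : ⊤ ≤ (u ≫ f) ⁻¹ᵁ U) (h' : ⊤ ≤ u ⁻¹ᵁ (f ⁻¹ᵁ U)) (x : Γ(T', U)) :
    (evalOn u (f ⁻¹ᵁ U) h').hom ((f.app U).hom x) = (evalOn (u ≫ f) U h).hom x := by
  have := Scheme.Hom.comp_appLE u f U ⊤ h
  exact congrArg (fun χ => (Scheme.ΓSpecIso B).hom.hom (χ.hom x)) this.symm

lemma evalOn_SpecMap_fromSpec {T : Scheme.{0}} {B : CommRingCat.{0}} {U : T.Opens}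
    (hU : IsAffineOpen U) (ε : Γ(T, U) ⟶ B) :
    ∃ h : ⊤ ≤ (Spec.map ε ≫ hU.fromSpec) ⁻¹ᵁ U, evalOn (Spec.map ε ≫ hU.fromSpec) U h = ε := by
  have h1 : ⊤ ≤ hU.fromSpec ⁻¹ᵁ U := hU.fromSpec_preimage_self.ge
  have h2 : evalOn hU.fromSpec U h1 = 𝟙 _ := by
    rw [evalOn, fromSpec_appLE_top hU, Iso.inv_hom_id]
  have h3 : ⊤ ≤ (Spec.map ε ≫ hU.fromSpec) ⁻¹ᵁ U := fun x _ => h1 (x := Spec.map ε x) trivial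
  exact ⟨h3, by rw [evalOn_SpecMap _ _ _ h1 h3, h2, Category.id_comp]⟩

variable {B B' : CommRingCat.{0}}

/-- `b` is a tuple of homogeneous coordinates of `u : Spec B ⟶ ℙⁿ`. -/
def HasPPCoords (u : Spec B ⟶ PP n) (b : Fin (n + 1) → B) : Prop :=
  ∃ (i : Fin (n + 1)) (h : ⊤ ≤ u ⁻¹ᵁ PPchart n i), IsUnit (b i) ∧
    ∀ j, b j = b i * (evalOn u (PPchart n i) h).hom (PPcoord n i j)

lemma iSup_PPchart (n : ℕ) : ⨆ i, PPchart n i = ⊤ := by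
  refine Proj.iSup_basicOpen_eq_top' (grading n) _ (fun i => ⟨1, X_mem_grading i⟩) ?_
  rw [eq_top_iff]
  intro p _
  induction p using MvPolynomial.induction_on with
  | C a => exact Subalgebra.algebraMap_mem _ (algebraMap ℂ (grading n 0) a)
  | add p q hp hq => exact add_mem (hp trivial) (hq trivial)
  | mul_X p i hp => exact mul_mem (hp trivial) (Algebra.subset_adjoin ⟨i, rfl⟩)

lemma HasPPCoords.exists_of_isLocalRing [IsLocalRing B] (u : Spec B ⟶ PP n) :
    ∃ b, HasPPCoords u b := by
  have h1 : u (IsLocalRing.closedPoint B) ∈ (⨆ i, PPchart n i : (PP n).Opens) := by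
    rw [iSup_PPchart]; trivial
  obtain ⟨i, hi⟩ := Opens.mem_iSup.1 h1
  have h := (Scheme.preimage_eq_top_of_closedPoint_mem u hi).ge
  refine ⟨fun j => (evalOn u (PPchart n i) h).hom (PPcoord n i j), i, h, ?_, fun j => ?_⟩ <;>
    simp [PPcoord_self]

lemma HasPPCoords.eval_mul (u : Spec B ⟶ PP n) {i j : Fin (n + 1)}
    (hi : ⊤ ≤ u ⁻¹ᵁ PPchart n i) (hj : ⊤ ≤ u ⁻¹ᵁ PPchart n j) (k : Fin (n + 1)) :
    (evalOn u (PPchart n i) hi).hom (PPcoord n i k) =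
      (evalOn u (PPchart n i) hi).hom (PPcoord n i j) *
        (evalOn u (PPchart n j) hj).hom (PPcoord n j k) := by
  have hij : ⊤ ≤ u ⁻¹ᵁ (PPchart n i ⊓ PPchart n j) := fun x hx => ⟨hi hx, hj hx⟩
  have := congrArg (evalOn u _ hij).hom (PPcoord_map_mul i j k)
  rwa [map_mul, evalOn_map, evalOn_map, evalOn_map] at this

lemma le_preimage_PPchart {u : Spec B ⟶ PP n} {i j : Fin (n + 1)} (hi : ⊤ ≤ u ⁻¹ᵁ PPchart n i)
    (hu : IsUnit ((evalOn u (PPchart n i) hi).hom (PPcoord n i j))) :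
    ⊤ ≤ u ⁻¹ᵁ PPchart n j := by
  intro x _
  have h1 := SpecMap_evalOn_fromSpec u (isAffineOpen_PPchart i) hi
  rw [fromSpec_eq_PPι, ← Category.assoc, ← Spec.map_comp] at h1
  have h2 : PPι n i ⁻¹ᵁ PPchart n j = PrimeSpectrum.basicOpen
      (HomogeneousLocalization.Away.isLocalizationElem (X_mem_grading i) (X_mem_grading j)) :=
    Proj.awayι_preimage_basicOpen (grading n) (X_mem_grading i) one_pos (X_mem_grading j) one_pos
  have h3 : HomogeneousLocalization.Away.isLocalizationElem (X_mem_grading i) (X_mem_grading j) =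
      awayCoord n i j := by
    apply HomogeneousLocalization.val_injective
    change Localization.mk (MvPolynomial.X j ^ 1) _ = Localization.mk (MvPolynomial.X j) _
    simp only [pow_one]
  rw [← h1]
  have h4 : Spec.map (PPsec n i ≫ evalOn u (PPchart n i) hi) x ∈ PPι n i ⁻¹ᵁ PPchart n j := by
    rw [h2, h3]
    intro hx
    exact x.2.ne_top (Ideal.eq_top_of_isUnit_mem _ hx hu)
  exact h4

lemma HasPPCoords.of_isUnit {u : Spec B ⟶ PP n} {b : Fin (n + 1) → B} (hb : HasPPCoords u b)
    {j : Fin (n + 1)} (hj : IsUnit (b j)) : ∃ h : ⊤ ≤ u ⁻¹ᵁ PPchart n j,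
      ∀ k, b k = b j * (evalOn u (PPchart n j) h).hom (PPcoord n j k) := by
  obtain ⟨i, hi, hbi, h⟩ := hb
  have h1 : ⊤ ≤ u ⁻¹ᵁ PPchart n j := by
    refine le_preimage_PPchart hi ?_
    have := h j ▸ hj
    exact isUnit_of_mul_isUnit_right this
  refine ⟨h1, fun k => ?_⟩
  rw [h k, h j, eval_mul u hi h1 k, mul_assoc]

lemma HasPPCoords.isUnit {u : Spec B ⟶ PP n} {b : Fin (n + 1) → B} (hb : HasPPCoords u b)
    {j : Fin (n + 1)} (hj : ⊤ ≤ u ⁻¹ᵁ PPchart n j) : IsUnit (b j) := by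
  obtain ⟨i, hi, hbi, h⟩ := hb
  rw [h j]
  refine hbi.mul (IsUnit.of_mul_eq_one _ ((eval_mul u hi hj i).symm.trans ?_))
  rw [PPcoord_self, map_one]

lemma HasPPCoords.smul {u : Spec B ⟶ PP n} {b : Fin (n + 1) → B} (hb : HasPPCoords u b)
    {c : B} (hc : IsUnit c) : HasPPCoords u (fun j => c * b j) := by
  obtain ⟨i, hi, hbi, h⟩ := hb
  exact ⟨i, hi, hc.mul hbi, fun j => by
    change c * b j = c * b i * _
    rw [h j]; ring⟩

lemma HasPPCoords.comp {u : Spec B ⟶ PP n} {b : Fin (n + 1) → B} (hb : HasPPCoords u b)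
    (φ : B ⟶ B') : HasPPCoords (Spec.map φ ≫ u) (fun j => φ.hom (b j)) := by
  obtain ⟨i, hi, hbi, h⟩ := hb
  have h' : ⊤ ≤ (Spec.map φ ≫ u) ⁻¹ᵁ PPchart n i := fun x _ => hi (x := Spec.map φ x) trivial
  refine ⟨i, h', hbi.map _, fun j => ?_⟩
  rw [evalOn_SpecMap u φ _ hi h']
  exact (congrArg _ (h j)).trans (map_mul _ _ _)

lemma HasPPCoords.exists_smul {u : Spec B ⟶ PP n} {b b' : Fin (n + 1) → B}
    (hb : HasPPCoords u b) (hb' : HasPPCoords u b') : ∃ c, IsUnit c ∧ ∀ j, b' j = c * b j := by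
  obtain ⟨i, hi, hbi, h⟩ := hb
  obtain ⟨h1, h2⟩ := hb'.of_isUnit (hb'.isUnit hi)
  obtain ⟨w, hw⟩ := hbi
  refine ⟨b' i * ↑w⁻¹, (hb'.isUnit hi).mul (Units.isUnit _), fun j => ?_⟩
  rw [h j, ← hw, h2 j]
  linear_combination (-b' i * (evalOn u (PPchart n i) hi).hom (PPcoord n i j)) * w.inv_mul

lemma HasPPCoords.exists_of_isUnit (φ : CommRingCat.of ℂ ⟶ B) (b : Fin (n + 1) → B)
    {i : Fin (n + 1)} (hi : IsUnit (b i)) :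
    ∃ u : Spec B ⟶ PP n, u ≫ PPstr n = Spec.map φ ∧ HasPPCoords u b := by
  obtain ⟨ε, h1, h2⟩ := exists_PP_hom i φ b hi
  obtain ⟨h3, h4⟩ := evalOn_SpecMap_fromSpec (isAffineOpen_PPchart i) ε
  refine ⟨Spec.map ε ≫ (isAffineOpen_PPchart i).fromSpec, ?_, i, h3, hi, fun j => ?_⟩
  · rw [Category.assoc, fromSpec_PPstr, ← Spec.map_comp, h1]
  · rw [h4, h2]

lemma HasPPCoords.ext {u u' : Spec B ⟶ PP n} {b : Fin (n + 1) → B} (h : HasPPCoords u b)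
    (h' : HasPPCoords u' b) (hs : u ≫ PPstr n = u' ≫ PPstr n) : u = u' := by
  obtain ⟨i, hi, hbi, h1⟩ := h
  obtain ⟨hi', h2⟩ := h'.of_isUnit hbi
  rw [← SpecMap_evalOn_fromSpec u (isAffineOpen_PPchart i) hi,
    ← SpecMap_evalOn_fromSpec u' (isAffineOpen_PPchart i) hi'] at hs ⊢
  congr 2
  refine PP_hom_ext i ?_ fun j => hbi.mul_left_cancel ((h1 j).symm.trans (h2 j))
  rw [Category.assoc, Category.assoc, fromSpec_PPstr, ← Spec.map_comp, ← Spec.map_comp] at hs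
  exact Spec.map_injective hs

end

section

/-! ### Multihomogeneous coordinates and ideal sheaves of multihomogeneous forms -/

variable {B B' : CommRingCat.{0}} {T : Scheme.{0}}

/-- `b` is a tuple of multihomogeneous coordinates of the point `u` of `T`. -/
structure Coords.HasTuple (c : Coords T) (u : Spec B ⟶ T) (b : HomCoord → B) : Prop where
  p : HasPPCoords (u ≫ c.p) (fun l => b (Sum.inl l))
  q : HasPPCoords (u ≫ c.q) (fun l => b (Sum.inr (Sum.inl l)))
  r : HasPPCoords (u ≫ c.r) (fun l => b (Sum.inr (Sum.inr l)))

/-- Rescaling a tuple of multihomogeneous coordinates. -/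
def scaleTuple {R : Type} [CommRing R] (l m n : R) (b : HomCoord → R) : HomCoord → R
  | Sum.inl i => l * b (Sum.inl i)
  | Sum.inr (Sum.inl i) => m * b (Sum.inr (Sum.inl i))
  | Sum.inr (Sum.inr i) => n * b (Sum.inr (Sum.inr i))

/-- Multihomogeneous forms, characterized by their behaviour under rescaling. -/
def IsMultihomogeneous (G : MvPolynomial HomCoord ℤ) (d₁ d₂ d₃ : ℕ) : Prop :=
  ∀ (R : Type) [CommRing R] (l m n : R) (b : HomCoord → R),
    MvPolynomial.aeval (scaleTuple l m n b) G =
      l ^ d₁ * m ^ d₂ * n ^ d₃ * MvPolynomial.aeval b G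

namespace Coords

variable {c : Coords T}

lemma HasTuple.comp {u : Spec B ⟶ T} {b : HomCoord → B} (h : c.HasTuple u b) (φ : B ⟶ B') :
    c.HasTuple (Spec.map φ ≫ u) (fun l => φ.hom (b l)) :=
  ⟨by simpa using h.p.comp φ, by simpa using h.q.comp φ, by simpa using h.r.comp φ⟩

lemma HasTuple.scale {u : Spec B ⟶ T} {b : HomCoord → B} (h : c.HasTuple u b) {l m n : B}
    (hl : IsUnit l) (hm : IsUnit m) (hn : IsUnit n) : c.HasTuple u (scaleTuple l m n b) :=
  ⟨h.p.smul hl, h.q.smul hm, h.r.smul hn⟩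

lemma HasTuple.exists_scale {u : Spec B ⟶ T} {b b' : HomCoord → B} (h : c.HasTuple u b)
    (h' : c.HasTuple u b') :
    ∃ l m n, IsUnit l ∧ IsUnit m ∧ IsUnit n ∧ b' = scaleTuple l m n b := by
  obtain ⟨l, hl, h1⟩ := h.p.exists_smul h'.p
  obtain ⟨m, hm, h2⟩ := h.q.exists_smul h'.q
  obtain ⟨n, hn, h3⟩ := h.r.exists_smul h'.r
  refine ⟨l, m, n, hl, hm, hn, funext fun i => ?_⟩
  rcases i with i | i | i
  exacts [h1 i, h2 i, h3 i]

lemma HasTuple.exists_of_isLocalRing [IsLocalRing B] (c : Coords T) (u : Spec B ⟶ T) :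
    ∃ b, c.HasTuple u b := by
  obtain ⟨x, hx⟩ := HasPPCoords.exists_of_isLocalRing (u ≫ c.p)
  obtain ⟨y, hy⟩ := HasPPCoords.exists_of_isLocalRing (u ≫ c.q)
  obtain ⟨z, hz⟩ := HasPPCoords.exists_of_isLocalRing (u ≫ c.r)
  exact ⟨Sum.elim x (Sum.elim y z), hx, hy, hz⟩

lemma HasTuple.exists_isUnit {u : Spec B ⟶ T} {b : HomCoord → B} (h : c.HasTuple u b) :
    ∃ i j k, IsUnit (b (Sum.inl i)) ∧ IsUnit (b (Sum.inr (Sum.inl j))) ∧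
      IsUnit (b (Sum.inr (Sum.inr k))) := by
  obtain ⟨i, _, hi, _⟩ := h.p
  obtain ⟨j, _, hj, _⟩ := h.q
  obtain ⟨k, _, hk, _⟩ := h.r
  exact ⟨i, j, k, hi, hj, hk⟩

lemma HasTuple.le_preimage_chart {u : Spec B ⟶ T} {b : HomCoord → B} (h : c.HasTuple u b)
    {i j : Fin 2} {k : Fin 3} (hi : IsUnit (b (Sum.inl i))) (hj : IsUnit (b (Sum.inr (Sum.inl j))))
    (hk : IsUnit (b (Sum.inr (Sum.inr k)))) : ⊤ ≤ u ⁻¹ᵁ c.chart i j k := by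
  obtain ⟨h1, -⟩ := h.p.of_isUnit hi
  obtain ⟨h2, -⟩ := h.q.of_isUnit hj
  obtain ⟨h3, -⟩ := h.r.of_isUnit hk
  exact fun x hx => ⟨⟨h1 hx, h2 hx⟩, h3 hx⟩

lemma HasTuple.isUnit_of_le {u : Spec B ⟶ T} {b : HomCoord → B} (h : c.HasTuple u b)
    {i j : Fin 2} {k : Fin 3} (hu : ⊤ ≤ u ⁻¹ᵁ c.chart i j k) :
    IsUnit (b (Sum.inl i)) ∧ IsUnit (b (Sum.inr (Sum.inl j))) ∧
      IsUnit (b (Sum.inr (Sum.inr k))) :=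
  ⟨h.p.isUnit fun _ hx => (hu hx).1.1, h.q.isUnit fun _ hx => (hu hx).1.2,
    h.r.isUnit fun _ hx => (hu hx).2⟩

lemma HasTuple.eq_scale_ratio {u : Spec B ⟶ T} {b : HomCoord → B} (h : c.HasTuple u b)
    {i j : Fin 2} {k : Fin 3} (hu : ⊤ ≤ u ⁻¹ᵁ c.chart i j k) :
    b = scaleTuple (b (Sum.inl i)) (b (Sum.inr (Sum.inl j))) (b (Sum.inr (Sum.inr k)))
      (fun l => (evalOn u (c.chart i j k) hu).hom (c.ratio i j k l)) := by
  obtain ⟨hi, hj, hk⟩ := h.isUnit_of_le hu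
  obtain ⟨h1, h1'⟩ := h.p.of_isUnit hi
  obtain ⟨h2, h2'⟩ := h.q.of_isUnit hj
  obtain ⟨h3, h3'⟩ := h.r.of_isUnit hk
  funext l
  rcases l with l | l | l
  · refine (h1' l).trans (congrArg _ (Eq.symm ?_))
    exact (evalOn_map u _ hu _).trans (evalOn_app u c.p _ h1 _ _)
  · refine (h2' l).trans (congrArg _ (Eq.symm ?_))
    exact (evalOn_map u _ hu _).trans (evalOn_app u c.q _ h2 _ _)
  · refine (h3' l).trans (congrArg _ (Eq.symm ?_))
    exact (evalOn_map u _ hu _).trans (evalOn_app u c.r _ h3 _ _)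

lemma evalOn_dehom (u : Spec B ⟶ T) (G : MvPolynomial HomCoord ℤ)
    {i j : Fin 2} {k : Fin 3} (hu : ⊤ ≤ u ⁻¹ᵁ c.chart i j k) :
    (evalOn u (c.chart i j k) hu).hom (c.dehom G i j k) =
      MvPolynomial.aeval (fun l => (evalOn u (c.chart i j k) hu).hom (c.ratio i j k l)) G := by
  rw [dehom, MvPolynomial.aeval_def, MvPolynomial.aeval_def]
  refine (MvPolynomial.hom_eval₂ G _ (evalOn u (c.chart i j k) hu).hom _).trans ?_
  exact congrArg (fun f => MvPolynomial.eval₂ f _ G) (RingHom.ext_int _ _)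

lemma HasTuple.associated_dehom {u : Spec B ⟶ T} {b : HomCoord → B} (h : c.HasTuple u b)
    {G : MvPolynomial HomCoord ℤ} {d₁ d₂ d₃ : ℕ} (hG : IsMultihomogeneous G d₁ d₂ d₃)
    {i j : Fin 2} {k : Fin 3} (hu : ⊤ ≤ u ⁻¹ᵁ c.chart i j k) :
    Ideal.span {MvPolynomial.aeval b G} =
      Ideal.span {(evalOn u (c.chart i j k) hu).hom (c.dehom G i j k)} := by
  obtain ⟨hi, hj, hk⟩ := h.isUnit_of_le hu
  rw [h.eq_scale_ratio hu, hG, ← evalOn_dehom]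
  exact Ideal.span_singleton_mul_left_unit (((hi.pow _).mul (hj.pow _)).mul (hk.pow _)) _

/-- The family of ideals in the definition of `Coords.ideal`. -/
def family (c : Coords T) (G : MvPolynomial HomCoord ℤ) (U : T.Opens) : Ideal Γ(T, U) :=
  ⨅ (i : Fin 2) (j : Fin 2) (k : Fin 3),
    Ideal.comap
      (T.presheaf.map (homOfLE (inf_le_left : U ⊓ c.chart i j k ≤ U)).op).hom
      (Ideal.span {(T.presheaf.map
        (homOfLE (inf_le_right : U ⊓ c.chart i j k ≤ c.chart i j k)).op).hom (c.dehom G i j k)})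

lemma map_map_apply {U V W : T.Opens} (h₁ : V ≤ U) (h₂ : W ≤ V) (x : Γ(T, U)) :
    (T.presheaf.map (homOfLE h₂).op).hom ((T.presheaf.map (homOfLE h₁).op).hom x) =
      (T.presheaf.map (homOfLE (h₂.trans h₁)).op).hom x := by
  rw [← RingHom.comp_apply, ← CommRingCat.hom_comp, ← Functor.map_comp]
  rfl

lemma mem_family {G : MvPolynomial HomCoord ℤ} {U : T.Opens} {a : Γ(T, U)} :
    a ∈ c.family G U ↔ ∀ i j k, ∃ t : Γ(T, U ⊓ c.chart i j k),
      (T.presheaf.map (homOfLE (inf_le_left : U ⊓ c.chart i j k ≤ U)).op).hom a =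
        t * (T.presheaf.map (homOfLE (inf_le_right : U ⊓ c.chart i j k ≤ c.chart i j k)).op).hom
          (c.dehom G i j k) := by
  simp only [family, Ideal.mem_iInf, Ideal.mem_comap, Ideal.mem_span_singleton']
  exact forall_congr' fun i => forall_congr' fun j => forall_congr' fun k =>
    exists_congr fun t => eq_comm

lemma family_res {G : MvPolynomial HomCoord ℤ} {U V : T.Opens} (h : V ≤ U) {a : Γ(T, U)}
    (ha : a ∈ c.family G U) : (T.presheaf.map (homOfLE h).op).hom a ∈ c.family G V := by
  rw [mem_family] at ha ⊢
  intro i j k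
  obtain ⟨t, ht⟩ := ha i j k
  refine ⟨(T.presheaf.map (homOfLE (inf_le_inf_right _ h)).op).hom t, ?_⟩
  have := congrArg (T.presheaf.map (homOfLE (inf_le_inf_right (c.chart i j k) h)).op).hom ht
  rw [map_mul, map_map_apply, map_map_apply] at this
  rw [map_map_apply, this]

lemma exists_pow_mul_mem [IsLocallyNoetherian T] (G : MvPolynomial HomCoord ℤ) (U : T.affineOpens)
    (s a : Γ(T, U.1)) (ha : (T.presheaf.map (homOfLE (T.basicOpen_le s)).op).hom a ∈
      c.family G (T.basicOpen s)) (i j : Fin 2) (k : Fin 3) :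
    ∃ N : ℕ, ∀ M, N ≤ M → ∃ t : Γ(T, U.1 ⊓ c.chart i j k),
      (T.presheaf.map (homOfLE (inf_le_left : U.1 ⊓ c.chart i j k ≤ U.1)).op).hom (s ^ M * a) =
        t * (T.presheaf.map (homOfLE (inf_le_right : U.1 ⊓ c.chart i j k ≤ c.chart i j k)).op).hom
          (c.dehom G i j k) := by
  obtain ⟨t, ht⟩ := mem_family.1 ha i j k
  set W : T.Opens := U.1 ⊓ c.chart i j k
  have hU : IsAffineOpen U.1 := U.2
  have hWc : IsCompact W.1 := by
    have : IsNoetherianRing Γ(T, U.1) := IsLocallyNoetherian.component_noetherian U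
    have : NoetherianSpace U.1 := noetherianSpace_of_isAffineOpen U.1 hU
    have := (noetherianSpace_set_iff (U.1 : Set T)).1 this W.1 inf_le_left
    exact this
  have hWq : IsQuasiSeparated W.1 := isQuasiSeparated_univ.of_subset (Set.subset_univ _)
  let ρ := (T.presheaf.map (homOfLE (inf_le_left : W ≤ U.1)).op).hom
  have hloc := isLocalization_basicOpen_of_qcqs hWc hWq (ρ s)
  have hD : T.basicOpen (ρ s) ≤ T.basicOpen s ⊓ c.chart i j k := by
    have h1 : T.basicOpen (ρ s) = W ⊓ T.basicOpen s := T.basicOpen_res s _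
    rw [h1]
    exact le_inf inf_le_right (inf_le_left.trans inf_le_right)
  have ht2 := congrArg (T.presheaf.map (homOfLE hD).op).hom ht
  rw [map_mul, map_map_apply, map_map_apply, map_map_apply] at ht2
  obtain ⟨⟨y, ⟨_, m, rfl⟩⟩, hy⟩ := IsLocalization.surj (M := .powers (ρ s))
    ((T.presheaf.map (homOfLE hD).op).hom t)
  obtain ⟨⟨_, l, rfl⟩, hl⟩ := IsLocalization.exists_of_eq (M := .powers (ρ s))
    (S := Γ(T, T.basicOpen (ρ s))) (x := ρ s ^ m * ρ a)
    (y := y * (T.presheaf.map (homOfLE (inf_le_right : W ≤ c.chart i j k)).op).hom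
      (c.dehom G i j k)) (by
        rw [map_mul, map_mul, ← hy]
        have e1 : algebraMap Γ(T, W) Γ(T, T.basicOpen (ρ s)) (ρ a) =
          (T.presheaf.map (homOfLE ((T.basicOpen_le (ρ s)).trans inf_le_left)).op).hom a :=
          map_map_apply _ _ _
        have e2 : algebraMap Γ(T, W) Γ(T, T.basicOpen (ρ s))
          ((T.presheaf.map (homOfLE (inf_le_right : W ≤ c.chart i j k)).op).hom (c.dehom G i j k)) =
          (T.presheaf.map (homOfLE ((T.basicOpen_le (ρ s)).trans inf_le_right)).op).hom
            (c.dehom G i j k) := map_map_apply _ _ _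
        rw [e1, e2, ht2]
        ring)
  refine ⟨l + m, fun M hM => ⟨ρ s ^ (M - (l + m)) * (ρ s ^ l * y), ?_⟩⟩
  have hM' : s ^ M = s ^ (M - (l + m)) * (s ^ l * s ^ m) := by rw [← pow_add, ← pow_add]; congr 1; omega
  rw [hM']
  change ρ _ = _
  simp only [map_mul, map_pow]
  simp only at hl
  linear_combination ρ s ^ (M - (l + m)) * hl

/-- The ideal sheaf whose sections over each affine open are given by the family. -/
def familyIdeal [IsLocallyNoetherian T] (c : Coords T) (G : MvPolynomial HomCoord ℤ) :
    T.IdealSheafData where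
  ideal U := c.family G U.1
  map_ideal_basicOpen U s := by
    have hU : IsAffineOpen U.1 := U.2
    apply le_antisymm
    · exact Ideal.map_le_iff_le_comap.2 fun a ha => family_res (T.basicOpen_le s) ha
    · intro a ha
      have hloc := hU.isLocalization_basicOpen s
      obtain ⟨⟨a', ⟨_, n, rfl⟩⟩, h⟩ := IsLocalization.surj (M := .powers s)
        (S := Γ(T, T.basicOpen s)) a
      have h2 : (T.presheaf.map (homOfLE (T.basicOpen_le s)).op).hom a' ∈
          c.family G (T.basicOpen s) := by
        have : (T.presheaf.map (homOfLE (T.basicOpen_le s)).op).hom a' = a * _ := h.symm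
        rw [this]
        exact Ideal.mul_mem_right _ _ ha
      choose N hN using exists_pow_mul_mem G U s a' h2
      obtain ⟨K, hK⟩ : ∃ K, ∀ i j k, N i j k ≤ K :=
        ⟨∑ i, ∑ j, ∑ k, N i j k, fun i j k =>
          (Finset.single_le_sum (f := fun k => N i j k) (fun _ _ => Nat.zero_le _)
            (Finset.mem_univ k)).trans ((Finset.single_le_sum (f := fun j => ∑ k, N i j k)
            (fun _ _ => Nat.zero_le _) (Finset.mem_univ j)).trans (Finset.single_le_sum
            (f := fun i => ∑ j, ∑ k, N i j k) (fun _ _ => Nat.zero_le _) (Finset.mem_univ i)))⟩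
      have h3 : s ^ K * a' ∈ c.family G U.1 := mem_family.2 fun i j k => hN i j k K (hK i j k)
      have hs : IsUnit (algebraMap Γ(T, U.1) Γ(T, T.basicOpen s) s) :=
        IsLocalization.Away.algebraMap_isUnit s
      obtain ⟨w, hw⟩ := hs.pow (K + n)
      have h4 : a = ↑w⁻¹ * algebraMap Γ(T, U.1) Γ(T, T.basicOpen s) (s ^ K * a') := by
        rw [Units.eq_inv_mul_iff_mul_eq, hw, map_mul, ← h, map_pow, map_pow, pow_add]
        ring
      rw [h4]
      exact Ideal.mul_mem_left _ _ (Ideal.mem_map_of_mem _ h3)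

lemma ideal_eq_familyIdeal [IsLocallyNoetherian T] (c : Coords T) (G : MvPolynomial HomCoord ℤ) :
    c.ideal G = c.familyIdeal G :=
  Scheme.IdealSheafData.ofIdeals_ideal (c.familyIdeal G)

end Coords

end

section

variable {B B' : CommRingCat.{0}} {T : Scheme.{0}} {n : ℕ}

lemma PPcoord_appLE_mul {T : Scheme.{0}} (f : T ⟶ PP n) {V : T.Opens} {i j : Fin (n + 1)}
    (hi : V ≤ f ⁻¹ᵁ PPchart n i) (hj : V ≤ f ⁻¹ᵁ PPchart n j) (k : Fin (n + 1)) :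
    (f.appLE (PPchart n i) V hi).hom (PPcoord n i k) =
      (f.appLE (PPchart n i) V hi).hom (PPcoord n i j) *
        (f.appLE (PPchart n j) V hj).hom (PPcoord n j k) := by
  have hij : V ≤ f ⁻¹ᵁ (PPchart n i ⊓ PPchart n j) := fun x hx => ⟨hi hx, hj hx⟩
  have := congrArg (f.appLE _ V hij).hom (PPcoord_map_mul i j k)
  simp only [map_mul, ← RingHom.comp_apply, ← CommRingCat.hom_comp, Scheme.Hom.map_appLE] at this
  exact this

lemma hom_ext_of_iSup_eq_top {T W : Scheme.{0}} {ι : Type} (U : ι → T.Opens) (hU : iSup U = ⊤)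
    {f g : T ⟶ W} (h : ∀ i, (U i).ι ≫ f = (U i).ι ≫ g) : f = g :=
  (T.openCoverOfIsOpenCover U (.mk hU)).hom_ext _ _ h

lemma hom_ext_of_Spec {T W : Scheme.{0}} {f g : T ⟶ W}
    (h : ∀ (R : CommRingCat.{0}) (w : Spec R ⟶ T), w ≫ f = w ≫ g) : f = g :=
  T.affineCover.hom_ext _ _ fun j => h _ (T.affineCover.f j)

lemma exists_glue {T W : Scheme.{0}} {ι : Type} (U : ι → T.Opens) (hU : iSup U = ⊤)
    (f : ∀ i, (U i : Scheme.{0}) ⟶ W)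
    (h : ∀ i j, pullback.fst (U i).ι (U j).ι ≫ f i = pullback.snd (U i).ι (U j).ι ≫ f j) :
    ∃ F : T ⟶ W, ∀ i, (U i).ι ≫ F = f i :=
  ⟨(T.openCoverOfIsOpenCover U (.mk hU)).glueMorphisms f h,
    (T.openCoverOfIsOpenCover U (.mk hU)).ι_glueMorphisms f h⟩

namespace Coords

variable {c : Coords T}

lemma res_ratio {V : T.Opens} {i j : Fin 2} {k : Fin 3} (h : V ≤ c.chart i j k) (l : HomCoord) :
    (T.presheaf.map (homOfLE h).op).hom (c.ratio i j k l) =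
      Sum.elim (fun l => (c.p.appLE (PPchart 1 i) V fun _ hx => (h hx).1.1).hom (PPcoord 1 i l))
        (Sum.elim
          (fun l => (c.q.appLE (PPchart 1 j) V fun _ hx => (h hx).1.2).hom (PPcoord 1 j l))
          (fun l => (c.r.appLE (PPchart 2 k) V fun _ hx => (h hx).2).hom (PPcoord 2 k l))) l := by
  rcases l with l | l | l <;> exact map_map_apply _ _ _

lemma res_dehom_mul {G : MvPolynomial HomCoord ℤ} {d₁ d₂ d₃ : ℕ}
    (hG : IsMultihomogeneous G d₁ d₂ d₃) {V : T.Opens} {i j i' j' : Fin 2} {k k' : Fin 3}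
    (h : V ≤ c.chart i j k) (h' : V ≤ c.chart i' j' k') :
    ∃ t, (T.presheaf.map (homOfLE h).op).hom (c.dehom G i j k) =
      t * (T.presheaf.map (homOfLE h').op).hom (c.dehom G i' j' k') := by
  have e : ∀ {i j : Fin 2} {k : Fin 3} (h : V ≤ c.chart i j k),
      (T.presheaf.map (homOfLE h).op).hom (c.dehom G i j k) =
        MvPolynomial.aeval (fun l => (T.presheaf.map (homOfLE h).op).hom (c.ratio i j k l)) G := by
    intro i j k h
    rw [dehom, MvPolynomial.aeval_def, MvPolynomial.aeval_def]
    refine (MvPolynomial.hom_eval₂ G _ _ _).trans ?_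
    exact congrArg (fun f => MvPolynomial.eval₂ f _ G) (RingHom.ext_int _ _)
  have h2 : (fun l => (T.presheaf.map (homOfLE h).op).hom (c.ratio i j k l)) =
      scaleTuple ((T.presheaf.map (homOfLE h).op).hom (c.ratio i j k (Sum.inl i')))
        ((T.presheaf.map (homOfLE h).op).hom (c.ratio i j k (Sum.inr (Sum.inl j'))))
        ((T.presheaf.map (homOfLE h).op).hom (c.ratio i j k (Sum.inr (Sum.inr k'))))
        (fun l => (T.presheaf.map (homOfLE h').op).hom (c.ratio i' j' k' l)) := by
    funext l
    simp only [res_ratio]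
    rcases l with l | l | l
    · refine (PPcoord_appLE_mul c.p (fun _ hx => (h hx).1.1) (fun _ hx => (h' hx).1.1) l).trans ?_
      simp only [scaleTuple, Sum.elim_inl]
    · refine (PPcoord_appLE_mul c.q (fun _ hx => (h hx).1.2) (fun _ hx => (h' hx).1.2) l).trans ?_
      simp only [scaleTuple, Sum.elim_inl, Sum.elim_inr]
    · refine (PPcoord_appLE_mul c.r (fun _ hx => (h hx).2) (fun _ hx => (h' hx).2) l).trans ?_
      simp only [scaleTuple, Sum.elim_inr]
  rw [e h, e h', h2, hG]
  exact ⟨_, rfl⟩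

lemma family_eq_span {G : MvPolynomial HomCoord ℤ} {d₁ d₂ d₃ : ℕ}
    (hG : IsMultihomogeneous G d₁ d₂ d₃) {U : T.Opens} {i j : Fin 2} {k : Fin 3}
    (h : U ≤ c.chart i j k) :
    c.family G U = Ideal.span {(T.presheaf.map (homOfLE h).op).hom (c.dehom G i j k)} := by
  apply le_antisymm
  · intro a ha
    obtain ⟨t, ht⟩ := mem_family.1 ha i j k
    have h2 := congrArg (T.presheaf.map (homOfLE (le_inf le_rfl h)).op).hom ht
    rw [map_mul, map_map_apply, map_map_apply] at h2
    have h3 : (T.presheaf.map (homOfLE (le_refl U)).op).hom a = a :=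
      congrArg (fun χ => χ.hom a) (T.presheaf.map_id (Opposite.op U))
    rw [h3] at h2
    exact Ideal.mem_span_singleton'.2 ⟨_, h2.symm⟩
  · rw [Ideal.span_singleton_le_iff_mem, mem_family]
    intro i' j' k'
    rw [map_map_apply]
    exact res_dehom_mul hG _ _

lemma HasTuple.pullbackIdeal_ideal [IsLocallyNoetherian T] [IsLocalRing B] {u : Spec B ⟶ T}
    {b : HomCoord → B} (h : c.HasTuple u b) {G : MvPolynomial HomCoord ℤ} {d₁ d₂ d₃ : ℕ}
    (hG : IsMultihomogeneous G d₁ d₂ d₃) :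
    pullbackIdeal (c.ideal G) u = Ideal.span {MvPolynomial.aeval b G} := by
  obtain ⟨i, j, k, hi, hj, hk⟩ := h.exists_isUnit
  have hu := h.le_preimage_chart hi hj hk
  obtain ⟨U, hUc, hU⟩ := exists_affine_of_isLocalRing u (c.chart i j k) (hu trivial)
  rw [pullbackIdeal_eq_map _ u U hU, ideal_eq_familyIdeal, h.associated_dehom hG hu]
  change Ideal.map _ (c.family G U.1) = _
  rw [family_eq_span hG hUc, Ideal.map_span, Set.image_singleton, evalOn_map]

end Coords

/-! ### The product of projective spaces -/

instance : LocallyOfFiniteType (PPstr n) := by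
  have : IsScalarTower ℂ (grading n 0) (MvPolynomial (Fin (n + 1)) ℂ) :=
    IsScalarTower.of_algebraMap_eq (R := ℂ) (S := grading n 0) fun _ => rfl
  have h1 : Algebra.FiniteType (grading n 0) (MvPolynomial (Fin (n + 1)) ℂ) :=
    Algebra.FiniteType.of_restrictScalars_finiteType ℂ _ _
  have h2 : Function.Surjective (algebraMap ℂ (grading n 0)) := by
    rintro ⟨p, hp⟩
    have hp' : p.IsHomogeneous 0 := (MvPolynomial.mem_homogeneousSubmodule 0 p).1 hp
    refine ⟨MvPolynomial.coeff 0 p, Subtype.ext ?_⟩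
    exact (MvPolynomial.totalDegree_eq_zero_iff_eq_C.1
      ((MvPolynomial.totalDegree_zero_iff_isHomogeneous _).2 hp')).symm
  have h3 : LocallyOfFiniteType (Spec.map (CommRingCat.ofHom (algebraMap ℂ (grading n 0)))) := by
    rw [HasRingHomProperty.Spec_iff (P := @LocallyOfFiniteType)]
    exact RingHom.FiniteType.of_surjective _ h2
  rw [PPstr]
  infer_instance

instance : IsLocallyNoetherian PPP := by
  have : LocallyOfFiniteType (PPPcoords.p ≫ PPstr 1) := by
    rw [PPPcoords]
    dsimp only
    unfold PPP
    infer_instance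
  have : IsLocallyNoetherian SpecC := inferInstance
  exact LocallyOfFiniteType.isLocallyNoetherian (PPPcoords.p ≫ PPstr 1)

lemma PPPcoords_q : PPPcoords.q ≫ PPstr 1 = PPPcoords.p ≫ PPstr 1 :=
  (Category.assoc _ _ _).trans (pullback.condition (f := PPstr 1)).symm

lemma PPPcoords_r : PPPcoords.r ≫ PPstr 2 = PPPcoords.p ≫ PPstr 1 :=
  (Category.assoc _ _ _).trans ((congrArg _ (pullback.condition (f := PPstr 1)).symm).trans
    (pullback.condition (f := PPstr 1)).symm)

lemma PPP_hom_ext {W : Scheme.{0}} {u v : W ⟶ PPP} (hp : u ≫ PPPcoords.p = v ≫ PPPcoords.p)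
    (hq : u ≫ PPPcoords.q = v ≫ PPPcoords.q) (hr : u ≫ PPPcoords.r = v ≫ PPPcoords.r) : u = v :=
  pullback.hom_ext hp (pullback.hom_ext
    ((Category.assoc _ _ _).trans (hq.trans (Category.assoc _ _ _).symm))
    ((Category.assoc _ _ _).trans (hr.trans (Category.assoc _ _ _).symm)))

lemma exists_PPP_hom {W : Scheme.{0}} (p : W ⟶ PP 1) (q : W ⟶ PP 1) (r : W ⟶ PP 2)
    (hq : q ≫ PPstr 1 = p ≫ PPstr 1) (hr : r ≫ PPstr 2 = p ≫ PPstr 1) :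
    ∃ u : W ⟶ PPP, u ≫ PPPcoords.p = p ∧ u ≫ PPPcoords.q = q ∧ u ≫ PPPcoords.r = r := by
  have h0 : p ≫ PPstr 1 = pullback.lift q r (hq.trans hr.symm) ≫
      pullback.fst (PPstr 1) (PPstr 2) ≫ PPstr 1 := by
    rw [← Category.assoc, pullback.lift_fst, hq]
  refine ⟨pullback.lift p (pullback.lift q r (hq.trans hr.symm)) h0, pullback.lift_fst _ _ _, ?_, ?_⟩
  · exact (Category.assoc _ _ _).symm.trans
      ((congrArg (· ≫ _) (pullback.lift_snd _ _ h0)).trans (pullback.lift_fst _ _ _))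
  · exact (Category.assoc _ _ _).symm.trans
      ((congrArg (· ≫ _) (pullback.lift_snd _ _ h0)).trans (pullback.lift_snd _ _ _))

/-! ### Diagonal and permutation automorphisms of projective space -/

lemma PP_hom_ext_of_points {W : Scheme.{0}} {f g : W ⟶ PP n} (hs : f ≫ PPstr n = g ≫ PPstr n)
    (h : ∀ (R : CommRingCat.{0}) (w : Spec R ⟶ W) (i : Fin (n + 1)),
      ⊤ ≤ (w ≫ f) ⁻¹ᵁ PPchart n i →
        ∃ b, HasPPCoords (w ≫ f) b ∧ HasPPCoords (w ≫ g) b) : f = g := by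
  let V : Fin (n + 1) → W.Opens := fun i => f ⁻¹ᵁ PPchart n i
  have hV : iSup V = ⊤ := by
    rw [← Scheme.Hom.preimage_iSup, iSup_PPchart]; rfl
  refine hom_ext_of_iSup_eq_top V hV fun i => ?_
  refine hom_ext_of_Spec fun R w => ?_
  rw [← Category.assoc, ← Category.assoc]
  obtain ⟨b, hb, hb'⟩ := h R (w ≫ (V i).ι) i (by
    rw [Category.assoc]
    intro x _
    exact (w x).2)
  exact hb.ext hb' (by simp only [Category.assoc, hs])

/-- Permuting and rescaling homogeneous coordinates. -/
lemma exists_PPmap (c : Fin (n + 1) → ℂ) (hc : ∀ j, c j ≠ 0) (π : Fin (n + 1) ≃ Fin (n + 1)) :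
    ∃ m : PP n ⟶ PP n, m ≫ PPstr n = PPstr n ∧
      ∀ (B : CommRingCat.{0}) (φ : CommRingCat.of ℂ ⟶ B) (u : Spec B ⟶ PP n) (b : Fin (n + 1) → B),
        u ≫ PPstr n = Spec.map φ → HasPPCoords u b →
          HasPPCoords (u ≫ m) (fun j => φ.hom (c j) * b (π j)) := by
  have hex : ∀ i : Fin (n + 1), ∃ m : Spec Γ(PP n, PPchart n i) ⟶ PP n,
      m ≫ PPstr n = Spec.map (PPconst n i) ∧
        HasPPCoords m (fun j => (PPconst n i).hom (c j) * PPcoord n i (π j)) := fun i =>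
    HasPPCoords.exists_of_isUnit _ _ (i := π.symm i) (by
      simp only [Equiv.apply_symm_apply, PPcoord_self, mul_one]
      exact (isUnit_iff_ne_zero.2 (hc _)).map (PPconst n i).hom)
  choose m hm hmb using hex
  have key : ∀ (i : Fin (n + 1)) (B : CommRingCat.{0}) (φ : CommRingCat.of ℂ ⟶ B)
      (ε : Γ(PP n, PPchart n i) ⟶ B) (b : Fin (n + 1) → B),
      Spec.map ε ≫ (isAffineOpen_PPchart i).fromSpec ≫ PPstr n = Spec.map φ →
      HasPPCoords (Spec.map ε ≫ (isAffineOpen_PPchart i).fromSpec) b →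
        HasPPCoords (Spec.map ε ≫ m i) (fun j => φ.hom (c j) * b (π j)) := by
    intro i B φ ε b h1 h2
    obtain ⟨h3, h4⟩ := evalOn_SpecMap_fromSpec (isAffineOpen_PPchart i) ε
    rw [fromSpec_PPstr, ← Spec.map_comp] at h1
    have h5 := Spec.map_injective h1
    have hbi := h2.isUnit h3
    obtain ⟨_, h6⟩ := h2.of_isUnit hbi
    have h7 := ((hmb i).comp ε).smul hbi
    convert h7 using 2 with j
    rw [h6 (π j), h4, map_mul, ← h5]
    simp only [CommRingCat.hom_comp, RingHom.comp_apply]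
    ring
  have hι : ∀ k : Fin (n + 1), (isAffineOpen_PPchart k).isoSpec.hom ≫
      (isAffineOpen_PPchart k).fromSpec = (PPchart n k).ι := by
    intro k; rw [IsAffineOpen.isoSpec_hom, IsAffineOpen.toSpecΓ_fromSpec]
  have hcompat : ∀ i j : Fin (n + 1),
      pullback.fst ((PPchart n i).ι) ((PPchart n j).ι) ≫ (isAffineOpen_PPchart i).isoSpec.hom ≫ m i =
      pullback.snd ((PPchart n i).ι) ((PPchart n j).ι) ≫ (isAffineOpen_PPchart j).isoSpec.hom ≫ m j := by
    intro i j
    have hcond : pullback.fst ((PPchart n i).ι) ((PPchart n j).ι) ≫ (isAffineOpen_PPchart i).isoSpec.hom ≫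
        (isAffineOpen_PPchart i).fromSpec = pullback.snd ((PPchart n i).ι) ((PPchart n j).ι) ≫
        (isAffineOpen_PPchart j).isoSpec.hom ≫ (isAffineOpen_PPchart j).fromSpec := by
      rw [hι, hι, pullback.condition]
    have hstr : ∀ k : Fin (n + 1), (isAffineOpen_PPchart k).isoSpec.hom ≫ m k ≫ PPstr n =
        (isAffineOpen_PPchart k).isoSpec.hom ≫ (isAffineOpen_PPchart k).fromSpec ≫ PPstr n := by
      intro k; rw [hm, fromSpec_PPstr]
    refine PP_hom_ext_of_points ?_ fun R w l hl => ?_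
    · simp only [Category.assoc, hstr]
      simp only [← Category.assoc] at hcond ⊢
      rw [hcond]
    · let s := Spec.preimage (w ≫ pullback.fst ((PPchart n i).ι) ((PPchart n j).ι) ≫
        (isAffineOpen_PPchart i).isoSpec.hom)
      let s' := Spec.preimage (w ≫ pullback.snd ((PPchart n i).ι) ((PPchart n j).ι) ≫
        (isAffineOpen_PPchart j).isoSpec.hom)
      have hs : Spec.map s = w ≫ pullback.fst ((PPchart n i).ι) ((PPchart n j).ι) ≫
        (isAffineOpen_PPchart i).isoSpec.hom := Spec.map_preimage _
      have hs' : Spec.map s' = w ≫ pullback.snd ((PPchart n i).ι) ((PPchart n j).ι) ≫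
        (isAffineOpen_PPchart j).isoSpec.hom := Spec.map_preimage _
      have hss : Spec.map s ≫ (isAffineOpen_PPchart i).fromSpec =
          Spec.map s' ≫ (isAffineOpen_PPchart j).fromSpec := by
        rw [hs, hs']; simp only [Category.assoc]; exact congrArg (w ≫ ·) hcond
      have hc0 : HasPPCoords (isAffineOpen_PPchart i).fromSpec (PPcoord n i) := by
        obtain ⟨h3, h4⟩ := evalOn_SpecMap_fromSpec (isAffineOpen_PPchart i) (𝟙 _)
        rw [Spec.map_id, Category.id_comp] at h3
        simp only [Spec.map_id, Category.id_comp] at h4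
        refine ⟨i, h3, by rw [PPcoord_self]; exact isUnit_one, fun j => ?_⟩
        rw [PPcoord_self, one_mul, h4]; rfl
      have hφ : Spec.map s ≫ (isAffineOpen_PPchart i).fromSpec ≫ PPstr n =
        Spec.map (PPconst n i ≫ s) := by rw [fromSpec_PPstr, Spec.map_comp]
      have k1 := key i R _ s _ hφ (hc0.comp s)
      have k2 := key j R _ s' _ (by rw [← hφ, ← Category.assoc, ← Category.assoc, hss])
        (hss ▸ hc0.comp s)
      rw [hs] at k1
      rw [hs'] at k2
      simp only [Category.assoc] at k1 k2
      exact ⟨_, k1, k2⟩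
  obtain ⟨M, hMι⟩ := exists_glue (PPchart n) (iSup_PPchart n)
    (fun i : Fin (n + 1) => (isAffineOpen_PPchart i).isoSpec.hom ≫ m i) hcompat
  have hM : ∀ i : Fin (n + 1), (isAffineOpen_PPchart i).fromSpec ≫ M = m i := by
    intro i
    rw [← cancel_epi (isAffineOpen_PPchart i).isoSpec.hom, ← hMι, ← Category.assoc, hι]
  refine ⟨M, ?_, fun B φ u b h1 h2 => ?_⟩
  · refine hom_ext_of_iSup_eq_top _ (iSup_PPchart n) fun i => ?_
    rw [← Category.assoc, hMι, Category.assoc, hm, ← fromSpec_PPstr, ← Category.assoc, hι]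
  · obtain ⟨i, hi, -, -⟩ := id h2
    rw [← SpecMap_evalOn_fromSpec u (isAffineOpen_PPchart i) hi] at h1 h2 ⊢
    rw [Category.assoc, hM]
    rw [Category.assoc] at h1
    exact key i B φ _ b h1 h2

end

section

variable {B B' : CommRingCat.{0}} {n : ℕ}

lemma hasPPCoords_eval (u : Spec B ⟶ PP n) {i : Fin (n + 1)} (h : ⊤ ≤ u ⁻¹ᵁ PPchart n i) :
    HasPPCoords u (fun j => (evalOn u (PPchart n i) h).hom (PPcoord n i j)) :=
  ⟨i, h, by simp [PPcoord_self], fun j => by simp [PPcoord_self]⟩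

lemma exists_PPiso (c : Fin (n + 1) → ℂ) (hc : ∀ j, c j ≠ 0) (π : Fin (n + 1) ≃ Fin (n + 1)) :
    ∃ m : PP n ≅ PP n, m.hom ≫ PPstr n = PPstr n ∧
      ∀ (B : CommRingCat.{0}) (φ : CommRingCat.of ℂ ⟶ B) (u : Spec B ⟶ PP n) (b : Fin (n + 1) → B),
        u ≫ PPstr n = Spec.map φ → HasPPCoords u b →
          HasPPCoords (u ≫ m.hom) (fun j => φ.hom (c j) * b (π j)) := by
  obtain ⟨m, hm, hmb⟩ := exists_PPmap c hc π
  obtain ⟨m', hm', hmb'⟩ := exists_PPmap (fun j => (c (π.symm j))⁻¹)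
    (fun j => inv_ne_zero (hc _)) π.symm
  have key : ∀ W : PP n ⟶ PP n, W ≫ PPstr n = PPstr n →
      (∀ (B : CommRingCat.{0}) (φ : CommRingCat.of ℂ ⟶ B) (u : Spec B ⟶ PP n)
        (b : Fin (n + 1) → B), u ≫ PPstr n = Spec.map φ → HasPPCoords u b →
          HasPPCoords (u ≫ W) b) → W = 𝟙 _ := by
    intro W hW h
    refine Eq.symm (PP_hom_ext_of_points (by rw [hW, Category.id_comp]) fun R w i hi => ?_)
    obtain ⟨b, hb⟩ : ∃ b, HasPPCoords (w ≫ 𝟙 (PP n)) b := ⟨_, hasPPCoords_eval _ hi⟩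
    refine ⟨b, hb, h R (Spec.preimage (w ≫ PPstr n)) w b (Spec.map_preimage _).symm ?_⟩
    rwa [Category.comp_id] at hb
  refine ⟨⟨m, m', key _ (by rw [Category.assoc, hm', hm]) fun B φ u b h1 h2 => ?_,
    key _ (by rw [Category.assoc, hm, hm']) fun B φ u b h1 h2 => ?_⟩, hm, hmb⟩
  · have h3 := hmb' B φ (u ≫ m) _ (by rw [Category.assoc, hm, h1]) (hmb B φ u b h1 h2)
    rw [Category.assoc] at h3
    convert h3 using 2 with j
    rw [← mul_assoc, ← map_mul, inv_mul_cancel₀ (hc _), map_one, one_mul, Equiv.apply_symm_apply]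
  · have h3 := hmb B φ (u ≫ m') _ (by rw [Category.assoc, hm', h1]) (hmb' B φ u b h1 h2)
    rw [Category.assoc] at h3
    convert h3 using 2 with j
    rw [Equiv.symm_apply_apply, ← mul_assoc, ← map_mul, mul_inv_cancel₀ (hc _), map_one, one_mul]

/-! ### The threefold in coordinates -/

section Eqs

variable {R : Type} [CommRing R]

/-- The equation of the threefold. -/
def formX (b : HomCoord → R) : R :=
  b (.inl 0) * b (.inr (.inl 0)) * b (.inr (.inr 2)) +
    b (.inl 1) * b (.inr (.inl 1)) * b (.inr (.inr 0)) -
    b (.inl 0) * b (.inr (.inl 1)) * b (.inr (.inr 1)) -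
    b (.inl 1) * b (.inr (.inl 0)) * b (.inr (.inr 1))

/-- The ideal generated by the equations of `E₁` and `E₂`. -/
def idealEq (b : HomCoord → R) : Ideal R :=
  Ideal.span {b (.inl 0) * b (.inr (.inr 2)) - b (.inl 1) * b (.inr (.inr 1)),
    b (.inl 1) * b (.inr (.inr 0)) - b (.inl 0) * b (.inr (.inr 1)),
    b (.inr (.inl 0)) * b (.inr (.inr 2)) - b (.inr (.inl 1)) * b (.inr (.inr 1)),
    b (.inr (.inl 1)) * b (.inr (.inr 0)) - b (.inr (.inl 0)) * b (.inr (.inr 1))}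

/-- The action of a permutation and rescaling on tuples of coordinates. -/
def actTuple (φ : ℂ →+* R) (c₁ c₂ : Fin 2 → ℂ) (c₃ : Fin 3 → ℂ) (π₁ π₂ : Fin 2 ≃ Fin 2)
    (π₃ : Fin 3 ≃ Fin 3) (b : HomCoord → R) : HomCoord → R
  | .inl j => φ (c₁ j) * b (.inl (π₁ j))
  | .inr (.inl j) => φ (c₂ j) * b (.inr (.inl (π₂ j)))
  | .inr (.inr j) => φ (c₃ j) * b (.inr (.inr (π₃ j)))

end Eqs

lemma Coords.HasTuple.congr {T : Scheme.{0}} {c : Coords T} {u v : Spec B ⟶ T} {b : HomCoord → B}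
    (h : c.HasTuple u b) (huv : u = v) : c.HasTuple v b := huv ▸ h

lemma Coords.HasTuple.comp_iff {T T' : Scheme.{0}} {c : Coords T} {g : T' ⟶ T} {u : Spec B ⟶ T'}
    {b : HomCoord → B} : (c.comp g).HasTuple u b ↔ c.HasTuple (u ≫ g) b := by
  constructor
  · rintro ⟨h1, h2, h3⟩
    exact ⟨by simpa [Coords.comp] using h1, by simpa [Coords.comp] using h2,
      by simpa [Coords.comp] using h3⟩
  · rintro ⟨h1, h2, h3⟩
    exact ⟨by simpa [Coords.comp] using h1, by simpa [Coords.comp] using h2,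
      by simpa [Coords.comp] using h3⟩

lemma PPP_over : PPP ↘ SpecC = PPPcoords.p ≫ PPstr 1 := rfl

lemma PPP_ext_of_hasTuple {u v : Spec B ⟶ PPP} {b : HomCoord → B} (hu : PPPcoords.HasTuple u b)
    (hv : PPPcoords.HasTuple v b) (h : u ≫ PPP ↘ SpecC = v ≫ PPP ↘ SpecC) : u = v := by
  rw [PPP_over] at h
  refine PPP_hom_ext (hu.p.ext hv.p ?_) (hu.q.ext hv.q ?_) (hu.r.ext hv.r ?_)
  · simpa only [Category.assoc] using h
  · simpa only [Category.assoc, PPPcoords_q] using h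
  · simpa only [Category.assoc, PPPcoords_r] using h

lemma exists_PPP_hasTuple (φ : CommRingCat.of ℂ ⟶ B) (b : HomCoord → B) {i j : Fin 2} {k : Fin 3}
    (hi : IsUnit (b (.inl i))) (hj : IsUnit (b (.inr (.inl j)))) (hk : IsUnit (b (.inr (.inr k)))) :
    ∃ u : Spec B ⟶ PPP, u ≫ PPP ↘ SpecC = Spec.map φ ∧ PPPcoords.HasTuple u b := by
  obtain ⟨x, hx, hx'⟩ := HasPPCoords.exists_of_isUnit (n := 1) φ (fun l => b (.inl l)) hi
  obtain ⟨y, hy, hy'⟩ := HasPPCoords.exists_of_isUnit (n := 1) φ (fun l => b (.inr (.inl l))) hj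
  obtain ⟨z, hz, hz'⟩ := HasPPCoords.exists_of_isUnit (n := 2) φ (fun l => b (.inr (.inr l))) hk
  obtain ⟨u, h1, h2, h3⟩ := exists_PPP_hom x y z (hy.trans hx.symm) (hz.trans hx.symm)
  refine ⟨u, ?_, ?_, ?_, ?_⟩
  · rw [PPP_over, ← Category.assoc, h1, hx]
  · rwa [h1]
  · rwa [h2]
  · rwa [h3]

lemma isMultihomogeneous_formX : IsMultihomogeneous (cx 0 * cy 0 * cz 2 + cx 1 * cy 1 * cz 0 -
    cx 0 * cy 1 * cz 1 - cx 1 * cy 0 * cz 1) 1 1 1 := by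
  intro R _ l m n b
  simp only [map_sub, map_add, map_mul, MvPolynomial.aeval_X, scaleTuple]
  ring

lemma pullbackIdeal_idealX [IsLocalRing B] {u : Spec B ⟶ PPP} {b : HomCoord → B}
    (h : PPPcoords.HasTuple u b) : pullbackIdeal idealX u = Ideal.span {formX b} := by
  rw [idealX, h.pullbackIdeal_ideal isMultihomogeneous_formX]
  simp [formX]

lemma le_ker_iff {T T' : Scheme.{0}} (I : T.IdealSheafData) (u : T' ⟶ T) :
    I ≤ u.ker ↔ I.comap u = ⊥ := by
  rw [← Scheme.IdealSheafData.map_bot, Scheme.IdealSheafData.le_map_iff_comap_le, le_bot_iff]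

lemma pullbackIdeal_bot {T : Scheme.{0}} (u : Spec B ⟶ T) :
    pullbackIdeal (⊥ : T.IdealSheafData) u = ⊥ := by
  rw [pullbackIdeal, Scheme.IdealSheafData.comap_bot]
  refine (RingHom.injective_iff_ker_eq_bot _).1 ?_
  exact (Scheme.ΓSpecIso B).symm.commRingCatIsoToRingEquiv.injective

lemma comap_eq_bot_of_pullbackIdeal {T : Scheme.{0}} (I : T.IdealSheafData) (u : Spec B ⟶ T)
    (h : pullbackIdeal I u = ⊥) : I.comap u = ⊥ := by
  have h2 : (⊥ : T.IdealSheafData).comap u = ⊥ := Scheme.IdealSheafData.comap_bot _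
  rw [comap_eq_idealSheafOf, h, ← pullbackIdeal_bot (T := T) u, ← comap_eq_idealSheafOf, h2]

section Threefold

variable {X : Scheme.{0}} [X.Over SpecC] {i : X ⟶ PPP} [i.IsOver SpecC]

lemma comp_i_over {W : Scheme.{0}} (u : W ⟶ X) : (u ≫ i) ≫ PPP ↘ SpecC = u ≫ X ↘ SpecC := by
  rw [Category.assoc, comp_over]

variable [IsClosedImmersion i]

lemma X_ext {u v : Spec B ⟶ X} {b : HomCoord → B} (hu : (PPPcoords.comp i).HasTuple u b)
    (hv : (PPPcoords.comp i).HasTuple v b) (h : u ≫ X ↘ SpecC = v ≫ X ↘ SpecC) : u = v := by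
  rw [← cancel_mono i]
  exact PPP_ext_of_hasTuple (Coords.HasTuple.comp_iff.1 hu) (Coords.HasTuple.comp_iff.1 hv)
    (by rw [comp_i_over, comp_i_over, h])

lemma exists_X_hasTuple (hX : i.ker = idealX) [IsLocalRing B] (φ : CommRingCat.of ℂ ⟶ B)
    (b : HomCoord → B) (hb : formX b = 0) {j k : Fin 2} {l : Fin 3} (hj : IsUnit (b (.inl j)))
    (hk : IsUnit (b (.inr (.inl k)))) (hl : IsUnit (b (.inr (.inr l)))) :
    ∃ u : Spec B ⟶ X, u ≫ X ↘ SpecC = Spec.map φ ∧ (PPPcoords.comp i).HasTuple u b := by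
  obtain ⟨v, hv, hvb⟩ := exists_PPP_hasTuple φ b hj hk hl
  have hker : i.ker ≤ v.ker := by
    rw [hX, le_ker_iff]
    apply comap_eq_bot_of_pullbackIdeal
    rw [pullbackIdeal_idealX hvb, hb, Ideal.span_singleton_zero]
  have hfac := IsClosedImmersion.lift_fac i v hker
  refine ⟨IsClosedImmersion.lift i v hker, ?_, Coords.HasTuple.comp_iff.2 (by rwa [hfac])⟩
  rw [← comp_i_over (i := i), hfac, hv]

lemma formX_eq_zero (hX : i.ker = idealX) [IsLocalRing B] {u : Spec B ⟶ X} {b : HomCoord → B}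
    (h : (PPPcoords.comp i).HasTuple u b) : formX b = 0 := by
  have h1 := pullbackIdeal_idealX (Coords.HasTuple.comp_iff.1 h)
  have h2 : idealX.comap i = ⊥ := (le_ker_iff _ _).1 hX.ge
  rw [← pullbackIdeal_comap, h2, pullbackIdeal_bot] at h1
  exact Ideal.span_singleton_eq_bot.1 h1.symm

variable [IsLocallyNoetherian X]

lemma pullbackIdeal_idealC [IsLocalRing B] {u : Spec B ⟶ X} {b : HomCoord → B}
    (h : (PPPcoords.comp i).HasTuple u b) : pullbackIdeal (idealC i) u = idealEq b := by
  have h1 : IsMultihomogeneous (cx 0 * cz 2 - cx 1 * cz 1) 1 0 1 := by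
    intro R _ l m n b
    simp only [map_sub, map_mul, MvPolynomial.aeval_X, scaleTuple]
    ring
  have h2 : IsMultihomogeneous (cx 1 * cz 0 - cx 0 * cz 1) 1 0 1 := by
    intro R _ l m n b
    simp only [map_sub, map_mul, MvPolynomial.aeval_X, scaleTuple]
    ring
  have h3 : IsMultihomogeneous (cy 0 * cz 2 - cy 1 * cz 1) 0 1 1 := by
    intro R _ l m n b
    simp only [map_sub, map_mul, MvPolynomial.aeval_X, scaleTuple]
    ring
  have h4 : IsMultihomogeneous (cy 1 * cz 0 - cy 0 * cz 1) 0 1 1 := by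
    intro R _ l m n b
    simp only [map_sub, map_mul, MvPolynomial.aeval_X, scaleTuple]
    ring
  rw [idealC, idealE₁, idealE₂, pullbackIdeal_sup, pullbackIdeal_sup, pullbackIdeal_sup,
    h.pullbackIdeal_ideal h1, h.pullbackIdeal_ideal h2, h.pullbackIdeal_ideal h3,
    h.pullbackIdeal_ideal h4, idealEq, Ideal.span_insert, Ideal.span_insert, Ideal.span_insert,
    sup_assoc]
  simp

end Threefold

/-! ### Automorphisms of the threefold and their lifts -/

lemma IsBlowup.exists_lift_iso {T' T : Scheme.{0}} {f : T' ⟶ T} {I : T.IdealSheafData}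
    (hf : IsBlowup f I) (σ : T ≅ T) (h : I.comap σ.hom = I) :
    ∃ τ : T' ≅ T', τ.hom ≫ f = f ≫ σ.hom := by
  have h' : I.comap σ.inv = I := by
    conv_lhs => rw [← h]
    rw [← Scheme.IdealSheafData.comap_comp, Iso.inv_hom_id, Scheme.IdealSheafData.comap_id]
  have ex : ∀ s : T ⟶ T, I.comap s = I → ∃ t : T' ⟶ T', t ≫ f = f ≫ s := by
    intro s hs
    refine (hf.2 T' (f ≫ s) ?_).exists
    rw [Scheme.IdealSheafData.comap_comp, hs]
    exact hf.1
  obtain ⟨t, ht⟩ := ex _ h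
  obtain ⟨t', ht'⟩ := ex _ h'
  have uniq : ∀ s : T' ⟶ T', s ≫ f = f → s = 𝟙 _ := fun s hs =>
    (hf.2 T' f hf.1).unique hs (Category.id_comp f)
  refine ⟨⟨t, t', uniq _ ?_, uniq _ ?_⟩, ht⟩
  · rw [Category.assoc, ht', ← Category.assoc, ht, Category.assoc, Iso.hom_inv_id, Category.comp_id]
  · rw [Category.assoc, ht, ← Category.assoc, ht', Category.assoc, Iso.inv_hom_id, Category.comp_id]

section Aut

variable (c₁ c₂ : Fin 2 → ℂ) (c₃ : Fin 3 → ℂ) (π₁ π₂ : Fin 2 ≃ Fin 2) (π₃ : Fin 3 ≃ Fin 3)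

lemma exists_PPP_iso (hc₁ : ∀ j, c₁ j ≠ 0) (hc₂ : ∀ j, c₂ j ≠ 0) (hc₃ : ∀ j, c₃ j ≠ 0) :
    ∃ σ : PPP ≅ PPP, σ.hom ≫ PPP ↘ SpecC = PPP ↘ SpecC ∧
      ∀ (B : CommRingCat.{0}) (φ : CommRingCat.of ℂ ⟶ B) (u : Spec B ⟶ PPP) (b : HomCoord → B),
        u ≫ PPP ↘ SpecC = Spec.map φ → PPPcoords.HasTuple u b →
          PPPcoords.HasTuple (u ≫ σ.hom) (actTuple φ.hom c₁ c₂ c₃ π₁ π₂ π₃ b) := by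
  obtain ⟨m₁, h₁, g₁⟩ := exists_PPiso (n := 1) c₁ hc₁ π₁
  obtain ⟨m₂, h₂, g₂⟩ := exists_PPiso (n := 1) c₂ hc₂ π₂
  obtain ⟨m₃, h₃, g₃⟩ := exists_PPiso (n := 2) c₃ hc₃ π₃
  have h₁' : m₁.inv ≫ PPstr 1 = PPstr 1 := by rw [Iso.inv_comp_eq, h₁]
  have h₂' : m₂.inv ≫ PPstr 1 = PPstr 1 := by rw [Iso.inv_comp_eq, h₂]
  have h₃' : m₃.inv ≫ PPstr 2 = PPstr 2 := by rw [Iso.inv_comp_eq, h₃]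
  obtain ⟨s, sp, sq, sr⟩ := exists_PPP_hom (PPPcoords.p ≫ m₁.hom) (PPPcoords.q ≫ m₂.hom)
    (PPPcoords.r ≫ m₃.hom) (by rw [Category.assoc, Category.assoc, h₁, h₂, PPPcoords_q])
    (by rw [Category.assoc, Category.assoc, h₁, h₃, PPPcoords_r])
  obtain ⟨t, tp, tq, tr⟩ := exists_PPP_hom (PPPcoords.p ≫ m₁.inv) (PPPcoords.q ≫ m₂.inv)
    (PPPcoords.r ≫ m₃.inv) (by rw [Category.assoc, Category.assoc, h₁', h₂', PPPcoords_q])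
    (by rw [Category.assoc, Category.assoc, h₁', h₃', PPPcoords_r])
  refine ⟨⟨s, t, PPP_hom_ext ?_ ?_ ?_, PPP_hom_ext ?_ ?_ ?_⟩, ?_, fun B φ u b h1 h2 => ⟨?_, ?_, ?_⟩⟩
  · rw [Category.assoc, tp, ← Category.assoc, sp]; simp
  · rw [Category.assoc, tq, ← Category.assoc, sq]; simp
  · rw [Category.assoc, tr, ← Category.assoc, sr]; simp
  · rw [Category.assoc, sp, ← Category.assoc, tp]; simp
  · rw [Category.assoc, sq, ← Category.assoc, tq]; simp
  · rw [Category.assoc, sr, ← Category.assoc, tr]; simp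
  · rw [PPP_over, ← Category.assoc, sp, Category.assoc, h₁]
  · rw [Category.assoc, sp, ← Category.assoc]
    exact g₁ B φ _ _ (by rw [← h1, PPP_over, Category.assoc]) h2.p
  · rw [Category.assoc, sq, ← Category.assoc]
    exact g₂ B φ _ _ (by rw [← h1, PPP_over, Category.assoc, PPPcoords_q]) h2.q
  · rw [Category.assoc, sr, ← Category.assoc]
    exact g₃ B φ _ _ (by rw [← h1, PPP_over, Category.assoc, PPPcoords_r]) h2.r

variable {X : Scheme.{0}} [X.Over SpecC] [IsLocallyNoetherian X] {i : X ⟶ PPP} [i.IsOver SpecC]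
  [IsClosedImmersion i]

lemma exists_fac_of_isIso (hX : i.ker = idealX) (s : PPP ⟶ PPP)
    (h : idealX.comap s = idealX) : ∃ t : X ⟶ X, t ≫ i = i ≫ s := by
  have hker : i.ker ≤ (i ≫ s).ker := by
    rw [hX, le_ker_iff, Scheme.IdealSheafData.comap_comp, h]
    exact (le_ker_iff _ _).1 hX.ge
  exact ⟨_, IsClosedImmersion.lift_fac i (i ≫ s) hker⟩

/-- A linear substitution preserving the equations of `X` and of `C` gives an automorphism of `X`
that lifts to the blow-up of `C`. -/
lemma exists_aut_lift (hX : i.ker = idealX) {X₁ : Scheme.{0}} {f : X₁ ⟶ X}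
    (hf : IsBlowup f (idealC i))
    (hc₁ : ∀ j, c₁ j ≠ 0) (hc₂ : ∀ j, c₂ j ≠ 0) (hc₃ : ∀ j, c₃ j ≠ 0)
    (hG : ∀ (R : Type) [CommRing R] (φ : ℂ →+* R) (b : HomCoord → R),
      Ideal.span {formX (actTuple φ c₁ c₂ c₃ π₁ π₂ π₃ b)} = Ideal.span {formX b})
    (hE : ∀ (R : Type) [CommRing R] (φ : ℂ →+* R) (b : HomCoord → R),
      idealEq (actTuple φ c₁ c₂ c₃ π₁ π₂ π₃ b) = idealEq b) :
    ∃ (σ : X ≅ X) (τ : X₁ ≅ X₁), σ.hom.IsOver SpecC ∧ τ.hom ≫ f = f ≫ σ.hom ∧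
      ∀ (B : CommRingCat.{0}) (φ : CommRingCat.of ℂ ⟶ B) (u : Spec B ⟶ X) (b : HomCoord → B),
        u ≫ X ↘ SpecC = Spec.map φ → (PPPcoords.comp i).HasTuple u b →
          (PPPcoords.comp i).HasTuple (u ≫ σ.hom) (actTuple φ.hom c₁ c₂ c₃ π₁ π₂ π₃ b) := by
  obtain ⟨s, hs, hsb⟩ := exists_PPP_iso c₁ c₂ c₃ π₁ π₂ π₃ hc₁ hc₂ hc₃
  have h1 : idealX.comap s.hom = idealX := by
    refine eq_of_pullbackIdeal_eq fun x => ?_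
    obtain ⟨b, hb⟩ := Coords.HasTuple.exists_of_isLocalRing PPPcoords (PPP.fromSpecStalk x)
    rw [pullbackIdeal_comap, pullbackIdeal_idealX hb,
      pullbackIdeal_idealX (hsb _ _ _ _ (Spec.map_preimage _).symm hb), hG]
  have h2 : idealX.comap s.inv = idealX := by
    conv_lhs => rw [← h1]
    rw [← Scheme.IdealSheafData.comap_comp, Iso.inv_hom_id, Scheme.IdealSheafData.comap_id]
  obtain ⟨t, ht⟩ := exists_fac_of_isIso hX s.hom h1
  obtain ⟨t', ht'⟩ := exists_fac_of_isIso hX s.inv h2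
  let σ : X ≅ X := ⟨t, t', by
    rw [← cancel_mono i, Category.assoc, ht', ← Category.assoc, ht, Category.assoc,
      Iso.hom_inv_id, Category.comp_id, Category.id_comp], by
    rw [← cancel_mono i, Category.assoc, ht, ← Category.assoc, ht', Category.assoc,
      Iso.inv_hom_id, Category.comp_id, Category.id_comp]⟩
  have hσ : ∀ (B : CommRingCat.{0}) (φ : CommRingCat.of ℂ ⟶ B) (u : Spec B ⟶ X)
      (b : HomCoord → B), u ≫ X ↘ SpecC = Spec.map φ → (PPPcoords.comp i).HasTuple u b →
        (PPPcoords.comp i).HasTuple (u ≫ σ.hom) (actTuple φ.hom c₁ c₂ c₃ π₁ π₂ π₃ b) := by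
    intro B φ u b h3 h4
    rw [Coords.HasTuple.comp_iff] at h4 ⊢
    have h5 : (u ≫ σ.hom) ≫ i = (u ≫ i) ≫ s.hom := by
      rw [Category.assoc, Category.assoc]; exact congrArg (u ≫ ·) ht
    rw [h5]
    exact hsb B φ _ b (by rw [comp_i_over, h3]) h4
  obtain ⟨τ, hτ⟩ := hf.exists_lift_iso σ (by
    refine eq_of_pullbackIdeal_eq fun x => ?_
    obtain ⟨b, hb⟩ := Coords.HasTuple.exists_of_isLocalRing (PPPcoords.comp i) (X.fromSpecStalk x)
    rw [pullbackIdeal_comap, pullbackIdeal_idealC hb,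
      pullbackIdeal_idealC (hσ _ _ _ _ (Spec.map_preimage _).symm hb), hE])
  refine ⟨σ, τ, ⟨?_⟩, hτ, hσ⟩
  change t ≫ X ↘ SpecC = X ↘ SpecC
  rw [← comp_over i SpecC, ← Category.assoc, ht, Category.assoc, hs]

end Aut

end

section

variable {B B' : CommRingCat.{0}}

/-! ### Morphisms from local schemes and stalks -/

lemma exists_stalk_hom {T : Scheme.{0}} [IsLocalRing B] (u : Spec B ⟶ T) {x : T}
    (hx : u (IsLocalRing.closedPoint B) = x) :
    ∃ φ : T.presheaf.stalk x ⟶ B, IsLocalHom φ.hom ∧ Spec.map φ ≫ T.fromSpecStalk x = u := by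
  subst hx
  exact ⟨Scheme.stalkClosedPointTo u, inferInstance,
    Scheme.Spec_stalkClosedPointTo_fromSpecStalk u⟩

lemma closedPoint_of_isLocalHom [IsLocalRing B] [IsLocalRing B'] (φ : B ⟶ B') [IsLocalHom φ.hom] :
    Spec.map φ (IsLocalRing.closedPoint B') = IsLocalRing.closedPoint B :=
  PrimeSpectrum.ext (IsLocalRing.comap_closedPoint φ.hom ▸ rfl)

lemma exists_retraction {T : Scheme.{0}} [IsLocalRing B] (u : Spec B ⟶ T) (x : T)
    (ψ : B ⟶ T.presheaf.stalk x) [IsLocalHom ψ.hom] (h : Spec.map ψ ≫ u = T.fromSpecStalk x) :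
    ∃ φ : T.presheaf.stalk x ⟶ B, IsLocalHom φ.hom ∧ Spec.map φ ≫ T.fromSpecStalk x = u ∧
      φ ≫ ψ = 𝟙 _ := by
  have h1 : u (IsLocalRing.closedPoint B) = x := by
    have h2 := congrArg u (closedPoint_of_isLocalHom ψ)
    rw [← h2]
    refine (Scheme.Hom.comp_apply (Spec.map ψ) u _).symm.trans ?_
    rw [h]
    exact Scheme.fromSpecStalk_closedPoint
  obtain ⟨φ, h2, h3⟩ := exists_stalk_hom u h1
  refine ⟨φ, h2, h3, Spec.map_injective ?_⟩
  rw [Spec.map_comp, Spec.map_id, ← cancel_mono (T.fromSpecStalk x), Category.assoc, h3, h,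
    Category.id_comp]

/-- The structure of a `ℂ`-algebra on the stalks of a scheme over `ℂ`. -/
def stalkConst (T : Scheme.{0}) [T.Over SpecC] (x : T) :
    CommRingCat.of ℂ ⟶ T.presheaf.stalk x :=
  Spec.preimage (T.fromSpecStalk x ≫ T ↘ SpecC)

lemma map_stalkConst (T : Scheme.{0}) [T.Over SpecC] (x : T) :
    T.fromSpecStalk x ≫ T ↘ SpecC = Spec.map (stalkConst T x) :=
  (Spec.map_preimage _).symm

/-! ### Affine charts of the threefold -/

/-- A chart of the threefold isomorphic to affine space. -/
structure Chart where
  i : Fin 2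
  j : Fin 2
  k : Fin 3
  b : HomCoord → MvPolynomial (Fin 3) ℤ
  e : Fin 3 → MvPolynomial HomCoord ℤ
  b_i : b (.inl i) = 1
  b_j : b (.inr (.inl j)) = 1
  b_k : b (.inr (.inr k)) = 1
  formX_b : formX b = 0
  aeval_e : ∀ l, MvPolynomial.aeval b (e l) = MvPolynomial.X l
  aeval_b : ∀ (R : Type) [CommRing R] (β : HomCoord → R), formX β = 0 → β (.inl i) = 1 →
    β (.inr (.inl j)) = 1 → β (.inr (.inr k)) = 1 →
    ∀ h, MvPolynomial.aeval (fun l => MvPolynomial.aeval β (e l)) (b h) = β h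

namespace Chart

/-- The tuple `β` is normalized with respect to the chart. -/
structure Normalized (κ : Chart) {R : Type} [CommRing R] (β : HomCoord → R) : Prop where
  i : β (.inl κ.i) = 1
  j : β (.inr (.inl κ.j)) = 1
  k : β (.inr (.inr κ.k)) = 1

/-- The tuple `β` gives a point of the chart. -/
structure Units (κ : Chart) {R : Type} [CommRing R] (β : HomCoord → R) : Prop where
  i : IsUnit (β (.inl κ.i))
  j : IsUnit (β (.inr (.inl κ.j)))
  k : IsUnit (β (.inr (.inr κ.k)))

variable (κ : Chart) {R S : Type} [CommRing R] [CommRing S]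

lemma Normalized.units {κ : Chart} {β : HomCoord → R} (h : κ.Normalized β) : κ.Units β :=
  ⟨h.i ▸ isUnit_one, h.j ▸ isUnit_one, h.k ▸ isUnit_one⟩

lemma Normalized.map {κ : Chart} {β : HomCoord → R} (h : κ.Normalized β) (f : R →+* S) :
    κ.Normalized (fun l => f (β l)) :=
  ⟨by simp [h.i], by simp [h.j], by simp [h.k]⟩

/-- The tuple normalized with respect to the chart. -/
def normalize (β : HomCoord → R) : HomCoord → R :=
  scaleTuple (Ring.inverse (β (.inl κ.i))) (Ring.inverse (β (.inr (.inl κ.j))))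
    (Ring.inverse (β (.inr (.inr κ.k)))) β

lemma Units.normalized {κ : Chart} {β : HomCoord → R} (h : κ.Units β) :
    κ.Normalized (κ.normalize β) :=
  ⟨Ring.inverse_mul_cancel _ h.i, Ring.inverse_mul_cancel _ h.j, Ring.inverse_mul_cancel _ h.k⟩

lemma Units.hasTuple_normalize {κ : Chart} {T : Scheme.{0}} {c : Coords T} {u : Spec B ⟶ T}
    {β : HomCoord → B} (h : κ.Units β) (hu : c.HasTuple u β) : c.HasTuple u (κ.normalize β) :=
  hu.scale h.i.ringInverse h.j.ringInverse h.k.ringInverse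

lemma Normalized.eq_of_hasTuple {κ : Chart} {T : Scheme.{0}} {c : Coords T} {u : Spec B ⟶ T}
    {β β' : HomCoord → B} (h : κ.Normalized β) (h' : κ.Normalized β') (hu : c.HasTuple u β)
    (hu' : c.HasTuple u β') : β = β' := by
  obtain ⟨l, m, n, -, -, -, rfl⟩ := hu.exists_scale hu'
  have hl : l * β (.inl κ.i) = 1 := h'.i
  have hm : m * β (.inr (.inl κ.j)) = 1 := h'.j
  have hn : n * β (.inr (.inr κ.k)) = 1 := h'.k
  rw [h.i, mul_one] at hl
  rw [h.j, mul_one] at hm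
  rw [h.k, mul_one] at hn
  subst hl hm hn
  funext x
  rcases x with x | x | x <;> simp [scaleTuple]

/-- The affine coordinates in the chart of the point given by a normalized tuple. -/
def coord (β : HomCoord → R) (l : Fin 3) : R := MvPolynomial.aeval β (κ.e l)

/-- The homomorphism given by the affine coordinates of the point with normalized tuple `β`. -/
def hom (φ : ℂ →+* R) (β : HomCoord → R) : MvPolynomial (Fin 3) ℂ →+* R :=
  MvPolynomial.eval₂Hom φ (κ.coord β)

/-- The universal normalized tuple of the chart. -/
def tuple (v : Fin 3 → R) (h : HomCoord) : R := MvPolynomial.aeval v (κ.b h)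

lemma map_aevalInt {σ : Type} (f : R →+* S) (v : σ → R) (p : MvPolynomial σ ℤ) :
    f (MvPolynomial.aeval v p) = MvPolynomial.aeval (fun l => f (v l)) p := by
  rw [MvPolynomial.aeval_def, MvPolynomial.aeval_def]
  refine (MvPolynomial.hom_eval₂ p _ f v).trans ?_
  exact congrArg (fun g => MvPolynomial.eval₂ g _ p) (RingHom.ext_int _ _)

lemma map_tuple (f : R →+* S) (v : Fin 3 → R) (h : HomCoord) :
    f (κ.tuple v h) = κ.tuple (fun l => f (v l)) h := map_aevalInt f v _

lemma map_coord (f : R →+* S) (β : HomCoord → R) (l : Fin 3) :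
    f (κ.coord β l) = κ.coord (fun h => f (β h)) l := map_aevalInt f β _

lemma normalized_tuple (v : Fin 3 → R) : κ.Normalized (κ.tuple v) :=
  ⟨by simp [tuple, κ.b_i], by simp [tuple, κ.b_j], by simp [tuple, κ.b_k]⟩

lemma formX_tuple (v : Fin 3 → R) : formX (κ.tuple v) = 0 := by
  have := congrArg (MvPolynomial.aeval v) κ.formX_b
  rw [map_zero] at this
  rw [← this]
  simp [formX, tuple]

lemma coord_tuple (v : Fin 3 → R) (l : Fin 3) : κ.coord (κ.tuple v) l = v l := by
  have h1 := map_aevalInt (MvPolynomial.aeval v : _ →ₐ[ℤ] R).toRingHom κ.b (κ.e l)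
  have h2 := congrArg (MvPolynomial.aeval v : _ →ₐ[ℤ] R).toRingHom (κ.aeval_e l)
  exact h1.symm.trans (h2.trans (MvPolynomial.aeval_X _ _))

lemma Normalized.tuple_coord {κ : Chart} {β : HomCoord → R} (h : κ.Normalized β)
    (hβ : formX β = 0) : κ.tuple (κ.coord β) = β :=
  funext fun x => κ.aeval_b R β hβ h.i h.j h.k x

lemma hom_X (φ : ℂ →+* R) (β : HomCoord → R) (l : Fin 3) :
    κ.hom φ β (MvPolynomial.X l) = κ.coord β l := MvPolynomial.eval₂Hom_X' _ _ _

lemma hom_C (φ : ℂ →+* R) (β : HomCoord → R) (a : ℂ) :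
    κ.hom φ β (MvPolynomial.C a) = φ a := MvPolynomial.eval₂Hom_C _ _ _

end Chart

/-- `ψ` identifies a localization of the polynomial ring with the ring `O`. -/
structure IsLocalCoords {O : Type} [CommRing O] (ψ : MvPolynomial (Fin 3) ℂ →+* O) : Prop where
  inj : Function.Injective ψ
  surj : ∀ z, ∃ p d, IsUnit (ψ d) ∧ z * ψ d = ψ p

section Threefold

variable {X : Scheme.{0}} [X.Over SpecC] [IsLocallyNoetherian X] {i : X ⟶ PPP} [i.IsOver SpecC]
  [IsClosedImmersion i]


lemma Chart.exists_point (κ : Chart) (hX : i.ker = idealX) [IsLocalRing B]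
    (al : MvPolynomial (Fin 3) ℂ →+* B) :
    ∃ u : Spec B ⟶ X, u ≫ X ↘ SpecC = Spec.map (CommRingCat.ofHom (al.comp MvPolynomial.C)) ∧
      (PPPcoords.comp i).HasTuple u (κ.tuple fun l => al (MvPolynomial.X l)) :=
  exists_X_hasTuple hX _ _ (κ.formX_tuple _) (κ.normalized_tuple _).units.i
    (κ.normalized_tuple _).units.j (κ.normalized_tuple _).units.k

lemma Chart.comp_eq (κ : Chart) {x : X} {β : HomCoord → X.presheaf.stalk x}
    (hβ : (PPPcoords.comp i).HasTuple (X.fromSpecStalk x) β) (hn : κ.Normalized β)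
    {al : MvPolynomial (Fin 3) ℂ →+* B} {u : Spec B ⟶ X}
    (hu : u ≫ X ↘ SpecC = Spec.map (CommRingCat.ofHom (al.comp MvPolynomial.C)))
    (hu' : (PPPcoords.comp i).HasTuple u (κ.tuple fun l => al (MvPolynomial.X l)))
    (φ : X.presheaf.stalk x ⟶ B) (hφ : Spec.map φ ≫ X.fromSpecStalk x = u) :
    φ.hom.comp (κ.hom (stalkConst X x).hom β) = al := by
  refine MvPolynomial.ringHom_ext (fun a => ?_) (fun l => ?_)
  · rw [RingHom.comp_apply, κ.hom_C]
    rw [← hφ, Category.assoc, map_stalkConst, ← Spec.map_comp] at hu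
    exact congrArg (fun χ => χ.hom a) (Spec.map_injective hu)
  · rw [RingHom.comp_apply, κ.hom_X, κ.map_coord]
    have h1 := (hβ.comp φ).congr hφ
    rw [Normalized.eq_of_hasTuple (hn.map φ.hom) (κ.normalized_tuple _) h1 hu', κ.coord_tuple]

lemma Chart.isLocalCoords (κ : Chart) (hX : i.ker = idealX) (x : X)
    {β : HomCoord → X.presheaf.stalk x}
    (hβ : (PPPcoords.comp i).HasTuple (X.fromSpecStalk x) β) (hn : κ.Normalized β) :
    IsLocalCoords (κ.hom (stalkConst X x).hom β) := by
  set ψ := κ.hom (stalkConst X x).hom β with hψ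
  let 𝔭 : Ideal (MvPolynomial (Fin 3) ℂ) := (IsLocalRing.maximalIdeal _).comap ψ
  have : 𝔭.IsPrime := Ideal.comap_isPrime _ _
  let A : CommRingCat.{0} := CommRingCat.of (Localization.AtPrime 𝔭)
  let al : MvPolynomial (Fin 3) ℂ →+* A := algebraMap _ (Localization.AtPrime 𝔭)
  have : IsLocalRing A := inferInstanceAs (IsLocalRing (Localization.AtPrime 𝔭))
  have hunit : ∀ d : 𝔭.primeCompl, IsUnit (ψ d) := fun d => by
    by_contra h
    exact d.2 ((IsLocalRing.mem_maximalIdeal _).2 h)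
  let l : Localization.AtPrime 𝔭 →+* X.presheaf.stalk x := IsLocalization.lift hunit
  let ψ' : A ⟶ X.presheaf.stalk x := CommRingCat.ofHom l
  have hl : ∀ p, ψ'.hom (al p) = ψ p := fun p => IsLocalization.lift_eq hunit p
  have hloc : IsLocalHom ψ'.hom := by
    refine ⟨fun a ha => ?_⟩
    obtain ⟨⟨p, d⟩, h⟩ := IsLocalization.surj (M := 𝔭.primeCompl) (S := Localization.AtPrime 𝔭) a
    have h1 : ψ'.hom a * ψ d = ψ p := by
      rw [← hl, ← hl, ← map_mul]; exact congrArg _ h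
    have h2 : p ∈ 𝔭.primeCompl := fun hp =>
      (IsLocalRing.mem_maximalIdeal _).1 (Ideal.mem_comap.1 hp) (h1 ▸ ha.mul (hunit d))
    have h3 : IsUnit (a * al d) := h ▸ IsLocalization.map_units (Localization.AtPrime 𝔭) ⟨p, h2⟩
    exact isUnit_of_mul_isUnit_left h3
  obtain ⟨u, hu, hu'⟩ := κ.exists_point (i := i) hX al
  have hfac : Spec.map ψ' ≫ u = X.fromSpecStalk x := by
    have h1 := hu'.comp ψ'
    have h2 : (fun h => ψ'.hom (κ.tuple (fun l => al (MvPolynomial.X l)) h)) = β := by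
      funext h
      rw [κ.map_tuple]
      simp only [hl, hψ, κ.hom_X]
      rw [hn.tuple_coord (formX_eq_zero hX hβ)]
    rw [h2] at h1
    refine X_ext h1 hβ ?_
    rw [Category.assoc, hu, map_stalkConst, ← Spec.map_comp]
    congr 1
    ext a
    exact (hl _).trans (κ.hom_C _ _ _)
  obtain ⟨φ, -, hφ, hret⟩ := exists_retraction u x ψ' hfac
  have hφψ := κ.comp_eq hβ hn hu hu' φ hφ
  have hinj : Function.Injective al :=
    IsLocalization.injective (Localization.AtPrime 𝔭) 𝔭.primeCompl_le_nonZeroDivisors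
  have hret' : ∀ z, ψ'.hom (φ.hom z) = z := fun z => congrArg (fun χ => χ.hom z) hret
  constructor
  · refine Function.Injective.of_comp (f := φ.hom) ?_
    rw [← RingHom.coe_comp, hφψ]
    exact hinj
  · intro z
    obtain ⟨⟨p, d⟩, h⟩ := IsLocalization.surj (M := 𝔭.primeCompl) (S := Localization.AtPrime 𝔭)
      (φ.hom z)
    refine ⟨p, d, hunit d, ?_⟩
    have h2 : ψ'.hom (φ.hom z * al d) = ψ'.hom (al p) := congrArg _ h
    rwa [map_mul, hret', hl, hl] at h2

end Threefold

end

section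

/-! ### The eight charts -/

/-- A tuple of multihomogeneous coordinates. -/
def mkTuple {R : Type} (x₀ x₁ y₀ y₁ z₀ z₁ z₂ : R) : HomCoord → R :=
  Sum.elim ![x₀, x₁] (Sum.elim ![y₀, y₁] ![z₀, z₁, z₂])

section mkTuple

variable {R : Type} (x₀ x₁ y₀ y₁ z₀ z₁ z₂ : R)

@[simp] lemma mkTuple_x₀ : mkTuple x₀ x₁ y₀ y₁ z₀ z₁ z₂ (.inl 0) = x₀ := rfl
@[simp] lemma mkTuple_x₁ : mkTuple x₀ x₁ y₀ y₁ z₀ z₁ z₂ (.inl 1) = x₁ := rfl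
@[simp] lemma mkTuple_y₀ : mkTuple x₀ x₁ y₀ y₁ z₀ z₁ z₂ (.inr (.inl 0)) = y₀ := rfl
@[simp] lemma mkTuple_y₁ : mkTuple x₀ x₁ y₀ y₁ z₀ z₁ z₂ (.inr (.inl 1)) = y₁ := rfl
@[simp] lemma mkTuple_z₀ : mkTuple x₀ x₁ y₀ y₁ z₀ z₁ z₂ (.inr (.inr 0)) = z₀ := rfl
@[simp] lemma mkTuple_z₁ : mkTuple x₀ x₁ y₀ y₁ z₀ z₁ z₂ (.inr (.inr 1)) = z₁ := rfl
@[simp] lemma mkTuple_z₂ : mkTuple x₀ x₁ y₀ y₁ z₀ z₁ z₂ (.inr (.inr 2)) = z₂ := rfl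

lemma forall_homCoord {p : HomCoord → Prop} : (∀ h, p h) ↔
    (p (.inl 0) ∧ p (.inl 1)) ∧ (p (.inr (.inl 0)) ∧ p (.inr (.inl 1))) ∧
      p (.inr (.inr 0)) ∧ p (.inr (.inr 1)) ∧ p (.inr (.inr 2)) := by
  simp [Sum.forall, Fin.forall_fin_succ]

end mkTuple

/-- The polynomial variables on the charts. -/
abbrev vX (l : Fin 3) : MvPolynomial (Fin 3) ℤ := MvPolynomial.X l

namespace Chart

/-- The chart `x₀ y₀ z₀ ≠ 0`. -/
def c000 : Chart where
  i := 0
  j := 0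
  k := 0
  b := mkTuple 1 (vX 0) 1 (vX 1) 1 (vX 2) ((vX 0 + vX 1) * vX 2 - vX 0 * vX 1)
  e := ![cx 1, cy 1, cz 1]
  b_i := rfl
  b_j := rfl
  b_k := rfl
  formX_b := by
    simp only [formX, mkTuple_x₀, mkTuple_x₁, mkTuple_y₀, mkTuple_y₁, mkTuple_z₀, mkTuple_z₁,
      mkTuple_z₂]
    ring
  aeval_e l := by
    fin_cases l <;> simp
  aeval_b R _ β hβ h1 h2 h3 := by
    rw [formX, h1, h2, h3] at hβ
    refine forall_homCoord.2 ?_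
    simp only [mkTuple_x₀, mkTuple_x₁, mkTuple_y₀, mkTuple_y₁, mkTuple_z₀, mkTuple_z₁, mkTuple_z₂]
    simp [h1, h2, h3]
    linear_combination -hβ

/-- The chart `x₀ y₀ z₁ ≠ 0`. -/
def c001 : Chart where
  i := 0
  j := 0
  k := 1
  b := mkTuple 1 (vX 0) 1 (vX 1) (vX 2) 1 ((vX 0 + vX 1) - vX 0 * vX 1 * vX 2)
  e := ![cx 1, cy 1, cz 0]
  b_i := rfl
  b_j := rfl
  b_k := rfl
  formX_b := by
    simp only [formX, mkTuple_x₀, mkTuple_x₁, mkTuple_y₀, mkTuple_y₁, mkTuple_z₀, mkTuple_z₁,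
      mkTuple_z₂]
    ring
  aeval_e l := by
    fin_cases l <;> simp
  aeval_b R _ β hβ h1 h2 h3 := by
    rw [formX, h1, h2, h3] at hβ
    refine forall_homCoord.2 ?_
    simp only [mkTuple_x₀, mkTuple_x₁, mkTuple_y₀, mkTuple_y₁, mkTuple_z₀, mkTuple_z₁, mkTuple_z₂]
    simp [h1, h2, h3]
    linear_combination -hβ

/-- The chart `x₁ y₁ z₂ ≠ 0`. -/
def c112 : Chart where
  i := 1
  j := 1
  k := 2
  b := mkTuple (vX 0) 1 (vX 1) 1 ((vX 0 + vX 1) * vX 2 - vX 0 * vX 1) (vX 2) 1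
  e := ![cx 0, cy 0, cz 1]
  b_i := rfl
  b_j := rfl
  b_k := rfl
  formX_b := by
    simp only [formX, mkTuple_x₀, mkTuple_x₁, mkTuple_y₀, mkTuple_y₁, mkTuple_z₀, mkTuple_z₁,
      mkTuple_z₂]
    ring
  aeval_e l := by
    fin_cases l <;> simp
  aeval_b R _ β hβ h1 h2 h3 := by
    rw [formX, h1, h2, h3] at hβ
    refine forall_homCoord.2 ?_
    simp only [mkTuple_x₀, mkTuple_x₁, mkTuple_y₀, mkTuple_y₁, mkTuple_z₀, mkTuple_z₁, mkTuple_z₂]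
    simp [h1, h2, h3]
    linear_combination -hβ

/-- The chart `x₁ y₁ z₁ ≠ 0`. -/
def c111 : Chart where
  i := 1
  j := 1
  k := 1
  b := mkTuple (vX 0) 1 (vX 1) 1 ((vX 0 + vX 1) - vX 0 * vX 1 * vX 2) 1 (vX 2)
  e := ![cx 0, cy 0, cz 2]
  b_i := rfl
  b_j := rfl
  b_k := rfl
  formX_b := by
    simp only [formX, mkTuple_x₀, mkTuple_x₁, mkTuple_y₀, mkTuple_y₁, mkTuple_z₀, mkTuple_z₁,
      mkTuple_z₂]
    ring
  aeval_e l := by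
    fin_cases l <;> simp
  aeval_b R _ β hβ h1 h2 h3 := by
    rw [formX, h1, h2, h3] at hβ
    refine forall_homCoord.2 ?_
    simp only [mkTuple_x₀, mkTuple_x₁, mkTuple_y₀, mkTuple_y₁, mkTuple_z₀, mkTuple_z₁, mkTuple_z₂]
    simp [h1, h2, h3]
    linear_combination -hβ

/-- The chart `x₀ y₁ z₀ ≠ 0`. -/
def c010 : Chart where
  i := 0
  j := 1
  k := 0
  b := mkTuple 1 (vX 0) (vX 1) 1 1 (vX 0 + vX 1 * vX 2) (vX 2 + vX 0 ^ 2 + vX 0 * vX 1 * vX 2)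
  e := ![cx 1, cy 0, cz 2 - cx 1 * cz 1]
  b_i := rfl
  b_j := rfl
  b_k := rfl
  formX_b := by
    simp only [formX, mkTuple_x₀, mkTuple_x₁, mkTuple_y₀, mkTuple_y₁, mkTuple_z₀, mkTuple_z₁,
      mkTuple_z₂]
    ring
  aeval_e l := by
    fin_cases l <;> simp <;> ring
  aeval_b R _ β hβ h1 h2 h3 := by
    rw [formX, h1, h2, h3] at hβ
    refine forall_homCoord.2 ?_
    simp only [mkTuple_x₀, mkTuple_x₁, mkTuple_y₀, mkTuple_y₁, mkTuple_z₀, mkTuple_z₁, mkTuple_z₂]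
    simp [h1, h2, h3]
    refine ⟨?_, ?_⟩
    · linear_combination hβ
    · linear_combination β (.inl 1) * hβ

/-- The chart `x₁ y₀ z₀ ≠ 0`. -/
def c100 : Chart where
  i := 1
  j := 0
  k := 0
  b := mkTuple (vX 0) 1 1 (vX 1) 1 (vX 1 + vX 0 * vX 2) (vX 2 + vX 1 ^ 2 + vX 1 * vX 0 * vX 2)
  e := ![cx 0, cy 1, cz 2 - cy 1 * cz 1]
  b_i := rfl
  b_j := rfl
  b_k := rfl
  formX_b := by
    simp only [formX, mkTuple_x₀, mkTuple_x₁, mkTuple_y₀, mkTuple_y₁, mkTuple_z₀, mkTuple_z₁,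
      mkTuple_z₂]
    ring
  aeval_e l := by
    fin_cases l <;> simp <;> ring
  aeval_b R _ β hβ h1 h2 h3 := by
    rw [formX, h1, h2, h3] at hβ
    refine forall_homCoord.2 ?_
    simp only [mkTuple_x₀, mkTuple_x₁, mkTuple_y₀, mkTuple_y₁, mkTuple_z₀, mkTuple_z₁, mkTuple_z₂]
    simp [h1, h2, h3]
    refine ⟨?_, ?_⟩
    · linear_combination hβ
    · linear_combination β (.inr (.inl 1)) * hβ

/-- The chart `x₀ y₁ z₂ ≠ 0`. -/
def c012 : Chart where
  i := 0
  j := 1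
  k := 2
  b := mkTuple 1 (vX 0) (vX 1) 1 (vX 2 + vX 1 ^ 2 + vX 1 * vX 0 * vX 2) (vX 1 + vX 0 * vX 2) 1
  e := ![cx 1, cy 0, cz 0 - cy 0 * cz 1]
  b_i := rfl
  b_j := rfl
  b_k := rfl
  formX_b := by
    simp only [formX, mkTuple_x₀, mkTuple_x₁, mkTuple_y₀, mkTuple_y₁, mkTuple_z₀, mkTuple_z₁,
      mkTuple_z₂]
    ring
  aeval_e l := by
    fin_cases l <;> simp <;> ring
  aeval_b R _ β hβ h1 h2 h3 := by
    rw [formX, h1, h2, h3] at hβ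
    refine forall_homCoord.2 ?_
    simp only [mkTuple_x₀, mkTuple_x₁, mkTuple_y₀, mkTuple_y₁, mkTuple_z₀, mkTuple_z₁, mkTuple_z₂]
    simp [h1, h2, h3]
    refine ⟨?_, ?_⟩
    · linear_combination β (.inr (.inl 0)) * hβ
    · linear_combination hβ

/-- The chart `x₁ y₀ z₂ ≠ 0`. -/
def c102 : Chart where
  i := 1
  j := 0
  k := 2
  b := mkTuple (vX 0) 1 1 (vX 1) (vX 2 + vX 0 ^ 2 + vX 0 * vX 1 * vX 2) (vX 0 + vX 1 * vX 2) 1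
  e := ![cx 0, cy 1, cz 0 - cx 0 * cz 1]
  b_i := rfl
  b_j := rfl
  b_k := rfl
  formX_b := by
    simp only [formX, mkTuple_x₀, mkTuple_x₁, mkTuple_y₀, mkTuple_y₁, mkTuple_z₀, mkTuple_z₁,
      mkTuple_z₂]
    ring
  aeval_e l := by
    fin_cases l <;> simp <;> ring
  aeval_b R _ β hβ h1 h2 h3 := by
    rw [formX, h1, h2, h3] at hβ
    refine forall_homCoord.2 ?_
    simp only [mkTuple_x₀, mkTuple_x₁, mkTuple_y₀, mkTuple_y₁, mkTuple_z₀, mkTuple_z₁, mkTuple_z₂]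
    simp [h1, h2, h3]
    refine ⟨?_, ?_⟩
    · linear_combination β (.inl 0) * hβ
    · linear_combination hβ

end Chart

/-- The eight charts of the threefold. -/
def chart : Fin 8 → Chart :=
  ![.c000, .c001, .c112, .c111, .c010, .c100, .c012, .c102]

lemma isUnit_of_eq_of_not_isUnit {R : Type} [CommRing R] [IsLocalRing R] {a b c d : R}
    (h : a = b + c + d) (ha : IsUnit a) (hb : ¬ IsUnit b) (hc : ¬ IsUnit c) : IsUnit d := by
  by_contra hd
  have h1 := fun x : R => (IsLocalRing.mem_maximalIdeal x)
  refine (h1 a).1 ?_ ha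
  rw [h]
  exact add_mem (add_mem ((h1 b).2 hb) ((h1 c).2 hc)) ((h1 d).2 hd)

lemma false_of_forall_not_isUnit {R : Type} [CommRing R] [IsLocalRing R]
    {x₀ x₁ y₀ y₁ z₀ z₁ z₂ : R}
    (hβ : x₀ * y₀ * z₂ + x₁ * y₁ * z₀ - x₀ * y₁ * z₁ - x₁ * y₀ * z₁ = 0)
    (hj : IsUnit x₀ ∨ IsUnit x₁) (hk : IsUnit y₀ ∨ IsUnit y₁)
    (hl : IsUnit z₀ ∨ IsUnit z₁ ∨ IsUnit z₂)
    (H0 : IsUnit x₀ → IsUnit y₀ → ¬ IsUnit z₀) (H1 : IsUnit x₀ → IsUnit y₀ → ¬ IsUnit z₁)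
    (H2 : IsUnit x₁ → IsUnit y₁ → ¬ IsUnit z₂) (H3 : IsUnit x₁ → IsUnit y₁ → ¬ IsUnit z₁)
    (H4 : IsUnit x₀ → IsUnit y₁ → ¬ IsUnit z₀) (H5 : IsUnit x₁ → IsUnit y₀ → ¬ IsUnit z₀)
    (H6 : IsUnit x₀ → IsUnit y₁ → ¬ IsUnit z₂) (H7 : IsUnit x₁ → IsUnit y₀ → ¬ IsUnit z₂) :
    False := by
  have h00 : IsUnit x₀ → IsUnit y₀ → False := fun hx hy => by
    have h0 := H0 hx hy
    have h1 := H1 hx hy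
    have h2 : IsUnit z₂ := (hl.resolve_left h0).resolve_left h1
    have := isUnit_of_eq_of_not_isUnit (show x₀ * y₀ * z₂ = x₀ * y₁ * z₁ + x₁ * y₀ * z₁ +
      -x₁ * y₁ * z₀ by linear_combination hβ) ((hx.mul hy).mul h2)
      (fun h => h1 (isUnit_of_mul_isUnit_right h)) (fun h => h1 (isUnit_of_mul_isUnit_right h))
    exact h0 (isUnit_of_mul_isUnit_right this)
  have h11 : IsUnit x₁ → IsUnit y₁ → False := fun hx hy => by
    have h0 := H2 hx hy
    have h1 := H3 hx hy
    have h2 : IsUnit z₀ := hl.resolve_right (fun h => h.elim h1 h0)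
    have := isUnit_of_eq_of_not_isUnit (show x₁ * y₁ * z₀ = x₀ * y₁ * z₁ + x₁ * y₀ * z₁ +
      -x₀ * y₀ * z₂ by linear_combination hβ) ((hx.mul hy).mul h2)
      (fun h => h1 (isUnit_of_mul_isUnit_right h)) (fun h => h1 (isUnit_of_mul_isUnit_right h))
    exact h0 (isUnit_of_mul_isUnit_right this)
  rcases hj with hx | hx
  · have hy : IsUnit y₁ := hk.resolve_left (h00 hx)
    have hz : IsUnit z₁ := (hl.resolve_left (H4 hx hy)).resolve_right (H6 hx hy)
    have := isUnit_of_eq_of_not_isUnit (show x₀ * y₁ * z₁ = y₀ * (x₀ * z₂) + x₁ * (y₁ * z₀) +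
      x₁ * (-y₀ * z₁) by linear_combination -hβ) ((hx.mul hy).mul hz)
      (fun h => h00 hx (isUnit_of_mul_isUnit_left h))
      (fun h => h11 (isUnit_of_mul_isUnit_left h) hy)
    exact h11 (isUnit_of_mul_isUnit_left this) hy
  · have hy : IsUnit y₀ := hk.resolve_right (h11 hx)
    have hz : IsUnit z₁ := (hl.resolve_left (H5 hx hy)).resolve_right (H7 hx hy)
    have := isUnit_of_eq_of_not_isUnit (show x₁ * y₀ * z₁ = x₀ * (y₀ * z₂) + y₁ * (x₁ * z₀) +
      x₀ * (-y₁ * z₁) by linear_combination -hβ) ((hx.mul hy).mul hz)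
      (fun h => h00 (isUnit_of_mul_isUnit_left h) hy)
      (fun h => h11 hx (isUnit_of_mul_isUnit_left h))
    exact h00 (isUnit_of_mul_isUnit_left this) hy

/-- The charts cover the threefold. -/
lemma exists_chart_units {R : Type} [CommRing R] [IsLocalRing R] {β : HomCoord → R}
    (hβ : formX β = 0) {j k : Fin 2} {l : Fin 3} (hj : IsUnit (β (.inl j)))
    (hk : IsUnit (β (.inr (.inl k)))) (hl : IsUnit (β (.inr (.inr l)))) :
    ∃ a, (chart a).Units β := by
  by_contra! H
  refine false_of_forall_not_isUnit (hβ) ?_ ?_ ?_ (fun h1 h2 h3 => H 0 ⟨h1, h2, h3⟩)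
    (fun h1 h2 h3 => H 1 ⟨h1, h2, h3⟩) (fun h1 h2 h3 => H 2 ⟨h1, h2, h3⟩)
    (fun h1 h2 h3 => H 3 ⟨h1, h2, h3⟩) (fun h1 h2 h3 => H 4 ⟨h1, h2, h3⟩)
    (fun h1 h2 h3 => H 5 ⟨h1, h2, h3⟩) (fun h1 h2 h3 => H 6 ⟨h1, h2, h3⟩)
    (fun h1 h2 h3 => H 7 ⟨h1, h2, h3⟩)
  · fin_cases j
    exacts [.inl hj, .inr hj]
  · fin_cases k
    exacts [.inl hk, .inr hk]
  · fin_cases l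
    exacts [.inl hl, .inr (.inl hl), .inr (.inr hl)]

end

section

variable {B B' : CommRingCat.{0}}

/-! ### Lifting points to blow-ups -/

section Blowup

variable {T' T : Scheme.{0}} {f : T' ⟶ T} {I : T.IdealSheafData}

lemma IsBlowup.exists_lift [IsDomain B] (hf : IsBlowup f I) (u : Spec B ⟶ T) {s : B}
    (hs : s ≠ 0) (h : pullbackIdeal I u = Ideal.span {s}) : ∃ v, v ≫ f = u :=
  (hf.2 _ u (isInvertibleIdeal_comap I u s hs h)).exists

lemma IsBlowup.exists_eq_span [IsLocalRing B] (hf : IsBlowup f I) (v : Spec B ⟶ T') :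
    ∃ s, pullbackIdeal I (v ≫ f) = Ideal.span {s} := by
  obtain ⟨s, hs⟩ := hf.1.exists_pullbackIdeal_eq v
  exact ⟨s, by rw [← pullbackIdeal_comap, hs]⟩

lemma IsBlowup.eq_of_comp_eq [IsDomain B] [IsLocalRing B] (hf : IsBlowup f I)
    {v₁ v₂ : Spec B ⟶ T'} (h : v₁ ≫ f = v₂ ≫ f) (hne : pullbackIdeal I (v₁ ≫ f) ≠ ⊥) :
    v₁ = v₂ := by
  obtain ⟨s, hs⟩ := hf.exists_eq_span v₁
  have hs0 : s ≠ 0 := by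
    rintro rfl
    exact hne (hs.trans (Ideal.span_singleton_eq_bot.2 rfl))
  exact (hf.2 _ _ (isInvertibleIdeal_comap I (v₁ ≫ f) s hs0 hs)).unique rfl h.symm

lemma IsBlowup.exists_lift_of_isPrincipalIdealRing [IsDomain B] [IsPrincipalIdealRing B]
    (hf : IsBlowup f I) (u : Spec B ⟶ T) (h : pullbackIdeal I u ≠ ⊥) : ∃ v, v ≫ f = u := by
  refine hf.exists_lift u (s := Submodule.IsPrincipal.generator (pullbackIdeal I u)) ?_
    (Ideal.span_singleton_generator _).symm
  rwa [Ne, ← Submodule.IsPrincipal.eq_bot_iff_generator_eq_zero]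

end Blowup

section Model

variable {X : Scheme.{0}} (i : X ⟶ PPP)

/-- The birational morphism `η` to the threefold satisfies the valuative criterion for points whose
generic point does not lie on `C`. -/
structure IsModel {Z : Scheme.{0}} (η : Z ⟶ X) : Prop where
  eq_of_comp_eq : ∀ (B : CommRingCat.{0}) [IsDomain B] [IsLocalRing B] (v₁ v₂ : Spec B ⟶ Z),
    v₁ ≫ η = v₂ ≫ η → pullbackIdeal (idealC i) (v₁ ≫ η) ≠ ⊥ → v₁ = v₂
  exists_lift : ∀ (B : CommRingCat.{0}) [IsDomain B] [IsLocalRing B] [IsPrincipalIdealRing B]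
    (u : Spec B ⟶ X), pullbackIdeal (idealC i) u ≠ ⊥ → ∃ v, v ≫ η = u

lemma isModel_id : IsModel i (𝟙 X) :=
  ⟨fun B _ _ v₁ v₂ h _ => by simpa using h, fun B _ _ _ u _ => ⟨u, by simp⟩⟩

variable {i} {X₁ : Scheme.{0}} {f : X₁ ⟶ X}

lemma IsBlowup.isModel (hf : IsBlowup f (idealC i)) : IsModel i f :=
  ⟨fun _ _ _ _ _ h hne => hf.eq_of_comp_eq h hne,
    fun _ _ _ _ u hne => hf.exists_lift_of_isPrincipalIdealRing u hne⟩

variable {C' : Closeds X₁}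

lemma pullbackIdeal_idealC'_ne_bot [IsDomain B] (hC' : C' ≤ surfaceE i f) (v : Spec B ⟶ X₁)
    (h : pullbackIdeal (idealC i) (v ≫ f) ≠ ⊥) : pullbackIdeal (idealC' C') v ≠ ⊥ := by
  intro h0
  let x : Spec B := ⟨⊥, Ideal.isPrime_bot⟩
  have h1 : v x ∈ (idealC' C').support := (mem_support_iff_pullbackIdeal_le _ v x).2 (h0 ▸ le_rfl)
  rw [← SetLike.mem_coe, idealC', Scheme.IdealSheafData.coe_support_vanishingIdeal] at h1
  have h2 := (mem_support_iff_pullbackIdeal_le _ v x).1 (hC' h1)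
  rw [pullbackIdeal_comap] at h2
  exact h (le_bot_iff.1 h2)

variable {X₂ : Scheme.{0}} {g : X₂ ⟶ X₁}

lemma IsModel.comp_blowup (hf : IsModel i f) (hC' : C' ≤ surfaceE i f)
    (hg : IsBlowup g (idealC' C')) : IsModel i (g ≫ f) := by
  refine ⟨fun B _ _ v₁ v₂ h hne => ?_, fun B _ _ _ u hne => ?_⟩
  · rw [← Category.assoc] at hne
    refine hg.eq_of_comp_eq (hf.eq_of_comp_eq B _ _ (by simpa using h) hne) ?_
    exact pullbackIdeal_idealC'_ne_bot hC' _ hne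
  · obtain ⟨v, rfl⟩ := hf.exists_lift B u hne
    obtain ⟨w, rfl⟩ := hg.exists_lift_of_isPrincipalIdealRing v
      (pullbackIdeal_idealC'_ne_bot hC' _ hne)
    exact ⟨w, (Category.assoc _ _ _).symm⟩

lemma pullbackIdeal_weightedIdeal_ne_bot [IsDomain B] [IsLocalRing B] (hC' : C' ≤ surfaceE i f)
    (J : X₂.IdealSheafData)
    (a b : ℕ) (v : Spec B ⟶ X₂) (h : pullbackIdeal (idealC i) (v ≫ g ≫ f) ≠ ⊥) :
    pullbackIdeal (weightedIdeal (idealR' C' g) J a b (a * b)) v ≠ ⊥ := by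
  rw [← Category.assoc] at h
  have h1 := pullbackIdeal_idealC'_ne_bot hC' _ h
  rw [← pullbackIdeal_comap] at h1
  obtain ⟨s, hs, hs0⟩ := Submodule.exists_mem_ne_zero_of_ne_bot h1
  rw [pullbackIdeal_weightedIdeal]
  refine fun h0 => pow_ne_zero b hs0 ((Submodule.mem_bot B).1 (h0 ▸ ?_))
  refine Ideal.mem_sSup_of_mem (Set.mem_range_self ⟨(b, 0), by simp⟩) ?_
  simpa [idealR'] using Ideal.pow_mem_pow hs b

lemma IsModel.comp_weightedBlowup (hf : IsModel i f) (hC' : C' ≤ surfaceE i f)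
    (hg : IsBlowup g (idealC' C')) {a b : ℕ} {Y : Scheme.{0}} {ν : Y ⟶ X₂}
    {J : X₂.IdealSheafData} (hν : IsWeightedBlowup ν (idealR' C' g) J a b) :
    IsModel i ((ν ≫ g) ≫ f) := by
  have h2 := hf.comp_blowup hC' hg
  refine ⟨fun B _ _ v₁ v₂ h hne => ?_, fun B _ _ _ u hne => ?_⟩
  · have h3 : pullbackIdeal (idealC i) ((v₁ ≫ ν) ≫ g ≫ f) ≠ ⊥ := by simpa using hne
    exact hν.eq_of_comp_eq (h2.eq_of_comp_eq B _ _ (by simpa using h) h3)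
      (pullbackIdeal_weightedIdeal_ne_bot hC' J a b _ h3)
  · obtain ⟨v, rfl⟩ := h2.exists_lift B u hne
    obtain ⟨w, rfl⟩ := hν.exists_lift_of_isPrincipalIdealRing v
      (pullbackIdeal_weightedIdeal_ne_bot hC' J a b _ hne)
    exact ⟨w, by simp⟩

end Model


/-! ### Rational functions on the threefold and its models -/

/-- The field of rational functions in three variables. -/
abbrev LL : Type := FractionRing (MvPolynomial (Fin 3) ℂ)

/-- The three variables, as rational functions. -/
def genCoord (l : Fin 3) : LL := algebraMap (MvPolynomial (Fin 3) ℂ) LL (MvPolynomial.X l)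

/-- The coordinates of the generic point. -/
def genTuple : HomCoord → LL := Chart.c000.tuple genCoord

lemma genTuple_eq : genTuple = mkTuple 1 (genCoord 0) 1 (genCoord 1) 1 (genCoord 2)
    ((genCoord 0 + genCoord 1) * genCoord 2 - genCoord 0 * genCoord 1) := by
  refine funext (forall_homCoord.2 ?_)
  simp [genTuple, Chart.tuple, Chart.c000]

lemma genCoord_ne {p q : MvPolynomial (Fin 3) ℂ} (v : Fin 3 → ℂ)
    (h : MvPolynomial.eval v p ≠ MvPolynomial.eval v q) :
    algebraMap (MvPolynomial (Fin 3) ℂ) LL p ≠ algebraMap _ LL q := fun h1 =>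
  h (congrArg _ (IsFractionRing.injective (MvPolynomial (Fin 3) ℂ) LL h1))

lemma genTuple_ne_zero (h : HomCoord) : genTuple h ≠ 0 := by
  have key : ∀ p : MvPolynomial (Fin 3) ℂ, MvPolynomial.eval (fun l => ![1, 1, 2] l) p ≠ 0 →
      algebraMap (MvPolynomial (Fin 3) ℂ) LL p ≠ 0 := fun p hp h => by
    refine genCoord_ne (p := p) (q := 0) _ (by simpa using hp) (by simpa using h)
  rw [genTuple_eq]
  revert h
  refine forall_homCoord.2 ?_
  simp only [mkTuple_x₀, mkTuple_x₁, mkTuple_y₀, mkTuple_y₁, mkTuple_z₀, mkTuple_z₁, mkTuple_z₂]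
  refine ⟨⟨one_ne_zero, key _ (by simp)⟩, ⟨one_ne_zero, key _ (by simp)⟩, one_ne_zero,
    key _ (by simp), ?_⟩
  have := key ((MvPolynomial.X 0 + MvPolynomial.X 1) * MvPolynomial.X 2 -
    MvPolynomial.X 0 * MvPolynomial.X 1) (by simp; norm_num)
  rwa [map_sub, map_mul, map_mul, map_add] at this

lemma units_genTuple (κ : Chart) : κ.Units genTuple :=
  ⟨(genTuple_ne_zero _).isUnit, (genTuple_ne_zero _).isUnit, (genTuple_ne_zero _).isUnit⟩

/-- The rational functions given by the polynomials on a chart. -/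
def Chart.toLL (κ : Chart) : MvPolynomial (Fin 3) ℂ →+* LL :=
  κ.hom (algebraMap ℂ LL) (κ.normalize genTuple)

lemma formX_genTuple : formX genTuple = 0 := Chart.c000.formX_tuple _

lemma idealEq_genTuple_ne_bot : idealEq genTuple ≠ ⊥ := by
  intro h
  have h1 : genCoord 0 - genCoord 2 ∈ idealEq genTuple := by
    refine Ideal.subset_span (.inr (.inl ?_))
    simp [genTuple_eq]
  rw [h, Ideal.mem_bot, sub_eq_zero] at h1
  exact genCoord_ne (fun l => ![1, 1, 2] l) (by simp) h1

/-- Identifications of the function field of a model with the field of rational functions in three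
variables. -/
structure FieldCoords {X : Scheme.{0}} (i : X ⟶ PPP) {Z : Scheme.{0}} [IsIntegral Z] [Z.Over SpecC]
    (η : Z ⟶ X) where
  θ : LL ≃+* Z.functionField
  const : ∀ a, θ (algebraMap ℂ LL a) = algebraMap ℂ Z.functionField a
  tuple : (PPPcoords.comp i).HasTuple (Z.fromSpecStalk (genericPoint Z) ≫ η)
    (B := Z.functionField) fun h => θ (genTuple h)

lemma stalkConst_genericPoint (Z : Scheme.{0}) [IsIntegral Z] [Z.Over SpecC] (a : ℂ) :
    (stalkConst Z (genericPoint Z)).hom a = algebraMap ℂ Z.functionField a := by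
  have h1 : Z.fromSpecStalk (genericPoint Z) ≫ Z ↘ SpecC =
      Spec.map ((Scheme.ΓSpecIso (CommRingCat.of ℂ)).inv ≫ (Z ↘ SpecC).appTop ≫
        Z.presheaf.germ ⊤ (genericPoint Z) trivial) := by
    rw [Spec.map_comp, Spec.map_comp, Category.assoc, ← Scheme.fromSpecStalk_toSpecΓ_assoc,
      ← Scheme.toSpecΓ_naturality_assoc]
    simp
  rw [map_stalkConst] at h1
  exact congrArg (fun χ => χ.hom a) (Spec.map_injective h1)

/-- The inclusion of a stalk in the function field. -/
def toFunctionField (Z : Scheme.{0}) [IsIntegral Z] (P : Z) :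
    Z.presheaf.stalk P ⟶ Z.functionField :=
  Z.presheaf.stalkSpecializes ((genericPoint_spec Z).specializes trivial)

lemma toFunctionField_apply (Z : Scheme.{0}) [IsIntegral Z] (P : Z) (z : Z.presheaf.stalk P) :
    (toFunctionField Z P).hom z = algebraMap (Z.presheaf.stalk P) Z.functionField z := rfl

lemma map_toFunctionField (Z : Scheme.{0}) [IsIntegral Z] (P : Z) :
    Spec.map (toFunctionField Z P) ≫ Z.fromSpecStalk P = Z.fromSpecStalk (genericPoint Z) :=
  Scheme.SpecMap_stalkSpecializes_fromSpecStalk _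

lemma toFunctionField_injective (Z : Scheme.{0}) [IsIntegral Z] (P : Z) :
    Function.Injective (toFunctionField Z P).hom :=
  IsFractionRing.injective (Z.presheaf.stalk P) Z.functionField

lemma stalkConst_map {Z : Scheme.{0}} [Z.Over SpecC] {P Q : Z} {φ : Z.presheaf.stalk P ⟶
    Z.presheaf.stalk Q} (h : Spec.map φ ≫ Z.fromSpecStalk P = Z.fromSpecStalk Q) (a : ℂ) :
    φ.hom ((stalkConst Z P).hom a) = (stalkConst Z Q).hom a := by
  have h1 := congrArg (· ≫ Z ↘ SpecC) h
  simp only [Category.assoc, map_stalkConst, ← Spec.map_comp] at h1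
  exact congrArg (fun χ => χ.hom a) (Spec.map_injective h1)

section Model

variable {X : Scheme.{0}} [X.Over SpecC] {i : X ⟶ PPP} {Z : Scheme.{0}} [IsIntegral Z]
  [Z.Over SpecC] {η : Z ⟶ X}

lemma Chart.map_hom (κ : Chart) {R S : Type} [CommRing R] [CommRing S] (f : R →+* S) (φ : ℂ →+* R)
    (β : HomCoord → R) (p : MvPolynomial (Fin 3) ℂ) :
    f (κ.hom φ β p) = κ.hom (f.comp φ) (fun h => f (β h)) p := by
  refine RingHom.congr_fun (f := f.comp (κ.hom φ β)) (MvPolynomial.ringHom_ext (fun a => ?_)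
    (fun l => ?_)) p
  · rw [RingHom.comp_apply, κ.hom_C, κ.hom_C]; rfl
  · rw [RingHom.comp_apply, κ.hom_X, κ.hom_X, κ.map_coord]

/-- The coordinates at a point are compatible with those at the generic point. -/
lemma FieldCoords.toFunctionField_tuple (F : FieldCoords i η) {P : Z} {κ : Chart}
    {β : HomCoord → Z.presheaf.stalk P}
    (hβ : (PPPcoords.comp i).HasTuple (Z.fromSpecStalk P ≫ η) β) (hn : κ.Normalized β)
    (h : HomCoord) :
    (toFunctionField Z P).hom (β h) = F.θ (κ.normalize genTuple h) := by
  have h1 := (hβ.comp (toFunctionField Z P)).congr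
    ((Category.assoc _ _ _).symm.trans (congrArg (· ≫ η) (map_toFunctionField Z P)))
  have hg := units_genTuple κ
  have h2 := F.tuple.scale (hg.i.ringInverse.map F.θ) (hg.j.ringInverse.map F.θ)
    (hg.k.ringInverse.map F.θ)
  have h3 : scaleTuple (F.θ (Ring.inverse (genTuple (.inl κ.i))))
      (F.θ (Ring.inverse (genTuple (.inr (.inl κ.j)))))
      (F.θ (Ring.inverse (genTuple (.inr (.inr κ.k))))) (fun h => F.θ (genTuple h)) =
      fun h => F.θ (κ.normalize genTuple h) := by
    funext h
    rcases h with h | h | h <;> exact (map_mul F.θ _ _).symm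
  rw [h3] at h2
  exact congrFun (Chart.Normalized.eq_of_hasTuple (hn.map (toFunctionField Z P).hom)
    (hg.normalized.map F.θ.toRingHom) h1 h2) h

lemma FieldCoords.toFunctionField_hom (F : FieldCoords i η) {P : Z} {κ : Chart}
    {β : HomCoord → Z.presheaf.stalk P}
    (hβ : (PPPcoords.comp i).HasTuple (Z.fromSpecStalk P ≫ η) β) (hn : κ.Normalized β)
    (p : MvPolynomial (Fin 3) ℂ) :
    (toFunctionField Z P).hom (κ.hom (stalkConst Z P).hom β p) = F.θ (κ.toLL p) := by
  have h1 := κ.map_hom F.θ.toRingHom (algebraMap ℂ LL) (κ.normalize genTuple) p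
  refine (κ.map_hom _ _ _ p).trans (Eq.trans ?_ h1.symm)
  congr 1
  congr 1
  · ext a
    exact (stalkConst_map (map_toFunctionField Z P) a).trans
      ((stalkConst_genericPoint Z a).trans (F.const a).symm)
  · funext h
    exact F.toFunctionField_tuple hβ hn h

end Model

end

section

variable {B B' : CommRingCat.{0}}

/-! ### Points of models -/

lemma Chart.Units.of_isLocalHom {T : Scheme.{0}} {c : Coords T} {κ : Chart} {w : Spec B' ⟶ T}
    {β : HomCoord → B'} (hβ : c.HasTuple w β) (φ : B' ⟶ B) [IsLocalHom φ.hom] {u : Spec B ⟶ T}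
    (h : Spec.map φ ≫ w = u) {b : HomCoord → B} (hb : c.HasTuple u b) (hu : κ.Units b) :
    κ.Units β := by
  obtain ⟨l, m, n, hl, hm, hn, h⟩ := hb.exists_scale ((hβ.comp φ).congr h)
  have h1 : ∀ x, φ.hom (β x) = scaleTuple l m n b x := congrFun h
  have hφ : IsLocalHom φ.hom := inferInstance
  refine ⟨hφ.map_nonunit _ ?_, hφ.map_nonunit _ ?_, hφ.map_nonunit _ ?_⟩
  · rw [h1]; exact hl.mul hu.i
  · rw [h1]; exact hm.mul hu.j
  · rw [h1]; exact hn.mul hu.k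

lemma comp_const_eq {T : Scheme.{0}} [T.Over SpecC] {w : Spec B' ⟶ T} {χ : CommRingCat.of ℂ ⟶ B'}
    (hw : w ≫ T ↘ SpecC = Spec.map χ) {φ : B' ⟶ B} {u : Spec B ⟶ T} (h : Spec.map φ ≫ w = u)
    {ψ : CommRingCat.of ℂ ⟶ B} (hu : u ≫ T ↘ SpecC = Spec.map ψ) (a : ℂ) :
    φ.hom (χ.hom a) = ψ.hom a := by
  rw [← h, Category.assoc, hw, ← Spec.map_comp] at hu
  exact congrArg (fun χ => χ.hom a) (Spec.map_injective hu)

lemma Chart.map_hom_eq {X : Scheme.{0}} [X.Over SpecC] {c : Coords X} (κ : Chart) {w : Spec B' ⟶ X}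
    {χ : CommRingCat.of ℂ ⟶ B'} (hw : w ≫ X ↘ SpecC = Spec.map χ) {β : HomCoord → B'}
    (hβ : c.HasTuple w β) (hn : κ.Normalized β) {u : Spec B ⟶ X}
    {al : MvPolynomial (Fin 3) ℂ →+* B}
    (hu : u ≫ X ↘ SpecC = Spec.map (CommRingCat.ofHom (al.comp MvPolynomial.C)))
    (hu' : c.HasTuple u (κ.tuple fun l => al (MvPolynomial.X l)))
    (φ : B' ⟶ B) (hφ : Spec.map φ ≫ w = u) (p : MvPolynomial (Fin 3) ℂ) :
    φ.hom (κ.hom χ.hom β p) = al p := by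
  refine RingHom.congr_fun (f := φ.hom.comp (κ.hom χ.hom β))
    (MvPolynomial.ringHom_ext (fun a => ?_) (fun l => ?_)) p
  · rw [RingHom.comp_apply, κ.hom_C]
    exact comp_const_eq hw hφ hu a
  · rw [RingHom.comp_apply, κ.hom_X, κ.map_coord]
    have h1 := (hβ.comp φ).congr hφ
    rw [Normalized.eq_of_hasTuple (hn.map φ.hom) (κ.normalized_tuple _) h1 hu', κ.coord_tuple]

section

variable {X : Scheme.{0}} [X.Over SpecC] [IsLocallyNoetherian X] {i : X ⟶ PPP} [i.IsOver SpecC]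
  [IsClosedImmersion i] {Z : Scheme.{0}} [Z.Over SpecC] {η : Z ⟶ X} [η.IsOver SpecC]


lemma fromSpecStalk_comp_over (P : Z) :
    (Z.fromSpecStalk P ≫ η) ≫ X ↘ SpecC = Spec.map (stalkConst Z P) := by
  rw [Category.assoc, comp_over, map_stalkConst]

lemma pullbackIdeal_ne_bot_of_comp {T : Scheme.{0}} {I : T.IdealSheafData} {w : Spec B' ⟶ T}
    {φ : B' ⟶ B} {u : Spec B ⟶ T} (h : Spec.map φ ≫ w = u) (hu : pullbackIdeal I u ≠ ⊥) :
    pullbackIdeal I w ≠ ⊥ := by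
  rintro h0
  rw [← h, pullbackIdeal_map, h0, Ideal.map_bot] at hu
  exact hu rfl

/-- If a point of a model over a localization of the coordinate ring of a chart lifts to a model,
then the local ring of the model is that localization. -/
lemma IsModel.exists_stalk_equiv (hX : i.ker = idealX) [IsIntegral Z] (hη : IsModel i η) {A : Type} [CommRing A] [IsLocalRing A]
    [Algebra (MvPolynomial (Fin 3) ℂ) A] (M : Submonoid (MvPolynomial (Fin 3) ℂ))
    [IsLocalization M A] (κ : Chart) (v : Spec (CommRingCat.of A) ⟶ Z)
    (hv : (v ≫ η) ≫ X ↘ SpecC = Spec.map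
      (CommRingCat.ofHom ((algebraMap (MvPolynomial (Fin 3) ℂ) A).comp MvPolynomial.C)))
    (hv' : (PPPcoords.comp i).HasTuple (v ≫ η) (κ.tuple fun l => algebraMap (MvPolynomial (Fin 3) ℂ) A (MvPolynomial.X l)))
    (hne : pullbackIdeal (idealC i) (v ≫ η) ≠ ⊥) {P : Z}
    (hP : v (IsLocalRing.closedPoint A) = P) :
    ∃ β, (PPPcoords.comp i).HasTuple (Z.fromSpecStalk P ≫ η) β ∧ κ.Normalized β ∧
      ∃ φ : Z.presheaf.stalk P ⟶ CommRingCat.of A, Function.Bijective φ.hom ∧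
        Spec.map φ ≫ Z.fromSpecStalk P = v ∧
        ∀ p, φ.hom (κ.hom (stalkConst Z P).hom β p) = algebraMap _ A p := by
  obtain ⟨φ, hloc, hφ⟩ := exists_stalk_hom (B := CommRingCat.of A) v hP
  have hφ' : Spec.map φ ≫ Z.fromSpecStalk P ≫ η = v ≫ η := by rw [← hφ, Category.assoc]
  obtain ⟨β, hβ⟩ := Coords.HasTuple.exists_of_isLocalRing (PPPcoords.comp i)
    (Z.fromSpecStalk P ≫ η)
  have hun : κ.Units β := .of_isLocalHom hβ φ hφ' hv' (κ.normalized_tuple _).units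
  have hβ' := hun.hasTuple_normalize hβ
  have hn := hun.normalized
  have hcomp := κ.map_hom_eq (fromSpecStalk_comp_over P) hβ' hn hv hv' φ hφ'
  set ψ := κ.hom (stalkConst Z P).hom (κ.normalize β) with hψ
  have hunit : ∀ d : M, IsUnit (ψ d) := fun d => hloc.map_nonunit _ (by
    rw [hcomp]; exact IsLocalization.map_units A d)
  let l : A →+* Z.presheaf.stalk P := IsLocalization.lift hunit
  have hl : ∀ p, l (algebraMap _ A p) = ψ p := fun p => IsLocalization.lift_eq hunit p
  have hret : φ.hom.comp l = RingHom.id A := by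
    refine IsLocalization.ringHom_ext M (RingHom.ext fun p => ?_)
    exact (congrArg φ.hom (hl p)).trans (hcomp p)
  have hfac : Spec.map (CommRingCat.ofHom l) ≫ v = Z.fromSpecStalk P := by
    have h2 : (Spec.map (CommRingCat.ofHom l) ≫ v) ≫ η = Z.fromSpecStalk P ≫ η := by
      have h1 := (hv'.comp (CommRingCat.ofHom l)).congr (Category.assoc _ _ _).symm
      have h2 : (fun h => (CommRingCat.ofHom l).hom (κ.tuple
          (fun l => algebraMap (MvPolynomial (Fin 3) ℂ) A (MvPolynomial.X l)) h)) = κ.normalize β := by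
        funext h
        refine (κ.map_tuple l _ h).trans ?_
        simp only [hl, hψ, κ.hom_X]
        rw [hn.tuple_coord (formX_eq_zero hX hβ')]
      rw [h2] at h1
      refine X_ext h1 hβ' ?_
      rw [fromSpecStalk_comp_over, Category.assoc, Category.assoc, ← Category.assoc v, hv,
        ← Spec.map_comp]
      congr 1
      ext a
      exact (hl _).trans (κ.hom_C _ _ _)
    refine hη.eq_of_comp_eq _ _ _ h2 ?_
    rw [h2]
    exact pullbackIdeal_ne_bot_of_comp hφ' hne
  have hret' : φ ≫ CommRingCat.ofHom l = 𝟙 _ := by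
    refine Spec.map_injective ?_
    rw [Spec.map_comp, Spec.map_id, ← cancel_mono (Z.fromSpecStalk P), Category.assoc, hφ, hfac]
    exact (Category.id_comp _).symm
  refine ⟨_, hβ', hn, φ, ⟨?_, ?_⟩, hφ, hcomp⟩
  · exact Function.LeftInverse.injective (g := l) fun z => congrArg (fun χ => χ.hom z) hret'
  · exact Function.RightInverse.surjective (g := l) fun z => RingHom.congr_fun hret z


lemma eq_genericPoint_of_isField [IsIntegral Z] (P : Z) (h : IsField (Z.presheaf.stalk P)) :
    P = genericPoint Z := by
  have h1 : genericPoint Z ∈ Set.range (Z.fromSpecStalk P) := by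
    rw [Scheme.range_fromSpecStalk]
    exact (genericPoint_spec Z).specializes trivial
  obtain ⟨x, hx⟩ := h1
  let := h.toField
  have h2 : x = IsLocalRing.closedPoint (Z.presheaf.stalk P) :=
    PrimeSpectrum.ext (((Ideal.eq_bot_or_top x.asIdeal).resolve_right x.2.ne_top).trans
      ((Ideal.eq_bot_or_top (IsLocalRing.maximalIdeal (Z.presheaf.stalk P))).resolve_right
        (IsLocalRing.maximalIdeal.isMaximal _).ne_top).symm)
  rw [← hx, h2, Scheme.fromSpecStalk_closedPoint]

lemma IsModel.nonempty_fieldCoords (hX : i.ker = idealX) [IsIntegral Z] (hη : IsModel i η) :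
    Nonempty (FieldCoords i η) := by
  obtain ⟨u, hu, hu'⟩ := Chart.c000.exists_point (i := i) (B := CommRingCat.of LL) hX
    (algebraMap (MvPolynomial (Fin 3) ℂ) LL)
  have hne : pullbackIdeal (idealC i) u ≠ ⊥ := by
    rw [pullbackIdeal_idealC hu']
    exact idealEq_genTuple_ne_bot
  obtain ⟨v, rfl⟩ := hη.exists_lift _ u hne
  obtain ⟨β, hβ, hn, φ, hφ, hφv, hcomp⟩ := hη.exists_stalk_equiv hX
    (nonZeroDivisors (MvPolynomial (Fin 3) ℂ)) Chart.c000 v hu hu' hne rfl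
  have hP : v (IsLocalRing.closedPoint LL) = genericPoint Z :=
    eq_genericPoint_of_isField _
      ((RingEquiv.ofBijective φ.hom hφ).toMulEquiv.isField (Field.toIsField LL))
  obtain ⟨β, hβ, hn, φ, hφ, hφv, hcomp⟩ := hη.exists_stalk_equiv hX
    (nonZeroDivisors (MvPolynomial (Fin 3) ℂ)) Chart.c000 v hu hu' hne hP
  let e : Z.functionField ≃+* LL := RingEquiv.ofBijective φ.hom hφ
  have he : ∀ h, e (β h) = genTuple h := fun h => by
    have h1 := (hβ.comp φ).congr ((Category.assoc _ _ _).symm.trans (congrArg (· ≫ η) hφv))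
    exact congrFun (Chart.Normalized.eq_of_hasTuple (hn.map φ.hom)
      (Chart.c000.normalized_tuple _) h1 hu') h
  refine ⟨⟨e.symm, fun a => ?_, ?_⟩⟩
  · rw [RingEquiv.symm_apply_eq, ← stalkConst_genericPoint]
    have := hcomp (MvPolynomial.C a)
    rw [Chart.hom_C] at this
    refine Eq.trans ?_ this.symm
    exact (IsScalarTower.algebraMap_apply ℂ (MvPolynomial (Fin 3) ℂ) LL a)
  · have h1 : (fun h => e.symm (genTuple h)) = β := by
      funext h
      rw [← he, RingEquiv.symm_apply_apply]
    exact h1 ▸ hβ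

end

/-! ### Orders along prime divisors -/

section Order

variable {Z : Scheme.{0}} [IsIntegral Z] [IsLocallyNoetherian Z]

lemma coheight_eq_one {P : Z} (hP : IsDiscreteValuationRing (Z.presheaf.stalk P)) :
    Order.coheight P = 1 := by
  have h1 : ringKrullDim (Z.presheaf.stalk P) = 1 :=
    IsPrincipalIdealRing.ringKrullDim_eq_one _ (IsDiscreteValuationRing.not_isField _)
  rw [ringKrullDim_stalk_eq_coheight] at h1
  exact_mod_cast h1

lemma ord_toFunctionField_nonneg (P : Z) {z : Z.presheaf.stalk P} (hz : z ≠ 0) :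
    0 ≤ Scheme.ord ((toFunctionField Z P).hom z) P := by
  by_cases hP : Order.coheight P = 1
  · have : Ring.KrullDimLE 1 (Z.presheaf.stalk P) := krullDimLE_of_coheight_le hP.le
    have hne : (toFunctionField Z P).hom z ≠ 0 := fun h =>
      hz (toFunctionField_injective Z P (h.trans (map_zero _).symm))
    rw [Scheme.le_ord_iff hP hne]
    exact Ring.ordFrac_ge_one_of_ne_zero hz
  · rw [Scheme.ord_eq_zero_of_coheight_neq_one hP]

lemma ord_irreducible {P : Z} (hP : IsDiscreteValuationRing (Z.presheaf.stalk P))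
    {ϖ : Z.presheaf.stalk P} (hϖ : Irreducible ϖ) :
    Scheme.ord ((toFunctionField Z P).hom ϖ) P = 1 := by
  have hP1 := coheight_eq_one hP
  have : Ring.KrullDimLE 1 (Z.presheaf.stalk P) := krullDimLE_of_coheight_le hP1.le
  have hne : (toFunctionField Z P).hom ϖ ≠ 0 := fun h =>
    hϖ.ne_zero (toFunctionField_injective Z P (h.trans (map_zero _).symm))
  rw [Scheme.ord_eq_iff hP1 hne]
  exact Ring.ordFrac_irreducible hϖ

lemma ord_inv {P : Z} {f : Z.functionField} (hf : f ≠ 0) :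
    Scheme.ord f⁻¹ P = - Scheme.ord f P := by
  have h1 := Scheme.ord_mul (x := P) hf (inv_ne_zero hf)
  have h2 := Scheme.ord_mul (x := P) (f := (1 : Z.functionField)) (g := 1) one_ne_zero one_ne_zero
  rw [mul_inv_cancel₀ hf] at h1
  rw [one_mul] at h2
  linarith

lemma ord_one' (P : Z) : Scheme.ord (1 : Z.functionField) P = 0 := by
  have h2 := Scheme.ord_mul (x := P) (f := (1 : Z.functionField)) (g := 1) one_ne_zero one_ne_zero
  rw [one_mul] at h2
  linarith

lemma ord_pow' (P : Z) {f : Z.functionField} (hf : f ≠ 0) (n : ℕ) :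
    Scheme.ord (f ^ n) P = n * Scheme.ord f P := by
  induction n with
  | zero => simp [ord_one']
  | succ n ih => rw [pow_succ, Scheme.ord_mul (pow_ne_zero n hf) hf, ih]; push_cast; ring

lemma ord_toFunctionField_of_isUnit (P : Z) {z : Z.presheaf.stalk P} (hz : IsUnit z) :
    Scheme.ord ((toFunctionField Z P).hom z) P = 0 := by
  obtain ⟨w, hw⟩ := hz.exists_right_inv
  have hz0 : (toFunctionField Z P).hom z ≠ 0 := (hz.map _).ne_zero
  have h1 : ((toFunctionField Z P).hom z)⁻¹ = (toFunctionField Z P).hom w :=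
    (eq_inv_of_mul_eq_one_right ((map_mul _ _ _).symm.trans ((congrArg _ hw).trans
      (map_one _)))).symm
  have h2 := ord_inv (P := P) hz0
  rw [h1] at h2
  have h3 := ord_toFunctionField_nonneg P hz.ne_zero
  have h4 := ord_toFunctionField_nonneg P (z := w) (right_ne_zero_of_mul (hw ▸ one_ne_zero))
  linarith

lemma le_ord_iff_of_isDiscreteValuationRing {P : Z}
    (hP : IsDiscreteValuationRing (Z.presheaf.stalk P)) {ϖ : Z.presheaf.stalk P}
    (hϖ : Irreducible ϖ) {f : Z.functionField} (hf : f ≠ 0) (n : ℕ) :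
    (n : ℤ) ≤ Scheme.ord f P ↔ ∃ r, f = (toFunctionField Z P).hom (ϖ ^ n * r) := by
  have hι : ∀ {z}, z ≠ 0 → (toFunctionField Z P).hom z ≠ 0 := fun {z} hz h =>
    hz (toFunctionField_injective Z P (h.trans (map_zero _).symm))
  have hpow : ∀ k : ℕ, Scheme.ord ((toFunctionField Z P).hom (ϖ ^ k)) P = k := fun k => by
    rw [map_pow, ord_pow' P (hι hϖ.ne_zero), ord_irreducible hP hϖ, mul_one]
  constructor
  · intro h
    obtain ⟨x, y, hy, hxy⟩ := IsFractionRing.div_surjective (A := Z.presheaf.stalk P) f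
    replace hxy : (toFunctionField Z P).hom x / (toFunctionField Z P).hom y = f := hxy
    have hy0 : y ≠ 0 := nonZeroDivisors.ne_zero hy
    have hx0 : x ≠ 0 := by
      rintro rfl
      exact hf (by rw [← hxy, map_zero, zero_div])
    obtain ⟨k, u, rfl⟩ := IsDiscreteValuationRing.eq_unit_mul_pow_irreducible hx0 hϖ
    obtain ⟨l, u', rfl⟩ := IsDiscreteValuationRing.eq_unit_mul_pow_irreducible hy0 hϖ
    have h1 : Scheme.ord f P = k - l := by
      rw [← hxy, div_eq_mul_inv, Scheme.ord_mul (hι hx0) (inv_ne_zero (hι hy0)),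
        ord_inv (hι hy0), map_mul, map_mul, Scheme.ord_mul (hι u.isUnit.ne_zero)
        (hι (pow_ne_zero _ hϖ.ne_zero)), Scheme.ord_mul (hι u'.isUnit.ne_zero)
        (hι (pow_ne_zero _ hϖ.ne_zero)), ord_toFunctionField_of_isUnit P u.isUnit,
        ord_toFunctionField_of_isUnit P u'.isUnit, hpow, hpow]
      ring
    rw [h1] at h
    obtain ⟨m, rfl⟩ : ∃ m, k = n + m + l := ⟨k - n - l, by omega⟩
    refine ⟨u * ϖ ^ m * (↑u'⁻¹ : Z.presheaf.stalk P), ?_⟩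
    rw [← hxy, div_eq_iff (hι hy0), ← map_mul]
    congr 1
    linear_combination (-(u : Z.presheaf.stalk P) * ϖ ^ (n + m + l)) * u'.inv_mul
  · rintro ⟨r, rfl⟩
    have hr : r ≠ 0 := by
      rintro rfl
      exact hf (by rw [mul_zero, map_zero])
    rw [map_mul, Scheme.ord_mul (hι (pow_ne_zero _ hϖ.ne_zero)) (hι hr), hpow]
    linarith [ord_toFunctionField_nonneg P hr]

lemma eq_or_eq_genericPoint {P R : Z} (hP : IsDiscreteValuationRing (Z.presheaf.stalk P))
    (h : R ⤳ P) : R = P ∨ R = genericPoint Z := by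
  have h1 : R ∈ Set.range (Z.fromSpecStalk P) := by rwa [Scheme.range_fromSpecStalk]
  obtain ⟨x, rfl⟩ := h1
  by_cases hx : x.asIdeal = ⊥
  · right
    refine ((genericPoint_spec Z).eq (isGenericPoint_def.2 ?_)).symm
    refine Set.eq_univ_of_univ_subset (fun y _ => ?_)
    have h2 : genericPoint Z ∈ Set.range (Z.fromSpecStalk P) := by
      rw [Scheme.range_fromSpecStalk]
      exact (genericPoint_spec Z).specializes trivial
    obtain ⟨w, hw⟩ := h2
    have h3 : x ⤳ w := (PrimeSpectrum.le_iff_specializes x w).1 (by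
      change x.asIdeal ≤ w.asIdeal
      rw [hx]; exact bot_le)
    have h4 := h3.map (Z.fromSpecStalk P).continuous
    rw [hw] at h4
    exact (h4.trans ((genericPoint_spec Z).specializes trivial)).mem_closure
  · left
    have h2 : x = IsLocalRing.closedPoint (Z.presheaf.stalk P) := by
      refine PrimeSpectrum.ext (IsLocalRing.eq_maximalIdeal ?_)
      have := x.2
      exact IsPrime.to_maximal_ideal hx
    rw [h2, Scheme.fromSpecStalk_closedPoint]

end Order

end

section

/-! ### Exterior powers -/

section Exterior

variable {K : Type} [Field K] {V : Type} [AddCommGroup V] [Module K V]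

lemma ιMulti_sum_smul {n : ℕ} (A : Matrix (Fin n) (Fin n) K) (m : Fin n → V) :
    exteriorPower.ιMulti K n (fun i => ∑ j, A i j • m j) = A.det • exteriorPower.ιMulti K n m := by
  let f : (Fin n → K) [⋀^Fin n]→ₗ[K] (⋀[K]^n V) :=
    (exteriorPower.ιMulti K n).compLinearMap (Fintype.linearCombination K m)
  let g : (Fin n → K) [⋀^Fin n]→ₗ[K] (⋀[K]^n V) :=
    (LinearMap.toSpanSingleton K _ (exteriorPower.ιMulti K n m)).compAlternatingMap
      Matrix.detRowAlternating
  have h : f = g := by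
    refine Module.Basis.ext_alternating (Pi.basisFun K (Fin n)) fun v hv => ?_
    let σ : Equiv.Perm (Fin n) := Equiv.ofBijective v (Finite.injective_iff_bijective.1 hv)
    have h1 : (f fun i => Pi.basisFun K (Fin n) (v i)) = exteriorPower.ιMulti K n (m ∘ σ) := by
      refine congrArg (exteriorPower.ιMulti K n) (funext fun i => ?_)
      simp [Fintype.linearCombination_apply, σ, Pi.single_apply]
    have h2 : (g fun i => Pi.basisFun K (Fin n) (v i)) =
        Matrix.det (fun i => Pi.basisFun K (Fin n) (σ i)) • exteriorPower.ιMulti K n m := rfl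
    have h3 : Matrix.det (fun i => Pi.basisFun K (Fin n) (σ i)) = Equiv.Perm.sign σ := by
      have h4 := (Matrix.detRowAlternating (R := K) (n := Fin n)).map_perm
        (fun i => Pi.basisFun K (Fin n) i) σ
      refine h4.trans ?_
      have h5 : Matrix.detRowAlternating (R := K) (n := Fin n) (fun i => Pi.basisFun K (Fin n) i) =
          1 := by
        refine Eq.trans ?_ (Matrix.det_one (n := Fin n) (R := K))
        refine congrArg Matrix.det ?_
        ext i j
        simp [Matrix.one_apply, Pi.single_apply, eq_comm]
      rw [h5, Units.smul_def, zsmul_eq_mul, mul_one]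
    rw [h1, h2, h3, AlternatingMap.map_perm, Units.smul_def, ← Int.cast_smul_eq_zsmul K]
  have h1 := congrArg (fun k => k fun i => A i) h
  refine Eq.trans ?_ (h1.trans rfl)
  exact congrArg (exteriorPower.ιMulti K n) (funext fun i =>
    (Fintype.linearCombination_apply K m (A i)).symm)

lemma ιMulti_basis_ne_zero {n : ℕ} (b : Module.Basis (Fin n) K V) :
    exteriorPower.ιMulti K n b ≠ 0 := by
  intro h
  have h1 := exteriorPower.alternatingMapLinearEquiv_apply_ιMulti b.det b
  rw [h, map_zero, b.det_self] at h1
  exact zero_ne_one h1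

lemma exists_eq_smul_ιMulti_basis {n : ℕ} (b : Module.Basis (Fin n) K V) (ω : ⋀[K]^n V) :
    ∃ h : K, ω = h • exteriorPower.ιMulti K n b := by
  have h1 : ω ∈ Submodule.span K (Set.range (exteriorPower.ιMulti K n (M := V))) := by
    rw [exteriorPower.ιMulti_span]; trivial
  have h2 : Submodule.span K (Set.range (exteriorPower.ιMulti K n (M := V))) ≤
      Submodule.span K {exteriorPower.ιMulti K n b} := by
    rw [Submodule.span_le]
    rintro _ ⟨v, rfl⟩
    refine Submodule.mem_span_singleton.2 ⟨Matrix.det fun i j => b.repr (v i) j, ?_⟩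
    refine (ιMulti_sum_smul (Matrix.of fun i j => b.repr (v i) j) b).symm.trans ?_
    exact congrArg _ (funext fun i => b.sum_repr (v i))
  obtain ⟨h, hh⟩ := Submodule.mem_span_singleton.1 (h2 h1)
  exact ⟨h, hh.symm⟩

end Exterior

/-! ### Rational forms -/

section Forms

variable {K : Type} [Field K] [Algebra ℂ K]

/-- The form `dc₀ ∧ dc₁ ∧ dc₂`. -/
def wedgeD (c : Fin 3 → K) : ⋀[K]^3 Ω[K⁄ℂ] :=
  exteriorPower.ιMulti K 3 fun l => KaehlerDifferential.D ℂ K (c l)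

lemma wedgeD_eq_smul {c c' : Fin 3 → K} (A : Matrix (Fin 3) (Fin 3) K)
    (h : ∀ l, KaehlerDifferential.D ℂ K (c l) =
      ∑ j, A l j • KaehlerDifferential.D ℂ K (c' j)) : wedgeD c = A.det • wedgeD c' := by
  rw [wedgeD, wedgeD, ← ιMulti_sum_smul]
  exact congrArg _ (funext h)

lemma exists_basis_D [Algebra (MvPolynomial (Fin 3) ℂ) K]
    [IsScalarTower ℂ (MvPolynomial (Fin 3) ℂ) K] [IsFractionRing (MvPolynomial (Fin 3) ℂ) K] :
    ∃ b : Module.Basis (Fin 3) K Ω[K⁄ℂ], ∀ l, b l =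
      KaehlerDifferential.D ℂ K (algebraMap (MvPolynomial (Fin 3) ℂ) K (MvPolynomial.X l)) := by
  have := KaehlerDifferential.isLocalizedModule_map ℂ (MvPolynomial (Fin 3) ℂ) K
    (nonZeroDivisors (MvPolynomial (Fin 3) ℂ))
  refine ⟨(KaehlerDifferential.mvPolynomialBasis ℂ (Fin 3)).ofIsLocalizedModule K
    (nonZeroDivisors (MvPolynomial (Fin 3) ℂ))
    (KaehlerDifferential.map ℂ ℂ (MvPolynomial (Fin 3) ℂ) K), fun l => ?_⟩
  rw [Module.Basis.ofIsLocalizedModule_apply, KaehlerDifferential.mvPolynomialBasis_apply,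
    KaehlerDifferential.map_D]

lemma exists_basis_D_of_equiv (θ : LL ≃+* K) (hθ : ∀ a, θ (algebraMap ℂ LL a) = algebraMap ℂ K a) :
    ∃ b : Module.Basis (Fin 3) K Ω[K⁄ℂ], ∀ l, b l = KaehlerDifferential.D ℂ K (θ (genCoord l)) := by
  let : Algebra (MvPolynomial (Fin 3) ℂ) K :=
    (θ.toRingHom.comp (algebraMap (MvPolynomial (Fin 3) ℂ) LL)).toAlgebra
  have : IsScalarTower ℂ (MvPolynomial (Fin 3) ℂ) K := .of_algebraMap_eq fun a => by
    rw [← hθ]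
    exact congrArg θ (IsScalarTower.algebraMap_apply ℂ (MvPolynomial (Fin 3) ℂ) LL a)
  have : IsFractionRing (MvPolynomial (Fin 3) ℂ) K :=
    IsLocalization.isLocalization_of_algEquiv (nonZeroDivisors (MvPolynomial (Fin 3) ℂ))
      (AlgEquiv.ofRingEquiv (f := θ) fun _ => rfl : LL ≃ₐ[MvPolynomial (Fin 3) ℂ] K)
  exact exists_basis_D

variable {O : Type} [CommRing O] {ψ : MvPolynomial (Fin 3) ℂ →+* O} (ι : O →+* K)

lemma exists_D_eq_of_polynomial (hC : ∀ a, ι (ψ (MvPolynomial.C a)) = algebraMap ℂ K a)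
    (p : MvPolynomial (Fin 3) ℂ) : ∃ a : Fin 3 → O, KaehlerDifferential.D ℂ K (ι (ψ p)) =
      ∑ j, ι (a j) • KaehlerDifferential.D ℂ K (ι (ψ (MvPolynomial.X j))) := by
  induction p using MvPolynomial.induction_on with
  | C a => exact ⟨0, by simp [hC, Derivation.map_algebraMap]⟩
  | add p q hp hq =>
    obtain ⟨a, ha⟩ := hp
    obtain ⟨b, hb⟩ := hq
    exact ⟨a + b, by simp [ha, hb, add_smul, Finset.sum_add_distrib]⟩
  | mul_X p n hp =>
    obtain ⟨a, ha⟩ := hp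
    refine ⟨fun j => a j * ψ (MvPolynomial.X n) + if j = n then ψ p else 0, ?_⟩
    rw [map_mul, map_mul, Derivation.leibniz, ha, add_comm, Finset.smul_sum]
    simp only [map_add, map_mul, add_smul, Finset.sum_add_distrib, smul_smul]
    congr 1
    · exact Finset.sum_congr rfl fun j _ => by rw [mul_comm]
    · rw [Finset.sum_eq_single n (fun j _ hj => by simp [hj]) (by simp)]
      simp

lemma IsLocalCoords.exists_D_eq (hψ : IsLocalCoords ψ)
    (hC : ∀ a, ι (ψ (MvPolynomial.C a)) = algebraMap ℂ K a) (z : O) :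
    ∃ a : Fin 3 → O, KaehlerDifferential.D ℂ K (ι z) =
      ∑ j, ι (a j) • KaehlerDifferential.D ℂ K (ι (ψ (MvPolynomial.X j))) := by
  obtain ⟨p, q, hq, h⟩ := hψ.surj z
  obtain ⟨a, ha⟩ := exists_D_eq_of_polynomial ι hC p
  obtain ⟨b, hb⟩ := exists_D_eq_of_polynomial ι hC q
  obtain ⟨d, hd⟩ := hq
  refine ⟨fun j => (↑d⁻¹ : O) * (a j - z * b j), ?_⟩
  have h1 : ι z * ι d = ι (ψ p) := by rw [hd, ← map_mul, h]
  have h2 := congrArg (KaehlerDifferential.D ℂ K) h1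
  rw [Derivation.leibniz, ha, hd, hb, ← hd] at h2
  have h3 : ι (↑d⁻¹ : O) * ι d = 1 := by rw [← map_mul, d.inv_mul, map_one]
  have h4 : KaehlerDifferential.D ℂ K (ι z) = ι (↑d⁻¹ : O) • (ι d •
      KaehlerDifferential.D ℂ K (ι z)) := by rw [smul_smul, h3, one_smul]
  rw [h4, eq_sub_of_add_eq' h2, smul_sub, Finset.smul_sum, Finset.smul_sum, Finset.smul_sum,
    ← Finset.sum_sub_distrib]
  refine Finset.sum_congr rfl fun j _ => ?_
  simp only [map_mul, map_sub, smul_smul, mul_sub, sub_smul]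

end Forms

/-! ### Gradients -/

section Grad

variable {K : Type} [Field K] [Algebra ℂ K]

/-- The differential of `f` is `∑ j, v j • d(x j)`. -/
def Grad (x : Fin 3 → K) (f : K) (v : Fin 3 → K) : Prop :=
  KaehlerDifferential.D ℂ K f = ∑ j, v j • KaehlerDifferential.D ℂ K (x j)

variable {x : Fin 3 → K} {f g : K} {v w : Fin 3 → K}

lemma Grad.var (l : Fin 3) : Grad x (x l) (Pi.single l 1) := by
  simp [Grad, Pi.single_apply]

lemma Grad.const (a : ℂ) : Grad x (algebraMap ℂ K a) 0 := by
  simp [Grad, Derivation.map_algebraMap]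

lemma Grad.add (hf : Grad x f v) (hg : Grad x g w) : Grad x (f + g) (v + w) := by
  rw [Grad, map_add, hf, hg]
  simp [add_smul, Finset.sum_add_distrib]

lemma Grad.sub (hf : Grad x f v) (hg : Grad x g w) : Grad x (f - g) (v - w) := by
  rw [Grad, map_sub, hf, hg]
  simp [sub_smul, Finset.sum_sub_distrib]

lemma Grad.mul (hf : Grad x f v) (hg : Grad x g w) : Grad x (f * g) (f • w + g • v) := by
  rw [Grad, Derivation.leibniz, hf, hg]
  simp [add_smul, Finset.sum_add_distrib, Finset.smul_sum, smul_smul]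

lemma Grad.inv (hf : Grad x f v) : Grad x f⁻¹ (-f⁻¹ ^ 2 • v) := by
  rw [Grad, Derivation.leibniz_inv, hf]
  simp [Finset.smul_sum, smul_smul]

lemma Grad.pow (hf : Grad x f v) (n : ℕ) : Grad x (f ^ n) ((n * f ^ (n - 1)) • v) := by
  rw [Grad, Derivation.leibniz_pow, hf, ← Nat.cast_smul_eq_nsmul K]
  simp [Finset.smul_sum, smul_smul, mul_assoc]

lemma Grad.congr {f' : K} {v' : Fin 3 → K} (h : Grad x f v) (hf : f = f') (hv : v = v') :
    Grad x f' v' := hf ▸ hv ▸ h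

lemma wedgeD_of_grad {c : Fin 3 → K} {A : Matrix (Fin 3) (Fin 3) K} (h : ∀ l, Grad x (c l) (A l)) :
    wedgeD c = A.det • wedgeD x := wedgeD_eq_smul A h

/-- The factor relating the coordinate forms of the charts. -/
def Chart.tau (κ : Chart) (β : HomCoord → K) : K :=
  (β (.inl κ.i) * β (.inr (.inl κ.j)) * β (.inr (.inr κ.k)) ^ 2)⁻¹

lemma wedgeD_of_grad_det {c : Fin 3 → K} {A : Matrix (Fin 3) (Fin 3) K} {τ : K}
    (h0 : Grad x (c 0) (A 0)) (h1 : Grad x (c 1) (A 1)) (h2 : Grad x (c 2) (A 2))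
    (h : A.det = τ ∨ A.det = -τ) : ∃ ε : K, (ε = 1 ∨ ε = -1) ∧ wedgeD c = (ε * τ) • wedgeD x := by
  have h3 := wedgeD_of_grad (A := A) (x := x) (c := c)
    (fun l => by fin_cases l; exacts [h0, h1, h2])
  rcases h with h | h
  · exact ⟨1, .inl rfl, by rw [h3, h, one_mul]⟩
  · exact ⟨-1, .inr rfl, by rw [h3, h, neg_one_mul]⟩

lemma chart_coord (a : Fin 8) {t s q : K} (ht : t ≠ 0) (hs : s ≠ 0)
    (hZ : (t + s) * q - t * s ≠ 0) : (chart a).coord ((chart a).normalize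
      (mkTuple 1 t 1 s 1 q ((t + s) * q - t * s))) =
    ![![t, s, q], ![t, s, q⁻¹], ![t⁻¹, s⁻¹, q * ((t + s) * q - t * s)⁻¹],
      ![t⁻¹, s⁻¹, ((t + s) * q - t * s) * q⁻¹], ![t, s⁻¹, s * q - t * s],
      ![t⁻¹, s, t * q - t * s], ![t, s⁻¹, (s - q) * (s⁻¹ * ((t + s) * q - t * s)⁻¹)],
      ![t⁻¹, s, (t - q) * (t⁻¹ * ((t + s) * q - t * s)⁻¹)]] a := by
  fin_cases a
  all_goals
    funext l
    fin_cases l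
    all_goals
      simp [chart, Chart.coord, Chart.normalize, scaleTuple, Chart.c000, Chart.c001, Chart.c112,
        Chart.c111, Chart.c010, Chart.c100, Chart.c012, Chart.c102, Ring.inverse_eq_inv']
  · ring
  · ring
  · ring
  · ring
  · field_simp
  · field_simp

lemma wedgeD_chart (a : Fin 8) {t s q : K} (ht : t ≠ 0) (hs : s ≠ 0) (hq : q ≠ 0)
    (hZ : (t + s) * q - t * s ≠ 0) : ∃ ε : K, (ε = 1 ∨ ε = -1) ∧
      wedgeD ((chart a).coord ((chart a).normalize
        (mkTuple 1 t 1 s 1 q ((t + s) * q - t * s)))) =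
      (ε * (chart a).tau (mkTuple 1 t 1 s 1 q ((t + s) * q - t * s))) • wedgeD ![t, s, q] := by
  have gt : Grad ![t, s, q] t ![1, 0, 0] :=
    (Grad.var (x := ![t, s, q]) 0).congr rfl (by funext j; fin_cases j <;> rfl)
  have gs : Grad ![t, s, q] s ![0, 1, 0] :=
    (Grad.var (x := ![t, s, q]) 1).congr rfl (by funext j; fin_cases j <;> rfl)
  have gq : Grad ![t, s, q] q ![0, 0, 1] :=
    (Grad.var (x := ![t, s, q]) 2).congr rfl (by funext j; fin_cases j <;> rfl)
  have gZ := ((gt.add gs).mul gq).sub (gt.mul gs)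
  rw [chart_coord a ht hs hZ]
  have red : ∀ {c : Fin 3 → K} {A₀ A₁ A₂ : Fin 3 → K} {τ : K} (_ : Grad ![t, s, q] (c 0) A₀)
      (_ : Grad ![t, s, q] (c 1) A₁) (_ : Grad ![t, s, q] (c 2) A₂)
      (_ : A₀ 1 = 0) (_ : A₀ 2 = 0) (_ : A₁ 0 = 0) (_ : A₁ 2 = 0)
      (_ : A₀ 0 * A₁ 1 * A₂ 2 = τ ∨ A₀ 0 * A₁ 1 * A₂ 2 = -τ), ∃ ε : K, (ε = 1 ∨ ε = -1) ∧
      wedgeD c = (ε * τ) • wedgeD ![t, s, q] := by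
    intro c A₀ A₁ A₂ τ h0 h1 h2 e1 e2 e3 e4 h
    refine wedgeD_of_grad_det (A := Matrix.of ![A₀, A₁, A₂]) h0 h1 h2 ?_
    simpa [Matrix.det_fin_three, e1, e2, e3, e4] using h
  fin_cases a
  · refine red gt gs gq rfl rfl rfl rfl (.inl ?_)
    simp [chart, Chart.tau, Chart.c000]
  · refine red gt gs gq.inv rfl rfl rfl rfl (.inr ?_)
    simp [chart, Chart.tau, Chart.c001]
  · refine red gt.inv gs.inv (gq.mul gZ.inv) (by simp) (by simp) (by simp) (by simp) (.inr ?_)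
    simp [chart, Chart.tau, Chart.c112]
    field_simp
    ring
  · refine red gt.inv gs.inv (gZ.mul gq.inv) (by simp) (by simp) (by simp) (by simp) (.inl ?_)
    simp [chart, Chart.tau, Chart.c111]
    field_simp
    ring
  · refine red gt gs.inv ((gs.mul gq).sub (gt.mul gs)) (by simp) (by simp) (by simp) (by simp)
      (.inr ?_)
    simp [chart, Chart.tau, Chart.c010]
    field_simp
  · refine red gt.inv gs ((gt.mul gq).sub (gt.mul gs)) (by simp) (by simp) (by simp) (by simp)
      (.inr ?_)
    simp [chart, Chart.tau, Chart.c100]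
    field_simp
  · refine red gt gs.inv ((gs.sub gq).mul (gs.inv.mul gZ.inv)) (by simp) (by simp) (by simp)
      (by simp) (.inl ?_)
    simp [chart, Chart.tau, Chart.c012]
    field_simp
    ring
  · refine red gt.inv gs ((gt.sub gq).mul (gt.inv.mul gZ.inv)) (by simp) (by simp) (by simp)
      (by simp) (.inl ?_)
    simp [chart, Chart.tau, Chart.c102]
    field_simp
    ring

end Grad

/-! ### Coefficients of canonical divisors -/

section Canonical

variable {Y X : Scheme.{0}} [IsIntegral Y] [IsLocallyNoetherian Y] [Y.Over SpecC]

lemma canonicalCoeff_eq (η : Y ⟶ X) (P : Y) (c : Fin 3 → Y.functionField)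
    (hc : wedgeD c ≠ 0) (g : Fin 3 → X.presheaf.stalk (η P))
    (hg : ∀ l, c l = (toFunctionField Y P).hom ((η.stalkMap P).hom (g l)))
    (h : ∀ z : X.presheaf.stalk (η P), ∃ a : Fin 3 → Y.presheaf.stalk P,
      KaehlerDifferential.D ℂ Y.functionField ((toFunctionField Y P).hom ((η.stalkMap P).hom z)) =
        ∑ j, (toFunctionField Y P).hom (a j) • KaehlerDifferential.D ℂ Y.functionField (c j))
    {k : Y.functionField} (hk : k ≠ 0) :
    canonicalCoeff η (k • wedgeD c) P = Scheme.ord k P := by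
  have key : ∀ μ ∈ pulledBackForms η P, ∃ r : Y.presheaf.stalk P,
      μ = (toFunctionField Y P).hom r • wedgeD c := by
    intro μ hμ
    induction hμ using Submodule.span_induction with
    | mem μ hμ =>
      obtain ⟨z, rfl⟩ := hμ
      choose a ha using fun l => h (z l)
      refine ⟨Matrix.det fun l j => a l j, ?_⟩
      refine Eq.trans (wedgeD_eq_smul (fun l j => (toFunctionField Y P).hom (a l j)) ha) ?_
      congr 1
      exact ((toFunctionField Y P).hom.map_det _).symm
    | zero => exact ⟨0, by rw [map_zero, zero_smul]⟩
    | add μ μ' _ _ h1 h2 =>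
      obtain ⟨r, rfl⟩ := h1
      obtain ⟨r', rfl⟩ := h2
      exact ⟨r + r', by rw [map_add, add_smul]⟩
    | smul s μ _ h1 =>
      obtain ⟨r, rfl⟩ := h1
      obtain ⟨s, s', rfl⟩ := s
      refine ⟨s' * r, ?_⟩
      rw [map_mul, mul_smul]
      rfl
  have hmem : wedgeD c ∈ pulledBackForms η P := by
    refine Submodule.subset_span ⟨g, ?_⟩
    exact congrArg _ (funext fun l => congrArg _ (hg l).symm)
  refine IsGreatest.csSup_eq ⟨⟨k, wedgeD c, hk, hmem, rfl, rfl⟩, ?_⟩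
  rintro n ⟨f, μ, hf, hμ, hω, rfl⟩
  obtain ⟨r, rfl⟩ := key μ hμ
  rw [smul_smul] at hω
  have h1 : k = f * (toFunctionField Y P).hom r := smul_left_injective _ hc hω
  have hr : r ≠ 0 := by
    rintro rfl
    exact hk (by rw [h1, map_zero, mul_zero])
  have hr' : (toFunctionField Y P).hom r ≠ 0 := fun h2 => hk (by rw [h1, h2, mul_zero])
  rw [h1, Scheme.ord_mul hf hr']
  linarith [ord_toFunctionField_nonneg P hr]

end Canonical

end

section

variable {B B' : CommRingCat.{0}}

/-! ### Algebraic preliminaries -/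

lemma isDiscreteValuationRing_localization {R : Type} [CommRing R] [IsDomain R] [IsNoetherianRing R]
    {π : R} (hπ : Prime π) (h𝔭 : (Ideal.span {π}).IsPrime) :
    IsDiscreteValuationRing (Localization.AtPrime (Ideal.span {π})) ∧
      Irreducible (algebraMap R (Localization.AtPrime (Ideal.span {π})) π) := by
  have h1 : IsLocalRing.maximalIdeal (Localization.AtPrime (Ideal.span {π})) =
      Ideal.span {algebraMap R (Localization.AtPrime (Ideal.span {π})) π} := by
    rw [← Localization.AtPrime.map_eq_maximalIdeal, Ideal.map_span, Set.image_singleton]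
  have hinj : Function.Injective (algebraMap R (Localization.AtPrime (Ideal.span {π}))) :=
    IsLocalization.injective _ (Ideal.span {π}).primeCompl_le_nonZeroDivisors
  have : IsDomain (Localization.AtPrime (Ideal.span {π})) :=
    IsLocalization.isDomain_localization (Ideal.span {π}).primeCompl_le_nonZeroDivisors
  have : IsNoetherianRing (Localization.AtPrime (Ideal.span {π})) :=
    IsLocalization.isNoetherianRing (Ideal.span {π}).primeCompl _ inferInstance
  have h0 : algebraMap R (Localization.AtPrime (Ideal.span {π})) π ≠ 0 := fun h =>
    hπ.ne_zero (hinj (h.trans (map_zero _).symm))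
  have h2 : ¬ IsField (Localization.AtPrime (Ideal.span {π})) := by
    rw [IsLocalRing.isField_iff_maximalIdeal_eq, h1, Ideal.span_singleton_eq_bot]
    exact h0
  have h3 : IsDiscreteValuationRing (Localization.AtPrime (Ideal.span {π})) :=
    ((IsDiscreteValuationRing.TFAE _ h2).out 0 4 :).2 ⟨⟨_, h1⟩⟩
  exact ⟨h3, (IsDiscreteValuationRing.irreducible_iff_uniformizer _).2 h1⟩

/-- A rational function without poles along prime divisors is a polynomial. -/
lemma IsLocalCoords.exists_eq_of_forall_irreducible {K : Type} [Field K]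
    {φ : MvPolynomial (Fin 3) ℂ →+* K} (hφ : IsLocalCoords φ) (g : K)
    (h : ∀ π, Irreducible π → ∃ p d, ¬ π ∣ d ∧ g * φ d = φ p) : ∃ p, g = φ p := by
  obtain ⟨b, c, hc, hg⟩ := hφ.surj g
  have hc0 : c ≠ 0 := by
    rintro rfl
    exact hc.ne_zero (map_zero φ)
  obtain ⟨b', c', e, hrel, rfl, rfl⟩ := UniqueFactorizationMonoid.exists_reduced_factors' b c hc0
  have he : φ e ≠ 0 := fun h => hc.ne_zero (by rw [map_mul, h, zero_mul])
  have hc'0 : c' ≠ 0 := right_ne_zero_of_mul hc0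
  have hg' : g * φ c' = φ b' := by
    refine mul_left_cancel₀ he ?_
    rw [← map_mul, ← hg, map_mul]
    ring
  by_cases hu : IsUnit c'
  · obtain ⟨u, hu⟩ := hu.exists_right_inv
    refine ⟨b' * u, ?_⟩
    rw [map_mul, ← hg', mul_assoc, ← map_mul, hu, map_one, mul_one]
  · exfalso
    obtain ⟨π, hπ, hπc⟩ := WfDvdMonoid.exists_irreducible_factor hu hc'0
    obtain ⟨p, d, hd, hpd⟩ := h π hπ
    have h1 : b' * d = p * c' := hφ.inj (by rw [map_mul, map_mul, ← hg', ← hpd]; ring)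
    have h2 : π ∣ b' * d := h1 ▸ hπc.mul_left p
    exact hπ.not_isUnit (hrel ((hπ.prime.dvd_or_dvd h2).resolve_right hd) hπc)

/-! ### The coordinates of the charts as rational functions -/

lemma toFunctionField_genericPoint (Z : Scheme.{0}) [IsIntegral Z] :
    toFunctionField Z (genericPoint Z) = 𝟙 _ := by
  refine Spec.map_injective ?_
  rw [← cancel_mono (Z.fromSpecStalk (genericPoint Z)), map_toFunctionField, Spec.map_id]
  exact (Category.id_comp _).symm

section

variable {X : Scheme.{0}} [X.Over SpecC] [IsIntegral X] [IsLocallyNoetherian X] {i : X ⟶ PPP}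
  [i.IsOver SpecC] [IsClosedImmersion i]

lemma exists_chart_hasTuple (hX : i.ker = idealX) [IsLocalRing B] (u : Spec B ⟶ X) :
    ∃ a β, (PPPcoords.comp i).HasTuple u β ∧ (chart a).Normalized β := by
  obtain ⟨β, hβ⟩ := Coords.HasTuple.exists_of_isLocalRing (PPPcoords.comp i) u
  obtain ⟨j, k, l, hj, hk, hl⟩ := hβ.exists_isUnit
  obtain ⟨a, ha⟩ := exists_chart_units (formX_eq_zero hX hβ) hj hk hl
  exact ⟨a, _, ha.hasTuple_normalize hβ, ha.normalized⟩

lemma coord_toLL (κ : Chart) (l : Fin 3) :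
    κ.toLL (MvPolynomial.X l) = κ.coord (κ.normalize genTuple) l := κ.hom_X _ _ l

lemma tuple_toLL (κ : Chart) :
    (κ.tuple fun l => κ.toLL (MvPolynomial.X l)) = κ.normalize genTuple := by
  simp only [coord_toLL]
  refine (units_genTuple κ).normalized.tuple_coord ?_
  have : formX (κ.normalize genTuple) = Ring.inverse (genTuple (.inl κ.i)) *
    Ring.inverse (genTuple (.inr (.inl κ.j))) * Ring.inverse (genTuple (.inr (.inr κ.k))) *
    formX genTuple := by
    simp only [formX, Chart.normalize, scaleTuple]
    ring
  rw [this, formX_genTuple, mul_zero]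

/-- The generic point, in the coordinates of a chart. -/
lemma Chart.exists_generic (κ : Chart) (hX : i.ker = idealX) {A : Type} [CommRing A] [IsLocalRing A]
    (al : MvPolynomial (Fin 3) ℂ →+* A) (j : A →+* LL) (hj : ∀ p, j (al p) = κ.toLL p) :
    ∃ u : Spec (CommRingCat.of A) ⟶ X,
      u ≫ X ↘ SpecC = Spec.map (CommRingCat.ofHom (al.comp MvPolynomial.C)) ∧
      (PPPcoords.comp i).HasTuple u (κ.tuple fun l => al (MvPolynomial.X l)) ∧
      pullbackIdeal (idealC i) u ≠ ⊥ := by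
  obtain ⟨u, hu, hu'⟩ := κ.exists_point (i := i) (B := CommRingCat.of A) hX al
  refine ⟨u, hu, hu', ?_⟩
  have h1 := hu'.comp (CommRingCat.ofHom j)
  have h2 : (fun h => (CommRingCat.ofHom j).hom (κ.tuple (fun l => al (MvPolynomial.X l)) h)) =
      κ.normalize genTuple := by
    funext h
    refine (κ.map_tuple j _ h).trans ?_
    simp only [hj]
    rw [tuple_toLL]
  rw [h2] at h1
  have h3 := h1.scale (units_genTuple κ).i (units_genTuple κ).j (units_genTuple κ).k
  have h4 : scaleTuple (genTuple (.inl κ.i)) (genTuple (.inr (.inl κ.j)))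
      (genTuple (.inr (.inr κ.k))) (κ.normalize genTuple) = genTuple := by
    have h5 : ∀ h h', genTuple h * (Ring.inverse (genTuple h) * genTuple h') = genTuple h' :=
      fun h h' => Ring.mul_inverse_cancel_left _ _ (genTuple_ne_zero h).isUnit
    funext h
    rcases h with h | h | h <;> exact h5 _ _
  rw [h4] at h3
  refine pullbackIdeal_ne_bot_of_comp (φ := CommRingCat.ofHom j) rfl ?_
  rw [pullbackIdeal_idealC (B := CommRingCat.of LL) h3]
  exact idealEq_genTuple_ne_bot

lemma isLocalCoords_toLL (κ : Chart) (hX : i.ker = idealX) : IsLocalCoords κ.toLL := by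
  obtain ⟨F⟩ := (isModel_id i).nonempty_fieldCoords hX
  obtain ⟨β, hβ⟩ : ∃ β, (PPPcoords.comp i).HasTuple (X.fromSpecStalk (genericPoint X)) β :=
    Coords.HasTuple.exists_of_isLocalRing _ _
  have hun : κ.Units β := by
    have h1 := F.tuple.congr (Category.comp_id _)
    refine .of_isLocalHom hβ (𝟙 _) (Spec.map_id _ ▸ Category.id_comp _) h1 ?_
    exact ⟨(units_genTuple κ).i.map F.θ, (units_genTuple κ).j.map F.θ,
      (units_genTuple κ).k.map F.θ⟩
  have hβ' := hun.hasTuple_normalize hβ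
  have h1 := κ.isLocalCoords hX _ hβ' hun.normalized
  have h2 : ∀ p, κ.hom (stalkConst X (genericPoint X)).hom (κ.normalize β) p = F.θ (κ.toLL p) :=
    fun p => by
      rw [← F.toFunctionField_hom (hβ'.congr (Category.comp_id _).symm) hun.normalized p,
        toFunctionField_genericPoint]
      rfl
  constructor
  · intro p q h
    exact h1.inj (by rw [h2, h2, h])
  · intro z
    obtain ⟨p, d, hd, h⟩ := h1.surj (F.θ z)
    rw [h2] at hd
    rw [h2, h2] at h
    exact ⟨p, d, by simpa using hd.map F.θ.symm, F.θ.injective ((map_mul _ _ _).trans h)⟩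

/-- Along the prime divisors of the threefold, a model has the same local rings. -/
lemma IsModel.exists_point_of_irreducible (hX : i.ker = idealX) {Z : Scheme.{0}} [Z.Over SpecC]
    {η : Z ⟶ X} [η.IsOver SpecC] [IsIntegral Z] [IsLocallyNoetherian Z] (hη : IsModel i η)
    (κ : Chart) {π : MvPolynomial (Fin 3) ℂ} (hπ : Irreducible π) :
    ∃ (P : Z) (β : HomCoord → Z.presheaf.stalk P),
      IsDiscreteValuationRing (Z.presheaf.stalk P) ∧
      (PPPcoords.comp i).HasTuple (Z.fromSpecStalk P ≫ η) β ∧ κ.Normalized β ∧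
      ∀ z, ∃ p d, ¬ π ∣ d ∧ z * κ.hom (stalkConst Z P).hom β d = κ.hom (stalkConst Z P).hom β p := by
  have h𝔭 : (Ideal.span {π}).IsPrime := (Ideal.span_singleton_prime hπ.ne_zero).2 hπ.prime
  obtain ⟨hdvr, -⟩ := isDiscreteValuationRing_localization hπ.prime h𝔭
  let A := Localization.AtPrime (Ideal.span {π})
  let al : MvPolynomial (Fin 3) ℂ →+* A := algebraMap _ A
  have hT := isLocalCoords_toLL κ hX
  let j : A →+* LL := IsLocalization.lift (M := (Ideal.span {π}).primeCompl) (g := κ.toLL)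
    fun d => (((map_ne_zero_iff _ hT.inj).2 fun h => d.2 (h ▸ zero_mem _)) : κ.toLL d ≠ 0).isUnit
  obtain ⟨u, hu, hu', hne⟩ := κ.exists_generic (i := i) hX al j fun p => IsLocalization.lift_eq _ p
  obtain ⟨v, rfl⟩ := hη.exists_lift (CommRingCat.of A) u hne
  obtain ⟨β, hβ, hn, φ, hφ, -, hcomp⟩ := hη.exists_stalk_equiv hX (Ideal.span {π}).primeCompl κ v hu
    hu' hne rfl
  let e := RingEquiv.ofBijective φ.hom hφ
  refine ⟨_, β, IsDiscreteValuationRing.RingEquivClass.isDiscreteValuationRing e.symm, hβ, hn, fun z => ?_⟩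
  obtain ⟨⟨p, d⟩, h⟩ := IsLocalization.surj (M := (Ideal.span {π}).primeCompl) (S := A) (φ.hom z)
  refine ⟨p, d, fun h => d.2 (Ideal.mem_span_singleton.2 h), hφ.1 ?_⟩
  rw [map_mul, hcomp, hcomp]
  exact h

end

end

section

variable {B B' : CommRingCat.{0}}

/-! ### Sections of the anticanonical divisor -/

/-- The factor relating the coordinate forms of the charts, as a rational function. -/
def tauLL (a : Fin 8) : LL := (chart a).tau genTuple

lemma tauLL_ne_zero (a : Fin 8) : tauLL a ≠ 0 :=
  inv_ne_zero (mul_ne_zero (mul_ne_zero (genTuple_ne_zero _) (genTuple_ne_zero _))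
    (pow_ne_zero 2 (genTuple_ne_zero _)))

/-- The rational functions that give sections of `-m K_X`. -/
def antiCanSections (m : ℕ) : Submodule ℂ LL where
  carrier := {g | ∀ a, ∃ p, g * tauLL a ^ m = (chart a).toLL p}
  add_mem' {g h} hg hh a := by
    obtain ⟨p, hp⟩ := hg a
    obtain ⟨q, hq⟩ := hh a
    exact ⟨p + q, by rw [add_mul, hp, hq, map_add]⟩
  zero_mem' a := ⟨0, by rw [zero_mul, map_zero]⟩
  smul_mem' c g hg a := by
    obtain ⟨p, hp⟩ := hg a
    refine ⟨MvPolynomial.C c * p, ?_⟩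
    rw [map_mul, ← hp, Algebra.smul_def, mul_assoc]
    exact congrArg (· * _) ((chart a).hom_C _ _ c).symm

lemma wedgeD_toLL {K : Type} [Field K] [Algebra ℂ K] (θ : LL ≃+* K) (a : Fin 8) :
    ∃ ε : K, (ε = 1 ∨ ε = -1) ∧ wedgeD (fun l => θ ((chart a).toLL (MvPolynomial.X l))) =
      (ε * θ (tauLL a)) • wedgeD fun l => θ (genCoord l) := by
  have h0 : (fun h => θ (genTuple h)) = mkTuple 1 (θ (genCoord 0)) 1 (θ (genCoord 1)) 1
      (θ (genCoord 2)) ((θ (genCoord 0) + θ (genCoord 1)) * θ (genCoord 2) -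
        θ (genCoord 0) * θ (genCoord 1)) := by
    rw [genTuple_eq]
    refine funext (forall_homCoord.2 ?_)
    simp
  have hne : ∀ h, θ (genTuple h) ≠ 0 := fun h => (map_ne_zero_iff _ θ.injective).2
    (genTuple_ne_zero h)
  have h1 := congrFun h0
  obtain ⟨ε, hε, h2⟩ := wedgeD_chart a (K := K) (t := θ (genCoord 0)) (s := θ (genCoord 1))
    (q := θ (genCoord 2)) ((h1 (.inl 1)).symm.trans_ne (hne _))
    ((h1 (.inr (.inl 1))).symm.trans_ne (hne _)) ((h1 (.inr (.inr 1))).symm.trans_ne (hne _))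
    ((h1 (.inr (.inr 2))).symm.trans_ne (hne _))
  refine ⟨ε, hε, ?_⟩
  rw [← h0] at h2
  have h3 : (fun l => θ (genCoord l)) = ![θ (genCoord 0), θ (genCoord 1), θ (genCoord 2)] := by
    funext l; fin_cases l <;> rfl
  have h4 : (fun l => θ ((chart a).toLL (MvPolynomial.X l))) =
      (chart a).coord ((chart a).normalize fun h => θ (genTuple h)) := by
    funext l
    rw [coord_toLL]
    refine ((chart a).map_coord θ.toRingHom _ l).trans ?_
    congr 1
    funext h
    rcases h with h | h | h <;>
      simp [Chart.normalize, scaleTuple, Ring.inverse_eq_inv']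
  have h5 : θ (tauLL a) = (chart a).tau fun h => θ (genTuple h) := by
    simp [tauLL, Chart.tau]
  rw [h3, h4, h5, h2]

section

variable {X : Scheme.{0}} [X.Over SpecC] [IsIntegral X] [IsLocallyNoetherian X] {i : X ⟶ PPP}
  [i.IsOver SpecC] [IsClosedImmersion i] {Z : Scheme.{0}} [Z.Over SpecC] {η : Z ⟶ X}
  [η.IsOver SpecC] [IsIntegral Z] [IsLocallyNoetherian Z]

lemma ord_of_eq_one_or_neg_one {ε : Z.functionField} (h : ε = 1 ∨ ε = -1) (P : Z) :
    Scheme.ord ε P = 0 := by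
  rcases h with rfl | rfl
  · exact ord_one' P
  · have h1 := Scheme.ord_mul (x := P) (f := (-1 : Z.functionField)) (g := -1) (by simp) (by simp)
    rw [neg_mul_neg, one_mul, ord_one'] at h1
    linarith

namespace FieldCoords

variable (F : FieldCoords i η)

/-- The rational form `dt ∧ ds ∧ dq`. -/
def form : RationalForms Z := wedgeD fun l => F.θ (genCoord l)

lemma form_ne_zero : F.form ≠ 0 := by
  obtain ⟨b, hb⟩ := exists_basis_D_of_equiv F.θ F.const
  have h := ιMulti_basis_ne_zero b
  rwa [show (b : Fin 3 → _) = _ from funext hb] at h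

lemma exists_someForm_eq : ∃ h : Z.functionField, h ≠ 0 ∧ someForm Z = h • F.form := by
  obtain ⟨b, hb⟩ := exists_basis_D_of_equiv F.θ F.const
  obtain ⟨h, hh⟩ := exists_eq_smul_ιMulti_basis b (someForm Z)
  rw [show (b : Fin 3 → _) = _ from funext hb] at hh
  refine ⟨h, ?_, hh⟩
  rintro rfl
  rw [zero_smul] at hh
  exact Classical.epsilon_spec (p := fun ω : RationalForms Z => ω ≠ 0) ⟨_, F.form_ne_zero⟩ hh

lemma θ_tauLL_ne_zero (a : Fin 8) : F.θ (tauLL a) ≠ 0 :=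
  (map_ne_zero_iff _ F.θ.injective).2 (tauLL_ne_zero a)

lemma canonicalCoeff_smul_form (hX : i.ker = idealX) {P : Z} {a : Fin 8}
    {β : HomCoord → Z.presheaf.stalk P}
    (hβ : (PPPcoords.comp i).HasTuple (Z.fromSpecStalk P ≫ η) β) (hn : (chart a).Normalized β)
    {k : Z.functionField} (hk : k ≠ 0) :
    canonicalCoeff η (k • F.form) P = Scheme.ord k P - Scheme.ord (F.θ (tauLL a)) P := by
  obtain ⟨β₀, hβ₀⟩ := Coords.HasTuple.exists_of_isLocalRing (PPPcoords.comp i)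
    (X.fromSpecStalk (η P))
  have hst := Scheme.SpecMap_stalkMap_fromSpecStalk η (x := P)
  have hu : (chart a).Units β₀ := .of_isLocalHom hβ₀ (η.stalkMap P) hst hβ hn.units
  have hβ₁ := hu.hasTuple_normalize hβ₀
  have hψ := (chart a).isLocalCoords hX _ hβ₁ hu.normalized
  set ψ := (chart a).hom (stalkConst X (η P)).hom ((chart a).normalize β₀)
  have hψ' : ∀ p, (toFunctionField Z P).hom ((η.stalkMap P).hom (ψ p)) =
      F.θ ((chart a).toLL p) := fun p => by
    rw [← F.toFunctionField_hom ((hβ₁.comp (η.stalkMap P)).congr hst)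
      (hu.normalized.map (η.stalkMap P).hom) p]
    refine congrArg (toFunctionField Z P).hom (((chart a).map_hom _ _ _ p).trans ?_)
    congr 1
    congr 1
    ext c
    refine comp_const_eq (φ := η.stalkMap P) (map_stalkConst X (η P)) hst
      (fromSpecStalk_comp_over P) c
  obtain ⟨ε, hε, hw⟩ := wedgeD_toLL F.θ a
  have hε0 : ε ≠ 0 := by rcases hε with rfl | rfl <;> simp
  have hτ := F.θ_tauLL_ne_zero a
  have hετ : ε * F.θ (tauLL a) ≠ 0 := mul_ne_zero hε0 hτ
  have h1 : k • F.form = (k * (ε * F.θ (tauLL a))⁻¹) •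
      wedgeD fun l => F.θ ((chart a).toLL (MvPolynomial.X l)) := by
    rw [hw, smul_smul, inv_mul_cancel_right₀ hετ]
    rfl
  rw [h1, canonicalCoeff_eq η P _ ?_ (fun l => ψ (MvPolynomial.X l)) (fun l => (hψ' _).symm) ?_
    (mul_ne_zero hk (inv_ne_zero hετ)), Scheme.ord_mul hk (inv_ne_zero hετ), ord_inv hετ,
    Scheme.ord_mul hε0 hτ, ord_of_eq_one_or_neg_one hε]
  · ring
  · rw [hw]
    exact smul_ne_zero hετ F.form_ne_zero
  · intro z
    obtain ⟨c, hc⟩ := hψ.exists_D_eq ((toFunctionField Z P).hom.comp (η.stalkMap P).hom)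
      (fun c => by
        refine (hψ' _).trans ?_
        rw [← F.const]
        exact congrArg F.θ ((chart a).hom_C _ _ c)) z
    refine ⟨fun j => (η.stalkMap P).hom (c j), hc.trans ?_⟩
    refine Finset.sum_congr rfl fun j _ => ?_
    rw [← hψ']
    rfl

/-- The rational functions `g` with `div (g) + m (-η^* K_X - E) ≥ 0`, with respect to the canonical
divisor given by the form `dt ∧ ds ∧ dq`. -/
def sections (m : ℕ) (E : Z → ℝ) : Set LL :=
  {g | g ≠ 0 → ∀ P, Order.coheight P = 1 → ∀ a (β : HomCoord → Z.presheaf.stalk P),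
    (PPPcoords.comp i).HasTuple (Z.fromSpecStalk P ≫ η) β → (chart a).Normalized β →
      m * E P ≤ (Scheme.ord (F.θ (g * tauLL a ^ m)) P : ℝ)}

lemma h0_eq (hX : i.ker = idealX) (m : ℕ) (E : Z → ℝ) :
    h0 Z (fun P => (m : ℝ) * (antiCan η - E) P) = Set.finrank ℂ (F.sections m E) := by
  obtain ⟨h, hh, hω⟩ := F.exists_someForm_eq
  let T : LL ≃ₗ[ℂ] Z.functionField :=
    { toFun := fun g => h ^ m * F.θ g
      invFun := fun f => F.θ.symm ((h ^ m)⁻¹ * f)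
      map_add' := fun g g' => by rw [map_add, mul_add]
      map_smul' := fun c g => by
        rw [Algebra.smul_def, Algebra.smul_def, map_mul, F.const, RingHom.id_apply]
        ring
      left_inv := fun g => by
        beta_reduce
        rw [inv_mul_cancel_left₀ (pow_ne_zero m hh), RingEquiv.symm_apply_apply]
      right_inv := fun f => by
        beta_reduce
        rw [RingEquiv.apply_symm_apply, mul_inv_cancel_left₀ (pow_ne_zero m hh)] }
  have key : ∀ g : LL, (T g ≠ 0 → ∀ P : Z, Order.coheight P = 1 →
      0 ≤ (Scheme.ord (T g) P : ℝ) + m * (antiCan η - E) P) ↔ g ∈ F.sections m E := by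
    intro g
    have h1 : ∀ (hg : g ≠ 0) (P : Z) (a) (β : HomCoord → Z.presheaf.stalk P)
        (_ : (PPPcoords.comp i).HasTuple (Z.fromSpecStalk P ≫ η) β) (_ : (chart a).Normalized β),
        (Scheme.ord (T g) P : ℝ) + m * (antiCan η - E) P =
          Scheme.ord (F.θ (g * tauLL a ^ m)) P - m * E P := by
      intro hg P a β hβ hn
      have hg' : F.θ g ≠ 0 := (map_ne_zero_iff _ F.θ.injective).2 hg
      have h2 : T g = h ^ m * F.θ g := rfl
      rw [h2, Scheme.ord_mul (pow_ne_zero m hh) hg', ord_pow' P hh, map_mul, map_pow,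
        Scheme.ord_mul hg' (pow_ne_zero m (F.θ_tauLL_ne_zero a)),
        ord_pow' P (F.θ_tauLL_ne_zero a), Pi.sub_apply, antiCan, hω,
        F.canonicalCoeff_smul_form hX hβ hn hh]
      push_cast
      ring
    have hT : T g ≠ 0 ↔ g ≠ 0 := by simp
    rw [hT]
    constructor
    · intro h2 hg P hP a β hβ hn
      have := h2 hg P hP
      rw [h1 hg P a β hβ hn] at this
      linarith
    · intro h2 hg P hP
      obtain ⟨a, β, hβ, hn⟩ := exists_chart_hasTuple hX (Z.fromSpecStalk P ≫ η)
      rw [h1 hg P a β hβ hn]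
      linarith [h2 hg P hP a β hβ hn]
  have h2 : {f : Z.functionField | f ≠ 0 → ∀ P : Z, Order.coheight P = 1 →
      0 ≤ (Scheme.ord f P : ℝ) + m * (antiCan η - E) P} = T '' F.sections m E := by
    ext f
    constructor
    · intro hf
      refine ⟨T.symm f, (key _).1 ?_, T.apply_symm_apply f⟩
      rwa [T.apply_symm_apply]
    · rintro ⟨g, hg, rfl⟩
      exact (key g).2 hg
  rw [h0, h2, Set.finrank, Set.finrank]
  have h3 : Submodule.span ℂ (T '' F.sections m E) =
      (Submodule.span ℂ (F.sections m E)).map (T : LL →ₗ[ℂ] Z.functionField) :=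
    (Submodule.map_span _ _).symm
  rw [h3]
  exact LinearEquiv.finrank_map_eq T _

lemma mem_range_of_mem_antiCanSections {m : ℕ} {g : LL} (hg : g ∈ antiCanSections m) {P : Z}
    {a : Fin 8} {β : HomCoord → Z.presheaf.stalk P}
    (hβ : (PPPcoords.comp i).HasTuple (Z.fromSpecStalk P ≫ η) β) (hn : (chart a).Normalized β) :
    ∃ z, F.θ (g * tauLL a ^ m) = (toFunctionField Z P).hom z := by
  obtain ⟨p, hp⟩ := hg a
  exact ⟨_, hp ▸ (F.toFunctionField_hom hβ hn p).symm⟩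

lemma ord_nonneg_of_mem_antiCanSections {m : ℕ} {g : LL} (hg : g ∈ antiCanSections m) (hg0 : g ≠ 0)
    {P : Z} {a : Fin 8} {β : HomCoord → Z.presheaf.stalk P}
    (hβ : (PPPcoords.comp i).HasTuple (Z.fromSpecStalk P ≫ η) β) (hn : (chart a).Normalized β) :
    0 ≤ Scheme.ord (F.θ (g * tauLL a ^ m)) P := by
  obtain ⟨z, hz⟩ := F.mem_range_of_mem_antiCanSections hg hβ hn
  rw [hz]
  refine ord_toFunctionField_nonneg P ?_
  rintro rfl
  rw [map_zero] at hz
  exact (map_ne_zero_iff _ F.θ.injective).2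
    (mul_ne_zero hg0 (pow_ne_zero m (tauLL_ne_zero a))) hz

lemma mem_antiCanSections (hX : i.ker = idealX) (hη : IsModel i η) {m : ℕ} {E : Z → ℝ}
    (hE : ∀ P, 0 ≤ E P) {g : LL} (hg : g ∈ F.sections m E) : g ∈ antiCanSections m := by
  by_cases hg0 : g = 0
  · exact hg0 ▸ zero_mem _
  intro a
  refine (isLocalCoords_toLL (chart a) hX).exists_eq_of_forall_irreducible _ fun π hπ => ?_
  obtain ⟨P, β, hdvr, hβ, hn, hP⟩ := hη.exists_point_of_irreducible hX (chart a) hπ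
  have h1 := hg hg0 P (coheight_eq_one hdvr) a β hβ hn
  have h2 : (0 : ℤ) ≤ Scheme.ord (F.θ (g * tauLL a ^ m)) P := by
    have : (0 : ℝ) ≤ (Scheme.ord (F.θ (g * tauLL a ^ m)) P : ℝ) :=
      (mul_nonneg (Nat.cast_nonneg m) (hE P)).trans h1
    exact_mod_cast this
  obtain ⟨ϖ, hϖ⟩ := IsDiscreteValuationRing.exists_irreducible (Z.presheaf.stalk P)
  have hne : F.θ (g * tauLL a ^ m) ≠ 0 := (map_ne_zero_iff _ F.θ.injective).2
    (mul_ne_zero hg0 (pow_ne_zero m (tauLL_ne_zero a)))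
  obtain ⟨r, hr⟩ := (le_ord_iff_of_isDiscreteValuationRing hdvr hϖ hne 0).1 (by exact_mod_cast h2)
  rw [pow_zero, one_mul] at hr
  obtain ⟨p, d, hd, h3⟩ := hP r
  refine ⟨p, d, hd, F.θ.injective ?_⟩
  rw [map_mul, hr, ← F.toFunctionField_hom hβ hn, ← F.toFunctionField_hom hβ hn, ← map_mul, h3]

lemma sections_zero (hX : i.ker = idealX) (hη : IsModel i η) (m : ℕ) :
    F.sections m 0 = antiCanSections m := by
  ext g
  refine ⟨F.mem_antiCanSections hX hη fun _ => le_rfl, fun hg hg0 P _ a β hβ hn => ?_⟩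
  rw [Pi.zero_apply, mul_zero]
  exact_mod_cast F.ord_nonneg_of_mem_antiCanSections hg hg0 hβ hn

end FieldCoords

end

end

section

/-! ### Monomial valuations -/

section Monomial

open MvPolynomial

/-- The linear substitution `(t, w, p) ↦ (t, t - (M₀₀ w + M₀₁ p), t - (M₁₀ w + M₁₁ p))`. -/
def linHom (M : Matrix (Fin 2) (Fin 2) ℂ) : MvPolynomial (Fin 3) ℂ →ₐ[ℂ] MvPolynomial (Fin 3) ℂ :=
  aeval ![X 0, X 0 - (C (M 0 0) * X 1 + C (M 0 1) * X 2),
    X 0 - (C (M 1 0) * X 1 + C (M 1 1) * X 2)]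

/-- The monomial substitution `(t, w, p) ↦ (t, χ ^ k u ^ A, χ ^ l u ^ B)`. -/
def monoHom (k A l B : ℕ) : MvPolynomial (Fin 3) ℂ →ₐ[ℂ] MvPolynomial (Fin 3) ℂ :=
  aeval ![X 0, X 1 ^ k * X 2 ^ A, X 1 ^ l * X 2 ^ B]

/-- The substitution defining the quasi-monomial valuation with weights `A`, `B` in the coordinates
given by `M`. -/
def toricHom (M : Matrix (Fin 2) (Fin 2) ℂ) (k A l B : ℕ) :
    MvPolynomial (Fin 3) ℂ →ₐ[ℂ] MvPolynomial (Fin 3) ℂ :=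
  (monoHom k A l B).comp (linHom M)

/-- The inverse of a linear substitution, as a substitution into `t - s`, `t - q`. -/
def linInvHom (M : Matrix (Fin 2) (Fin 2) ℂ) :
    MvPolynomial (Fin 3) ℂ →ₐ[ℂ] MvPolynomial (Fin 3) ℂ :=
  aeval ![X 0, C (M⁻¹ 0 0) * (X 0 - X 1) + C (M⁻¹ 0 1) * (X 0 - X 2),
    C (M⁻¹ 1 0) * (X 0 - X 1) + C (M⁻¹ 1 1) * (X 0 - X 2)]

lemma linInvHom_linHom {M : Matrix (Fin 2) (Fin 2) ℂ} (hM : M.det ≠ 0)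
    (p : MvPolynomial (Fin 3) ℂ) : linInvHom M (linHom M p) = p := by
  have h1 : M * M⁻¹ = 1 := Matrix.mul_nonsing_inv M hM.isUnit
  have h2 : ∀ a b, M a 0 * M⁻¹ 0 b + M a 1 * M⁻¹ 1 b = (1 : Matrix (Fin 2) (Fin 2) ℂ) a b := by
    intro a b
    rw [← h1, Matrix.mul_apply, Fin.sum_univ_two]
  have h3 : ∀ a b, (C (M a 0) * C (M⁻¹ 0 b) + C (M a 1) * C (M⁻¹ 1 b) : MvPolynomial (Fin 3) ℂ) =
      C ((1 : Matrix (Fin 2) (Fin 2) ℂ) a b) := by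
    intro a b
    rw [← h2, C_add, C_mul, C_mul]
  suffices h : (linInvHom M).comp (linHom M) = AlgHom.id ℂ _ from DFunLike.congr_fun h p
  have h00 := h3 0 0
  have h01 := h3 0 1
  have h10 := h3 1 0
  have h11 := h3 1 1
  simp only [Matrix.one_apply_eq, Matrix.one_apply_ne (show (0 : Fin 2) ≠ 1 by decide),
    Matrix.one_apply_ne (show (1 : Fin 2) ≠ 0 by decide), C_1, C_0] at h00 h01 h10 h11
  refine algHom_ext fun l => ?_
  fin_cases l
  · simp [linHom, linInvHom]
  · simp [linHom, linInvHom, algHom_C, algebraMap_eq]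
    linear_combination (-(X 0 - X 1)) * h00 - (X 0 - X 2) * h01
  · simp [linHom, linInvHom, algHom_C, algebraMap_eq]
    linear_combination (-(X 0 - X 1)) * h10 - (X 0 - X 2) * h11

lemma le_of_X_pow_dvd {n : ℕ} {R : MvPolynomial (Fin 3) ℂ} (h : X 2 ^ n ∣ R) {m : Fin 3 →₀ ℕ}
    (hm : coeff m R ≠ 0) : n ≤ m 2 := by
  obtain ⟨S, rfl⟩ := h
  rw [X_pow_eq_monomial, coeff_monomial_mul'] at hm
  by_contra hlt
  refine hm (if_neg fun hle => hlt ?_)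
  simpa using hle 2

/-- The exponents of the images of monomials under `monoHom`. -/
def monoExp (k A l B : ℕ) (e : Fin 3 →₀ ℕ) : Fin 3 →₀ ℕ :=
  Finsupp.equivFunOnFinite.symm ![e 0, k * e 1 + l * e 2, A * e 1 + B * e 2]

lemma monoExp_injective {k A l B : ℕ} (h : k * B ≠ l * A) :
    Function.Injective (monoExp k A l B) := by
  intro e f hef
  have h0 : e 0 = f 0 := DFunLike.congr_fun hef 0
  have h1 : k * e 1 + l * e 2 = k * f 1 + l * f 2 := DFunLike.congr_fun hef 1
  have h2 : A * e 1 + B * e 2 = A * f 1 + B * f 2 := DFunLike.congr_fun hef 2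
  zify at h h1 h2
  have h3 : ((k : ℤ) * B - l * A) * (e 1 - f 1) = 0 := by
    linear_combination (B : ℤ) * h1 - l * h2
  have h4 : ((k : ℤ) * B - l * A) * (e 2 - f 2) = 0 := by
    linear_combination (k : ℤ) * h2 - A * h1
  have h5 := (mul_eq_zero.1 h3).resolve_left (sub_ne_zero.2 h)
  have h6 := (mul_eq_zero.1 h4).resolve_left (sub_ne_zero.2 h)
  ext a
  fin_cases a
  · exact h0
  · exact_mod_cast sub_eq_zero.1 h5
  · exact_mod_cast sub_eq_zero.1 h6

lemma aeval_monomial_fin_three {S : Type} [CommRing S] [Algebra ℂ S] (v : Fin 3 → S)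
    (e : Fin 3 →₀ ℕ) (c : ℂ) :
    aeval v (monomial e c) = algebraMap ℂ S c * (v 0 ^ e 0 * v 1 ^ e 1 * v 2 ^ e 2) := by
  rw [aeval_monomial, Finsupp.prod_fintype _ _ (by simp), Fin.prod_univ_three]

lemma monoHom_monomial (k A l B : ℕ) (e : Fin 3 →₀ ℕ) (c : ℂ) :
    monoHom k A l B (monomial e c) = monomial (monoExp k A l B e) c := by
  have h1 := aeval_monomial_fin_three (X : Fin 3 → MvPolynomial (Fin 3) ℂ) (monoExp k A l B e) c
  rw [aeval_X_left_apply] at h1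
  rw [monoHom, aeval_monomial_fin_three, h1]
  simp [monoExp]
  ring_nf
  simp

lemma coeff_monoHom {k A l B : ℕ} (h : k * B ≠ l * A) (P : MvPolynomial (Fin 3) ℂ)
    (e : Fin 3 →₀ ℕ) : coeff (monoExp k A l B e) (monoHom k A l B P) = coeff e P := by
  classical
  induction P using MvPolynomial.induction_on' with
  | monomial f c =>
    simp [monoHom_monomial, coeff_monomial, (monoExp_injective h).eq_iff]
  | add p q hp hq => rw [map_add, coeff_add, coeff_add, hp, hq]

lemma le_of_X_pow_dvd_monoHom {k A l B n : ℕ} (h : k * B ≠ l * A) {P : MvPolynomial (Fin 3) ℂ}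
    (hP : X 2 ^ n ∣ monoHom k A l B P) {e : Fin 3 →₀ ℕ} (he : e ∈ P.support) :
    n ≤ A * e 1 + B * e 2 := by
  rw [mem_support_iff, ← coeff_monoHom h] at he
  exact le_of_X_pow_dvd hP he

lemma X_pow_dvd_of_forall_le {d : ℕ} {P : MvPolynomial (Fin 3) ℂ}
    (hP : ∀ e ∈ P.support, d ≤ e 1 + e 2) {v : Fin 3 → MvPolynomial (Fin 3) ℂ}
    (h1 : X 2 ∣ v 1) (h2 : X 2 ∣ v 2) : X 2 ^ d ∣ aeval v P := by
  rw [P.as_sum, map_sum]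
  refine Finset.dvd_sum fun e he => ?_
  rw [aeval_monomial_fin_three]
  refine Dvd.dvd.mul_left ?_ _
  rw [mul_assoc]
  refine Dvd.dvd.mul_left ?_ _
  refine (pow_dvd_pow _ (hP e he)).trans ?_
  rw [pow_add]
  exact mul_dvd_mul (pow_dvd_pow_of_dvd h1 _) (pow_dvd_pow_of_dvd h2 _)

lemma toricHom_injective {M : Matrix (Fin 2) (Fin 2) ℂ} (hM : M.det ≠ 0) {k A l B : ℕ}
    (h : k * B ≠ l * A) : Function.Injective (toricHom M k A l B) := by
  refine (injective_iff_map_eq_zero _).2 fun p hp => ?_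
  have h1 : linHom M p = 0 := by
    by_contra h0
    obtain ⟨e, he⟩ := support_nonempty.2 h0
    have := le_of_X_pow_dvd_monoHom (n := A * e 1 + B * e 2 + 1) h
      ((show monoHom k A l B (linHom M p) = 0 from hp) ▸ dvd_zero _) he
    omega
  rw [← linInvHom_linHom hM p, h1, map_zero]

/-- The quasi-monomial valuation with weights at most `N` is at most `N` times the multiplicity
along the curve. -/
lemma X_pow_dvd_toricHom {M M' : Matrix (Fin 2) (Fin 2) ℂ} (hM : M.det ≠ 0) {k A l B n d N : ℕ}
    (h : k * B ≠ l * A) (hA : A ≤ N) (hB : B ≤ N) (hd : ∀ m, n ≤ N * m → d ≤ m)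
    {k' A' l' B' : ℕ} (hA' : 1 ≤ A') (hB' : 1 ≤ B')
    {P : MvPolynomial (Fin 3) ℂ} (hP : X 2 ^ n ∣ toricHom M k A l B P) :
    X 2 ^ d ∣ toricHom M' k' A' l' B' P := by
  have h1 : ∀ e ∈ (linHom M P).support, d ≤ e 1 + e 2 := fun e he => hd _ <| by
    have h2 := le_of_X_pow_dvd_monoHom h hP he
    nlinarith
  have h3 : ∃ v : Fin 3 → MvPolynomial (Fin 3) ℂ, X 2 ∣ v 1 ∧ X 2 ∣ v 2 ∧
      ((toricHom M' k' A' l' B').comp (linInvHom M)) = aeval v := by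
    refine ⟨fun l => toricHom M' k' A' l' B' (linInvHom M (X l)), ?_, ?_, ?_⟩
    rotate_left 2
    · exact algHom_ext fun l => by simp
    all_goals
      have hX1 : (X 2 : MvPolynomial (Fin 3) ℂ) ∣ X 1 ^ k' * X 2 ^ A' :=
        (dvd_pow_self _ (by omega)).mul_left _
      have hX2 : (X 2 : MvPolynomial (Fin 3) ℂ) ∣ X 1 ^ l' * X 2 ^ B' :=
        (dvd_pow_self _ (by omega)).mul_left _
      simp [toricHom, linInvHom, linHom, monoHom, algHom_C, algebraMap_eq]
      refine dvd_add (Dvd.dvd.mul_left ?_ _) (Dvd.dvd.mul_left ?_ _) <;>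
        exact dvd_add (Dvd.dvd.mul_left hX1 _) (Dvd.dvd.mul_left hX2 _)
  obtain ⟨v, hv1, hv2, hv⟩ := h3
  have h4 := X_pow_dvd_of_forall_le h1 hv1 hv2
  rw [← hv, AlgHom.comp_apply, linInvHom_linHom hM] at h4
  exact h4

end Monomial

instance isPrime_span_X : (Ideal.span {(MvPolynomial.X 2 : MvPolynomial (Fin 3) ℂ)}).IsPrime :=
  (Ideal.span_singleton_prime (MvPolynomial.X_ne_zero 2)).2 (MvPolynomial.X_prime)

/-- The local ring of affine space along a coordinate plane. -/
abbrev toricDVR : Type :=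
  Localization.AtPrime (Ideal.span {(MvPolynomial.X 2 : MvPolynomial (Fin 3) ℂ)})

namespace toricDVR

lemma algebraMap_injective : Function.Injective (algebraMap (MvPolynomial (Fin 3) ℂ) toricDVR) :=
  IsLocalization.injective _ (Ideal.span {MvPolynomial.X 2}).primeCompl_le_nonZeroDivisors

instance : IsDomain toricDVR :=
  IsLocalization.isDomain_localization (Ideal.span {MvPolynomial.X 2}).primeCompl_le_nonZeroDivisors

instance : IsDiscreteValuationRing toricDVR :=
  (isDiscreteValuationRing_localization MvPolynomial.X_prime isPrime_span_X).1

lemma irreducible_X :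
    Irreducible (algebraMap (MvPolynomial (Fin 3) ℂ) toricDVR (MvPolynomial.X 2)) :=
  (isDiscreteValuationRing_localization MvPolynomial.X_prime isPrime_span_X).2

lemma isUnit_algebraMap_iff {p : MvPolynomial (Fin 3) ℂ} :
    IsUnit (algebraMap (MvPolynomial (Fin 3) ℂ) toricDVR p) ↔ ¬ MvPolynomial.X 2 ∣ p := by
  rw [← Ideal.mem_span_singleton]
  exact IsLocalization.AtPrime.isUnit_to_map_iff toricDVR (Ideal.span {MvPolynomial.X 2}) p

lemma isLocalCoords : IsLocalCoords (algebraMap (MvPolynomial (Fin 3) ℂ) toricDVR) := by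
  refine ⟨algebraMap_injective, fun z => ?_⟩
  obtain ⟨⟨a, d⟩, h⟩ := IsLocalization.surj
    (M := (Ideal.span {(MvPolynomial.X 2 : MvPolynomial (Fin 3) ℂ)}).primeCompl) z
  exact ⟨a, d, IsLocalization.map_units _ d, h⟩

lemma exists_eq_X_pow_mul_iff {p : MvPolynomial (Fin 3) ℂ} {n : ℕ} :
    (∃ r, algebraMap (MvPolynomial (Fin 3) ℂ) toricDVR p =
      algebraMap (MvPolynomial (Fin 3) ℂ) toricDVR (MvPolynomial.X 2) ^ n * r) ↔
      MvPolynomial.X 2 ^ n ∣ p := by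
  constructor
  · rintro ⟨r, hr⟩
    obtain ⟨a, d, hd, h⟩ := isLocalCoords.surj r
    have h1 : p * d = MvPolynomial.X 2 ^ n * a := algebraMap_injective (by
      rw [map_mul, hr, map_mul, map_pow, mul_assoc, h])
    exact MvPolynomial.X_prime.pow_dvd_of_dvd_mul_right n (isUnit_algebraMap_iff.1 hd) ⟨a, h1⟩
  · rintro ⟨a, rfl⟩
    exact ⟨algebraMap _ _ a, by rw [map_mul, map_pow]⟩

lemma isUnit_X_one : IsUnit (algebraMap (MvPolynomial (Fin 3) ℂ) toricDVR (MvPolynomial.X 1)) :=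
  isUnit_algebraMap_iff.2 (by simp [MvPolynomial.X_dvd_X])

end toricDVR

end

section

variable {B B' : CommRingCat.{0}}

/-! ### Divisors given by monomial valuations -/

lemma mem_idealEq_of_normalized {R : Type} [CommRing R] {β : HomCoord → R}
    (h : Chart.c000.Normalized β) : β (.inl 1) - β (.inr (.inr 1)) ∈ idealEq β := by
  have h1 : β (.inl 0) = 1 := h.i
  have h2 : β (.inr (.inr 0)) = 1 := h.k
  refine Ideal.subset_span (.inr (.inl ?_))
  rw [h1, h2]
  ring

/-- The ideal of the curve `C` in the chart. -/
lemma idealEq_of_normalized {R : Type} [CommRing R] {β : HomCoord → R}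
    (h : Chart.c000.Normalized β) (hβ : formX β = 0) : idealEq β =
      Ideal.span {β (.inl 1) - β (.inr (.inl 1)), β (.inl 1) - β (.inr (.inr 1))} := by
  have h1 : β (.inl 0) = 1 := h.i
  have h2 : β (.inr (.inr 0)) = 1 := h.k
  have h3 : β (.inr (.inl 0)) = 1 := h.j
  have h4 : β (.inr (.inr 2)) = (β (.inl 1) + β (.inr (.inl 1))) * β (.inr (.inr 1)) -
      β (.inl 1) * β (.inr (.inl 1)) := by
    rw [formX, h1, h2, h3] at hβ
    linear_combination hβ
  rw [idealEq, h1, h2, h3, h4]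
  generalize β (.inl 1) = t
  generalize β (.inr (.inl 1)) = s
  generalize β (.inr (.inr 1)) = q
  apply le_antisymm <;> rw [Ideal.span_le]
  · rintro x (rfl | rfl | rfl | rfl) <;> refine Ideal.mem_span_pair.2 ?_
    · exact ⟨0, -s, by ring⟩
    · exact ⟨0, 1, by ring⟩
    · exact ⟨t, -t, by ring⟩
    · exact ⟨-1, 1, by ring⟩
  · have e1 : t * 1 - 1 * q ∈ Ideal.span {1 * ((t + s) * q - t * s) - t * q, t * 1 - 1 * q,
        1 * ((t + s) * q - t * s) - s * q, s * 1 - 1 * q} := Ideal.subset_span (.inr (.inl rfl))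
    have e2 : s * 1 - 1 * q ∈ Ideal.span {1 * ((t + s) * q - t * s) - t * q, t * 1 - 1 * q,
        1 * ((t + s) * q - t * s) - s * q, s * 1 - 1 * q} :=
      Ideal.subset_span (.inr (.inr (.inr rfl)))
    rintro x (rfl | rfl)
    · have := sub_mem e1 e2
      rwa [show t * 1 - 1 * q - (s * 1 - 1 * q) = t - s by ring] at this
    · exact (show t * 1 - 1 * q = t - q by ring) ▸ e1

section

variable {X : Scheme.{0}} [X.Over SpecC] [IsIntegral X] [IsLocallyNoetherian X] {i : X ⟶ PPP}
  [i.IsOver SpecC] [IsClosedImmersion i] {Z : Scheme.{0}} [Z.Over SpecC] {η : Z ⟶ X}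
  [η.IsOver SpecC] [IsIntegral Z]

/-- A birational point with values in a local domain dominates the local ring of its centre. -/
lemma FieldCoords.exists_dominated (F : FieldCoords i η) (hX : i.ker = idealX) [IsLocalRing B]
    [IsDomain B]
    {κ : Chart} {al : MvPolynomial (Fin 3) ℂ →+* B} (hal : Function.Injective al)
    {v : Spec B ⟶ Z}
    (hv : (v ≫ η) ≫ X ↘ SpecC = Spec.map (CommRingCat.ofHom (al.comp MvPolynomial.C)))
    (hv' : (PPPcoords.comp i).HasTuple (v ≫ η) (κ.tuple fun l => al (MvPolynomial.X l))) {Q : Z}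
    (hQ : v (IsLocalRing.closedPoint B) = Q) :
    ∃ β, (PPPcoords.comp i).HasTuple (Z.fromSpecStalk Q ≫ η) β ∧ κ.Normalized β ∧
      ∃ φ : Z.presheaf.stalk Q ⟶ B, IsLocalHom φ.hom ∧ Function.Injective φ.hom ∧
        Spec.map φ ≫ Z.fromSpecStalk Q = v ∧
        ∀ p, φ.hom (κ.hom (stalkConst Z Q).hom β p) = al p := by
  obtain ⟨φ, hloc, hφ⟩ := exists_stalk_hom v hQ
  obtain ⟨β, hβ⟩ := Coords.HasTuple.exists_of_isLocalRing (PPPcoords.comp i)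
    (Z.fromSpecStalk Q ≫ η)
  have hφ' : Spec.map φ ≫ Z.fromSpecStalk Q ≫ η = v ≫ η := by rw [← hφ, Category.assoc]
  have hun : κ.Units β := .of_isLocalHom hβ φ hφ' hv' (κ.normalized_tuple _).units
  have hβ' := hun.hasTuple_normalize hβ
  have hcomp := κ.map_hom_eq (c := PPPcoords.comp i) (fromSpecStalk_comp_over Q) hβ' hun.normalized
    hv hv' φ hφ'
  refine ⟨_, hβ', hun.normalized, φ, hloc, ?_, hφ, hcomp⟩
  refine (injective_iff_map_eq_zero _).2 fun z hz => ?_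
  obtain ⟨p, d, hd, h⟩ := (isLocalCoords_toLL κ hX).surj (F.θ.symm ((toFunctionField Z Q).hom z))
  have h1 : z * κ.hom (stalkConst Z Q).hom (κ.normalize β) d =
      κ.hom (stalkConst Z Q).hom (κ.normalize β) p := by
    refine toFunctionField_injective Z Q ?_
    rw [map_mul, F.toFunctionField_hom hβ' hun.normalized, F.toFunctionField_hom hβ' hun.normalized,
      ← h, map_mul, RingEquiv.apply_symm_apply]
  have h2 := congrArg φ.hom h1
  rw [map_mul, hz, zero_mul, hcomp] at h2
  have h3 : p = 0 := hal (h2.symm.trans (map_zero al).symm)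
  rw [h3, map_zero] at h
  have h4 := (mul_eq_zero.1 h).resolve_right hd.ne_zero
  rw [map_eq_zero_iff _ F.θ.symm.injective] at h4
  exact toFunctionField_injective Z Q (h4.trans (map_zero _).symm)

lemma FieldCoords.pullbackIdeal_ne_bot (F : FieldCoords i η) (P : Z) :
    pullbackIdeal (idealC i) (Z.fromSpecStalk P ≫ η) ≠ ⊥ := by
  refine pullbackIdeal_ne_bot_of_comp (φ := toFunctionField Z P)
    ((Category.assoc _ _ _).symm.trans (congrArg (· ≫ η) (map_toFunctionField Z P))) ?_
  rw [pullbackIdeal_idealC (B := Z.functionField) F.tuple]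
  intro h
  have h1 : F.θ (genCoord 0 - genCoord 2) ∈ (⊥ : Ideal Z.functionField) := by
    rw [← h]
    have h2 := mem_idealEq_of_normalized ((Chart.c000.normalized_tuple genCoord).map F.θ.toRingHom)
    rw [map_sub]
    have e1 : F.θ (genTuple (.inl 1)) = F.θ (genCoord 0) := by rw [genTuple_eq]; rfl
    have e2 : F.θ (genTuple (.inr (.inr 1))) = F.θ (genCoord 2) := by rw [genTuple_eq]; rfl
    rw [← e1, ← e2]
    exact h2
  rw [Ideal.mem_bot, map_eq_zero_iff _ F.θ.injective, sub_eq_zero] at h1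
  exact genCoord_ne (p := MvPolynomial.X 0) (q := MvPolynomial.X 2) ![0, 0, 1] (by simp) h1

/-- A birational point of the threefold with values in a principal ideal domain lifts to every
model. -/
lemma IsModel.exists_lift_point (hη : IsModel i η) (hX : i.ker = idealX) [IsLocalRing B]
    [IsDomain B] [IsPrincipalIdealRing B] {al : MvPolynomial (Fin 3) ℂ →+* B}
    (hal : Function.Injective al) :
    ∃ v : Spec B ⟶ Z,
      (v ≫ η) ≫ X ↘ SpecC = Spec.map (CommRingCat.ofHom (al.comp MvPolynomial.C)) ∧
      (PPPcoords.comp i).HasTuple (v ≫ η) (Chart.c000.tuple fun l => al (MvPolynomial.X l)) ∧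
      pullbackIdeal (idealC i) (v ≫ η) =
        Ideal.span {al (MvPolynomial.X 0 - MvPolynomial.X 1),
          al (MvPolynomial.X 0 - MvPolynomial.X 2)} := by
  obtain ⟨u, hu, hu'⟩ := Chart.c000.exists_point (i := i) hX al
  have h1 : pullbackIdeal (idealC i) u = Ideal.span {al (MvPolynomial.X 0 - MvPolynomial.X 1),
      al (MvPolynomial.X 0 - MvPolynomial.X 2)} := by
    rw [pullbackIdeal_idealC hu',
      idealEq_of_normalized (Chart.c000.normalized_tuple _) (Chart.c000.formX_tuple _)]
    simp [Chart.tuple, Chart.c000]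
  have h2 : pullbackIdeal (idealC i) u ≠ ⊥ := by
    rw [h1]
    intro h
    have h3 : al (MvPolynomial.X 0 - MvPolynomial.X 1) ∈ (⊥ : Ideal B) :=
      h ▸ Ideal.subset_span (.inl rfl)
    have h4 : (MvPolynomial.X 0 - MvPolynomial.X 1 : MvPolynomial (Fin 3) ℂ) = 0 :=
      hal (((Ideal.mem_bot).1 h3).trans (map_zero al).symm)
    have h5 := congrArg (MvPolynomial.eval ![0, 1, 0]) h4
    simp at h5
  obtain ⟨v, rfl⟩ := hη.exists_lift B u h2
  exact ⟨v, hu, hu', h1⟩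

end

/-- The local ring at `Q` is identified with the local ring of a coordinate plane by the
substitution `δ`. -/
structure IsToricPoint {X : Scheme.{0}} [X.Over SpecC] (i : X ⟶ PPP) {Z : Scheme.{0}}
    [Z.Over SpecC] (η : Z ⟶ X)
    (δ : MvPolynomial (Fin 3) ℂ →ₐ[ℂ] MvPolynomial (Fin 3) ℂ) (Q : Z) : Prop where
  exists_equiv : ∃ β, (PPPcoords.comp i).HasTuple (Z.fromSpecStalk Q ≫ η) β ∧
    Chart.c000.Normalized β ∧ ∃ φ : Z.presheaf.stalk Q ≃+* toricDVR,
      ∀ p, φ (Chart.c000.hom (stalkConst Z Q).hom β p) = algebraMap _ _ (δ p)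

end

section

variable {B B' : CommRingCat.{0}}

/-! ### Orders and log discrepancies at toric points -/

/-- The sections of `-m K_X` whose image under the substitution `δ` is divisible by `u ^ k`. -/
def toricSections (δ : MvPolynomial (Fin 3) ℂ →ₐ[ℂ] MvPolynomial (Fin 3) ℂ) (m k : ℕ) : Set LL :=
  {g | g ∈ antiCanSections m ∧ ∃ P, g = Chart.c000.toLL P ∧ MvPolynomial.X 2 ^ k ∣ δ P}

lemma tauLL_c000 : tauLL 0 = 1 := by
  rw [tauLL, genTuple_eq]
  simp [chart, Chart.c000, Chart.tau]

lemma exists_eq_toLL_c000 {m : ℕ} {g : LL} (hg : g ∈ antiCanSections m) :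
    ∃ P, g = Chart.c000.toLL P := by
  obtain ⟨P, hP⟩ := hg 0
  rw [tauLL_c000, one_pow, mul_one] at hP
  exact ⟨P, hP⟩

section

variable {X : Scheme.{0}} [X.Over SpecC] [IsIntegral X] [IsLocallyNoetherian X] {i : X ⟶ PPP}
  [i.IsOver SpecC] [IsClosedImmersion i] {Z : Scheme.{0}} [Z.Over SpecC] {η : Z ⟶ X}
  [η.IsOver SpecC] [IsIntegral Z]

lemma IsToricPoint.of_dominated {δ : MvPolynomial (Fin 3) ℂ →ₐ[ℂ] MvPolynomial (Fin 3) ℂ} {Q : Z}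
    {β : HomCoord → Z.presheaf.stalk Q}
    (hβ : (PPPcoords.comp i).HasTuple (Z.fromSpecStalk Q ≫ η) β) (hn : Chart.c000.Normalized β)
    (φ : Z.presheaf.stalk Q ⟶ CommRingCat.of toricDVR) (hloc : IsLocalHom φ.hom)
    (hinj : Function.Injective φ.hom)
    (hφ : ∀ p, φ.hom (Chart.c000.hom (stalkConst Z Q).hom β p) = algebraMap (MvPolynomial (Fin 3) ℂ) toricDVR (δ p))
    (hX : ∀ l, ∃ z, φ.hom z = algebraMap (MvPolynomial (Fin 3) ℂ) toricDVR (MvPolynomial.X l)) :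
    IsToricPoint i η δ Q := by
  have h1 : ∀ p, ∃ z, φ.hom z = algebraMap (MvPolynomial (Fin 3) ℂ) toricDVR p := fun p => by
    induction p using MvPolynomial.induction_on with
    | C a =>
      refine ⟨_, (hφ (MvPolynomial.C a)).trans ?_⟩
      rw [MvPolynomial.algHom_C, MvPolynomial.algebraMap_eq]
    | add p q hp hq =>
      obtain ⟨z, hz⟩ := hp
      obtain ⟨w, hw⟩ := hq
      exact ⟨z + w, by rw [map_add, map_add, hz, hw]⟩
    | mul_X p n hp =>
      obtain ⟨z, hz⟩ := hp
      obtain ⟨w, hw⟩ := hX n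
      exact ⟨z * w, by rw [map_mul, map_mul, hz, hw]⟩
  have hsurj : Function.Surjective φ.hom := fun y => by
    obtain ⟨p, d, hd, h⟩ := toricDVR.isLocalCoords.surj y
    obtain ⟨z, hz⟩ := h1 p
    obtain ⟨w, hw⟩ := h1 d
    have hu : IsUnit w := hloc.map_nonunit _ (hw ▸ hd)
    obtain ⟨w', hw'⟩ := hu.exists_right_inv
    refine ⟨z * w', ?_⟩
    have h2 : algebraMap (MvPolynomial (Fin 3) ℂ) toricDVR d * φ.hom w' = 1 := by rw [← hw, ← map_mul, hw', map_one]
    rw [map_mul, hz, ← h, mul_assoc, h2, mul_one]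
  exact ⟨β, hβ, hn, RingEquiv.ofBijective φ.hom ⟨hinj, hsurj⟩, hφ⟩

namespace IsToricPoint

variable {δ : MvPolynomial (Fin 3) ℂ →ₐ[ℂ] MvPolynomial (Fin 3) ℂ} {Q : Z}
  (F : FieldCoords i η)

lemma isDiscreteValuationRing (hQ : IsToricPoint i η δ Q) :
    IsDiscreteValuationRing (Z.presheaf.stalk Q) := by
  obtain ⟨β, -, -, φ, -⟩ := hQ
  exact IsDiscreteValuationRing.RingEquivClass.isDiscreteValuationRing φ.symm

variable [IsLocallyNoetherian Z]

lemma le_ord_iff (hQ : IsToricPoint i η δ Q) {P : MvPolynomial (Fin 3) ℂ} (hP : Chart.c000.toLL P ≠ 0) (n : ℕ) :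
    (n : ℤ) ≤ Scheme.ord (F.θ (Chart.c000.toLL P)) Q ↔ MvPolynomial.X 2 ^ n ∣ δ P := by
  have hdvr := hQ.isDiscreteValuationRing
  obtain ⟨β, hβ, hn, φ, hφ⟩ := hQ
  have hϖ : Irreducible (φ.symm (algebraMap (MvPolynomial (Fin 3) ℂ) toricDVR (MvPolynomial.X 2))) :=
    (MulEquiv.irreducible_iff φ.symm).2 toricDVR.irreducible_X
  rw [le_ord_iff_of_isDiscreteValuationRing hdvr hϖ ((map_ne_zero_iff _ F.θ.injective).2 hP),
    ← F.toFunctionField_hom hβ hn, ← toricDVR.exists_eq_X_pow_mul_iff]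
  constructor
  · rintro ⟨r, hr⟩
    refine ⟨φ r, ?_⟩
    have h1 := congrArg φ (toFunctionField_injective Z Q hr)
    rwa [hφ, map_mul, map_pow, RingEquiv.apply_symm_apply] at h1
  · rintro ⟨r, hr⟩
    refine ⟨φ.symm r, congrArg _ (φ.injective ?_)⟩
    rw [hφ, hr, map_mul, map_pow, RingEquiv.apply_symm_apply, RingEquiv.apply_symm_apply]

lemma sections_eq (hQ : IsToricPoint i η δ Q) (hX : i.ker = idealX) (hη : IsModel i η) (m : ℕ) {x : ℝ} (hx : 0 ≤ x) :
    F.sections m (x • primeDiv Q) = toricSections δ m ⌈m * x⌉₊ := by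
  have hE : ∀ P : Z, 0 ≤ (x • primeDiv Q) P := fun P =>
    mul_nonneg hx (Set.indicator_nonneg (fun _ _ => zero_le_one) _)
  have hEQ : (x • primeDiv Q) Q = x := by simp [primeDiv]
  have hEP : ∀ P : Z, P ≠ Q → (x • primeDiv Q) P = 0 := fun P hP => by simp [primeDiv, hP]
  have hcast : ∀ n : ℤ, (m : ℝ) * x ≤ n ↔ ((⌈m * x⌉₊ : ℕ) : ℤ) ≤ n := fun n => by
    rw [Int.natCast_ceil_eq_ceil (mul_nonneg (Nat.cast_nonneg m) hx), Int.ceil_le]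
  ext g
  constructor
  · intro hg
    have h1 := F.mem_antiCanSections hX hη hE hg
    obtain ⟨P, rfl⟩ := exists_eq_toLL_c000 h1
    refine ⟨h1, P, rfl, ?_⟩
    by_cases h0 : Chart.c000.toLL P = 0
    · rw [← map_zero Chart.c000.toLL] at h0
      rw [(isLocalCoords_toLL Chart.c000 hX).inj h0, map_zero]
      exact dvd_zero _
    rw [← hQ.le_ord_iff F h0, ← hcast]
    obtain ⟨β, hβ, hn, -⟩ := hQ.exists_equiv
    have h2 := hg h0 Q (coheight_eq_one hQ.isDiscreteValuationRing) 0 β hβ hn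
    rwa [hEQ, tauLL_c000, one_pow, mul_one] at h2
  · rintro ⟨h1, P, rfl, hP⟩ h0 R hR a β hβ hn
    by_cases hRQ : R = Q
    · subst hRQ
      rw [← hQ.le_ord_iff F h0, ← hcast] at hP
      obtain ⟨β', hβ', hn', -⟩ := hQ.exists_equiv
      have h2 := F.canonicalCoeff_smul_form hX hβ hn (k := 1) one_ne_zero
      rw [F.canonicalCoeff_smul_form hX (a := 0) hβ' hn' one_ne_zero, tauLL_c000, map_one,
        ord_one'] at h2
      have h3 : Scheme.ord (F.θ (tauLL a)) R = 0 := by linarith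
      rw [hEQ, map_mul, Scheme.ord_mul ((map_ne_zero_iff _ F.θ.injective).2 h0) (by
        rw [map_pow]; exact pow_ne_zero m (F.θ_tauLL_ne_zero a)), map_pow,
        ord_pow' R (F.θ_tauLL_ne_zero a), h3, mul_zero, add_zero]
      exact hP
    · rw [hEP R hRQ, mul_zero]
      exact_mod_cast F.ord_nonneg_of_mem_antiCanSections h1 h0 hβ hn

lemma h0_eq (hQ : IsToricPoint i η δ Q) (hX : i.ker = idealX) (hη : IsModel i η) (m : ℕ) {x : ℝ} (hx : 0 ≤ x) :
    h0 Z (fun P => (m : ℝ) * (antiCan η - x • primeDiv Q) P) =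
      Set.finrank ℂ (toricSections δ m ⌈m * x⌉₊) := by
  obtain ⟨F⟩ := hη.nonempty_fieldCoords hX
  rw [F.h0_eq hX, hQ.sections_eq F hX hη m hx]

end IsToricPoint

end

end

section

variable {B B' : CommRingCat.{0}}

/-! ### Log discrepancies of toric points -/

lemma toLL_c000_X (l : Fin 3) : Chart.c000.toLL (MvPolynomial.X l) = genCoord l := by
  rw [coord_toLL, Chart.coord, genTuple_eq]
  fin_cases l <;> simp [Chart.c000, Chart.normalize, scaleTuple]

section Jacobian

variable {K : Type} [Field K] [Algebra ℂ K]

lemma Grad.monomial (c : Fin 3 → K) (k A : ℕ) : Grad c (c 1 ^ k * c 2 ^ A)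
    ![0, k * c 1 ^ (k - 1) * c 2 ^ A, c 1 ^ k * (A * c 2 ^ (A - 1))] := by
  refine (((Grad.var 1).pow k).mul ((Grad.var 2).pow A)).congr rfl ?_
  funext j
  fin_cases j <;> simp
  ring

lemma natCast_mul_pow_sub_one_mul (x : K) (n : ℕ) : (n : K) * x ^ (n - 1) * x = n * x ^ n := by
  cases n with
  | zero => simp
  | succ n => rw [Nat.add_sub_cancel, mul_assoc, ← pow_succ]

lemma Grad.sub_linear {c : Fin 3 → K} {t W P : K} {W₁ W₂ P₁ P₂ : K} (m n : ℂ)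
    (gt : Grad c t ![1, 0, 0]) (gW : Grad c W ![0, W₁, W₂]) (gP : Grad c P ![0, P₁, P₂]) :
    Grad c (t - (algebraMap ℂ K m * W + algebraMap ℂ K n * P))
      ![1, -(algebraMap ℂ K m * W₁ + algebraMap ℂ K n * P₁),
        -(algebraMap ℂ K m * W₂ + algebraMap ℂ K n * P₂)] := by
  refine (gt.sub (((Grad.const m).mul gW).add ((Grad.const n).mul gP))).congr rfl ?_
  funext j
  fin_cases j <;> simp [-algebraMap_smul]

lemma wedgeD_of_grad_cons {c : Fin 3 → K} {f₀ f₁ f₂ x y z w : K} (h₀ : Grad c f₀ ![1, 0, 0])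
    (h₁ : Grad c f₁ ![1, x, y]) (h₂ : Grad c f₂ ![1, z, w]) :
    wedgeD ![f₀, f₁, f₂] = (x * w - y * z) • wedgeD c := by
  rw [wedgeD_of_grad (c := ![f₀, f₁, f₂]) (A := Matrix.of ![![1, 0, 0], ![1, x, y], ![1, z, w]])
    (x := c) (fun l => by fin_cases l; exacts [h₀, h₁, h₂])]
  congr 1
  simp [Matrix.det_fin_three]

/-- The Jacobian of a toric substitution. -/
lemma exists_wedgeD_toric (M : Matrix (Fin 2) (Fin 2) ℂ) (k A l B : ℕ) (c : Fin 3 → K) :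
    ∃ J : K, wedgeD ![c 0, c 0 - (algebraMap ℂ K (M 0 0) * (c 1 ^ k * c 2 ^ A) +
          algebraMap ℂ K (M 0 1) * (c 1 ^ l * c 2 ^ B)),
        c 0 - (algebraMap ℂ K (M 1 0) * (c 1 ^ k * c 2 ^ A) +
          algebraMap ℂ K (M 1 1) * (c 1 ^ l * c 2 ^ B))] = J • wedgeD c ∧ J * (c 1 * c 2) =
      algebraMap ℂ K (M.det * (k * B - l * A)) * (c 1 ^ k * c 2 ^ A * (c 1 ^ l * c 2 ^ B)) := by
  have g0 : Grad c (c 0) ![1, 0, 0] := (Grad.var 0).congr rfl (by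
    funext j; fin_cases j <;> simp)
  have gW := Grad.monomial c k A
  have gP := Grad.monomial c l B
  have g1 := Grad.sub_linear (M 0 0) (M 0 1) g0 gW gP
  have g2 := Grad.sub_linear (M 1 0) (M 1 1) g0 gW gP
  refine ⟨_, wedgeD_of_grad_cons g0 g1 g2, ?_⟩
  rw [Matrix.det_fin_two]
  simp only [map_mul, map_sub, map_natCast]
  generalize algebraMap ℂ K (M 0 0) = m
  generalize algebraMap ℂ K (M 0 1) = n
  generalize algebraMap ℂ K (M 1 0) = m'
  generalize algebraMap ℂ K (M 1 1) = n'
  linear_combination ((m * n' - n * m') * c 2 ^ A * c 1 ^ l * (B * c 2 ^ (B - 1) * c 2)) *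
      natCast_mul_pow_sub_one_mul (c 1) k +
    ((m * n' - n * m') * c 2 ^ A * c 1 ^ l * (k * c 1 ^ k)) *
      natCast_mul_pow_sub_one_mul (c 2) B -
    ((m * n' - n * m') * c 2 ^ B * c 1 ^ k * (A * c 2 ^ (A - 1) * c 2)) *
      natCast_mul_pow_sub_one_mul (c 1) l -
    ((m * n' - n * m') * c 2 ^ B * c 1 ^ k * (l * c 1 ^ l)) *
      natCast_mul_pow_sub_one_mul (c 2) A

end Jacobian

section

variable {X : Scheme.{0}} [X.Over SpecC] [IsIntegral X] [IsLocallyNoetherian X] {i : X ⟶ PPP}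
  [i.IsOver SpecC] [IsClosedImmersion i] {Z : Scheme.{0}} [Z.Over SpecC] {η : Z ⟶ X}
  [η.IsOver SpecC] [IsIntegral Z] [IsLocallyNoetherian Z]

lemma ord_algebraMap {a : ℂ} (ha : a ≠ 0) (P : Z) :
    Scheme.ord (algebraMap ℂ Z.functionField a) P = 0 := by
  have h : (toFunctionField Z P).hom ((stalkConst Z P).hom a) = algebraMap ℂ Z.functionField a :=
    (stalkConst_map (map_toFunctionField Z P) a).trans (stalkConst_genericPoint Z a)
  rw [← h]
  exact ord_toFunctionField_of_isUnit P (ha.isUnit.map (stalkConst Z P).hom)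

lemma IsToricPoint.logDiscrepancy_eq {M : Matrix (Fin 2) (Fin 2) ℂ} (hM : M.det ≠ 0)
    {k A l B : ℕ} (h : k * B ≠ l * A) {Q : Z} (hQ : IsToricPoint i η (toricHom M k A l B) Q)
    (hX : i.ker = idealX) (hη : IsModel i η) : logDiscrepancy η Q = A + B := by
  obtain ⟨F⟩ := hη.nonempty_fieldCoords hX
  obtain ⟨f, hf, hω⟩ := F.exists_someForm_eq
  have hdvr := hQ.isDiscreteValuationRing
  obtain ⟨β, hβ, hn, φ, hφ⟩ := hQ
  have h1 : canonicalCoeff η (someForm Z) Q = Scheme.ord f Q := by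
    rw [hω, F.canonicalCoeff_smul_form hX (a := 0) hβ hn hf, tauLL_c000, map_one, ord_one', sub_zero]
  let ι : toricDVR →+* Z.functionField := (toFunctionField Z Q).hom.comp φ.symm.toRingHom
  let c : Fin 3 → Z.functionField := fun l =>
    ι (algebraMap (MvPolynomial (Fin 3) ℂ) toricDVR (MvPolynomial.X l))
  have hι : ∀ p, F.θ (Chart.c000.toLL p) =
      ι (algebraMap (MvPolynomial (Fin 3) ℂ) toricDVR (toricHom M k A l B p)) := fun p => by
    rw [← F.toFunctionField_hom hβ hn, ← hφ]
    exact congrArg (toFunctionField Z Q).hom (φ.symm_apply_apply _).symm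
  have hC : ∀ a, ι (algebraMap (MvPolynomial (Fin 3) ℂ) toricDVR (MvPolynomial.C a)) =
      algebraMap ℂ Z.functionField a := fun a => by
    have h2 := hι (MvPolynomial.C a)
    rw [MvPolynomial.algHom_C, MvPolynomial.algebraMap_eq] at h2
    rw [← h2, ← F.const]
    exact congrArg F.θ (Chart.c000.hom_C _ _ a)
  have hcoord : (fun l => F.θ (genCoord l)) =
      ![c 0, c 0 - (algebraMap ℂ _ (M 0 0) * (c 1 ^ k * c 2 ^ A) +
          algebraMap ℂ _ (M 0 1) * (c 1 ^ l * c 2 ^ B)),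
        c 0 - (algebraMap ℂ _ (M 1 0) * (c 1 ^ k * c 2 ^ A) +
          algebraMap ℂ _ (M 1 1) * (c 1 ^ l * c 2 ^ B))] := by
    funext l
    rw [← toLL_c000_X, hι]
    fin_cases l <;>
      simp [toricHom, linHom, monoHom, c, MvPolynomial.algHom_C, MvPolynomial.algebraMap_eq, hC]
  obtain ⟨J, hJ, hJ'⟩ := exists_wedgeD_toric M k A l B c
  rw [← hcoord] at hJ
  have hιinj : Function.Injective ι := (toFunctionField_injective Z Q).comp φ.symm.injective
  have hc : ∀ l, c l ≠ 0 := fun l h0 => MvPolynomial.X_ne_zero (R := ℂ) l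
    (toricDVR.algebraMap_injective (hιinj (h0.trans ((map_zero _).symm.trans
      (congrArg ι (map_zero _).symm)))))
  have hconst : M.det * (k * B - l * A) ≠ 0 := by
    refine mul_ne_zero hM (sub_ne_zero.2 ?_)
    exact_mod_cast h
  have hJ0 : J ≠ 0 := by
    rintro rfl
    rw [zero_smul] at hJ
    exact F.form_ne_zero hJ
  have ho1 : Scheme.ord (c 1) Q = 0 :=
    ord_toFunctionField_of_isUnit Q (toricDVR.isUnit_X_one.map φ.symm)
  have ho2 : Scheme.ord (c 2) Q = 1 :=
    ord_irreducible hdvr ((MulEquiv.irreducible_iff φ.symm).2 toricDVR.irreducible_X)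
  have hoJ : Scheme.ord J Q = A + B - 1 := by
    have h2 := congrArg (fun x => Scheme.ord x Q) hJ'
    have hpow : ∀ n m : ℕ, Scheme.ord (c 1 ^ n * c 2 ^ m) Q = m := fun n m => by
      rw [Scheme.ord_mul (pow_ne_zero _ (hc 1)) (pow_ne_zero _ (hc 2)), ord_pow' Q (hc 1),
        ord_pow' Q (hc 2), ho1, ho2]
      ring
    have hne : ∀ n m : ℕ, c 1 ^ n * c 2 ^ m ≠ 0 := fun n m =>
      mul_ne_zero (pow_ne_zero _ (hc 1)) (pow_ne_zero _ (hc 2))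
    beta_reduce at h2
    rw [Scheme.ord_mul hJ0 (mul_ne_zero (hc 1) (hc 2)), Scheme.ord_mul (hc 1) (hc 2), ho1, ho2,
      Scheme.ord_mul ((map_ne_zero_iff _ (algebraMap ℂ Z.functionField).injective).2 hconst)
        (mul_ne_zero (hne _ _) (hne _ _)), ord_algebraMap hconst,
      Scheme.ord_mul (hne _ _) (hne _ _), hpow, hpow] at h2
    linarith
  have h3 : canonicalCoeff (𝟙 Z) (someForm Z) Q = Scheme.ord f Q + (A + B - 1) := by
    have h4 : someForm Z = (f * J) • wedgeD c := by
      rw [hω, mul_smul, ← hJ]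
      rfl
    have hst : ∀ z : Z.presheaf.stalk Q, ∃ g : Z.presheaf.stalk ((𝟙 Z : Z ⟶ Z) Q),
        ((𝟙 Z : Z ⟶ Z).stalkMap Q).hom g = z := fun z =>
      (ConcreteCategory.bijective_of_isIso ((𝟙 Z : Z ⟶ Z).stalkMap Q)).2 z
    choose g hg using hst
    rw [h4, canonicalCoeff_eq (𝟙 Z) Q c ?_ (fun l => g (φ.symm (algebraMap (MvPolynomial (Fin 3) ℂ) toricDVR (MvPolynomial.X l))))
      (fun l => ?_) (fun z => ?_) (mul_ne_zero hf hJ0), Scheme.ord_mul hf hJ0, hoJ]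
    · intro h0
      rw [h0, smul_zero] at hJ
      exact F.form_ne_zero hJ
    · rw [hg]
      rfl
    · obtain ⟨a, ha⟩ := toricDVR.isLocalCoords.exists_D_eq ι hC
        (φ (((𝟙 Z : Z ⟶ Z).stalkMap Q).hom z))
      have h5 : ι (φ (((𝟙 Z : Z ⟶ Z).stalkMap Q).hom z)) =
          (toFunctionField Z Q).hom (((𝟙 Z : Z ⟶ Z).stalkMap Q).hom z) :=
        congrArg (toFunctionField Z Q).hom (φ.symm_apply_apply _)
      rw [h5] at ha
      exact ⟨fun j => φ.symm (a j), ha⟩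
  rw [logDiscrepancy, h1, h3]
  ring

end

end

section

variable {B B' : CommRingCat.{0}}

/-! ### The exceptional surface over `C` -/

lemma dvd_or_dvd_of_span_pair_eq {R : Type} [CommRing R] [IsDomain R] [IsLocalRing R] {a b s : R}
    (h : Ideal.span {a, b} = Ideal.span {s}) : a ∣ b ∨ b ∣ a := by
  obtain ⟨a', rfl⟩ := Ideal.mem_span_singleton.1 (h ▸ Ideal.subset_span (.inl rfl) : a ∈ Ideal.span {s})
  obtain ⟨b', rfl⟩ := Ideal.mem_span_singleton.1 (h ▸ Ideal.subset_span (.inr rfl) : b ∈ Ideal.span {s})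
  by_cases hs : s = 0
  · simp [hs]
  obtain ⟨x, y, hxy⟩ := Ideal.mem_span_pair.1 (h ▸ Ideal.mem_span_singleton_self s)
  have h1 : x * a' + y * b' = 1 := mul_left_cancel₀ hs (by linear_combination hxy)
  rcases IsLocalRing.isUnit_or_isUnit_of_add_one h1 with h2 | h2
  · exact .inl (mul_dvd_mul_left s ((isUnit_of_mul_isUnit_right h2).dvd))
  · exact .inr (mul_dvd_mul_left s ((isUnit_of_mul_isUnit_right h2).dvd))

section

variable {X : Scheme.{0}} [X.Over SpecC] [IsIntegral X] [IsLocallyNoetherian X] {i : X ⟶ PPP}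
  [i.IsOver SpecC] [IsClosedImmersion i] {Z : Scheme.{0}} [Z.Over SpecC] {η : Z ⟶ X}
  [η.IsOver SpecC] [IsIntegral Z]

lemma eq_of_isGenericPoint [IsLocallyNoetherian Z] {S : Set Z} {ξ Q : Z} (hξ : IsGenericPoint ξ S)
    (hdvr : IsDiscreteValuationRing (Z.presheaf.stalk Q)) (hQ : Q ∈ S) (hS : genericPoint Z ∉ S) :
    ξ = Q :=
  (eq_or_eq_genericPoint hdvr (hξ.specializes hQ)).resolve_right fun h => hS (h ▸ hξ.mem)

/-- The ideal of the curve `C` in the local rings of a model. -/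
lemma Chart.pullbackIdeal_idealC_hom (hX : i.ker = idealX) {P : Z}
    {β : HomCoord → Z.presheaf.stalk P}
    (hβ : (PPPcoords.comp i).HasTuple (Z.fromSpecStalk P ≫ η) β) (hn : Chart.c000.Normalized β) :
    pullbackIdeal (idealC i) (Z.fromSpecStalk P ≫ η) = Ideal.span
      {Chart.c000.hom (stalkConst Z P).hom β (MvPolynomial.X 0 - MvPolynomial.X 1),
        Chart.c000.hom (stalkConst Z P).hom β (MvPolynomial.X 0 - MvPolynomial.X 2)} := by
  rw [pullbackIdeal_idealC hβ, idealEq_of_normalized hn (formX_eq_zero hX hβ), map_sub, map_sub,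
    Chart.hom_X, Chart.hom_X, Chart.hom_X]
  simp [Chart.coord, Chart.c000]

lemma mem_surfaceE_iff {P : Z} : P ∈ surfaceE i η ↔
    pullbackIdeal (idealC i) (Z.fromSpecStalk P ≫ η) ≤
      IsLocalRing.maximalIdeal (Z.presheaf.stalk P) := by
  rw [← pullbackIdeal_comap, ← closedPoint_mem_support_iff, Scheme.fromSpecStalk_closedPoint]
  rfl

lemma FieldCoords.genericPoint_notMem_surfaceE (F : FieldCoords i η) :
    genericPoint Z ∉ surfaceE i η := by
  rw [mem_surfaceE_iff]
  intro h
  refine F.pullbackIdeal_ne_bot _ (le_bot_iff.1 (h.trans_eq ?_))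
  exact IsLocalRing.maximalIdeal_eq_bot (R := Z.functionField)

/-- In the local rings of the blow-up of `C`, one of the two equations of `C` divides the other. -/
lemma IsBlowup.dvd_or_dvd (hX : i.ker = idealX) (hη : IsBlowup η (idealC i)) {P : Z}
    {β : HomCoord → Z.presheaf.stalk P}
    (hβ : (PPPcoords.comp i).HasTuple (Z.fromSpecStalk P ≫ η) β) (hn : Chart.c000.Normalized β) :
    Chart.c000.hom (stalkConst Z P).hom β (MvPolynomial.X 0 - MvPolynomial.X 1) ∣
      Chart.c000.hom (stalkConst Z P).hom β (MvPolynomial.X 0 - MvPolynomial.X 2) ∨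
    Chart.c000.hom (stalkConst Z P).hom β (MvPolynomial.X 0 - MvPolynomial.X 2) ∣
      Chart.c000.hom (stalkConst Z P).hom β (MvPolynomial.X 0 - MvPolynomial.X 1) := by
  obtain ⟨s, hs⟩ := hη.exists_eq_span (Z.fromSpecStalk P)
  rw [Chart.pullbackIdeal_idealC_hom hX hβ hn] at hs
  exact dvd_or_dvd_of_span_pair_eq hs

/-- The substitution defining the multiplicity along `C`. -/
abbrev blowupHom : MvPolynomial (Fin 3) ℂ →ₐ[ℂ] MvPolynomial (Fin 3) ℂ := toricHom 1 0 1 1 1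

lemma blowupHom_sub_one : blowupHom (MvPolynomial.X 0 - MvPolynomial.X 1) = MvPolynomial.X 2 := by
  simp [toricHom, linHom, monoHom]

lemma blowupHom_sub_two : blowupHom (MvPolynomial.X 0 - MvPolynomial.X 2) =
    MvPolynomial.X 1 * MvPolynomial.X 2 := by
  simp [toricHom, linHom, monoHom]

lemma blowupHom_zero : blowupHom (MvPolynomial.X 0) = MvPolynomial.X 0 := by
  simp [toricHom, linHom, monoHom]

lemma blowupHom_injective : Function.Injective blowupHom :=
  toricHom_injective (by simp) (by simp)

lemma IsBlowup.isToricPoint [IsLocallyNoetherian Z] (hX : i.ker = idealX) (hη : IsBlowup η (idealC i)) {ξ : Z}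
    (hξ : IsGenericPoint ξ (surfaceE i η : Set Z)) : IsToricPoint i η blowupHom ξ := by
  obtain ⟨F⟩ := hη.isModel.nonempty_fieldCoords hX
  let al : MvPolynomial (Fin 3) ℂ →+* toricDVR :=
    (algebraMap (MvPolynomial (Fin 3) ℂ) toricDVR).comp blowupHom.toRingHom
  have hal : Function.Injective al := toricDVR.algebraMap_injective.comp blowupHom_injective
  obtain ⟨v, hv, hv', hv''⟩ := hη.isModel.exists_lift_point (B := CommRingCat.of toricDVR) hX hal
  obtain ⟨β, hβ, hn, φ, hloc, hinj, hφv, hφ⟩ := F.exists_dominated (B := CommRingCat.of toricDVR) hX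
    hal hv hv' rfl
  have e1 : φ.hom (Chart.c000.hom (stalkConst Z _).hom β (MvPolynomial.X 0 - MvPolynomial.X 1)) =
      algebraMap (MvPolynomial (Fin 3) ℂ) toricDVR (MvPolynomial.X 2) :=
    (hφ _).trans (congrArg (algebraMap _ toricDVR) blowupHom_sub_one)
  have e2 : φ.hom (Chart.c000.hom (stalkConst Z _).hom β (MvPolynomial.X 0 - MvPolynomial.X 2)) =
      algebraMap (MvPolynomial (Fin 3) ℂ) toricDVR (MvPolynomial.X 1 * MvPolynomial.X 2) :=
    (hφ _).trans (congrArg (algebraMap _ toricDVR) blowupHom_sub_two)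
  have e0 : φ.hom (Chart.c000.hom (stalkConst Z _).hom β (MvPolynomial.X 0)) =
      algebraMap (MvPolynomial (Fin 3) ℂ) toricDVR (MvPolynomial.X 0) :=
    (hφ _).trans (congrArg (algebraMap _ toricDVR) blowupHom_zero)
  have hne := toricDVR.irreducible_X.ne_zero
  have h1 : ∃ z, φ.hom z = algebraMap (MvPolynomial (Fin 3) ℂ) toricDVR (MvPolynomial.X 1) := by
    rcases hη.dvd_or_dvd hX hβ hn with ⟨z, hz⟩ | ⟨z, hz⟩
    · refine ⟨z, mul_left_cancel₀ hne ?_⟩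
      rw [hz, map_mul, e1, map_mul] at e2
      rw [e2, mul_comm]
    · rw [hz, map_mul, e2, map_mul] at e1
      have h2 : algebraMap (MvPolynomial (Fin 3) ℂ) toricDVR (MvPolynomial.X 1) * φ.hom z = 1 :=
        mul_left_cancel₀ hne (by linear_combination e1)
      have hz' : IsUnit z := hloc.map_nonunit _ (IsUnit.of_mul_eq_one _ ((mul_comm _ _).trans h2))
      obtain ⟨w, hw⟩ := hz'.exists_right_inv
      have h3 : φ.hom z * φ.hom w = 1 := by rw [← map_mul, hw, map_one]
      exact ⟨w, ((left_inv_eq_right_inv h2 h3).symm)⟩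
  have h2 := IsToricPoint.of_dominated hβ hn φ hloc hinj hφ (fun l => by
    fin_cases l
    exacts [⟨_, e0⟩, h1, ⟨_, e1⟩])
  have h3 := eq_of_isGenericPoint hξ h2.isDiscreteValuationRing ?_ F.genericPoint_notMem_surfaceE
  · exact h3 ▸ h2
  refine (closedPoint_mem_support_iff _ v).2 ?_
  rw [pullbackIdeal_comap, hv'', Ideal.span_le]
  have h4 : algebraMap (MvPolynomial (Fin 3) ℂ) toricDVR (MvPolynomial.X 2) ∈
      IsLocalRing.maximalIdeal toricDVR :=
    (IsLocalRing.mem_maximalIdeal _).2 toricDVR.irreducible_X.not_isUnit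
  rintro x (rfl | rfl)
  · exact (congrArg (algebraMap _ toricDVR) blowupHom_sub_one).symm ▸ h4
  · refine (congrArg (algebraMap (MvPolynomial (Fin 3) ℂ) toricDVR) blowupHom_sub_two).symm ▸ ?_
    rw [map_mul]
    exact Ideal.mul_mem_left _ _ h4

end

end

section

variable {B B' : CommRingCat.{0}}

/-! ### Automorphisms -/

lemma exists_stalk_endomorphism {T : Scheme.{0}} {S : Set T} {c : T} (hc : IsGenericPoint c S)
    (τ : T ≅ T) (hτ : τ.hom ⁻¹' S = S) :
    ∃ ε : T.presheaf.stalk c ⟶ T.presheaf.stalk c, IsLocalHom ε.hom ∧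
      Spec.map ε ≫ T.fromSpecStalk c = T.fromSpecStalk c ≫ τ.hom := by
  have hsurj : Function.Surjective τ.hom := τ.schemeIsoToHomeo.surjective
  have h1 : IsGenericPoint (τ.hom c) S := by
    have h2 := hc.image τ.hom.continuous
    have h3 : τ.hom '' S = S := by
      conv_lhs => rw [← hτ]
      exact Set.image_preimage_eq S hsurj
    rwa [h3, hc.isClosed.closure_eq] at h2
  have h4 : τ.hom c = c := h1.eq hc
  refine exists_stalk_hom _ ?_
  exact (Scheme.Hom.comp_apply _ _ _).trans (by rw [Scheme.fromSpecStalk_closedPoint, h4])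

section

variable {X : Scheme.{0}} [X.Over SpecC] [IsIntegral X] [IsLocallyNoetherian X] {i : X ⟶ PPP}
  [i.IsOver SpecC] [IsClosedImmersion i] {Z : Scheme.{0}} [Z.Over SpecC] {η : Z ⟶ X}
  [η.IsOver SpecC] [IsIntegral Z]

lemma units_of_idealEq_le {R : Type} [CommRing R] [IsLocalRing R] {β : HomCoord → R}
    (hy : ∃ j, IsUnit (β (.inr (.inl j)))) (hz : ∃ j, IsUnit (β (.inr (.inr j))))
    (h : idealEq β ≤ IsLocalRing.maximalIdeal R) :
    (IsUnit (β (.inl 0)) → Chart.c000.Units β) ∧ (IsUnit (β (.inl 1)) → Chart.c112.Units β) := by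
  have h0 : ∀ x, IsUnit (β x) ↔ IsLocalRing.residue R (β x) ≠ 0 := fun x =>
    (IsLocalRing.residue_ne_zero_iff_isUnit _).symm
  have hmem : ∀ z ∈ idealEq β, IsLocalRing.residue R z = 0 := fun z hz =>
    (IsLocalRing.residue_eq_zero_iff z).2 (h hz)
  have e1 := hmem _ (Ideal.subset_span (.inl rfl))
  have e2 := hmem _ (Ideal.subset_span (.inr (.inl rfl)))
  have e3 := hmem _ (Ideal.subset_span (.inr (.inr (.inl rfl))))
  have e4 := hmem _ (Ideal.subset_span (.inr (.inr (.inr rfl))))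
  simp only [map_sub, map_mul] at e1 e2 e3 e4
  simp only [Fin.exists_fin_succ, h0] at hy hz
  have hu : ∀ κ : Chart, κ.Units β ↔ IsLocalRing.residue R (β (.inl κ.i)) ≠ 0 ∧
      IsLocalRing.residue R (β (.inr (.inl κ.j))) ≠ 0 ∧
      IsLocalRing.residue R (β (.inr (.inr κ.k))) ≠ 0 := fun κ =>
    ⟨fun h => ⟨(h0 _).1 h.i, (h0 _).1 h.j, (h0 _).1 h.k⟩,
      fun h => ⟨(h0 _).2 h.1, (h0 _).2 h.2.1, (h0 _).2 h.2.2⟩⟩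
  rw [hu, hu, h0, h0]
  simp only [Chart.c000, Chart.c112]
  simp only [Fin.succ_zero_eq_one, Fin.succ_one_eq_two, IsEmpty.exists_iff, or_false] at hy hz
  generalize IsLocalRing.residue R (β (.inl 0)) = x₀ at *
  generalize IsLocalRing.residue R (β (.inl 1)) = x₁ at *
  generalize IsLocalRing.residue R (β (.inr (.inl 0))) = y₀ at *
  generalize IsLocalRing.residue R (β (.inr (.inl 1))) = y₁ at *
  generalize IsLocalRing.residue R (β (.inr (.inr 0))) = z₀ at *
  generalize IsLocalRing.residue R (β (.inr (.inr 1))) = z₁ at *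
  generalize IsLocalRing.residue R (β (.inr (.inr 2))) = z₂ at *
  constructor
  · intro hx
    have hz0 : z₀ ≠ 0 := by
      rintro rfl
      have h1 : z₁ = 0 := by simpa [hx] using e2
      have h2 : z₂ = 0 := by simpa [hx, h1] using e1
      simp [h1, h2] at hz
    refine ⟨hx, ?_, hz0⟩
    rintro rfl
    have h1 : y₁ = 0 := by simpa [hz0] using e4
    simp [h1] at hy
  · intro hx
    have hz2 : z₂ ≠ 0 := by
      rintro rfl
      have h1 : z₁ = 0 := by simpa [hx] using e1
      have h2 : z₀ = 0 := by simpa [hx, h1] using e2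
      simp [h1, h2] at hz
    refine ⟨hx, ?_, hz2⟩
    rintro rfl
    have h1 : y₀ = 0 := by simpa [hz2] using e3
    simp [h1] at hy

/-- The generic point of an invariant curve in `E` lies in the chart `x₀ y₀ z₀ ≠ 0`, and `x₁` does
not vanish there. -/
lemma IsBlowup.exists_normalized (hX : i.ker = idealX) (hη : IsBlowup η (idealC i)) {S : Set Z}
    (hS : IsAutInvariant η S) {c : Z} (hc : IsGenericPoint c S) (hcE : c ∈ surfaceE i η) :
    ∃ β, (PPPcoords.comp i).HasTuple (Z.fromSpecStalk c ≫ η) β ∧ Chart.c000.Normalized β ∧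
      IsUnit (β (.inl 1)) := by
  obtain ⟨β, hβ⟩ := Coords.HasTuple.exists_of_isLocalRing (PPPcoords.comp i)
    (Z.fromSpecStalk c ≫ η)
  have h1 : idealEq β ≤ IsLocalRing.maximalIdeal _ := by
    rw [← pullbackIdeal_idealC hβ]
    exact mem_surfaceE_iff.1 hcE
  obtain ⟨j, k, l, hj, hk, hl⟩ := hβ.exists_isUnit
  obtain ⟨hu0, hu1⟩ := units_of_idealEq_le ⟨k, hk⟩ ⟨l, hl⟩ h1
  obtain ⟨σ, τ, hσ, hτ, hact⟩ := exists_aut_lift (c₁ := 1) (c₂ := 1) (c₃ := 1)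
    (π₁ := Equiv.swap 0 1) (π₂ := Equiv.swap 0 1) (π₃ := Equiv.swap 0 2) hX hη
    (fun j => one_ne_zero) (fun j => one_ne_zero) (fun j => one_ne_zero)
    (fun R _ φ b => by
      congr 2
      simp [formX, actTuple, Equiv.swap_apply_of_ne_of_ne]
      ring)
    (fun R _ φ b => by
      simp [idealEq, actTuple, Equiv.swap_apply_of_ne_of_ne]
      congr 1
      ext x
      simp only [Set.mem_insert_iff, Set.mem_singleton_iff]
      tauto)
  obtain ⟨ε, hloc, hε⟩ := exists_stalk_endomorphism hc τ (hS σ τ hσ hτ)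
  have h2 : Spec.map ε ≫ Z.fromSpecStalk c ≫ η = (Z.fromSpecStalk c ≫ η) ≫ σ.hom := by
    rw [← Category.assoc, hε, Category.assoc, hτ, Category.assoc]
  obtain ⟨p, q, r, hp, -, -, h3⟩ := ((hβ.comp ε).congr h2).exists_scale
    (hact _ _ _ _ (fromSpecStalk_comp_over c) hβ)
  have e0 : β (.inl 1) = p * ε.hom (β (.inl 0)) := by
    have := congrFun h3 (.inl 0)
    simpa [actTuple, scaleTuple] using this
  have e1 : β (.inl 0) = p * ε.hom (β (.inl 1)) := by
    have := congrFun h3 (.inl 1)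
    simpa [actTuple, scaleTuple] using this
  have hx : IsUnit (β (.inl 0)) ∧ IsUnit (β (.inl 1)) := by
    fin_cases j
    · exact ⟨hj, e0 ▸ hp.mul (hj.map ε.hom)⟩
    · exact ⟨e1 ▸ hp.mul (hj.map ε.hom), hj⟩
  have hu := hu0 hx.1
  refine ⟨_, hu.hasTuple_normalize hβ, hu.normalized, ?_⟩
  exact hu.i.ringInverse.mul hx.2

/-- The action of the torus on the local ring of the generic point of an invariant curve. -/
lemma IsBlowup.exists_scaling (hX : i.ker = idealX) (hη : IsBlowup η (idealC i)) {S : Set Z}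
    (hS : IsAutInvariant η S) {c : Z} (hc : IsGenericPoint c S)
    {β : HomCoord → Z.presheaf.stalk c} (hβ : (PPPcoords.comp i).HasTuple (Z.fromSpecStalk c ≫ η) β)
    (hn : Chart.c000.Normalized β) :
    ∃ ε : Z.presheaf.stalk c →+* Z.presheaf.stalk c, IsLocalHom ε ∧
      (∀ a, ε ((stalkConst Z c).hom a) = (stalkConst Z c).hom a) ∧
      ∀ l, ε (Chart.c000.hom (stalkConst Z c).hom β (MvPolynomial.X l)) =
        2 * Chart.c000.hom (stalkConst Z c).hom β (MvPolynomial.X l) := by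
  obtain ⟨σ, τ, hσ, hτ, hact⟩ := exists_aut_lift (c₁ := ![1, 2]) (c₂ := ![1, 2]) (c₃ := ![1, 2, 4])
    (π₁ := Equiv.refl _) (π₂ := Equiv.refl _) (π₃ := Equiv.refl _) hX hη
    (fun j => by fin_cases j <;> simp) (fun j => by fin_cases j <;> simp)
    (fun j => by fin_cases j <;> simp)
    (fun R _ φ b => by
      have e2 : φ 2 = 2 := map_ofNat φ 2
      have e4 : φ 4 = 4 := map_ofNat φ 4
      have h4 : IsUnit (4 : R) := e4 ▸ (show IsUnit (4 : ℂ) from (by norm_num : (4 : ℂ) ≠ 0).isUnit).map φ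
      refine Eq.trans (congrArg (fun x => Ideal.span {x}) ?_)
        (Ideal.span_singleton_mul_left_unit h4 _)
      simp [formX, actTuple, e2, e4]
      ring)
    (fun R _ φ b => by
      have e4 : φ 4 = 4 := map_ofNat φ 4
      have h4 : IsUnit (4 : R) := e4 ▸ (show IsUnit (4 : ℂ) from (by norm_num : (4 : ℂ) ≠ 0).isUnit).map φ
      have e2 : φ 2 = 2 := map_ofNat φ 2
      have h2 : IsUnit (2 : R) := e2 ▸ (show IsUnit (2 : ℂ) from (by norm_num : (2 : ℂ) ≠ 0).isUnit).map φ
      simp only [idealEq, Ideal.span_insert]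
      congr 1
      · refine Eq.trans (congrArg (fun x => Ideal.span {x}) ?_)
          (Ideal.span_singleton_mul_left_unit h4 _)
        simp [actTuple, e2, e4]
        ring
      congr 1
      · refine Eq.trans (congrArg (fun x => Ideal.span {x}) ?_)
          (Ideal.span_singleton_mul_left_unit h2 _)
        simp [actTuple, e2]
        ring
      congr 1
      · refine Eq.trans (congrArg (fun x => Ideal.span {x}) ?_)
          (Ideal.span_singleton_mul_left_unit h4 _)
        simp [actTuple, e2, e4]
        ring
      · refine Eq.trans (congrArg (fun x => Ideal.span {x}) ?_)
          (Ideal.span_singleton_mul_left_unit h2 _)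
        simp [actTuple, e2, e4]
        ring)
  obtain ⟨ε, hloc, hε⟩ := exists_stalk_endomorphism hc τ (hS σ τ hσ hτ)
  have h1 : Spec.map ε ≫ Z.fromSpecStalk c ≫ η = (Z.fromSpecStalk c ≫ η) ≫ σ.hom := by
    rw [← Category.assoc, hε, Category.assoc, hτ, Category.assoc]
  have h2 := hact _ _ _ _ (fromSpecStalk_comp_over c) hβ
  have h3 := (hβ.comp ε).congr h1
  have h0 : ((Z.fromSpecStalk c ≫ η) ≫ σ.hom) ≫ X ↘ SpecC = Spec.map (stalkConst Z c) := by
    rw [Category.assoc, comp_over, fromSpecStalk_comp_over]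
  have hn2 : Chart.c000.Normalized (actTuple (stalkConst Z c).hom ![1, 2] ![1, 2] ![1, 2, 4]
      (Equiv.refl _) (Equiv.refl _) (Equiv.refl _) β) := by
    obtain ⟨e1, e2, e3⟩ := hn
    change β (.inl 0) = 1 at e1
    change β (.inr (.inl 0)) = 1 at e2
    change β (.inr (.inr 0)) = 1 at e3
    refine ⟨?_, ?_, ?_⟩ <;> simp [Chart.c000, actTuple, e1, e2, e3]
  have h4 := Chart.Normalized.eq_of_hasTuple (hn.map ε.hom) hn2 h3 h2
  refine ⟨ε.hom, hloc, comp_const_eq (fromSpecStalk_comp_over c) h1 h0, fun l => ?_⟩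
  rw [Chart.hom_X]
  have h5 : ∀ z, (stalkConst Z c).hom 2 * z = 2 * z := fun z => congrArg (· * z) (map_ofNat _ 2)
  have e1 := congrFun h4 (.inl 1)
  have e2 := congrFun h4 (.inr (.inl 1))
  have e3 := congrFun h4 (.inr (.inr 1))
  fin_cases l
  · simpa [Chart.coord, Chart.c000, actTuple, h5] using e1
  · simpa [Chart.coord, Chart.c000, actTuple, h5] using e2
  · simpa [Chart.coord, Chart.c000, actTuple, h5] using e3

end

end

section

/-! ### Local rings along a line -/

section Units

open Polynomial

variable {O : Type} [CommRing O]

lemma isUnit_of_forall_linear (φ : ℂ[X] →+* O) (h : ∀ a, IsUnit (φ (X - C a))) {P : ℂ[X]}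
    (hP : P ≠ 0) : IsUnit (φ P) := by
  induction hn : P.natDegree using Nat.strong_induction_on generalizing P with
  | _ n ih =>
  by_cases h0 : P.degree = 0
  · exact (isUnit_iff_degree_eq_zero.2 h0).map φ
  obtain ⟨a, ha⟩ := IsAlgClosed.exists_root P h0
  obtain ⟨Q, rfl⟩ := dvd_iff_isRoot.2 ha
  have hQ : Q ≠ 0 := right_ne_zero_of_mul hP
  rw [map_mul]
  refine (h a).mul (ih Q.natDegree ?_ hQ rfl)
  rw [← hn, natDegree_mul (X_sub_C_ne_zero a) hQ, natDegree_X_sub_C]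
  omega

variable [IsLocalRing O] (ε : O →+* O) [IsLocalHom ε]

/-- If `t` is an eigenvector and `λ` is invariant for a torus action, then a relation between them
at the closed point gives a relation for `λ`. -/
lemma exists_linear_mem_maximalIdeal (φ : ℂ[X][X] →+* O) (ht : IsUnit (φ X))
    (hεt : ε (φ X) = φ (C 2) * φ X) (hε : ∀ p, ε (φ (C p)) = φ (C p)) {P : ℂ[X][X]} (hP : P ≠ 0)
    (hφP : ¬ IsUnit (φ P)) : ∃ a : ℂ, ¬ IsUnit (φ (C (X - C a))) := by
  induction hn : P.natDegree using Nat.strong_induction_on generalizing P with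
  | _ n ih =>
  have hcomp : ε (φ P) = φ (P.comp (C 2 * X)) := by
    suffices h : (ε.comp φ) = φ.comp (compRingHom (C 2 * X)) from RingHom.congr_fun h P
    refine Polynomial.ringHom_ext (fun p => ?_) ?_
    · simp [hε]
    · simp [hεt]
  set P' := P.comp (C 2 * X) - C (2 ^ n) * P with hP'
  have hcoeff : ∀ m, P'.coeff m = P.coeff m * (2 ^ m - 2 ^ n) := fun m => by
    rw [hP', coeff_sub, comp_C_mul_X_coeff, coeff_C_mul]
    ring
  have hφP' : ¬ IsUnit (φ P') := by
    rw [hP', map_sub, ← hcomp, map_mul]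
    rw [← mem_nonunits_iff, ← IsLocalRing.mem_maximalIdeal] at hφP ⊢
    refine sub_mem ?_ (Ideal.mul_mem_left _ _ hφP)
    rw [IsLocalRing.mem_maximalIdeal, mem_nonunits_iff] at hφP ⊢
    exact fun h => hφP (isUnit_of_map_unit ε _ h)
  by_cases h0 : P' = 0
  · have h1 : P = C (P.coeff n) * X ^ n := by
      ext1 m
      rw [coeff_C_mul_X_pow]
      split_ifs with hm
      · rw [hm]
      · have h2 := hcoeff m
        rw [h0, coeff_zero] at h2
        refine (mul_eq_zero.1 h2.symm).resolve_right (sub_ne_zero.2 fun h3 => hm ?_)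
        have h4 : (2 : ℂ) ^ m = 2 ^ n := by simpa using congrArg (eval 0) h3
        have h5 : (2 : ℕ) ^ m = 2 ^ n := by exact_mod_cast h4
        exact Nat.pow_right_injective le_rfl h5
    by_contra! hcon
    refine hφP ?_
    rw [h1, map_mul, map_pow]
    refine (isUnit_of_forall_linear (φ.comp C) hcon ?_).mul (ht.pow n)
    rw [← hn]
    exact leadingCoeff_ne_zero.2 hP
  · refine ih P'.natDegree ?_ h0 hφP' rfl
    rw [natDegree_lt_iff_degree_lt h0, degree_lt_iff_coeff_zero]
    intro m hm
    rw [hcoeff]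
    rcases hm.eq_or_lt with rfl | hm
    · rw [sub_self, mul_zero]
    · rw [coeff_eq_zero_of_natDegree_lt (hn ▸ hm), zero_mul]

end Units

section Axis

open MvPolynomial

lemma map_sub_map_mem {S : Type} [CommRing S] (I : Ideal S) (f g : MvPolynomial (Fin 3) ℂ →+* S)
    (hC : ∀ a, f (C a) - g (C a) ∈ I) (hX : ∀ l, f (X l) - g (X l) ∈ I)
    (P : MvPolynomial (Fin 3) ℂ) : f P - g P ∈ I := by
  rw [← Ideal.Quotient.eq]
  refine RingHom.congr_fun (f := (Ideal.Quotient.mk I).comp f) (g := (Ideal.Quotient.mk I).comp g)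
    (MvPolynomial.ringHom_ext (fun a => ?_) fun l => ?_) P
  · exact Ideal.Quotient.eq.2 (hC a)
  · exact Ideal.Quotient.eq.2 (hX l)

/-- Restriction of polynomials to the first coordinate axis. -/
def axisHom : MvPolynomial (Fin 3) ℂ →ₐ[ℂ] Polynomial ℂ := aeval ![Polynomial.X, 0, 0]

/-- The ideal of the first coordinate axis. -/
def axisIdeal : Ideal (MvPolynomial (Fin 3) ℂ) := RingHom.ker axisHom

instance : axisIdeal.IsPrime := RingHom.ker_isPrime axisHom

lemma mem_axisIdeal {P : MvPolynomial (Fin 3) ℂ} : P ∈ axisIdeal ↔ axisHom P = 0 := Iff.rfl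

lemma axisHom_aeval (P : Polynomial ℂ) : axisHom (Polynomial.aeval (X 0) P) = P := by
  rw [← Polynomial.aeval_algHom_apply]
  simp [axisHom]

lemma sub_axisHom_mem (P : MvPolynomial (Fin 3) ℂ) :
    P - Polynomial.aeval (X 0) (axisHom P) ∈ (Ideal.span {X 1, X 2} : Ideal (MvPolynomial (Fin 3) ℂ)) := by
  refine map_sub_map_mem _ (RingHom.id _)
    (((Polynomial.aeval (X 0 : MvPolynomial (Fin 3) ℂ)).comp axisHom).toRingHom)
    (fun a => ?_) (fun l => ?_) P
  · simp [axisHom, algHom_C, algebraMap_eq]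
  · fin_cases l
    · simp [axisHom]
    · simpa [axisHom] using Ideal.subset_span (Set.mem_insert (X 1) {X 2})
    · simpa [axisHom] using Ideal.subset_span (.inr rfl)

lemma axisIdeal_eq_span : axisIdeal = Ideal.span {X 1, X 2} := by
  apply le_antisymm
  · intro P hP
    have h := sub_axisHom_mem P
    rwa [mem_axisIdeal.1 hP, map_zero, sub_zero] at h
  · rw [Ideal.span_le]
    rintro x (rfl | rfl) <;> simp [mem_axisIdeal, axisHom]

/-- The local ring of affine space along the first coordinate axis. -/
abbrev axisRing : Type := Localization.AtPrime axisIdeal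

namespace axisRing

lemma algebraMap_injective : Function.Injective (algebraMap (MvPolynomial (Fin 3) ℂ) axisRing) :=
  IsLocalization.injective _ axisIdeal.primeCompl_le_nonZeroDivisors

instance : IsDomain axisRing :=
  IsLocalization.isDomain_localization axisIdeal.primeCompl_le_nonZeroDivisors

lemma maximalIdeal_eq : IsLocalRing.maximalIdeal axisRing =
    Ideal.span {algebraMap (MvPolynomial (Fin 3) ℂ) axisRing (X 1),
      algebraMap (MvPolynomial (Fin 3) ℂ) axisRing (X 2)} := by
  rw [← Localization.AtPrime.map_eq_maximalIdeal]
  refine (congrArg (Ideal.map (algebraMap (MvPolynomial (Fin 3) ℂ) axisRing)) axisIdeal_eq_span).trans ?_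
  rw [Ideal.map_span, Set.image_pair]

lemma isUnit_algebraMap_iff {p : MvPolynomial (Fin 3) ℂ} :
    IsUnit (algebraMap (MvPolynomial (Fin 3) ℂ) axisRing p) ↔ p ∉ axisIdeal :=
  IsLocalization.AtPrime.isUnit_to_map_iff axisRing axisIdeal p

/-- Local homomorphisms from the local ring of an axis. -/
lemma exists_hom {O : Type} [CommRing O] [IsLocalRing O] (ψ : MvPolynomial (Fin 3) ℂ →+* O)
    (h1 : ¬ IsUnit (ψ (X 1))) (h2 : ¬ IsUnit (ψ (X 2)))
    (h0 : ∀ P : Polynomial ℂ, P ≠ 0 → IsUnit (ψ (Polynomial.aeval (X 0) P))) :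
    ∃ l : axisRing →+* O, IsLocalHom l ∧ ∀ p, l (algebraMap _ _ p) = ψ p := by
  have hmem : ∀ p ∈ axisIdeal, ¬ IsUnit (ψ p) := fun p hp => by
    have h3 : axisIdeal ≤ (IsLocalRing.maximalIdeal O).comap ψ := by
      rw [axisIdeal_eq_span, Ideal.span_le]
      rintro x (rfl | rfl)
      exacts [h1, h2]
    exact h3 hp
  have hunit : ∀ p ∉ axisIdeal, IsUnit (ψ p) := fun p hp => by
    have h3 := h0 _ (mt mem_axisIdeal.2 hp)
    by_contra h4
    have h5 := hmem _ (axisIdeal_eq_span ▸ sub_axisHom_mem p)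
    rw [← mem_nonunits_iff, ← IsLocalRing.mem_maximalIdeal, map_sub] at h5
    rw [← mem_nonunits_iff, ← IsLocalRing.mem_maximalIdeal] at h4
    have h6 := sub_mem h4 h5
    rw [sub_sub_cancel] at h6
    exact (IsLocalRing.mem_maximalIdeal _).1 h6 h3
  have hunit' : ∀ d : axisIdeal.primeCompl, IsUnit (ψ d) := fun d => hunit d d.2
  refine ⟨IsLocalization.lift hunit', ⟨fun a ha => ?_⟩, fun p => IsLocalization.lift_eq hunit' p⟩
  obtain ⟨⟨p, d⟩, h⟩ := IsLocalization.surj (M := axisIdeal.primeCompl) (S := axisRing) a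
  have h3 := congrArg (IsLocalization.lift (M := axisIdeal.primeCompl) (S := axisRing) hunit') h
  rw [map_mul, IsLocalization.lift_eq, IsLocalization.lift_eq] at h3
  have h4 : p ∉ axisIdeal := fun hp => hmem p hp (h3 ▸ ha.mul (hunit' d))
  have h5 : IsUnit (algebraMap (MvPolynomial (Fin 3) ℂ) axisRing p) := isUnit_algebraMap_iff.2 h4
  rw [← h] at h5
  exact isUnit_of_mul_isUnit_left h5

end axisRing

end Axis

end

section

variable {B B' : CommRingCat.{0}}

/-! ### Coordinates at the generic point of `C'` -/

section

variable {X : Scheme.{0}} [X.Over SpecC] [IsIntegral X] [IsLocallyNoetherian X] {i : X ⟶ PPP}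
  [i.IsOver SpecC] [IsClosedImmersion i] {Z : Scheme.{0}} [Z.Over SpecC] {η : Z ⟶ X}
  [η.IsOver SpecC] [IsIntegral Z]

/-- A compatible homomorphism to a local ring of a model. -/
lemma IsModel.map_comp_eq (hX : i.ker = idealX) (hη : IsModel i η) (F : FieldCoords i η) {P : Z}
    {κ : Chart} {β : HomCoord → Z.presheaf.stalk P}
    (hβ : (PPPcoords.comp i).HasTuple (Z.fromSpecStalk P ≫ η) β) (hn : κ.Normalized β)
    {al : MvPolynomial (Fin 3) ℂ →+* B} {v : Spec B ⟶ Z}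
    (hv : (v ≫ η) ≫ X ↘ SpecC = Spec.map (CommRingCat.ofHom (al.comp MvPolynomial.C)))
    (hv' : (PPPcoords.comp i).HasTuple (v ≫ η) (κ.tuple fun l => al (MvPolynomial.X l)))
    (l : B ⟶ Z.presheaf.stalk P) (hl : ∀ p, l.hom (al p) = κ.hom (stalkConst Z P).hom β p) :
    Spec.map l ≫ v = Z.fromSpecStalk P := by
  have h2 : (Spec.map l ≫ v) ≫ η = Z.fromSpecStalk P ≫ η := by
    have h1 := (hv'.comp l).congr (Category.assoc _ _ _).symm
    have h2 : (fun h => l.hom (κ.tuple (fun m => al (MvPolynomial.X m)) h)) = β := by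
      funext h
      refine (κ.map_tuple l.hom _ h).trans ?_
      simp only [hl, κ.hom_X]
      rw [hn.tuple_coord (formX_eq_zero hX hβ)]
    rw [h2] at h1
    refine X_ext h1 hβ ?_
    rw [fromSpecStalk_comp_over, Category.assoc, Category.assoc, ← Category.assoc v, hv,
      ← Spec.map_comp]
    congr 1
    ext a
    exact (hl _).trans (κ.hom_C _ _ _)
  refine hη.eq_of_comp_eq _ _ _ h2 ?_
  rw [h2]
  exact F.pullbackIdeal_ne_bot P

lemma FieldCoords.hom_injective (F : FieldCoords i η) (hX : i.ker = idealX) {P : Z} {κ : Chart}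
    {β : HomCoord → Z.presheaf.stalk P}
    (hβ : (PPPcoords.comp i).HasTuple (Z.fromSpecStalk P ≫ η) β) (hn : κ.Normalized β) :
    Function.Injective (κ.hom (stalkConst Z P).hom β) := fun p q h =>
  (isLocalCoords_toLL κ hX).inj (F.θ.injective (by
    rw [← F.toFunctionField_hom hβ hn, ← F.toFunctionField_hom hβ hn, h]))

/-- A local homomorphism between local rings of a model compatible with the coordinates. -/
lemma IsModel.eq_of_local_hom (hX : i.ker = idealX) (hη : IsModel i η) (F : FieldCoords i η)
    {P Q : Z} {β : HomCoord → Z.presheaf.stalk P}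
    (hβ : (PPPcoords.comp i).HasTuple (Z.fromSpecStalk P ≫ η) β) (hn : Chart.c000.Normalized β)
    {β' : HomCoord → Z.presheaf.stalk Q}
    (hβ' : (PPPcoords.comp i).HasTuple (Z.fromSpecStalk Q ≫ η) β') (hn' : Chart.c000.Normalized β')
    (l : Z.presheaf.stalk Q ⟶ Z.presheaf.stalk P) [IsLocalHom l.hom]
    (hl : ∀ p, l.hom (Chart.c000.hom (stalkConst Z Q).hom β' p) =
      Chart.c000.hom (stalkConst Z P).hom β p) : Q = P := by
  have h1 : (Z.fromSpecStalk Q ≫ η) ≫ X ↘ SpecC = Spec.map (CommRingCat.ofHom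
      ((Chart.c000.hom (stalkConst Z Q).hom β').comp MvPolynomial.C)) := by
    rw [fromSpecStalk_comp_over]
    congr 1
    ext a
    exact (Chart.c000.hom_C _ _ a).symm
  have h2 : (PPPcoords.comp i).HasTuple (Z.fromSpecStalk Q ≫ η) (Chart.c000.tuple
      fun l => Chart.c000.hom (stalkConst Z Q).hom β' (MvPolynomial.X l)) := by
    simp only [Chart.hom_X]
    rwa [hn'.tuple_coord (formX_eq_zero hX hβ')]
  have h3 := hη.map_comp_eq hX F hβ hn h1 h2 l hl
  have h4 := congrArg (fun u => u (IsLocalRing.closedPoint _)) h3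
  have h5 := Scheme.Hom.comp_apply (Spec.map l) (Z.fromSpecStalk Q) (IsLocalRing.closedPoint _)
  beta_reduce at h4
  rw [h5, closedPoint_of_isLocalHom, Scheme.fromSpecStalk_closedPoint,
    Scheme.fromSpecStalk_closedPoint] at h4
  exact h4

/-- Coordinates `t, ω, λ` in a local ring, such that the equations of `C` are linear combinations
of `ω` and `λ ω` and the local ring is that of the curve `ω = λ = 0`. -/
structure AxisCoords {O : Type} [CommRing O] (h : MvPolynomial (Fin 3) ℂ →+* O)
    (M : Matrix (Fin 2) (Fin 2) ℂ) (ψ : MvPolynomial (Fin 3) ℂ →+* O) : Prop where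
  det_ne_zero : M.det ≠ 0
  eq : ∀ p, h p = ψ (toricHom M 1 0 1 1 p)
  one : ¬ IsUnit (ψ (MvPolynomial.X 1))
  two : ¬ IsUnit (ψ (MvPolynomial.X 2))
  units : ∀ P : Polynomial ℂ, P ≠ 0 → IsUnit (ψ (Polynomial.aeval (MvPolynomial.X 0) P))

lemma toricHom_aeval_X (M : Matrix (Fin 2) (Fin 2) ℂ) (k A l B : ℕ) (P : Polynomial ℂ) :
    toricHom M k A l B (Polynomial.aeval (MvPolynomial.X 0) P) =
      Polynomial.aeval (MvPolynomial.X 0) P := by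
  rw [← Polynomial.aeval_algHom_apply]
  simp [toricHom, linHom, monoHom]

lemma AxisCoords.exists_of_eq {O : Type} [CommRing O] {h : MvPolynomial (Fin 3) ℂ →+* O}
    {M : Matrix (Fin 2) (Fin 2) ℂ} (hM : M.det ≠ 0) {ω lam : O}
    (hω : ¬ IsUnit ω) (hl : ¬ IsUnit lam)
    (hu : ∀ P : Polynomial ℂ, P ≠ 0 → IsUnit (h (Polynomial.aeval (MvPolynomial.X 0) P)))
    (h1 : h (MvPolynomial.X 0 - MvPolynomial.X 1) =
      h (MvPolynomial.C (M 0 0)) * ω + h (MvPolynomial.C (M 0 1)) * (ω * lam))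
    (h2 : h (MvPolynomial.X 0 - MvPolynomial.X 2) =
      h (MvPolynomial.C (M 1 0)) * ω + h (MvPolynomial.C (M 1 1)) * (ω * lam)) :
    ∃ ψ, AxisCoords h M ψ := by
  let ψ : MvPolynomial (Fin 3) ℂ →+* O :=
    MvPolynomial.eval₂Hom (h.comp MvPolynomial.C) ![h (MvPolynomial.X 0), ω, lam]
  have hψC : ∀ a, ψ (MvPolynomial.C a) = h (MvPolynomial.C a) := fun a =>
    MvPolynomial.eval₂Hom_C _ _ _
  have hψ0 : ψ (MvPolynomial.X 0) = h (MvPolynomial.X 0) := MvPolynomial.eval₂Hom_X' _ _ _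
  have hψ1 : ψ (MvPolynomial.X 1) = ω := MvPolynomial.eval₂Hom_X' _ _ _
  have hψ2 : ψ (MvPolynomial.X 2) = lam := MvPolynomial.eval₂Hom_X' _ _ _
  have heq : ∀ p, h p = ψ (toricHom M 1 0 1 1 p) := by
    suffices hs : h = ψ.comp (toricHom M 1 0 1 1).toRingHom from fun p => RingHom.congr_fun hs p
    rw [map_sub] at h1 h2
    refine MvPolynomial.ringHom_ext (fun a => ?_) (fun l => ?_)
    · refine (hψC a).symm.trans (congrArg ψ ?_)
      exact (MvPolynomial.algHom_C _ a).symm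
    · refine Eq.trans ?_ (RingHom.comp_apply _ _ _).symm
      fin_cases l
      · simp [toricHom, linHom, monoHom, hψ0]
      · simp [toricHom, linHom, monoHom, MvPolynomial.algHom_C, MvPolynomial.algebraMap_eq, hψC,
          hψ0, hψ1, hψ2]
        linear_combination -h1
      · simp [toricHom, linHom, monoHom, MvPolynomial.algHom_C, MvPolynomial.algebraMap_eq, hψC,
          hψ0, hψ1, hψ2]
        linear_combination -h2
  refine ⟨ψ, hM, heq, by rwa [hψ1], by rwa [hψ2], fun P hP => ?_⟩
  have := hu P hP
  rwa [heq, toricHom_aeval_X] at this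

end

end

section

section Algebra

variable {O : Type} [CommRing O] [IsLocalRing O] [IsDomain O]

/-- A local ring dominated by coordinates `t, λ, w`, without relation between `t` and `λ` at the
closed point. -/
lemma exists_toricDVR_hom {ψ : MvPolynomial (Fin 3) ℂ →+* O} (h2 : ¬ IsUnit (ψ (MvPolynomial.X 2)))
    (hu : ∀ P, ¬ MvPolynomial.X 2 ∣ P → IsUnit (ψ P)) :
    ∃ l : toricDVR →+* O, IsLocalHom l ∧ ∀ p, l (algebraMap _ _ p) = ψ p := by
  have hunit' : ∀ d : (Ideal.span {(MvPolynomial.X 2 : MvPolynomial (Fin 3) ℂ)}).primeCompl,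
      IsUnit (ψ d) := fun d => hu _ fun h => d.2 (Ideal.mem_span_singleton.2 h)
  refine ⟨IsLocalization.lift hunit', ⟨fun a ha => ?_⟩, fun p => IsLocalization.lift_eq hunit' p⟩
  obtain ⟨p, d, hd, h⟩ := toricDVR.isLocalCoords.surj a
  have h3 := congrArg (IsLocalization.lift (M := (Ideal.span
    {(MvPolynomial.X 2 : MvPolynomial (Fin 3) ℂ)}).primeCompl) (S := toricDVR) hunit') h
  rw [map_mul, IsLocalization.lift_eq, IsLocalization.lift_eq] at h3
  have h4 : IsUnit (algebraMap (MvPolynomial (Fin 3) ℂ) toricDVR p) := by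
    refine toricDVR.isUnit_algebraMap_iff.2 fun h5 => ?_
    obtain ⟨q, rfl⟩ := h5
    rw [map_mul] at h3
    exact h2 (isUnit_of_mul_isUnit_left (h3 ▸ ha.mul (hu _ (toricDVR.isUnit_algebraMap_iff.1 hd))))
  rw [← h] at h4
  exact isUnit_of_mul_isUnit_left h4

/-- Restriction of polynomials to a coordinate plane. -/
def planeHom : MvPolynomial (Fin 3) ℂ →ₐ[ℂ] Polynomial (Polynomial ℂ) :=
  MvPolynomial.aeval ![Polynomial.X, Polynomial.C Polynomial.X, 0]

lemma dvd_of_planeHom_eq_zero {P : MvPolynomial (Fin 3) ℂ} (h : planeHom P = 0) :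
    MvPolynomial.X 2 ∣ P := by
  rw [← Ideal.mem_span_singleton]
  have := map_sub_map_mem (Ideal.span {MvPolynomial.X 2}) (RingHom.id _)
    ((Polynomial.eval₂RingHom (Polynomial.aeval (MvPolynomial.X 1 : MvPolynomial (Fin 3) ℂ)).toRingHom
      (MvPolynomial.X 0)).comp planeHom.toRingHom) (fun a => ?_) (fun l => ?_) P
  · have h2 : planeHom.toRingHom P = 0 := h
    rwa [RingHom.comp_apply, h2, map_zero, sub_zero] at this
  · simp [planeHom, MvPolynomial.algHom_C, MvPolynomial.algebraMap_eq]
  · fin_cases l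
    · simp [planeHom]
    · simp [planeHom]
    · simp [planeHom]

/-- A local ring in which the equations of `C` are `w` and `λ w`, with `t` and `w` eigenvectors and
`λ` invariant for a torus action, either dominates the local ring of the exceptional surface, or
`λ` is constant at the closed point. -/
lemma exists_axisCoords_or {h : MvPolynomial (Fin 3) ℂ →+* O} (hinj : Function.Injective h)
    (ε : O →+* O) [IsLocalHom ε] (hεC : ∀ a, ε (h (MvPolynomial.C a)) = h (MvPolynomial.C a))
    (hεX : ∀ l, ε (h (MvPolynomial.X l)) = 2 * h (MvPolynomial.X l))
    (ht : IsUnit (h (MvPolynomial.X 0)))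
    (hu : ∀ P : Polynomial ℂ, P ≠ 0 → IsUnit (h (Polynomial.aeval (MvPolynomial.X 0) P)))
    (hw : ¬ IsUnit (h (MvPolynomial.X 0 - MvPolynomial.X 1)))
    (hdvd : h (MvPolynomial.X 0 - MvPolynomial.X 1) ∣ h (MvPolynomial.X 0 - MvPolynomial.X 2)) :
    (∃ l : toricDVR →+* O, IsLocalHom l ∧ ∀ p, l (algebraMap _ _ (blowupHom p)) = h p) ∨
    ∃ M ψ, AxisCoords h M ψ := by
  obtain ⟨lam, hlam⟩ := hdvd
  have hw0 : h (MvPolynomial.X 0 - MvPolynomial.X 1) ≠ 0 := by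
    intro h0
    have h1 := congrArg (MvPolynomial.eval ![0, 1, 0]) (hinj (h0.trans (map_zero h).symm))
    simp at h1
  have h20 : (2 : O) ≠ 0 := by
    intro h0
    have h1 := congrArg (MvPolynomial.eval ![0, 1, 0])
      (hinj ((map_ofNat h 2).trans (h0.trans (map_zero h).symm)))
    simp at h1
  have hεlam : ε lam = lam := by
    have h1 := congrArg ε hlam
    rw [map_mul, map_sub, map_sub, map_sub, map_sub, hεX, hεX, hεX] at h1
    rw [map_sub, map_sub] at hlam
    rw [map_sub] at hw0
    refine mul_left_cancel₀ (mul_ne_zero h20 hw0) ?_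
    linear_combination 2 * hlam - h1
  let φ : Polynomial (Polynomial ℂ) →+* O := Polynomial.eval₂RingHom
    (Polynomial.eval₂RingHom (h.comp MvPolynomial.C) lam) (h (MvPolynomial.X 0))
  have hφX : φ Polynomial.X = h (MvPolynomial.X 0) := Polynomial.eval₂_X _ _
  have hφC : ∀ p, φ (Polynomial.C p) = p.eval₂ (h.comp MvPolynomial.C) lam := fun p =>
    Polynomial.eval₂_C _ _
  have hφC2 : φ (Polynomial.C 2) = 2 := map_ofNat (φ.comp Polynomial.C) 2
  by_cases hcase : ∀ P, P ≠ 0 → IsUnit (φ P)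
  · left
    let ψ : MvPolynomial (Fin 3) ℂ →+* O := MvPolynomial.eval₂Hom (h.comp MvPolynomial.C)
      ![h (MvPolynomial.X 0), lam, h (MvPolynomial.X 0 - MvPolynomial.X 1)]
    have hψC : ∀ a, ψ (MvPolynomial.C a) = h (MvPolynomial.C a) := fun a =>
      MvPolynomial.eval₂Hom_C _ _ _
    have hψ0 : ψ (MvPolynomial.X 0) = h (MvPolynomial.X 0) := MvPolynomial.eval₂Hom_X' _ _ _
    have hψ1 : ψ (MvPolynomial.X 1) = lam := MvPolynomial.eval₂Hom_X' _ _ _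
    have hψ2 : ψ (MvPolynomial.X 2) = h (MvPolynomial.X 0 - MvPolynomial.X 1) :=
      MvPolynomial.eval₂Hom_X' _ _ _
    obtain ⟨l, hl, hlψ⟩ := exists_toricDVR_hom (ψ := ψ) (by rwa [hψ2]) fun P hP => by
      have h1 : planeHom P ≠ 0 := mt dvd_of_planeHom_eq_zero hP
      have h2 := map_sub_map_mem (IsLocalRing.maximalIdeal O) ψ (φ.comp planeHom.toRingHom)
        (fun a => ?_) (fun l => ?_) P
      · by_contra h3
        rw [← mem_nonunits_iff, ← IsLocalRing.mem_maximalIdeal] at h3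
        have h4 := sub_mem h3 h2
        rw [sub_sub_cancel, IsLocalRing.mem_maximalIdeal] at h4
        exact h4 (hcase _ h1)
      · have h3 : planeHom (MvPolynomial.C a) = Polynomial.C (Polynomial.C a) :=
          MvPolynomial.algHom_C planeHom a
        have h4 : (φ.comp planeHom.toRingHom) (MvPolynomial.C a) = h (MvPolynomial.C a) :=
          (congrArg φ h3).trans ((hφC _).trans (Polynomial.eval₂_C _ _))
        rw [hψC, h4, sub_self]
        exact zero_mem _
      · change ψ (MvPolynomial.X l) - φ (planeHom (MvPolynomial.X l)) ∈ _
        fin_cases l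
        · simp [planeHom, hψ0, hφX]
        · simp [planeHom, hψ1, hφC]
        · simpa [planeHom, hψ2] using hw
    refine ⟨l, hl, fun p => (hlψ _).trans ?_⟩
    suffices hs : ψ.comp blowupHom.toRingHom = h from RingHom.congr_fun hs p
    rw [map_sub, map_sub] at hlam
    refine MvPolynomial.ringHom_ext (fun a => ?_) (fun l => ?_)
    · refine Eq.trans (congrArg ψ ?_) (hψC a)
      exact MvPolynomial.algHom_C _ a
    · refine (RingHom.comp_apply _ _ _).trans ?_
      fin_cases l
      · simp [toricHom, linHom, monoHom, hψ0]
      · simp [toricHom, linHom, monoHom, hψ0, hψ2]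
      · simp [toricHom, linHom, monoHom, hψ0, hψ1, hψ2]
        linear_combination hlam
  · right
    push Not at hcase
    obtain ⟨P, hP, hφP⟩ := hcase
    obtain ⟨a, ha⟩ := exists_linear_mem_maximalIdeal ε φ (by rwa [hφX])
      (by rw [hφX, hφC2, hεX]) (fun p => by
        rw [hφC]
        have h1 := Polynomial.hom_eval₂ p (h.comp MvPolynomial.C) ε lam
        rw [hεlam] at h1
        rw [h1]
        congr 1
        ext a
        exact hεC a) hP hφP
    rw [hφC] at ha
    have ha' : Polynomial.eval₂ (h.comp MvPolynomial.C) lam (Polynomial.X - Polynomial.C a) =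
      lam - h (MvPolynomial.C a) := by simp
    rw [ha'] at ha
    refine ⟨!![1, 0; a, 1], ?_⟩
    refine AxisCoords.exists_of_eq (by simp [Matrix.det_fin_two]) hw ha hu (by simp) ?_
    rw [hlam]
    simp
    ring

/-- The second case, up to exchanging the two equations. -/
lemma exists_axisCoords_or' {h : MvPolynomial (Fin 3) ℂ →+* O} (hinj : Function.Injective h)
    (ε : O →+* O) [IsLocalHom ε] (hεC : ∀ a, ε (h (MvPolynomial.C a)) = h (MvPolynomial.C a))
    (hεX : ∀ l, ε (h (MvPolynomial.X l)) = 2 * h (MvPolynomial.X l))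
    (ht : IsUnit (h (MvPolynomial.X 0)))
    (hw : ¬ IsUnit (h (MvPolynomial.X 0 - MvPolynomial.X 1)))
    (hp : ¬ IsUnit (h (MvPolynomial.X 0 - MvPolynomial.X 2)))
    (hdvd : h (MvPolynomial.X 0 - MvPolynomial.X 1) ∣ h (MvPolynomial.X 0 - MvPolynomial.X 2) ∨
      h (MvPolynomial.X 0 - MvPolynomial.X 2) ∣ h (MvPolynomial.X 0 - MvPolynomial.X 1)) :
    (∃ l : toricDVR →+* O, IsLocalHom l ∧ ∀ p, l (algebraMap _ _ (blowupHom p)) = h p) ∨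
    ∃ M ψ, AxisCoords h M ψ := by
  have hlin : ∀ a, IsUnit (h (MvPolynomial.X 0 - MvPolynomial.C a)) := fun a => by
    by_contra h1
    have h2 : ¬ IsUnit (ε (h (MvPolynomial.X 0 - MvPolynomial.C a))) := fun h3 =>
      h1 (isUnit_of_map_unit ε _ h3)
    rw [map_sub, map_sub, hεX, hεC, ← mem_nonunits_iff, ← IsLocalRing.mem_maximalIdeal] at h2
    rw [map_sub, ← mem_nonunits_iff, ← IsLocalRing.mem_maximalIdeal] at h1
    have h3 := sub_mem h2 h1
    rw [show 2 * h (MvPolynomial.X 0) - h (MvPolynomial.C a) -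
      (h (MvPolynomial.X 0) - h (MvPolynomial.C a)) = h (MvPolynomial.X 0) by ring] at h3
    exact (IsLocalRing.mem_maximalIdeal _).1 h3 ht
  have hu : ∀ P : Polynomial ℂ, P ≠ 0 → IsUnit (h (Polynomial.aeval (MvPolynomial.X 0) P)) :=
    fun P hP => isUnit_of_forall_linear
      (h.comp (Polynomial.aeval (MvPolynomial.X 0 : MvPolynomial (Fin 3) ℂ)).toRingHom) (fun a => by
        have h1 : Polynomial.aeval (MvPolynomial.X 0 : MvPolynomial (Fin 3) ℂ)
          (Polynomial.X - Polynomial.C a) = MvPolynomial.X 0 - MvPolynomial.C a := by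
          simp [MvPolynomial.algebraMap_eq]
        exact (RingHom.comp_apply _ _ _).symm ▸ (congrArg h h1).symm ▸ hlin a) hP
  by_cases hd : h (MvPolynomial.X 0 - MvPolynomial.X 1) ∣ h (MvPolynomial.X 0 - MvPolynomial.X 2)
  · exact exists_axisCoords_or hinj ε hεC hεX ht hu hw hd
  · right
    obtain ⟨lam, hlam⟩ := hdvd.resolve_left hd
    have hl : ¬ IsUnit lam := fun hl => hd (by
      obtain ⟨l', hl'⟩ := hl.exists_right_inv
      exact ⟨l', by rw [hlam, mul_assoc, hl', mul_one]⟩)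
    refine ⟨!![0, 1; 1, 0], AxisCoords.exists_of_eq (by simp [Matrix.det_fin_two]) hp hl hu ?_
      (by simp)⟩
    rw [hlam]
    simp

end Algebra

section

variable {X : Scheme.{0}} [X.Over SpecC] [IsIntegral X] [IsLocallyNoetherian X] {i : X ⟶ PPP}
  [i.IsOver SpecC] [IsClosedImmersion i] {Z : Scheme.{0}} [Z.Over SpecC] {η : Z ⟶ X}
  [η.IsOver SpecC] [IsIntegral Z]

/-- Coordinates at the generic point of an invariant curve in `E`. -/
lemma IsBlowup.exists_axisCoords [IsLocallyNoetherian Z] (hX : i.ker = idealX) (hη : IsBlowup η (idealC i)) {S : Set Z}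
    (hS : IsAutInvariant η S) {c : Z} (hc : IsGenericPoint c S) (hcE : c ∈ surfaceE i η)
    {ξ : Z} (hξ : IsGenericPoint ξ (surfaceE i η : Set Z)) (hne : ξ ≠ c) :
    ∃ β, (PPPcoords.comp i).HasTuple (Z.fromSpecStalk c ≫ η) β ∧ Chart.c000.Normalized β ∧
      ∃ M ψ, AxisCoords (Chart.c000.hom (stalkConst Z c).hom β) M ψ := by
  obtain ⟨F⟩ := hη.isModel.nonempty_fieldCoords hX
  obtain ⟨β, hβ, hn, ht⟩ := hη.exists_normalized hX hS hc hcE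
  obtain ⟨ε, hloc, hεC, hεX⟩ := hη.exists_scaling hX hS hc hβ hn
  refine ⟨β, hβ, hn, ?_⟩
  have hE := mem_surfaceE_iff.1 hcE
  rw [Chart.pullbackIdeal_idealC_hom hX hβ hn, Ideal.span_le] at hE
  have ht' : IsUnit (Chart.c000.hom (stalkConst Z c).hom β (MvPolynomial.X 0)) := by
    rw [Chart.hom_X]
    simpa [Chart.coord, Chart.c000] using ht
  refine (exists_axisCoords_or' (F.hom_injective hX hβ hn) ε (fun a => ?_) hεX ht'
    ((IsLocalRing.mem_maximalIdeal _).1 (hE (.inl rfl)))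
    ((IsLocalRing.mem_maximalIdeal _).1 (hE (.inr rfl))) (hη.dvd_or_dvd hX hβ hn)).resolve_left ?_
  · rw [Chart.hom_C, hεC]
  · rintro ⟨l, hl, hlp⟩
    obtain ⟨β', hβ', hn', φ, hφ⟩ := hη.isToricPoint hX hξ
    let l' : Z.presheaf.stalk ξ ⟶ Z.presheaf.stalk c := CommRingCat.ofHom (l.comp φ.toRingHom)
    have hl' : IsLocalHom l'.hom := ⟨fun a ha => by
      have h1 : IsUnit (φ a) := hl.map_nonunit _ ha
      simpa using h1.map φ.symm⟩
    refine hne (hη.isModel.eq_of_local_hom hX F hβ hn hβ' hn' l' fun p => ?_)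
    exact (congrArg l (hφ p)).trans (hlp p)

end

end

section

/-! ### Equations of proper transforms -/

/-- If `ρ` is an equation of the exceptional divisor and `ρ d` vanishes on `A`, then `d` vanishes on
the proper transform of `A`. -/
lemma mem_pullbackIdeal_properTransform {T' T : Scheme.{0}} {g : T' ⟶ T} {Z A : Closeds T}
    {I J : T.IdealSheafData} (hZ : I.support = Z) (hA : J.support = A)
    (hI : IsInvertibleIdeal (I.comap g)) (x : T') {ρ d : T'.presheaf.stalk x}
    (hρ : pullbackIdeal I (T'.fromSpecStalk x ≫ g) = Ideal.span {ρ})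
    (h : ρ * d ∈ pullbackIdeal J (T'.fromSpecStalk x ≫ g)) :
    d ∈ pullbackIdeal (Scheme.IdealSheafData.vanishingIdeal (properTransform g Z A))
      (T'.fromSpecStalk x) := by
  rw [← pullbackIdeal_comap] at hρ h
  obtain ⟨U, hU, s, -, hs⟩ := hI x
  have h1 : (T'.presheaf.germ U.1 x hU).hom s ∈ Ideal.span {ρ} := by
    rw [← hρ, pullbackIdeal_fromSpecStalk _ x U hU]
    exact Ideal.mem_map_of_mem _ (hs ▸ Ideal.mem_span_singleton_self s)
  obtain ⟨u, hu⟩ := Ideal.mem_span_singleton.1 h1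
  obtain ⟨W₁, hW₁, e₁, he₁, hv⟩ := exists_section_of_mem_pullbackIdeal _ x _ h
  obtain ⟨W₂, hW₂, e₂, rfl⟩ := T'.presheaf.exists_germ_eq d
  obtain ⟨W₃, hW₃, e₃, rfl⟩ := T'.presheaf.exists_germ_eq ρ
  obtain ⟨W₄, hW₄, e₄, rfl⟩ := T'.presheaf.exists_germ_eq u
  have hcover : ∃ W : T'.Opens, x ∈ W ∧ W ≤ U.1 ∧ W ≤ W₁ ∧ W ≤ W₂ ∧ W ≤ W₃ ∧ W ≤ W₄ :=
    ⟨U.1 ⊓ W₁ ⊓ W₂ ⊓ W₃ ⊓ W₄, ⟨⟨⟨⟨hU, hW₁⟩, hW₂⟩, hW₃⟩, hW₄⟩,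
      inf_le_left.trans (inf_le_left.trans (inf_le_left.trans inf_le_left)),
      inf_le_left.trans (inf_le_left.trans (inf_le_left.trans inf_le_right)),
      inf_le_left.trans (inf_le_left.trans inf_le_right),
      inf_le_left.trans inf_le_right, inf_le_right⟩
  obtain ⟨W, hW, i₀, i₁, i₂, i₃, i₄⟩ := hcover
  let r {V : T'.Opens} (i : W ≤ V) : Γ(T', V) ⟶ Γ(T', W) := T'.presheaf.map (homOfLE i).op
  have hr : ∀ {V : T'.Opens} (i : W ≤ V) (y : T') (hy : y ∈ W) (e : Γ(T', V)),
      (T'.presheaf.germ W y hy).hom ((r i).hom e) = (T'.presheaf.germ V y (i hy)).hom e :=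
    fun i y hy e => T'.presheaf.germ_res_apply (homOfLE i) y hy e
  have e1 : (T'.presheaf.germ W x hW).hom ((r i₁).hom e₁) =
      (T'.presheaf.germ W x hW).hom ((r i₃).hom e₃ * (r i₂).hom e₂) := by
    rw [map_mul, hr, hr, hr]
    exact he₁
  have e2 : (T'.presheaf.germ W x hW).hom ((r i₀).hom s) =
      (T'.presheaf.germ W x hW).hom ((r i₃).hom e₃ * (r i₄).hom e₄) := by
    rw [map_mul, hr, hr, hr]
    exact hu
  obtain ⟨W', hW', j, j', ej⟩ := T'.presheaf.germ_eq x hW hW _ _ e1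
  obtain ⟨W'', hW'', k, k', ek⟩ := T'.presheaf.germ_eq x hW hW _ _ e2
  have hj : ∀ y (hy : y ∈ W'), (T'.presheaf.germ W₁ y (i₁ (j.le hy))).hom e₁ =
      (T'.presheaf.germ W₃ y (i₃ (j.le hy))).hom e₃ *
      (T'.presheaf.germ W₂ y (i₂ (j.le hy))).hom e₂ := fun y hy => by
    have h2 := congrArg (T'.presheaf.germ W' y hy).hom ej
    have h3 := (T'.presheaf.germ_res_apply j y hy ((r i₁).hom e₁)).symm.trans
      (h2.trans (T'.presheaf.germ_res_apply j' y hy _))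
    rwa [map_mul, hr, hr, hr] at h3
  have hk : ∀ y (hy : y ∈ W''), (T'.presheaf.germ U.1 y (i₀ (k.le hy))).hom s =
      (T'.presheaf.germ W₃ y (i₃ (k.le hy))).hom e₃ *
      (T'.presheaf.germ W₄ y (i₄ (k.le hy))).hom e₄ := fun y hy => by
    have h2 := congrArg (T'.presheaf.germ W'' y hy).hom ek
    have h3 := (T'.presheaf.germ_res_apply k y hy ((r i₀).hom s)).symm.trans
      (h2.trans (T'.presheaf.germ_res_apply k' y hy _))
    rwa [map_mul, hr, hr, hr] at h3
  let V : T'.Opens := W' ⊓ W''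
  have iV : V ≤ W₂ := inf_le_left.trans (j.le.trans i₂)
  have hV : (T'.presheaf.germ V x ⟨hW', hW''⟩).hom ((T'.presheaf.map (homOfLE iV).op).hom e₂) =
      (T'.presheaf.germ W₂ x hW₂).hom e₂ := T'.presheaf.germ_res_apply (homOfLE iV) x _ e₂
  refine (congrArg (· ∈ pullbackIdeal (Scheme.IdealSheafData.vanishingIdeal
    (properTransform g Z A)) (T'.fromSpecStalk x)) hV).mp ?_
  refine germ_mem_pullbackIdeal_vanishingIdeal _ x V _ _ fun y hy hyA hye => ?_
  have h2 : IsUnit ((T'.presheaf.germ W₂ y (iV hy)).hom e₂) := by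
    have h3 := (Scheme.mem_basicOpen (X := T') _ y hy).1 hye
    rwa [T'.presheaf.germ_res_apply (homOfLE iV) y hy e₂] at h3
  have hyU : y ∈ U.1 := i₀ (k.le hy.2)
  have h3 : IsUnit ((T'.presheaf.germ U.1 y hyU).hom s) := by
    refine (Scheme.mem_basicOpen (X := T') _ y hyU).1 ?_
    by_contra h4
    have h5 : y ∈ (I.comap g).support := by
      rw [Scheme.IdealSheafData.mem_support_iff_of_mem (U := U) hyU, Scheme.mem_zeroLocus_iff, hs]
      intro a ha
      obtain ⟨b, rfl⟩ := Ideal.mem_span_singleton.1 ha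
      rw [Scheme.basicOpen_mul]
      exact fun h => h4 h.1
    rw [Scheme.IdealSheafData.support_comap, hZ] at h5
    exact hyA.2 h5
  rw [hk y hy.2] at h3
  have h4 := (isUnit_of_mul_isUnit_left h3).mul h2
  have h5 : y ∈ T'.basicOpen e₁ := by
    refine (Scheme.mem_basicOpen (X := T') _ y (i₁ (j.le hy.1))).2 ?_
    rw [hj y hy.1]
    exact h4
  refine hv y (i₁ (j.le hy.1)) ?_ h5
  rw [Scheme.IdealSheafData.support_comap, hA]
  exact hyA.1

/-! ### The chart of the second blow-up -/

namespace axisRing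

lemma axisHom_monoHom_aeval (k A l B : ℕ) (P : Polynomial ℂ) :
    axisHom (monoHom k A l B (Polynomial.aeval (MvPolynomial.X 0) P)) = P := by
  rw [← Polynomial.aeval_algHom_apply]
  have : monoHom k A l B (MvPolynomial.X 0) = MvPolynomial.X 0 := by simp [monoHom]
  rw [this, axisHom_aeval]

lemma exists_monoHom : ∃ m : axisRing →+* axisRing, IsLocalHom m ∧
    ∀ p, m (algebraMap _ _ p) = algebraMap _ _ (monoHom 1 1 1 0 p) := by
  refine exists_hom ((algebraMap _ _).comp (monoHom 1 1 1 0).toRingHom) ?_ ?_ fun P hP => ?_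
  · refine mt isUnit_algebraMap_iff.1 (not_not.2 ?_)
    simp [mem_axisIdeal, axisHom, monoHom]
  · refine mt isUnit_algebraMap_iff.1 (not_not.2 ?_)
    simp [mem_axisIdeal, axisHom, monoHom]
  · exact isUnit_algebraMap_iff.2 fun h => hP ((axisHom_monoHom_aeval _ _ _ _ P).symm.trans h)

lemma exists_monoHom_toricDVR (k l : ℕ) {A B : ℕ} (hA : 0 < A) (hB : 0 < B) :
    ∃ m : axisRing →+* toricDVR, IsLocalHom m ∧
      ∀ p, m (algebraMap _ _ p) = algebraMap (MvPolynomial (Fin 3) ℂ) _ (monoHom k A l B p) := by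
  refine exists_hom ((algebraMap (MvPolynomial (Fin 3) ℂ) toricDVR).comp
    (monoHom k A l B).toRingHom) ?_ ?_ fun P hP => ?_
  · refine mt toricDVR.isUnit_algebraMap_iff.1 (not_not.2 ?_)
    have : monoHom k A l B (MvPolynomial.X 1) = MvPolynomial.X 1 ^ k * MvPolynomial.X 2 ^ A := by
      simp [monoHom]
    exact (congrArg (MvPolynomial.X 2 ∣ ·) this).mpr ((dvd_pow_self _ hA.ne').mul_left _)
  · refine mt toricDVR.isUnit_algebraMap_iff.1 (not_not.2 ?_)
    have : monoHom k A l B (MvPolynomial.X 2) = MvPolynomial.X 1 ^ l * MvPolynomial.X 2 ^ B := by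
      simp [monoHom]
    exact (congrArg (MvPolynomial.X 2 ∣ ·) this).mpr ((dvd_pow_self _ hB.ne').mul_left _)
  · refine toricDVR.isUnit_algebraMap_iff.2 fun h => hP ?_
    rw [← axisHom_monoHom_aeval k A l B P]
    obtain ⟨q, hq⟩ := h
    refine (congrArg axisHom hq).trans ?_
    simp [axisHom]

lemma isPrime_span : (Ideal.span {algebraMap (MvPolynomial (Fin 3) ℂ) axisRing
    (MvPolynomial.X 2)}).IsPrime ∧ algebraMap (MvPolynomial (Fin 3) ℂ) axisRing (MvPolynomial.X 1) ∉
      Ideal.span {algebraMap (MvPolynomial (Fin 3) ℂ) axisRing (MvPolynomial.X 2)} := by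
  have h1 : (Ideal.span {(MvPolynomial.X 2 : MvPolynomial (Fin 3) ℂ)}).IsPrime :=
    inferInstance
  have h2 : Disjoint (axisIdeal.primeCompl : Set (MvPolynomial (Fin 3) ℂ))
      (Ideal.span {(MvPolynomial.X 2 : MvPolynomial (Fin 3) ℂ)} : Set _) := by
    refine Set.disjoint_left.2 fun p hp hp2 => hp ?_
    rw [axisIdeal_eq_span]
    exact Ideal.span_mono (by simp) hp2
  have h3 := IsLocalization.isPrime_of_isPrime_disjoint axisIdeal.primeCompl axisRing _ h1 h2
  have h4 := IsLocalization.under_map_of_isPrime_disjoint axisIdeal.primeCompl axisRing h1 h2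
  rw [Ideal.map_span, Set.image_singleton] at h3 h4
  refine ⟨h3, fun h5 => ?_⟩
  have h6 : (MvPolynomial.X 1 : MvPolynomial (Fin 3) ℂ) ∈ Ideal.span {MvPolynomial.X 2} := by
    rw [← h4]
    exact h5
  obtain ⟨q, hq⟩ := Ideal.mem_span_singleton.1 h6
  have h7 := congrArg (MvPolynomial.eval ![0, 1, 0]) hq
  simp at h7

end axisRing

end

section

section

variable {X : Scheme.{0}} [X.Over SpecC] [IsIntegral X] [IsLocallyNoetherian X] {i : X ⟶ PPP}
  [i.IsOver SpecC] [IsClosedImmersion i] {X₁ : Scheme.{0}} [X₁.Over SpecC] {f : X₁ ⟶ X}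
  [f.IsOver SpecC] [IsIntegral X₁]

lemma monoHom_X_one (k A l B : ℕ) :
    monoHom k A l B (MvPolynomial.X 1) = MvPolynomial.X 1 ^ k * MvPolynomial.X 2 ^ A := by
  simp [monoHom]

lemma monoHom_X_two (k A l B : ℕ) :
    monoHom k A l B (MvPolynomial.X 2) = MvPolynomial.X 1 ^ l * MvPolynomial.X 2 ^ B := by
  simp [monoHom]

lemma exists_toricHom_eq {M : Matrix (Fin 2) (Fin 2) ℂ} (hM : M.det ≠ 0) (k A l B : ℕ)
    (l' : Fin 2) : ∃ a b : ℂ, toricHom M k A l B (MvPolynomial.C a *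
      (MvPolynomial.X 0 - MvPolynomial.X 1) + MvPolynomial.C b *
      (MvPolynomial.X 0 - MvPolynomial.X 2)) = monoHom k A l B (MvPolynomial.X l'.succ) := by
  have h1 : M⁻¹ * M = 1 := Matrix.nonsing_inv_mul M hM.isUnit
  refine ⟨M⁻¹ l' 0, M⁻¹ l' 1, congrArg (monoHom k A l B) ?_⟩
  have h2 : ∀ b, M⁻¹ l' 0 * M 0 b + M⁻¹ l' 1 * M 1 b = (1 : Matrix (Fin 2) (Fin 2) ℂ) l' b := by
    intro b
    rw [← h1, Matrix.mul_apply, Fin.sum_univ_two]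
  have h3 : ∀ b, (MvPolynomial.C (M⁻¹ l' 0) * MvPolynomial.C (M 0 b) +
      MvPolynomial.C (M⁻¹ l' 1) * MvPolynomial.C (M 1 b) : MvPolynomial (Fin 3) ℂ) =
      MvPolynomial.C ((1 : Matrix (Fin 2) (Fin 2) ℂ) l' b) := by
    intro b
    rw [← h2, MvPolynomial.C_add, MvPolynomial.C_mul, MvPolynomial.C_mul]
  change linHom M _ = _
  have e : linHom M (MvPolynomial.C (M⁻¹ l' 0) * (MvPolynomial.X 0 - MvPolynomial.X 1) +
      MvPolynomial.C (M⁻¹ l' 1) * (MvPolynomial.X 0 - MvPolynomial.X 2)) =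
      MvPolynomial.C (M⁻¹ l' 0) * (MvPolynomial.C (M 0 0) * MvPolynomial.X 1 +
        MvPolynomial.C (M 0 1) * MvPolynomial.X 2) +
      MvPolynomial.C (M⁻¹ l' 1) * (MvPolynomial.C (M 1 0) * MvPolynomial.X 1 +
        MvPolynomial.C (M 1 1) * MvPolynomial.X 2) := by
    simp [linHom, MvPolynomial.algHom_C, MvPolynomial.algebraMap_eq]
  rw [e]
  have h30 := h3 0
  have h31 := h3 1
  obtain rfl | rfl : l' = 0 ∨ l' = 1 := by omega
  · simp at h30 h31 ⊢
    linear_combination MvPolynomial.X 1 * h30 + MvPolynomial.X 2 * h31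
  · simp at h30 h31 ⊢
    linear_combination MvPolynomial.X 1 * h30 + MvPolynomial.X 2 * h31

/-- The point of `X₁` with values in the local ring of an axis given by coordinates at the generic
point of an invariant curve in `E`. -/
lemma AxisCoords.exists_point (hX : i.ker = idealX) (hf : IsBlowup f (idealC i)) {c : X₁}
    {β : HomCoord → X₁.presheaf.stalk c}
    (hβ : (PPPcoords.comp i).HasTuple (X₁.fromSpecStalk c ≫ f) β) (hn : Chart.c000.Normalized β)
    {M : Matrix (Fin 2) (Fin 2) ℂ} {ψ : MvPolynomial (Fin 3) ℂ →+* X₁.presheaf.stalk c}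
    (h : AxisCoords (Chart.c000.hom (stalkConst X₁ c).hom β) M ψ) :
    ∃ (v : Spec (CommRingCat.of axisRing) ⟶ X₁)
      (φ : X₁.presheaf.stalk c ⟶ CommRingCat.of axisRing),
      (v ≫ f) ≫ X ↘ SpecC = Spec.map (CommRingCat.ofHom (((algebraMap (MvPolynomial (Fin 3) ℂ) axisRing).comp
        (toricHom M 1 0 1 1).toRingHom).comp MvPolynomial.C)) ∧
      (PPPcoords.comp i).HasTuple (v ≫ f) (Chart.c000.tuple fun l =>
        algebraMap (MvPolynomial (Fin 3) ℂ) axisRing (toricHom M 1 0 1 1 (MvPolynomial.X l))) ∧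
      pullbackIdeal (idealC i) (v ≫ f) =
        Ideal.span {algebraMap (MvPolynomial (Fin 3) ℂ) axisRing (MvPolynomial.X 1)} ∧
      Spec.map φ ≫ X₁.fromSpecStalk c = v ∧ IsLocalHom φ.hom ∧
      φ.hom (ψ (MvPolynomial.X 1)) = algebraMap (MvPolynomial (Fin 3) ℂ) axisRing (MvPolynomial.X 1) ∧
      φ.hom (ψ (MvPolynomial.X 2)) = algebraMap (MvPolynomial (Fin 3) ℂ) axisRing (MvPolynomial.X 2) ∧
      IsLocalRing.maximalIdeal (X₁.presheaf.stalk c) =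
        Ideal.span {ψ (MvPolynomial.X 1), ψ (MvPolynomial.X 2)} := by
  obtain ⟨F⟩ := hf.isModel.nonempty_fieldCoords hX
  let al : MvPolynomial (Fin 3) ℂ →+* axisRing :=
    (algebraMap (MvPolynomial (Fin 3) ℂ) axisRing).comp (toricHom M 1 0 1 1).toRingHom
  have hal : ∀ p, al p = algebraMap (MvPolynomial (Fin 3) ℂ) axisRing (toricHom M 1 0 1 1 p) := fun p => rfl
  obtain ⟨u, hu, hu'⟩ := Chart.c000.exists_point (i := i) (B := CommRingCat.of axisRing) hX al
  have hw : al (MvPolynomial.X 0 - MvPolynomial.X 1) ∈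
      Ideal.span {algebraMap (MvPolynomial (Fin 3) ℂ) axisRing (MvPolynomial.X 1)} ∧
      al (MvPolynomial.X 0 - MvPolynomial.X 2) ∈
      Ideal.span {algebraMap (MvPolynomial (Fin 3) ℂ) axisRing (MvPolynomial.X 1)} := by
    simp only [Ideal.mem_span_singleton, hal]
    constructor
    · refine map_dvd _ ⟨MvPolynomial.C (M 0 0) + MvPolynomial.C (M 0 1) * MvPolynomial.X 2, ?_⟩
      simp [toricHom, linHom, monoHom, MvPolynomial.algHom_C, MvPolynomial.algebraMap_eq]
      ring
    · refine map_dvd _ ⟨MvPolynomial.C (M 1 0) + MvPolynomial.C (M 1 1) * MvPolynomial.X 2, ?_⟩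
      simp [toricHom, linHom, monoHom, MvPolynomial.algHom_C, MvPolynomial.algebraMap_eq]
      ring
  have h1 : pullbackIdeal (idealC i) u =
      Ideal.span {algebraMap (MvPolynomial (Fin 3) ℂ) axisRing (MvPolynomial.X 1)} := by
    have h2 : pullbackIdeal (idealC i) u = Ideal.span {al (MvPolynomial.X 0 - MvPolynomial.X 1),
        al (MvPolynomial.X 0 - MvPolynomial.X 2)} := by
      rw [pullbackIdeal_idealC hu',
        idealEq_of_normalized (Chart.c000.normalized_tuple _) (Chart.c000.formX_tuple _)]
      simp [Chart.tuple, Chart.c000]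
    rw [h2]
    apply le_antisymm
    · rw [Ideal.span_le]
      rintro x (rfl | rfl)
      exacts [hw.1, hw.2]
    · obtain ⟨a, b, hab⟩ := exists_toricHom_eq h.det_ne_zero 1 0 1 1 0
      rw [Ideal.span_le, Set.singleton_subset_iff]
      refine Ideal.mem_span_pair.2 ⟨al (MvPolynomial.C a), al (MvPolynomial.C b), ?_⟩
      rw [← map_mul, ← map_mul, ← map_add, hal, hab]
      exact congrArg _ ((monoHom_X_one _ _ _ _).trans (by rw [pow_one, pow_zero, mul_one]))
  have hX1 : algebraMap (MvPolynomial (Fin 3) ℂ) axisRing (MvPolynomial.X 1) ≠ 0 := fun h0 =>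
    MvPolynomial.X_ne_zero 1 (axisRing.algebraMap_injective (h0.trans (map_zero _).symm))
  obtain ⟨v, rfl⟩ := hf.exists_lift (B := CommRingCat.of axisRing) u hX1 h1
  obtain ⟨l, hl, hlψ⟩ := axisRing.exists_hom ψ h.one h.two h.units
  have hlal : ∀ p, l (al p) = Chart.c000.hom (stalkConst X₁ c).hom β p := fun p =>
    (hlψ _).trans (h.eq p).symm
  have hlv := hf.isModel.map_comp_eq hX F hβ hn hu hu' (CommRingCat.ofHom l) hlal
  have hl' : IsLocalHom (CommRingCat.ofHom l).hom := hl
  obtain ⟨φ, hφ, hφv, hret⟩ := exists_retraction (B := CommRingCat.of axisRing) v c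
    (CommRingCat.ofHom l) hlv
  have hret' : ∀ z, l (φ.hom z) = z := fun z => congrArg (fun χ => χ.hom z) hret
  have hφh : ∀ p, φ.hom (Chart.c000.hom (stalkConst X₁ c).hom β p) = al p := fun p =>
    Chart.c000.map_hom_eq (c := PPPcoords.comp i) (fromSpecStalk_comp_over c) hβ hn hu hu' φ
      ((Category.assoc _ _ _).symm.trans (congrArg (· ≫ f) hφv)) p
  have hφψ : ∀ p q, toricHom M 1 0 1 1 p = q → φ.hom (ψ q) = algebraMap (MvPolynomial (Fin 3) ℂ) axisRing q := by
    rintro p q rfl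
    rw [← h.eq, hφh, hal]
  have hφ1 : φ.hom (ψ (MvPolynomial.X 1)) = algebraMap (MvPolynomial (Fin 3) ℂ) axisRing (MvPolynomial.X 1) := by
    obtain ⟨a, b, hab⟩ := exists_toricHom_eq h.det_ne_zero 1 0 1 1 0
    have h2 := hφψ _ _ hab
    have h3 : monoHom 1 0 1 1 (MvPolynomial.X (Fin.succ 0)) = MvPolynomial.X 1 :=
      (monoHom_X_one _ _ _ _).trans (by rw [pow_one, pow_zero, mul_one])
    rwa [h3] at h2
  have hφ2 : φ.hom (ψ (MvPolynomial.X 2)) = algebraMap (MvPolynomial (Fin 3) ℂ) axisRing (MvPolynomial.X 2) := by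
    obtain ⟨a, b, hab⟩ := exists_toricHom_eq h.det_ne_zero 1 0 1 1 1
    have h2 := hφψ _ _ hab
    have h3 : monoHom 1 0 1 1 (MvPolynomial.X (Fin.succ 1)) = MvPolynomial.X 1 * MvPolynomial.X 2 :=
      (monoHom_X_two _ _ _ _).trans (by rw [pow_one, pow_one])
    rw [h3, map_mul, map_mul, map_mul, hφ1] at h2
    exact mul_left_cancel₀ hX1 h2
  refine ⟨v, φ, hu, hu', h1, hφv, hφ, hφ1, hφ2, le_antisymm (fun z hz => ?_) ?_⟩
  · have h2 : φ.hom z ∈ IsLocalRing.maximalIdeal axisRing := by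
      rw [IsLocalRing.mem_maximalIdeal, mem_nonunits_iff] at hz ⊢
      exact fun h3 => hz (hφ.map_nonunit _ h3)
    rw [axisRing.maximalIdeal_eq] at h2
    obtain ⟨x, y, hxy⟩ := Ideal.mem_span_pair.1 h2
    refine Ideal.mem_span_pair.2 ⟨l x, l y, ?_⟩
    rw [← hlψ, ← hlψ, ← map_mul, ← map_mul, ← map_add, hxy, hret']
  · rw [Ideal.span_le]
    rintro x (rfl | rfl)
    exacts [(IsLocalRing.mem_maximalIdeal _).2 h.one, (IsLocalRing.mem_maximalIdeal _).2 h.two]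

end

end

section

section

variable {X : Scheme.{0}} {i : X ⟶ PPP} {X₁ : Scheme.{0}} {f : X₁ ⟶ X} {C' : Closeds X₁}
  {X₂ : Scheme.{0}} {g : X₂ ⟶ X₁}

lemma idealC'_eq_of_isGenericPoint {c : X₁} (hc : IsGenericPoint c (C' : Set X₁)) :
    pullbackIdeal (idealC' C') (X₁.fromSpecStalk c) =
      IsLocalRing.maximalIdeal (X₁.presheaf.stalk c) := by
  have h : C' = Closeds.closure {c} := Closeds.ext hc.symm
  rw [idealC', h]
  exact pullbackIdeal_vanishingIdeal_closure_singleton c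

lemma support_idealC' : (idealC' C').support = C' :=
  Closeds.ext (Scheme.IdealSheafData.coe_support_vanishingIdeal _)

/-- The local ring of `X₂` at the generic point of the intersection of `R'` and `Ê`. -/
lemma IsBlowup.exists_point_of_axisPoint {c : X₁} (hc : IsGenericPoint c (C' : Set X₁))
    (hg : IsBlowup g (idealC' C')) {v : Spec (CommRingCat.of axisRing) ⟶ X₁}
    {φ : X₁.presheaf.stalk c ⟶ CommRingCat.of axisRing} [hφ : IsLocalHom φ.hom]
    (hv : pullbackIdeal (idealC i) (v ≫ f) =
      Ideal.span {algebraMap (MvPolynomial (Fin 3) ℂ) axisRing (MvPolynomial.X 1)})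
    (hφv : Spec.map φ ≫ X₁.fromSpecStalk c = v) {x y : X₁.presheaf.stalk c}
    (hx : φ.hom x = algebraMap (MvPolynomial (Fin 3) ℂ) axisRing (MvPolynomial.X 1))
    (hy : φ.hom y = algebraMap (MvPolynomial (Fin 3) ℂ) axisRing (MvPolynomial.X 2))
    (hmax : IsLocalRing.maximalIdeal (X₁.presheaf.stalk c) = Ideal.span {x, y})
    (hxE : x ∈ pullbackIdeal (idealC i) (X₁.fromSpecStalk c ≫ f)) :
    ∃ (m : axisRing →+* axisRing) (w : Spec (CommRingCat.of axisRing) ⟶ X₂) (x₂ : X₂)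
      (φ₂ : X₂.presheaf.stalk x₂ ⟶ CommRingCat.of axisRing) (r e : X₂.presheaf.stalk x₂),
      (∀ p, m (algebraMap _ _ p) = algebraMap _ _ (monoHom 1 1 1 0 p)) ∧
      w ≫ g = Spec.map (CommRingCat.ofHom m) ≫ v ∧
      IsLocalHom φ₂.hom ∧ Spec.map φ₂ ≫ X₂.fromSpecStalk x₂ = w ∧
      φ₂.hom r = algebraMap (MvPolynomial (Fin 3) ℂ) axisRing (MvPolynomial.X 1) ∧
      φ₂.hom e = algebraMap (MvPolynomial (Fin 3) ℂ) axisRing (MvPolynomial.X 2) ∧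
      pullbackIdeal (idealR' C' g) (X₂.fromSpecStalk x₂) = Ideal.span {r} ∧
      e ∈ pullbackIdeal (idealEhat i f C' g) (X₂.fromSpecStalk x₂) ∧
      pullbackIdeal (idealEhat i f C' g) w =
        Ideal.span {algebraMap (MvPolynomial (Fin 3) ℂ) axisRing (MvPolynomial.X 2)} := by
  let alg := algebraMap (MvPolynomial (Fin 3) ℂ) axisRing
  obtain ⟨m, hm, hmp⟩ := axisRing.exists_monoHom
  have hm1 : m (alg (MvPolynomial.X 1)) = alg (MvPolynomial.X 1) * alg (MvPolynomial.X 2) := by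
    refine (hmp _).trans ?_
    rw [monoHom_X_one, pow_one, pow_one, map_mul]
  have hm2 : m (alg (MvPolynomial.X 2)) = alg (MvPolynomial.X 1) := by
    refine (hmp _).trans ?_
    rw [monoHom_X_two, pow_one, pow_zero, mul_one]
  have hX1 : alg (MvPolynomial.X 1) ≠ 0 := fun h0 =>
    MvPolynomial.X_ne_zero 1 (axisRing.algebraMap_injective (h0.trans (map_zero _).symm))
  have hpv : pullbackIdeal (idealC' C') v = Ideal.span {alg (MvPolynomial.X 1), alg (MvPolynomial.X 2)} := by
    rw [← hφv, pullbackIdeal_map, idealC'_eq_of_isGenericPoint hc, hmax, Ideal.map_span,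
      Set.image_pair, hx, hy]
  have hpu : pullbackIdeal (idealC' C') (Spec.map (CommRingCat.ofHom m) ≫ v) =
      Ideal.span {alg (MvPolynomial.X 1)} := by
    rw [pullbackIdeal_map, hpv]
    refine (Ideal.map_span m _).trans ?_
    rw [Set.image_pair, hm1, hm2]
    apply le_antisymm
    · rw [Ideal.span_le]
      rintro z (rfl | rfl)
      · exact Ideal.mul_mem_right _ _ (Ideal.mem_span_singleton_self _)
      · exact Ideal.mem_span_singleton_self _
    · exact Ideal.span_mono (by simp)
  obtain ⟨w, hw⟩ := hg.exists_lift (B := CommRingCat.of axisRing) _ hX1 hpu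
  obtain ⟨x₂, hx₂⟩ : ∃ x₂, w (IsLocalRing.closedPoint (CommRingCat.of axisRing)) = x₂ := ⟨_, rfl⟩
  obtain ⟨φ₂, hφ₂, hφ₂w⟩ := exists_stalk_hom w hx₂
  obtain ⟨φ₁, hφ₁, hφ₁g⟩ := exists_stalk_hom (x := c)
    (X₂.fromSpecStalk x₂ ≫ g) (by
      refine (Scheme.Hom.comp_apply _ g _).trans ?_
      rw [Scheme.fromSpecStalk_closedPoint, ← hx₂]
      refine (Scheme.Hom.comp_apply w g _).symm.trans ?_
      rw [hw, ← hφv]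
      have h1 := closedPoint_of_isLocalHom (φ : X₁.presheaf.stalk c ⟶ CommRingCat.of axisRing)
      have hm' : IsLocalHom (CommRingCat.ofHom m).hom := hm
      have h2 := closedPoint_of_isLocalHom (CommRingCat.ofHom m)
      refine (Scheme.Hom.comp_apply _ _ _).trans ?_
      refine (congrArg (Spec.map φ ≫ X₁.fromSpecStalk c) h2).trans ?_
      refine (Scheme.Hom.comp_apply _ _ _).trans ?_
      exact (congrArg (X₁.fromSpecStalk c) h1).trans Scheme.fromSpecStalk_closedPoint)
  have hcomp : φ₁ ≫ φ₂ = φ ≫ CommRingCat.ofHom m := by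
    refine Spec.map_injective ?_
    rw [← cancel_mono (X₁.fromSpecStalk c), Spec.map_comp, Spec.map_comp, Category.assoc,
      Category.assoc, hφ₁g, hφv, ← Category.assoc, hφ₂w, hw]
  have hcomp' : ∀ z, φ₂.hom (φ₁.hom z) = m (φ.hom z) := fun z => congrArg (fun χ => χ.hom z) hcomp
  have h2y : φ₂.hom (φ₁.hom y) = alg (MvPolynomial.X 1) :=
    (hcomp' y).trans ((congrArg m hy).trans hm2)
  have h2x : φ₂.hom (φ₁.hom x) = alg (MvPolynomial.X 1) * alg (MvPolynomial.X 2) :=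
    (hcomp' x).trans ((congrArg m hx).trans hm1)
  obtain ⟨ρ, hρ⟩ := hg.exists_eq_span (X₂.fromSpecStalk x₂)
  have hspan : Ideal.span {ρ} = Ideal.span {φ₁.hom x, φ₁.hom y} := by
    rw [← hρ, ← hφ₁g, pullbackIdeal_map, idealC'_eq_of_isGenericPoint hc, hmax, Ideal.map_span,
      Set.image_pair]
  have hy2 : φ₁.hom y ∈ Ideal.span {ρ} := hspan ▸ Ideal.subset_span (.inr rfl)
  have hx2 : φ₁.hom x ∈ Ideal.span {ρ} := hspan ▸ Ideal.subset_span (.inl rfl)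
  obtain ⟨u, hu⟩ := Ideal.mem_span_singleton.1 hy2
  have hρ2 : φ₂.hom ρ ∈ Ideal.span {alg (MvPolynomial.X 1)} := by
    rw [← hpu, ← hw, ← hφ₂w, Category.assoc, pullbackIdeal_map, hρ]
    exact Ideal.mem_map_of_mem _ (Ideal.mem_span_singleton_self _)
  obtain ⟨z, hz⟩ := Ideal.mem_span_singleton.1 hρ2
  have huu : IsUnit u := by
    refine hφ₂.map_nonunit _ (IsUnit.of_mul_eq_one z (mul_left_cancel₀ hX1 ?_))
    have h3 := congrArg φ₂.hom hu
    rw [map_mul, h2y, hz] at h3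
    linear_combination -h3
  have hρy : Ideal.span {ρ} = Ideal.span {φ₁.hom y} := by
    rw [hu]
    exact (Ideal.span_singleton_mul_right_unit huu ρ).symm
  rw [hρy] at hx2 hρ
  obtain ⟨e, he⟩ := Ideal.mem_span_singleton.1 hx2
  have h2e : φ₂.hom e = alg (MvPolynomial.X 2) := by
    have h3 := congrArg φ₂.hom he
    rw [map_mul, h2x, h2y] at h3
    exact (mul_left_cancel₀ hX1 h3).symm
  have hmemE : e ∈ pullbackIdeal (idealEhat i f C' g)
      (X₂.fromSpecStalk x₂) := by
    refine mem_pullbackIdeal_properTransform (J := (idealC i).comap f) support_idealC' rfl hg.1 _ hρ ?_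
    rw [← he, pullbackIdeal_comap, ← hφ₁g, Category.assoc, pullbackIdeal_map]
    exact Ideal.mem_map_of_mem _ hxE
  refine ⟨m, w, _, φ₂, φ₁.hom y, e, hmp, hw, hφ₂, hφ₂w, h2y, h2e, ?_, hmemE, le_antisymm ?_ ?_⟩
  · rw [idealR', pullbackIdeal_comap, hρ]
  · have hprime := axisRing.isPrime_span
    let 𝔭 : Spec (CommRingCat.of axisRing) := ⟨Ideal.span {alg (MvPolynomial.X 2)}, hprime.1⟩
    refine (mem_support_iff_pullbackIdeal_le _ w 𝔭).1 ?_
    have hE : g (w 𝔭) ∈ surfaceE i f := by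
      have h3 : (w ≫ g) 𝔭 ∈ ((idealC i).comap f).support := by
        rw [mem_support_iff_pullbackIdeal_le, pullbackIdeal_comap, hw, Category.assoc,
          pullbackIdeal_map, hv]
        refine (Ideal.map_span m _).trans_le ?_
        rw [Set.image_singleton, Ideal.span_le, Set.singleton_subset_iff, hm1]
        exact Ideal.mul_mem_left _ _ (Ideal.mem_span_singleton_self _)
      exact (Scheme.Hom.comp_apply w g 𝔭) ▸ h3
    have hC : g (w 𝔭) ∉ C' := by
      intro h3
      have h4 : (w ≫ g) 𝔭 ∈ (idealC' C').support := by
        rw [support_idealC']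
        exact (Scheme.Hom.comp_apply w g 𝔭).symm ▸ h3
      rw [mem_support_iff_pullbackIdeal_le, hw, hpu] at h4
      exact hprime.2 (h4 (Ideal.mem_span_singleton_self _))
    have h5 : w 𝔭 ∈ ((idealEhat i f C' g).support : Set X₂) := by
      rw [idealEhat, Scheme.IdealSheafData.coe_support_vanishingIdeal]
      exact subset_closure ⟨hE, hC⟩
    exact h5
  · rw [Ideal.span_le, Set.singleton_subset_iff, ← hφ₂w, pullbackIdeal_map]
    exact h2e ▸ Ideal.mem_map_of_mem _ hmemE

end

end

section

lemma exists_bezout {a b : ℕ} (ha : 0 < a) (hb : 0 < b) (h : Nat.Coprime a b) :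
    ∃ i k j, a = i + k ∧ a * j = b * i + 1 := by
  rcases Nat.lt_or_ge 1 b with h1 | h1
  · obtain ⟨j, hj, h2⟩ := Nat.exists_mul_mod_eq_one_of_coprime h h1
    have h3 := Nat.div_add_mod (a * j) b
    rw [h2] at h3
    have h4 : a * j / b ≤ a := by
      refine Nat.div_le_of_le_mul ?_
      rw [mul_comm b]
      exact Nat.mul_le_mul_left _ hj.le
    exact ⟨a * j / b, a - a * j / b, j, by omega, h3.symm⟩
  · exact ⟨a - 1, 1, 1, by omega, by
      obtain rfl : b = 1 := by omega
      omega⟩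

/-- The coordinates on the exceptional surface of a weighted blow-up. -/
lemma exists_preimage_of_weighted {O : Type} [CommRing O] {φ : O →+* toricDVR} [IsLocalHom φ]
    {r e : O} {i k j a b n : ℕ} (hij : (i + k) * j = b * i + 1) (hak : a = i + k)
    (hr : φ r = algebraMap (MvPolynomial (Fin 3) ℂ) toricDVR
      (MvPolynomial.X 1 ^ i * MvPolynomial.X 2 ^ a))
    (he : φ e = algebraMap (MvPolynomial (Fin 3) ℂ) toricDVR
      (MvPolynomial.X 1 ^ j * MvPolynomial.X 2 ^ b))
    {W : Ideal O} {w : O} (hw : W = Ideal.span {w})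
    (hW : ∀ p q, a * ((n + 1) * b) ≤ a * p + b * q → r ^ p * e ^ q ∈ W)
    (hWφ : ∀ z ∈ W, algebraMap (MvPolynomial (Fin 3) ℂ) toricDVR
      (MvPolynomial.X 2 ^ (a * ((n + 1) * b))) ∣ φ z) :
    ∀ l, l = 1 ∨ l = 2 → ∃ z, φ z = algebraMap (MvPolynomial (Fin 3) ℂ) toricDVR (MvPolynomial.X l) := by
  set alg := algebraMap (MvPolynomial (Fin 3) ℂ) toricDVR
  have hne : ∀ l, alg (MvPolynomial.X l) ≠ 0 := fun l h0 =>
    MvPolynomial.X_ne_zero l (toricDVR.algebraMap_injective (h0.trans (map_zero _).symm))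
  simp only [map_mul, map_pow] at hr he hWφ
  have h1 : r ^ ((n + 1) * b) ∈ W := by
    have := hW ((n + 1) * b) 0 (by simp)
    rwa [pow_zero, mul_one] at this
  obtain ⟨z, hz⟩ := Ideal.mem_span_singleton.1 (hw ▸ h1)
  obtain ⟨y, hy⟩ := hWφ w (hw ▸ Ideal.mem_span_singleton_self w)
  have hzu : IsUnit z := by
    refine isUnit_of_map_unit φ z (isUnit_of_dvd_unit ⟨y, ?_⟩
      ((toricDVR.isUnit_X_one.pow (i * ((n + 1) * b)))))
    have h2 := congrArg φ hz
    rw [map_pow, map_mul, hr, hy, mul_pow, ← pow_mul, ← pow_mul] at h2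
    refine mul_left_cancel₀ (pow_ne_zero (a * ((n + 1) * b)) (hne 2)) ?_
    linear_combination h2
  have hW2 : W = Ideal.span {r ^ ((n + 1) * b)} := by
    rw [hw, hz, Ideal.span_singleton_mul_right_unit hzu]
  have key : ∀ p q s, i * p + j * q = i * ((n + 1) * b) + 1 → a * p + b * q = a * ((n + 1) * b) + s →
      ∃ y, φ y = alg (MvPolynomial.X 1) * alg (MvPolynomial.X 2) ^ s := fun p q s h1 h2 => by
    obtain ⟨y, hy⟩ := Ideal.mem_span_singleton.1 (hW2 ▸ hW p q (by omega))
    refine ⟨y, ?_⟩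
    have h3 := congrArg φ hy
    simp only [map_mul, map_pow, hr, he, mul_pow, ← pow_mul] at h3
    have h4 : alg (MvPolynomial.X 1) ^ (i * p + j * q) * alg (MvPolynomial.X 2) ^ (a * p + b * q) =
        alg (MvPolynomial.X 1) ^ (i * ((n + 1) * b)) * alg (MvPolynomial.X 2) ^ (a * ((n + 1) * b)) *
          φ y := by
      rw [← h3, pow_add, pow_add]
      ring
    rw [h1, h2] at h4
    refine (mul_left_cancel₀ (mul_ne_zero (pow_ne_zero (i * ((n + 1) * b)) (hne 1))
      (pow_ne_zero (a * ((n + 1) * b)) (hne 2))) ?_).symm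
    rw [← h4, pow_add, pow_add]
    ring
  subst hak
  obtain ⟨y₁, hy₁⟩ := key (n * b) (i + k) 0 (by linear_combination hij) (by ring)
  obtain ⟨y₂, hy₂⟩ := key (n * b + j) k 1 (by linear_combination hij) (by linear_combination hij)
  rw [pow_zero, mul_one] at hy₁
  have hy₁u : IsUnit y₁ := isUnit_of_map_unit φ y₁ (hy₁ ▸ toricDVR.isUnit_X_one)
  obtain ⟨u, hu⟩ := hy₁u.exists_right_inv
  rintro l (rfl | rfl)
  · exact ⟨y₁, hy₁⟩
  · refine ⟨u * y₂, ?_⟩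
    have h3 := congrArg φ hu
    rw [map_mul, map_one, hy₁] at h3
    rw [map_mul, hy₂]
    linear_combination alg (MvPolynomial.X 2) * h3

section

variable {X : Scheme.{0}} [X.Over SpecC] [IsIntegral X] [IsLocallyNoetherian X] {i : X ⟶ PPP}
  [i.IsOver SpecC] [IsClosedImmersion i] {X₁ : Scheme.{0}} [X₁.Over SpecC] [IsIntegral X₁]
  [IsLocallyNoetherian X₁] {f : X₁ ⟶ X} [f.IsOver SpecC] {C' : Closeds X₁} {X₂ : Scheme.{0}}
  {g : X₂ ⟶ X₁} {Y : Scheme.{0}} [Y.Over SpecC] [IsIntegral Y] [IsLocallyNoetherian Y] {ν : Y ⟶ X₂}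
  [((ν ≫ g) ≫ f).IsOver SpecC]

lemma monoHom_comp_toricHom (M : Matrix (Fin 2) (Fin 2) ℂ) (i a j b : ℕ)
    (p : MvPolynomial (Fin 3) ℂ) :
    monoHom i a j b (toricHom M 1 1 2 1 p) =
      toricHom M (i + j) (a + b) (2 * i + j) (2 * a + b) p := by
  refine congrArg (fun χ : MvPolynomial (Fin 3) ℂ →ₐ[ℂ] MvPolynomial (Fin 3) ℂ => χ (linHom M p))
    (?_ : (monoHom i a j b).comp (monoHom 1 1 2 1) =
      monoHom (i + j) (a + b) (2 * i + j) (2 * a + b))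
  refine MvPolynomial.algHom_ext fun l => ?_
  fin_cases l
  · simp [monoHom]
  · simp [monoHom]
    ring
  · simp [monoHom]
    ring

lemma monoHom_comp_toricHom_one (M : Matrix (Fin 2) (Fin 2) ℂ) (p : MvPolynomial (Fin 3) ℂ) :
    monoHom 1 1 1 0 (toricHom M 1 0 1 1 p) = toricHom M 1 1 2 1 p := by
  refine congrArg (fun χ : MvPolynomial (Fin 3) ℂ →ₐ[ℂ] MvPolynomial (Fin 3) ℂ => χ (linHom M p))
    (?_ : (monoHom 1 1 1 0).comp (monoHom 1 0 1 1) = monoHom 1 1 2 1)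
  refine MvPolynomial.algHom_ext fun l => ?_
  fin_cases l
  · simp [monoHom]
  · simp [monoHom]
  · simp [monoHom]
    ring

/-- Coordinates at the generic point of the intersection of `R'` and `Ê`. -/
lemma exists_axisPoint (hX : i.ker = idealX) (hf : IsBlowup f (idealC i))
    {ξE : X₁} (hξE : IsGenericPoint ξE (surfaceE i f : Set X₁)) (hC' : IsCurveC' i f C')
    (hg : IsBlowup g (idealC' C')) (hne : ((idealEhat i f C' g).support : Set X₂).Nonempty) :
    ∃ (M : Matrix (Fin 2) (Fin 2) ℂ) (w : Spec (CommRingCat.of axisRing) ⟶ X₂) (x₂ : X₂)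
      (φ₂ : X₂.presheaf.stalk x₂ ⟶ CommRingCat.of axisRing) (r e : X₂.presheaf.stalk x₂),
      M.det ≠ 0 ∧ (w ≫ g ≫ f) ≫ X ↘ SpecC = Spec.map (CommRingCat.ofHom
        (((algebraMap (MvPolynomial (Fin 3) ℂ) axisRing).comp
          (toricHom M 1 1 2 1).toRingHom).comp MvPolynomial.C)) ∧
      (PPPcoords.comp i).HasTuple (w ≫ g ≫ f) (Chart.c000.tuple fun l =>
        algebraMap (MvPolynomial (Fin 3) ℂ) axisRing (toricHom M 1 1 2 1 (MvPolynomial.X l))) ∧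
      pullbackIdeal (idealC i) (w ≫ g ≫ f) = Ideal.span
        {algebraMap (MvPolynomial (Fin 3) ℂ) axisRing (MvPolynomial.X 1 * MvPolynomial.X 2)} ∧
      IsLocalHom φ₂.hom ∧ Spec.map φ₂ ≫ X₂.fromSpecStalk x₂ = w ∧
      φ₂.hom r = algebraMap (MvPolynomial (Fin 3) ℂ) axisRing (MvPolynomial.X 1) ∧
      φ₂.hom e = algebraMap (MvPolynomial (Fin 3) ℂ) axisRing (MvPolynomial.X 2) ∧
      pullbackIdeal (idealR' C' g) (X₂.fromSpecStalk x₂) = Ideal.span {r} ∧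
      e ∈ pullbackIdeal (idealEhat i f C' g) (X₂.fromSpecStalk x₂) ∧
      pullbackIdeal (idealEhat i f C' g) w =
        Ideal.span {algebraMap (MvPolynomial (Fin 3) ℂ) axisRing (MvPolynomial.X 2)} := by
  obtain ⟨c, hc⟩ := (QuasiSober.sober hC'.2.1 C'.isClosed : ∃ c, IsGenericPoint c (C' : Set X₁))
  have hcE : c ∈ surfaceE i f := hC'.1 hc.mem
  have hne : ξE ≠ c := by
    rintro rfl
    have h1 : C' = surfaceE i f := Closeds.ext (hc.symm.trans hξE)
    rw [idealEhat, Scheme.IdealSheafData.coe_support_vanishingIdeal, h1] at hne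
    have h3 : (properTransform g (surfaceE i f) (surfaceE i f) : Set X₂) = ∅ := by
      change closure _ = _
      simp
    exact hne.ne_empty h3
  obtain ⟨β, hβ, hn, M, ψ, hψ⟩ := hf.exists_axisCoords hX hC'.2.2.2.1 hc hcE hξE hne
  obtain ⟨v, φ, hv, hv', hvC, hφv, hφ, hφ1, hφ2, hmax⟩ := hψ.exists_point hX hf hβ hn
  have hxE : ψ (MvPolynomial.X 1) ∈ pullbackIdeal (idealC i) (X₁.fromSpecStalk c ≫ f) := by
    rw [Chart.pullbackIdeal_idealC_hom hX hβ hn]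
    obtain ⟨p, q, hpq⟩ := exists_toricHom_eq hψ.det_ne_zero 1 0 1 1 0
    have h3 : monoHom 1 0 1 1 (MvPolynomial.X (Fin.succ 0)) = MvPolynomial.X 1 :=
      (monoHom_X_one _ _ _ _).trans (by rw [pow_one, pow_zero, mul_one])
    refine Ideal.mem_span_pair.2 ⟨Chart.c000.hom (stalkConst X₁ c).hom β (MvPolynomial.C p),
      Chart.c000.hom (stalkConst X₁ c).hom β (MvPolynomial.C q), ?_⟩
    rw [← map_mul, ← map_mul, ← map_add, hψ.eq, hpq, h3]
  obtain ⟨m, w, x₂, φ₂, r, e, hm, hwg, h⟩ :=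
    hg.exists_point_of_axisPoint hc hvC hφv hφ1 hφ2 hmax hxE
  have hwX : w ≫ g ≫ f = Spec.map (CommRingCat.ofHom m) ≫ v ≫ f := by
    rw [← Category.assoc w, hwg, Category.assoc]
  have hm' : ∀ p, m (algebraMap (MvPolynomial (Fin 3) ℂ) axisRing (toricHom M 1 0 1 1 p)) =
      algebraMap (MvPolynomial (Fin 3) ℂ) axisRing (toricHom M 1 1 2 1 p) := fun p => by
    rw [hm, monoHom_comp_toricHom_one]
  refine ⟨M, w, x₂, φ₂, r, e, hψ.det_ne_zero, ?_, ?_, ?_, h⟩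
  · rw [hwX, Category.assoc, hv, ← Spec.map_comp]
    congr 1
    ext p
    exact hm' (MvPolynomial.C p)
  · have h1 := (hv'.comp (CommRingCat.ofHom m)).congr hwX.symm
    convert h1 using 1
    funext h'
    refine Eq.symm ((Chart.c000.map_tuple m _ h').trans ?_)
    refine congrArg (fun z => Chart.c000.tuple z h') ?_
    funext l
    exact hm' _
  · rw [hwX, pullbackIdeal_map, hvC]
    refine (Ideal.map_span m _).trans ?_
    rw [Set.image_singleton, hm, monoHom_X_one, pow_one, pow_one]

lemma FieldCoords.map_genericPoint_notMem {T : Scheme.{0}} {η : Y ⟶ T} {θ : T ⟶ X₁}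
    [((η ≫ θ) ≫ f).IsOver SpecC] (F : FieldCoords i ((η ≫ θ) ≫ f)) (hC' : C' ≤ surfaceE i f) :
    η (genericPoint Y) ∉ (idealR' C' θ).support := by
  intro h1
  have h2 : (Y.fromSpecStalk (genericPoint Y) ≫ η) (IsLocalRing.closedPoint _) ∈
      (idealR' C' θ).support :=
    (congrArg (· ∈ (idealR' C' θ).support) ((Scheme.Hom.comp_apply _ η _).trans
      (congrArg η Scheme.fromSpecStalk_closedPoint))).mpr h1
  rw [closedPoint_mem_support_iff, idealR', pullbackIdeal_comap] at h2
  have h3 := pullbackIdeal_idealC'_ne_bot (B := Y.functionField) hC'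
    ((Y.fromSpecStalk (genericPoint Y) ≫ η) ≫ θ) (by
      simpa only [Category.assoc] using F.pullbackIdeal_ne_bot (genericPoint Y))
  exact h3 (le_bot_iff.1 (h2.trans_eq (IsLocalRing.maximalIdeal_eq_bot (R := Y.functionField))))

/-- The coordinates on the exceptional surface of the weighted blow-up are regular. -/
lemma exists_preimage_of_isWeightedBlowup {I J : X₂.IdealSheafData} {a b n a' b' i₀ j₀ k₀ : ℕ}
    (hν : IsWeightedBlowup ν I J a b) (ha' : a = a' * (n + 1)) (hb' : b = b' * (n + 1))
    (hik : a' = i₀ + k₀) (hij : a' * j₀ = b' * i₀ + 1)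
    {w : Spec (CommRingCat.of axisRing) ⟶ X₂} {x₂ : X₂}
    {φ₂ : X₂.presheaf.stalk x₂ ⟶ CommRingCat.of axisRing} {r e : X₂.presheaf.stalk x₂}
    (hφ₂w : Spec.map φ₂ ≫ X₂.fromSpecStalk x₂ = w)
    (h2r : φ₂.hom r = algebraMap (MvPolynomial (Fin 3) ℂ) axisRing (MvPolynomial.X 1))
    (h2e : φ₂.hom e = algebraMap (MvPolynomial (Fin 3) ℂ) axisRing (MvPolynomial.X 2))
    (hR : pullbackIdeal I (X₂.fromSpecStalk x₂) = Ideal.span {r})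
    (he : e ∈ pullbackIdeal J (X₂.fromSpecStalk x₂))
    (hEw : pullbackIdeal J w =
      Ideal.span {algebraMap (MvPolynomial (Fin 3) ℂ) axisRing (MvPolynomial.X 2)})
    {mV : axisRing →+* toricDVR} (hmVp : ∀ p, mV (algebraMap (MvPolynomial (Fin 3) ℂ) axisRing p) =
      algebraMap (MvPolynomial (Fin 3) ℂ) toricDVR (monoHom i₀ a' j₀ b' p))
    {y : Spec (CommRingCat.of toricDVR) ⟶ Y}
    (hy : y ≫ ν = Spec.map (CommRingCat.ofHom mV) ≫ w) {Q : Y}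
    {χ : Y.presheaf.stalk Q ⟶ CommRingCat.of toricDVR} [IsLocalHom χ.hom]
    (hχy : Spec.map χ ≫ Y.fromSpecStalk Q = y) {q : X₂.presheaf.stalk x₂ ⟶ Y.presheaf.stalk Q}
    (hqν : Spec.map q ≫ X₂.fromSpecStalk x₂ = Y.fromSpecStalk Q ≫ ν) :
    ∀ l, l = 1 ∨ l = 2 →
      ∃ z, χ.hom z = algebraMap (MvPolynomial (Fin 3) ℂ) toricDVR (MvPolynomial.X l) := by
  let mV' : CommRingCat.of axisRing ⟶ CommRingCat.of toricDVR := CommRingCat.ofHom mV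
  have hcomp : q ≫ χ = φ₂ ≫ mV' := by
    refine Spec.map_injective ?_
    rw [← cancel_mono (X₂.fromSpecStalk x₂), Spec.map_comp, Spec.map_comp, Category.assoc,
      Category.assoc, hqν, hφ₂w, ← Category.assoc, hχy, hy]
  have hcomp' : ∀ z, χ.hom (q.hom z) = mV (φ₂.hom z) := fun z => congrArg (fun χ => χ.hom z) hcomp
  have hQr : χ.hom (q.hom r) = algebraMap (MvPolynomial (Fin 3) ℂ) toricDVR
      (MvPolynomial.X 1 ^ i₀ * MvPolynomial.X 2 ^ a') := by
    rw [hcomp', h2r, hmVp, monoHom_X_one]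
  have hQe : χ.hom (q.hom e) = algebraMap (MvPolynomial (Fin 3) ℂ) toricDVR
      (MvPolynomial.X 1 ^ j₀ * MvPolynomial.X 2 ^ b') := by
    rw [hcomp', h2e, hmVp, monoHom_X_two]
  obtain ⟨ω, hω⟩ := IsBlowup.exists_eq_span hν (Y.fromSpecStalk Q)
  have hab : a * b = (n + 1) * (a' * ((n + 1) * b')) := by rw [ha', hb']; ring
  have hdeg : ∀ p q, a * b ≤ a * p + b * q ↔ a' * ((n + 1) * b') ≤ a' * p + b' * q := fun p q => by
    have : a * p + b * q = (n + 1) * (a' * p + b' * q) := by rw [ha', hb']; ring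
    rw [this, hab]
    exact Nat.mul_le_mul_left_iff (Nat.succ_pos n)
  exact exists_preimage_of_weighted (φ := χ.hom) (r := q.hom r) (e := q.hom e) (n := n)
    (hik ▸ hij) hik hQr hQe hω (fun p q' hpq => by
      rw [pullbackIdeal_weightedIdeal]
      refine Ideal.mem_sSup_of_mem (Set.mem_range_self ⟨(p, q'), (hdeg p q').2 hpq⟩) ?_
      rw [← hqν, pullbackIdeal_map, pullbackIdeal_map]
      refine Ideal.mul_mem_mul (Ideal.pow_mem_pow (Ideal.mem_map_of_mem _ ?_) _)
        (Ideal.pow_mem_pow (Ideal.mem_map_of_mem _ he) _)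
      rw [hR]
      exact Ideal.mem_span_singleton_self _) (fun z hz => by
      have h1 : χ.hom z ∈ pullbackIdeal (weightedIdeal I J a b (a * b))
          (y ≫ ν) := by
        rw [← hχy, Category.assoc, pullbackIdeal_map]
        exact Ideal.mem_map_of_mem _ hz
      rw [hy, pullbackIdeal_weightedIdeal] at h1
      refine Ideal.mem_span_singleton.1 ((iSup_le fun p => ?_ : _ ≤ Ideal.span
        {algebraMap (MvPolynomial (Fin 3) ℂ) toricDVR (MvPolynomial.X 2 ^ (a' * ((n + 1) * b')))}) h1)
      have h2 : pullbackIdeal I (Spec.map mV' ≫ w) = Ideal.span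
          {algebraMap (MvPolynomial (Fin 3) ℂ) toricDVR
            (MvPolynomial.X 1 ^ i₀ * MvPolynomial.X 2 ^ a')} := by
        rw [← hφ₂w, pullbackIdeal_map, pullbackIdeal_map, hR, Ideal.map_span, Ideal.map_span,
          Set.image_singleton, Set.image_singleton, h2r, ← monoHom_X_one i₀ a' j₀ b', ← hmVp]
        rfl
      have h3 : pullbackIdeal J (Spec.map mV' ≫ w) = Ideal.span
          {algebraMap (MvPolynomial (Fin 3) ℂ) toricDVR
            (MvPolynomial.X 1 ^ j₀ * MvPolynomial.X 2 ^ b')} := by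
        rw [pullbackIdeal_map, hEw, Ideal.map_span, Set.image_singleton,
          ← monoHom_X_two i₀ a' j₀ b', ← hmVp]
        rfl
      rw [h2, h3, Ideal.span_singleton_pow, Ideal.span_singleton_pow,
        Ideal.span_singleton_mul_span_singleton, Ideal.span_singleton_le_span_singleton,
        ← map_pow, ← map_pow, ← map_mul]
      refine map_dvd _ ?_
      have h4 := (hdeg _ _).1 p.2
      refine (pow_dvd_pow _ h4).trans ⟨MvPolynomial.X 1 ^ (i₀ * p.1.1 + j₀ * p.1.2), ?_⟩
      rw [mul_pow, mul_pow, ← pow_mul, ← pow_mul, ← pow_mul, ← pow_mul, pow_add, pow_add]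
      ring)

/-- The exceptional surface of the weighted blow-up is given by monomial coordinates. -/
lemma exists_isToricPoint (hX : i.ker = idealX) (hf : IsBlowup f (idealC i))
    {ξE : X₁} (hξE : IsGenericPoint ξE (surfaceE i f : Set X₁)) (hC' : IsCurveC' i f C')
    (hg : IsBlowup g (idealC' C')) {a b : ℕ} (ha : 0 < a) (hb : 0 < b)
    (hν : IsWeightedBlowup ν (idealR' C' g) (idealEhat i f C' g) a b)
    {ξF : Y} (hξF : IsGenericPoint ξF
      (ν ⁻¹' (((idealEhat i f C' g).support : Set X₂) ∩ (idealR' C' g).support))) :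
    ∃ M k A l B, M.det ≠ 0 ∧ IsToricPoint i ((ν ≫ g) ≫ f) (toricHom M k A l B) ξF ∧
      k * B ≠ l * A ∧ 1 ≤ A ∧ A ≤ B ∧ B < 2 * A ∧ B ≤ 2 * a + b := by
  obtain ⟨M, w, x₂, φ₂, r, e, hM, hwX, hwX', hwC, hφ₂, hφ₂w, h2r, h2e, hR, he, hEw⟩ :=
    exists_axisPoint hX hf hξE hC' hg ⟨_, hξF.mem.1⟩
  obtain ⟨d, a', b', hd, hcop, ha', hb'⟩ := Nat.exists_coprime' (m := a) (n := b) (Nat.gcd_pos_of_pos_left _ ha)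
  have ha'0 : 0 < a' := Nat.pos_of_ne_zero fun h => by simp [h] at ha'; omega
  have hb'0 : 0 < b' := Nat.pos_of_ne_zero fun h => by simp [h] at hb'; omega
  obtain ⟨i₀, k₀, j₀, hik, hij⟩ := exists_bezout ha'0 hb'0 hcop
  obtain ⟨n, rfl⟩ : ∃ n, d = n + 1 := ⟨d - 1, by omega⟩
  obtain ⟨mV, hmV, hmVp⟩ := axisRing.exists_monoHom_toricDVR i₀ j₀ ha'0 hb'0
  let mV' : CommRingCat.of axisRing ⟶ CommRingCat.of toricDVR := CommRingCat.ofHom mV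
  have hX1 : ∀ l, algebraMap (MvPolynomial (Fin 3) ℂ) toricDVR (MvPolynomial.X l) ≠ 0 := fun l h0 =>
    MvPolynomial.X_ne_zero l (toricDVR.algebraMap_injective (h0.trans (map_zero _).symm))
  obtain ⟨δ, hδM⟩ : ∃ δ, δ = toricHom M (i₀ + j₀) (a' + b') (2 * i₀ + j₀) (2 * a' + b') := ⟨_, rfl⟩
  have hδ : ∀ p, mV (algebraMap (MvPolynomial (Fin 3) ℂ) axisRing (toricHom M 1 1 2 1 p)) =
      algebraMap (MvPolynomial (Fin 3) ℂ) toricDVR (δ p) := fun p => by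
    rw [hmVp, monoHom_comp_toricHom, hδM]
  have hdet : (i₀ + j₀) * (2 * a' + b') ≠ (2 * i₀ + j₀) * (a' + b') := by
    intro h
    have : (i₀ + j₀) * (2 * a' + b') = (2 * i₀ + j₀) * (a' + b') + 1 := by linear_combination hij
    omega
  have hCne : pullbackIdeal (idealC i) ((Spec.map mV' ≫ w) ≫ g ≫ f) ≠ ⊥ := by
    rw [Category.assoc, pullbackIdeal_map, hwC]
    intro h
    have h1 : mV (algebraMap (MvPolynomial (Fin 3) ℂ) axisRing
        (MvPolynomial.X 1 * MvPolynomial.X 2)) = 0 :=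
      (Ideal.mem_bot).1 (h ▸ Ideal.mem_map_of_mem mV'.hom (Ideal.mem_span_singleton_self _))
    rw [hmVp, map_mul, monoHom_X_one, monoHom_X_two] at h1
    simp only [map_mul, map_pow] at h1
    simp [hX1] at h1
  obtain ⟨y, hy⟩ := hν.exists_lift_of_isPrincipalIdealRing (B := CommRingCat.of toricDVR)
    (Spec.map mV' ≫ w) (pullbackIdeal_weightedIdeal_ne_bot hC'.1 _ a b _ hCne)
  have hmodel := hf.isModel.comp_weightedBlowup hC'.1 hg hν
  obtain ⟨F⟩ := hmodel.nonempty_fieldCoords hX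
  obtain ⟨Q, hQ⟩ : ∃ Q, y (IsLocalRing.closedPoint (CommRingCat.of toricDVR)) = Q := ⟨_, rfl⟩
  obtain ⟨al, hal⟩ : ∃ al : MvPolynomial (Fin 3) ℂ →+* toricDVR,
      ∀ p, al p = algebraMap (MvPolynomial (Fin 3) ℂ) toricDVR (δ p) :=
    ⟨(algebraMap (MvPolynomial (Fin 3) ℂ) toricDVR).comp δ.toRingHom, fun p => rfl⟩
  have halinj : Function.Injective al := fun p p' h => by
    rw [hal, hal, hδM] at h
    exact toricHom_injective hM hdet (toricDVR.algebraMap_injective h)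
  have hyX : y ≫ (ν ≫ g) ≫ f = Spec.map mV' ≫ w ≫ g ≫ f := by
    rw [← Category.assoc _ w, ← hy]
    simp only [Category.assoc]
  have hyover : (y ≫ (ν ≫ g) ≫ f) ≫ X ↘ SpecC =
      Spec.map (CommRingCat.ofHom (al.comp MvPolynomial.C)) := by
    rw [hyX, Category.assoc, hwX, ← Spec.map_comp]
    congr 1
    ext p
    exact (hδ (MvPolynomial.C p)).trans (hal _).symm
  have hytuple : (PPPcoords.comp i).HasTuple (y ≫ (ν ≫ g) ≫ f)
      (Chart.c000.tuple fun l => al (MvPolynomial.X l)) := by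
    have h1 := (hwX'.comp mV').congr hyX.symm
    convert h1 using 1
    funext h'
    refine Eq.symm ((Chart.c000.map_tuple mV _ h').trans ?_)
    refine congrArg (fun z => Chart.c000.tuple z h') ?_
    funext l
    exact (hδ _).trans (hal _).symm
  obtain ⟨γ, hγ, hγn, χ, hχ, hχinj, hχy, hχp⟩ := F.exists_dominated (B := CommRingCat.of toricDVR)
    (κ := Chart.c000) hX halinj hyover hytuple hQ
  have hx₂ : w (IsLocalRing.closedPoint (CommRingCat.of axisRing)) = x₂ := by
    rw [← hφ₂w]
    refine (Scheme.Hom.comp_apply _ _ _).trans ?_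
    exact (congrArg (X₂.fromSpecStalk x₂) (closedPoint_of_isLocalHom φ₂)).trans
      Scheme.fromSpecStalk_closedPoint
  have hνQ : ν Q = x₂ := by
    have h1 : (y ≫ ν) (IsLocalRing.closedPoint (CommRingCat.of toricDVR)) = x₂ := by
      rw [hy, ← hx₂]
      have hmV' : IsLocalHom mV'.hom := hmV
      refine (Scheme.Hom.comp_apply _ _ _).trans ?_
      exact congrArg w (closedPoint_of_isLocalHom mV')
    rw [← h1, ← hQ]
    exact (Scheme.Hom.comp_apply y ν _).symm
  obtain ⟨q, hq, hqν⟩ := exists_stalk_hom (x := x₂) (Y.fromSpecStalk Q ≫ ν) (by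
    refine (Scheme.Hom.comp_apply _ ν _).trans ?_
    rw [Scheme.fromSpecStalk_closedPoint, hνQ])
  have hX12 := exists_preimage_of_isWeightedBlowup hν ha' hb' hik hij hφ₂w h2r h2e hR he hEw hmVp hy
    hχy hqν
  have htoric : IsToricPoint i ((ν ≫ g) ≫ f) δ Q := by
    refine IsToricPoint.of_dominated hγ hγn χ hχ hχinj
      (fun p => (hχp p).trans (hal p)) fun l => ?_
    rcases (by omega : l = 0 ∨ l = 1 ∨ l = 2) with rfl | h
    · refine ⟨_, ((hχp (MvPolynomial.X 0)).trans (hal _)).trans ?_⟩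
      refine congrArg (algebraMap (MvPolynomial (Fin 3) ℂ) toricDVR) ?_
      simp [hδM, toricHom, linHom, monoHom]
    · exact hX12 l h
  have hξQ : ξF = Q := by
    refine eq_of_isGenericPoint hξF htoric.isDiscreteValuationRing ?_ ?_
    · have hmax := axisRing.maximalIdeal_eq
      rw [Set.mem_preimage, hνQ, ← hx₂]
      constructor
      · refine (closedPoint_mem_support_iff _ w).2 (hEw.trans_le (le_trans ?_ hmax.ge))
        exact Ideal.span_mono (by simp)
      · have hRw : pullbackIdeal (idealR' C' g) w = Ideal.span
            {algebraMap (MvPolynomial (Fin 3) ℂ) axisRing (MvPolynomial.X 1)} := by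
          rw [← hφ₂w, pullbackIdeal_map, hR, Ideal.map_span, Set.image_singleton, h2r]
        refine (closedPoint_mem_support_iff _ w).2 (hRw.trans_le (le_trans ?_ hmax.ge))
        exact Ideal.span_mono (by simp)
    · exact fun h1 => F.map_genericPoint_notMem hC'.1 h1.2
  rw [hξQ]
  exact ⟨M, _, _, _, _, hM, hδM ▸ htoric, hdet, by omega, by omega, by omega, by
    rw [ha', hb']
    nlinarith⟩

end

end

section

/-! ### Leading terms of sections of `-m K_X` along `E` -/

section LeadingTerms

open MvPolynomial (X C)

/-- The field of fractions of the coordinate ring of a coordinate plane. -/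
abbrev planeField : Type := FractionRing (Polynomial (Polynomial ℂ))

/-- The inclusion of the coefficients. -/
abbrev planeC : Polynomial ℂ →+* planeField :=
  (algebraMap (Polynomial (Polynomial ℂ)) planeField).comp Polynomial.C

lemma exists_residueHom : ∃ ρ : toricDVR →+* planeField,
    ∀ p, ρ (algebraMap (MvPolynomial (Fin 3) ℂ) _ p) = algebraMap _ _ (planeHom p) := by
  obtain ⟨ρ, -, hρ⟩ := exists_toricDVR_hom (ψ := (algebraMap _ planeField).comp planeHom.toRingHom)
    (fun h => h.ne_zero (by simp [planeHom])) (fun P hP => IsUnit.mk0 _ fun h =>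
      hP (dvd_of_planeHom_eq_zero (IsFractionRing.injective _ planeField (h.trans (map_zero _).symm))))
  exact ⟨ρ, hρ⟩

lemma natDegree_add_le_of_eval₂_inv {c c' : Polynomial (Polynomial ℂ)} (hc : c ≠ 0) {n l : ℕ}
    {ε : planeField} (hε : ε = 1 ∨ ε = -1)
    (h : c.eval₂ planeC
      (algebraMap (Polynomial (Polynomial ℂ)) planeField Polynomial.X)⁻¹ * algebraMap (Polynomial (Polynomial ℂ)) planeField Polynomial.X ^ n =
        ε * algebraMap (Polynomial (Polynomial ℂ)) planeField Polynomial.X ^ l * algebraMap _ planeField c') :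
    c.natDegree + l ≤ n := by
  set T := algebraMap (Polynomial (Polynomial ℂ)) planeField Polynomial.X with hT
  have hT0 : T ≠ 0 := fun h0 => Polynomial.X_ne_zero
    (IsFractionRing.injective _ planeField (h0.trans (map_zero _).symm))
  by_contra hlt
  let inv : Invertible T⁻¹ := invertibleOfNonzero (inv_ne_zero hT0)
  have h1 := Polynomial.eval₂_reverse_mul_pow planeC T⁻¹ c
  rw [invOf_eq_inv, inv_inv] at h1
  have h2 : ∀ q : Polynomial (Polynomial ℂ), q.eval₂ planeC T =
      algebraMap _ planeField q := fun q => by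
    rw [hT, ← Polynomial.hom_eval₂, Polynomial.eval₂_C_X]
  rw [h2] at h1
  have h3 : algebraMap _ planeField c.reverse * T ^ n = ε * T ^ (l + c.natDegree) *
      algebraMap _ planeField c' := by
    rw [← h1, inv_pow] at h
    have h4 : T ^ c.natDegree ≠ 0 := pow_ne_zero _ hT0
    rw [pow_add]
    field_simp at h
    linear_combination h
  have h5 : ∃ c'' : Polynomial (Polynomial ℂ), c.reverse = Polynomial.X * c'' := by
    obtain ⟨r, hr⟩ : ∃ r, l + c.natDegree = n + (1 + r) := ⟨l + c.natDegree - n - 1, by omega⟩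
    rw [hr, pow_add, pow_add, pow_one] at h3
    have h6 : algebraMap _ planeField c.reverse = ε * (T * T ^ r) * algebraMap _ planeField c' :=
      mul_right_cancel₀ (pow_ne_zero n hT0) (by linear_combination h3)
    rcases hε with rfl | rfl
    · refine ⟨Polynomial.X ^ r * c', IsFractionRing.injective _ planeField ?_⟩
      rw [h6, map_mul, map_mul, map_pow]
      ring
    · refine ⟨-(Polynomial.X ^ r * c'), IsFractionRing.injective _ planeField ?_⟩
      rw [h6, map_mul, map_neg, map_mul, map_pow]
      ring
  obtain ⟨c'', hc''⟩ := h5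
  have h7 := congrArg (Polynomial.coeff · 0) hc''
  simp [hc] at h7

lemma exists_mul_of_X_pow_dvd {Φ : MvPolynomial (Fin 3) ℂ →+* toricDVR}
    {R p : MvPolynomial (Fin 3) ℂ} {k : ℕ} {θ ε : toricDVR}
    (hΦ : Φ (X 2) = algebraMap _ _ (X 2 : MvPolynomial (Fin 3) ℂ) * ε)
    (h : Φ (X 2 ^ k * R) * θ = algebraMap _ _ p) :
    ∃ R', Φ R * ε ^ k * θ = algebraMap (MvPolynomial (Fin 3) ℂ) _ R' := by
  rw [map_mul, map_pow, hΦ, mul_pow] at h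
  have h1 : algebraMap (MvPolynomial (Fin 3) ℂ) toricDVR p =
      algebraMap (MvPolynomial (Fin 3) ℂ) toricDVR (X 2) ^ k * (Φ R * ε ^ k * θ) := by
    rw [← h]
    ring
  obtain ⟨R', rfl⟩ := toricDVR.exists_eq_X_pow_mul_iff.1 ⟨_, h1⟩
  refine ⟨R', mul_left_cancel₀ (pow_ne_zero k toricDVR.irreducible_X.ne_zero) ?_⟩
  rw [← h1, map_mul, map_pow]

/-- Substitution of the inverse of a coordinate, on a coordinate plane. -/
lemma eval₂_planeHom {ψ : MvPolynomial (Fin 3) ℂ →+* planeField}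
    (hC : ∀ a, ψ (C a) = algebraMap (Polynomial (Polynomial ℂ)) planeField (Polynomial.C (Polynomial.C a)))
    (h1 : ψ (X 1) = algebraMap (Polynomial (Polynomial ℂ)) planeField (Polynomial.C Polynomial.X)) (h2 : ψ (X 2) = 0)
    (R : MvPolynomial (Fin 3) ℂ) :
    ψ R = (planeHom R).eval₂ planeC (ψ (X 0)) := by
  refine RingHom.congr_fun (f := ψ) (g := (Polynomial.eval₂RingHom
    planeC (ψ (X 0))).comp planeHom.toRingHom)
    (MvPolynomial.ringHom_ext (fun a => ?_) fun l => ?_) R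
  · have h3 : planeHom.toRingHom (C a) = Polynomial.C (Polynomial.C a) :=
      MvPolynomial.algHom_C planeHom a
    rw [RingHom.comp_apply, h3, hC]
    simp
  · rw [RingHom.comp_apply]
    fin_cases l
    · simp [planeHom]
    · simp [planeHom, h1]
    · simp [planeHom, h2]

/-- Homomorphisms from the field of rational functions, given in a chart. -/
lemma Chart.exists_hom_of_injective {κ : Chart} (hκ : IsLocalCoords κ.toLL) {K : Type} [Field K]
    {μ : MvPolynomial (Fin 3) ℂ →+* K} (hμ : Function.Injective μ) :
    ∃ Θ : LL →+* K, ∀ p, Θ (κ.toLL p) = μ p := by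
  let _ := κ.toLL.toAlgebra
  have : IsFractionRing (MvPolynomial (Fin 3) ℂ) LL := by
    refine (isLocalization_iff _ _).2 ⟨fun d => ?_, fun z => ?_, fun {a b} h => ?_⟩
    · exact IsUnit.mk0 _ ((map_ne_zero_iff _ hκ.inj).2 (nonZeroDivisors.ne_zero d.2))
    · obtain ⟨p, d, hd, h⟩ := hκ.surj z
      exact ⟨(p, ⟨d, mem_nonZeroDivisors_of_ne_zero fun h0 =>
        hd.ne_zero (by rw [h0, map_zero])⟩), h⟩
    · exact ⟨1, by rw [hκ.inj h]⟩
  exact ⟨IsFractionRing.lift hμ, fun p => IsFractionRing.lift_algebraMap hμ p⟩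

end LeadingTerms

end

section

section LeadingTerms

open MvPolynomial (X C)

lemma planeHom_monomial (e : Fin 3 →₀ ℕ) (a : ℂ) : planeHom (MvPolynomial.monomial e a) =
    if e 2 = 0 then Polynomial.monomial (e 0) (Polynomial.monomial (e 1) a) else 0 := by
  rw [planeHom, aeval_monomial_fin_three]
  rw [← Polynomial.C_mul_X_pow_eq_monomial, ← Polynomial.C_mul_X_pow_eq_monomial (n := e 1)]
  split_ifs with h
  · simp only [h, pow_zero, mul_one, Matrix.cons_val_zero, Matrix.cons_val_one, map_mul, map_pow,
      Polynomial.algebraMap_apply, Polynomial.algebraMap_eq]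
    ring
  · simp [h]

lemma coeff_planeHom (R : MvPolynomial (Fin 3) ℂ) (α γ : ℕ) :
    ((planeHom R).coeff α).coeff γ =
      R.coeff (Finsupp.single 0 α + Finsupp.single 1 γ) := by
  induction R using MvPolynomial.induction_on' with
  | add p q hp hq => simp [hp, hq]
  | monomial e a =>
    rw [planeHom_monomial, MvPolynomial.coeff_monomial]
    have key : e = Finsupp.single 0 α + Finsupp.single 1 γ ↔ e 2 = 0 ∧ e 0 = α ∧ e 1 = γ := by
      constructor
      · rintro rfl
        simp
      · rintro ⟨h2, h0, h1⟩
        ext l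
        fin_cases l <;> simp [h0, h1, h2]
    by_cases h2 : e 2 = 0
    · rw [if_pos h2, Polynomial.coeff_monomial]
      by_cases h0 : e 0 = α
      · simp [key, h2, h0, Polynomial.coeff_monomial]
      · simp [key, h2, h0]
    · simp [key, h2]

/-- The substitution `q ↦ q + r s`. -/
def shearHom (r : ℂ) : MvPolynomial (Fin 3) ℂ →ₐ[ℂ] MvPolynomial (Fin 3) ℂ :=
  MvPolynomial.aeval ![X 0, X 1, X 2 + C r * X 1]

lemma shearHom_neg_shearHom (r : ℂ) (P : MvPolynomial (Fin 3) ℂ) :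
    shearHom (-r) (shearHom r P) = P := by
  refine AlgHom.congr_fun (φ₁ := (shearHom (-r)).comp (shearHom r)) (φ₂ := AlgHom.id ℂ _)
    (MvPolynomial.algHom_ext fun l => ?_) P
  fin_cases l <;> simp [shearHom, MvPolynomial.algHom_C, MvPolynomial.algebraMap_eq]

/-- Bound for the exponents of a section in the chart `100`. -/
lemma le_of_mem_support_shearHom {K : Type} [Field K] [Algebra ℂ K]
    {θ : MvPolynomial (Fin 3) ℂ →ₐ[ℂ] K} (hθ : Function.Injective θ)
    {P p : MvPolynomial (Fin 3) ℂ} {m : ℕ}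
    (h : θ P = θ (X 0) ^ m * MvPolynomial.aeval
      ![(θ (X 0))⁻¹, θ (X 1), θ (X 0) * (θ (X 2) - θ (X 1))] p) {e : Fin 3 →₀ ℕ}
    (he : e ∈ (shearHom 1 P).support) : e 0 ≤ m + e 2 := by
  have hX0 : θ (X 0) ≠ 0 := (map_ne_zero_iff _ hθ).2 (MvPolynomial.X_ne_zero 0)
  set N := p.totalDegree with hN
  have h1 : X 0 ^ N * shearHom 1 P = ∑ f ∈ p.support, MvPolynomial.monomial
      (Finsupp.single 0 (N + m + f 2 - f 0) + Finsupp.single 1 (f 1) + Finsupp.single 2 (f 2))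
      (p.coeff f) := by
    have h2 : X 0 ^ N * P = shearHom (-1) (∑ f ∈ p.support, MvPolynomial.monomial
        (Finsupp.single 0 (N + m + f 2 - f 0) + Finsupp.single 1 (f 1) + Finsupp.single 2 (f 2))
        (p.coeff f)) := by
      refine hθ ?_
      rw [map_mul, map_pow, h]
      conv_lhs => rw [p.as_sum]
      rw [map_sum, map_sum, map_sum, Finset.mul_sum, Finset.mul_sum]
      refine Finset.sum_congr rfl fun f hf => ?_
      have h3 : f 0 ≤ N := (MvPolynomial.le_totalDegree hf).trans' (by
        rw [Finsupp.sum_fintype _ _ fun _ => rfl]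
        exact Finset.single_le_sum (f := fun l => f l) (fun _ _ => Nat.zero_le _)
          (Finset.mem_univ 0))
      rw [aeval_monomial_fin_three, shearHom, aeval_monomial_fin_three]
      simp only [Matrix.cons_val_zero, Matrix.cons_val_one, Matrix.cons_val, map_mul, map_pow,
        Finsupp.add_apply, Finsupp.single_apply]
      simp only [Fin.isValue, if_true, MvPolynomial.algebraMap_eq, map_add, map_neg, map_one,
        neg_mul, one_mul, MvPolynomial.algHom_C]
      simp only [Fin.reduceEq, if_false, add_zero, zero_add]
      have h4 : θ (X 0) ^ (N + m + f 2 - f 0) * θ (X 0) ^ f 0 = θ (X 0) ^ (N + m + f 2) := by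
        rw [← pow_add, Nat.sub_add_cancel (by omega)]
      rw [mul_pow, inv_pow]
      field_simp
      rw [← sub_eq_add_neg]
      rw [pow_add, pow_add] at h4
      linear_combination -(algebraMap ℂ K (p.coeff f)) * θ (X 1) ^ f 1 *
        (θ (X 2) - θ (X 1)) ^ f 2 * h4
    have h5 := congrArg (shearHom 1) h2
    rw [map_mul, map_pow] at h5
    have h6 := shearHom_neg_shearHom (-1) (∑ f ∈ p.support, MvPolynomial.monomial
        (Finsupp.single 0 (N + m + f 2 - f 0) + Finsupp.single 1 (f 1) + Finsupp.single 2 (f 2))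
        (p.coeff f))
    rw [neg_neg] at h6
    rw [h6] at h5
    simpa [shearHom] using h5
  have h7 := congrArg (MvPolynomial.coeff (Finsupp.single 0 N + e)) h1
  rw [MvPolynomial.X_pow_eq_monomial, MvPolynomial.coeff_monomial_mul, one_mul,
    MvPolynomial.coeff_sum] at h7
  have h8 : (shearHom 1 P).coeff e ≠ 0 := MvPolynomial.mem_support_iff.1 he
  rw [h7] at h8
  obtain ⟨f, hf, hfe⟩ := Finset.exists_ne_zero_of_sum_ne_zero h8
  rw [MvPolynomial.coeff_monomial] at hfe
  have h9 := (ite_ne_right_iff.1 hfe).1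
  have h10 := DFunLike.congr_fun h9 0
  have h11 := DFunLike.congr_fun h9 2
  simp at h10 h11
  omega

/-- A section vanishing along `C` vanishes along `q = s`. -/
lemma pow_dvd_of_X_pow_dvd_blowupHom {P : MvPolynomial (Fin 3) ℂ} {m k j : ℕ}
    (hP : ∀ e ∈ (shearHom 1 P).support, e 0 ≤ m + e 2) (hk : X 2 ^ k ∣ blowupHom P)
    (hj : ∀ γ < j, m + 2 * γ < k) : (X 2 - X 1) ^ j ∣ P := by
  by_cases hP0 : P = 0
  · rw [hP0]
    exact dvd_zero _
  have hQ0 : shearHom 1 P ≠ 0 := fun h => hP0 (by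
    rw [← shearHom_neg_shearHom 1 P, h, map_zero])
  obtain ⟨γ, Q, hQ, hPQ⟩ := (FiniteMultiplicity.of_not_isUnit
    (MvPolynomial.X_prime (i := (2 : Fin 3)) (R := ℂ)).not_isUnit hQ0).exists_eq_pow_mul_and_not_dvd
    |> fun ⟨c, hc, h⟩ => (⟨_, c, h, hc⟩ : ∃ γ Q, ¬ X 2 ∣ Q ∧ shearHom 1 P = X 2 ^ γ * Q)
  have hPγ : P = (X 2 - X 1) ^ γ * shearHom (-1) Q := by
    rw [← shearHom_neg_shearHom 1 P, hPQ, map_mul, map_pow]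
    simp [shearHom, sub_eq_add_neg]
  refine (pow_dvd_pow _ ?_).trans ⟨_, hPγ⟩
  by_contra hlt
  have hγ := hj γ (not_le.1 hlt)
  obtain ⟨ψ, hψ⟩ : ∃ ψ : MvPolynomial (Fin 3) ℂ →ₐ[ℂ] MvPolynomial (Fin 3) ℂ,
    ψ = MvPolynomial.aeval ![X 0, X 0 - X 2, X 2 * (1 - X 1)] := ⟨_, rfl⟩
  have h1 : ψ (shearHom 1 P) = blowupHom P := by
    refine AlgHom.congr_fun (φ₁ := ψ.comp (shearHom 1)) (MvPolynomial.algHom_ext fun l => ?_) P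
    rw [AlgHom.comp_apply, hψ]
    fin_cases l
    · simp [shearHom, blowupHom_zero]
    · have h := blowupHom_sub_one
      rw [map_sub, blowupHom_zero] at h
      simp [shearHom]
      linear_combination h
    · have h := blowupHom_sub_two
      rw [map_sub, blowupHom_zero] at h
      simp [shearHom]
      linear_combination h
  have hX : Prime (X 2 : MvPolynomial (Fin 3) ℂ) := MvPolynomial.X_prime
  have hX1 : ¬ (X 2 : MvPolynomial (Fin 3) ℂ) ∣ (1 - X 1) ^ γ := fun h => by
    have h2 := map_dvd (MvPolynomial.eval (0 : Fin 3 → ℂ)) (hX.dvd_of_dvd_pow h)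
    simp at h2
  have h2 : (X 2 : MvPolynomial (Fin 3) ℂ) ^ (k - γ) ∣ ψ Q := by
    refine hX.pow_dvd_of_dvd_mul_left _ hX1 ?_
    rw [← h1, hPQ, map_mul, map_pow, ← Nat.add_sub_cancel' (show γ ≤ k by omega), pow_add] at hk
    have h3 : ψ (X 2) = X 2 * (1 - X 1) := by simp [hψ]
    rw [h3, mul_pow, mul_assoc] at hk
    exact (mul_dvd_mul_iff_left (pow_ne_zero γ hX.ne_zero)).1 hk
  obtain ⟨χ, hχ⟩ : ∃ χ : MvPolynomial (Fin 3) ℂ →ₐ[ℂ] Polynomial (Polynomial ℂ),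
    χ = MvPolynomial.aeval ![Polynomial.X, 1, Polynomial.X - Polynomial.C Polynomial.X] := ⟨_, rfl⟩
  have h3 : χ (ψ Q) = planeHom Q := by
    refine AlgHom.congr_fun (φ₁ := χ.comp ψ) (MvPolynomial.algHom_ext fun l => ?_) Q
    rw [AlgHom.comp_apply, hψ, hχ]
    fin_cases l <;> simp [planeHom]
  have h4 := map_dvd χ h2
  rw [h3, map_pow] at h4
  have h5 : χ (X 2) = Polynomial.X - Polynomial.C Polynomial.X := by simp [hχ]
  rw [h5] at h4
  have h6 := Polynomial.natDegree_le_of_dvd h4 (mt dvd_of_planeHom_eq_zero hQ)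
  rw [Polynomial.natDegree_pow, Polynomial.natDegree_X_sub_C, mul_one] at h6
  have h7 : (planeHom Q).natDegree ≤ m + γ := by
    refine Polynomial.natDegree_le_iff_coeff_eq_zero.2 fun α hα => Polynomial.ext fun β => ?_
    rw [coeff_planeHom, Polynomial.coeff_zero]
    by_contra h8
    have h9 := hP (Finsupp.single 2 γ + (Finsupp.single 0 α + Finsupp.single 1 β)) (by
      rw [MvPolynomial.mem_support_iff, hPQ, MvPolynomial.X_pow_eq_monomial,
        MvPolynomial.coeff_monomial_mul, one_mul]
      exact h8)
    simp at h9
    omega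
  omega

end LeadingTerms

end

section

section LeadingTerms

open MvPolynomial (X C)

/-- The third homogeneous coordinate of the plane at the generic point. -/
def genZ : LL := (genCoord 0 + genCoord 1) * genCoord 2 - genCoord 0 * genCoord 1

lemma genCoord_ne_zero (l : Fin 3) : genCoord l ≠ 0 :=
  (map_ne_zero_iff _ (IsFractionRing.injective _ LL)).2 (MvPolynomial.X_ne_zero l)

lemma genZ_ne_zero : genZ ≠ 0 := by
  have h := genTuple_ne_zero (.inr (.inr 2))
  rw [genTuple_eq] at h
  exact h

lemma tauLL_c100 : tauLL 5 = (genCoord 0)⁻¹ := by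
  rw [tauLL, genTuple_eq]
  simp [chart, Chart.c100, Chart.tau]

lemma tauLL_c010 : tauLL 4 = (genCoord 1)⁻¹ := by
  rw [tauLL, genTuple_eq]
  simp [chart, Chart.c010, Chart.tau]

lemma tauLL_c112 : tauLL 2 = (genCoord 0 * genCoord 1 * genZ ^ 2)⁻¹ := by
  rw [tauLL, genTuple_eq]
  simp [chart, Chart.c112, Chart.tau, genZ]

lemma toLL_chart_X (a : Fin 8) : (fun l => (chart a).toLL (X l)) =
    ![![genCoord 0, genCoord 1, genCoord 2], ![genCoord 0, genCoord 1, (genCoord 2)⁻¹],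
      ![(genCoord 0)⁻¹, (genCoord 1)⁻¹, genCoord 2 * genZ⁻¹],
      ![(genCoord 0)⁻¹, (genCoord 1)⁻¹, genZ * (genCoord 2)⁻¹],
      ![genCoord 0, (genCoord 1)⁻¹, genCoord 1 * genCoord 2 - genCoord 0 * genCoord 1],
      ![(genCoord 0)⁻¹, genCoord 1, genCoord 0 * genCoord 2 - genCoord 0 * genCoord 1],
      ![genCoord 0, (genCoord 1)⁻¹, (genCoord 1 - genCoord 2) * ((genCoord 1)⁻¹ * genZ⁻¹)],
      ![(genCoord 0)⁻¹, genCoord 1, (genCoord 0 - genCoord 2) * ((genCoord 0)⁻¹ * genZ⁻¹)]] a := by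
  rw [funext (coord_toLL _), genTuple_eq]
  exact chart_coord a (genCoord_ne_zero 0) (genCoord_ne_zero 1) genZ_ne_zero

lemma toLL_eq_aeval (κ : Chart) (p : MvPolynomial (Fin 3) ℂ) :
    κ.toLL p = MvPolynomial.aeval (fun l => κ.toLL (X l)) p :=
  RingHom.congr_fun (f := κ.toLL) (g := (MvPolynomial.aeval fun l => κ.toLL (X l)).toRingHom)
    (MvPolynomial.ringHom_ext (fun a => (κ.hom_C _ _ a).trans
      (MvPolynomial.algHom_C (MvPolynomial.aeval fun l => κ.toLL (X l)) a).symm)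
      fun l => (MvPolynomial.aeval_X (R := ℂ) (fun l => κ.toLL (X l)) l).symm) p

lemma toLL_c000 : Chart.c000.toLL = algebraMap (MvPolynomial (Fin 3) ℂ) LL :=
  MvPolynomial.ringHom_ext (fun a => (Chart.c000.hom_C _ _ a).trans
    (IsScalarTower.algebraMap_apply ℂ (MvPolynomial (Fin 3) ℂ) LL a)) fun l => toLL_c000_X l

/-- The exchange of the two projective lines, in coordinates. -/
def swapHom : MvPolynomial (Fin 3) ℂ →ₐ[ℂ] MvPolynomial (Fin 3) ℂ :=
  MvPolynomial.aeval ![X 1, X 0, X 2]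

lemma swapHom_swapHom (P : MvPolynomial (Fin 3) ℂ) : swapHom (swapHom P) = P := by
  refine AlgHom.congr_fun (φ₁ := swapHom.comp swapHom) (φ₂ := AlgHom.id ℂ _)
    (MvPolynomial.algHom_ext fun l => ?_) P
  fin_cases l <;> simp [swapHom]

lemma X_pow_dvd_blowupHom_swapHom {P : MvPolynomial (Fin 3) ℂ} {k : ℕ}
    (h : X 2 ^ k ∣ blowupHom P) : X 2 ^ k ∣ blowupHom (swapHom P) := by
  obtain ⟨ζ, hζ⟩ : ∃ ζ : MvPolynomial (Fin 3) ℂ →ₐ[ℂ] MvPolynomial (Fin 3) ℂ,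
    ζ = MvPolynomial.aeval ![X 0 - X 2, 1 - X 1, -X 2] := ⟨_, rfl⟩
  have h1 : blowupHom (swapHom P) = ζ (blowupHom P) := by
    refine AlgHom.congr_fun (φ₁ := blowupHom.comp swapHom) (φ₂ := ζ.comp blowupHom)
      (MvPolynomial.algHom_ext fun l => ?_) P
    fin_cases l <;> simp [swapHom, hζ, toricHom, linHom, monoHom]
    ring
  have h2 := map_dvd ζ h
  rw [h1]
  have h3 : ζ (X 2) = -X 2 := by simp [hζ]
  rw [map_pow, h3, neg_pow] at h2
  exact (Dvd.intro_left _ rfl).trans h2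

lemma aeval_swapHom {K : Type} [CommRing K] [Algebra ℂ K] (x y z : K)
    (p : MvPolynomial (Fin 3) ℂ) : MvPolynomial.aeval ![x, y, z] (swapHom p) =
      MvPolynomial.aeval ![y, x, z] p := by
  refine AlgHom.congr_fun (φ₁ := (MvPolynomial.aeval ![x, y, z]).comp swapHom)
    (MvPolynomial.algHom_ext fun l => ?_) p
  fin_cases l <;> simp [swapHom]

/-- Sections vanishing along `C` to a high order vanish along `q = s`. -/
lemma pow_dvd_of_mem_antiCanSections {m k j : ℕ} {P : MvPolynomial (Fin 3) ℂ}
    (hP : Chart.c000.toLL P ∈ antiCanSections m) (hk : X 2 ^ k ∣ blowupHom P)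
    (hj : ∀ γ < j, m + 2 * γ < k) : (X 2 - X 1) ^ j ∣ P := by
  obtain ⟨p, hp⟩ := hP 5
  refine pow_dvd_of_X_pow_dvd_blowupHom (fun e he => le_of_mem_support_shearHom
    (θ := IsScalarTower.toAlgHom ℂ (MvPolynomial (Fin 3) ℂ) LL) (p := p)
    (IsFractionRing.injective _ LL) ?_ he) hk hj
  rw [tauLL_c100, toLL_c000, toLL_eq_aeval, toLL_chart_X, inv_pow,
    mul_inv_eq_iff_eq_mul₀ (pow_ne_zero _ (genCoord_ne_zero 0))] at hp
  refine hp.trans ((mul_comm _ _).trans ?_)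
  rw [mul_sub]
  rfl

/-- Sections vanishing along `C` to a high order vanish along `q = t`. -/
lemma pow_dvd_of_mem_antiCanSections' {m k j : ℕ} {P : MvPolynomial (Fin 3) ℂ}
    (hP : Chart.c000.toLL P ∈ antiCanSections m) (hk : X 2 ^ k ∣ blowupHom P)
    (hj : ∀ γ < j, m + 2 * γ < k) : (X 2 - X 0) ^ j ∣ P := by
  obtain ⟨p, hp⟩ := hP 4
  have hinj : Function.Injective swapHom := Function.LeftInverse.injective swapHom_swapHom
  obtain ⟨θ, hθ⟩ : ∃ θ : MvPolynomial (Fin 3) ℂ →ₐ[ℂ] LL,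
    θ = (IsScalarTower.toAlgHom ℂ (MvPolynomial (Fin 3) ℂ) LL).comp swapHom := ⟨_, rfl⟩
  have h0 : θ (X 0) = genCoord 1 := by simp [hθ, swapHom, genCoord]
  have h1 : θ (X 1) = genCoord 0 := by simp [hθ, swapHom, genCoord]
  have h2 : θ (X 2) = genCoord 2 := by simp [hθ, swapHom, genCoord]
  have h3 : (X 2 - X 1) ^ j ∣ swapHom P := by
    refine pow_dvd_of_X_pow_dvd_blowupHom (fun e he => le_of_mem_support_shearHom
      (θ := θ) (p := swapHom p) (m := m) ?_ ?_ he) (X_pow_dvd_blowupHom_swapHom hk) hj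
    · rw [hθ]
      exact (IsFractionRing.injective _ LL).comp hinj
    · rw [tauLL_c010, toLL_c000, toLL_eq_aeval, toLL_chart_X, inv_pow,
        mul_inv_eq_iff_eq_mul₀ (pow_ne_zero _ (genCoord_ne_zero 1))] at hp
      have h4 : θ (swapHom P) = algebraMap (MvPolynomial (Fin 3) ℂ) LL P := by
        rw [hθ, AlgHom.comp_apply, swapHom_swapHom]
        rfl
      rw [h4, h0, h1, h2, aeval_swapHom, mul_sub, mul_comm (genCoord 1) (genCoord 0)]
      exact hp.trans (mul_comm _ _)
  have h4 := map_dvd swapHom h3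
  rw [swapHom_swapHom] at h4
  simpa [swapHom] using h4

end LeadingTerms

end

section

section LeadingTerms

open MvPolynomial (X C)

lemma exists_injective_ringHom_field (A : Type) [CommRing A] [IsDomain A] :
    ∃ (K : Type) (_ : Field K) (j : A →+* K), Function.Injective j :=
  ⟨FractionRing A, inferInstance, algebraMap _ _, IsFractionRing.injective _ _⟩

/-- A section in the chart `112`, in coordinates along `E` of that chart. -/
lemma exists_hom_of_mem_antiCanSections (hκ : IsLocalCoords Chart.c112.toLL) {m : ℕ} :
    ∃ (Φ : MvPolynomial (Fin 3) ℂ →+* toricDVR) (u v w : toricDVR),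
      algebraMap (MvPolynomial (Fin 3) ℂ) toricDVR (X 0) * u = 1 ∧ algebraMap (MvPolynomial (Fin 3) ℂ) toricDVR (X 0 - X 2) * v = 1 ∧
      algebraMap (MvPolynomial (Fin 3) ℂ) toricDVR ((X 0 - X 1 * X 2) * (X 0 + (X 0 - X 2)) - X 0 * (X 0 - X 2)) * w = 1 ∧
      (∀ a, Φ (C a) = algebraMap (MvPolynomial (Fin 3) ℂ) toricDVR (C a)) ∧ Φ (X 0) = u ∧
      Φ (X 1) = algebraMap (MvPolynomial (Fin 3) ℂ) toricDVR ((X 0 - X 2) ^ 2 * X 1) * w ∧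
      Φ (X 2) = algebraMap (MvPolynomial (Fin 3) ℂ) toricDVR (X 2) * -(u * v) ∧
      ∀ P : MvPolynomial (Fin 3) ℂ, Chart.c000.toLL P ∈ antiCanSections m → ∃ p,
        Φ (blowupHom P) * algebraMap (MvPolynomial (Fin 3) ℂ) toricDVR (X 0 * (X 0 - X 2) *
          ((X 0 - X 1 * X 2) * (X 0 + (X 0 - X 2)) - X 0 * (X 0 - X 2)) ^ 2) ^ m =
          algebraMap (MvPolynomial (Fin 3) ℂ) toricDVR p := by
  obtain ⟨al, hal⟩ : ∃ al, al = algebraMap (MvPolynomial (Fin 3) ℂ) toricDVR := ⟨_, rfl⟩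
  have hu : ∀ p : MvPolynomial (Fin 3) ℂ, planeHom p ≠ 0 → ∃ u, al p * u = 1 := fun p hp => by
    rw [hal]
    refine (toricDVR.isUnit_algebraMap_iff.2 fun h => hp ?_).exists_right_inv
    obtain ⟨q, rfl⟩ := h
    simp [planeHom]
  have hal0 : Function.Injective al := hal ▸ toricDVR.algebraMap_injective
  rw [← hal]
  obtain ⟨b, hb⟩ : ∃ b : MvPolynomial (Fin 3) ℂ, b = X 0 - X 2 := ⟨_, rfl⟩
  obtain ⟨c, hc⟩ : ∃ c : MvPolynomial (Fin 3) ℂ, c = X 0 - X 1 * X 2 := ⟨_, rfl⟩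
  obtain ⟨z, hz⟩ : ∃ z : MvPolynomial (Fin 3) ℂ, z = c * (X 0 + b) - X 0 * b := ⟨_, rfl⟩
  rw [← hb, ← hc, ← hz]
  have hpz : planeHom z = Polynomial.X ^ 2 := by
    simp [hz, hb, hc, planeHom]
    ring
  obtain ⟨u, hu1⟩ := hu (X 0) (by simp [planeHom, Polynomial.X_ne_zero])
  obtain ⟨v, hv1⟩ := hu b (by simp [hb, planeHom, Polynomial.X_ne_zero])
  obtain ⟨w, hw1⟩ := hu z (by rw [hpz]; exact pow_ne_zero _ Polynomial.X_ne_zero)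
  obtain ⟨Φ, hΦ⟩ : ∃ Φ, Φ = MvPolynomial.eval₂Hom (al.comp C)
    ![u, al (b ^ 2 * X 1) * w, al (X 2) * -(u * v)] := ⟨_, rfl⟩
  have hΦ0 : Φ (X 0) = u := by simp [hΦ]
  have hΦ1 : Φ (X 1) = al (b ^ 2 * X 1) * w := by simp [hΦ]
  have hΦ2 : Φ (X 2) = al (X 2) * -(u * v) := by simp [hΦ]
  have hΦC : ∀ a, Φ (C a) = al (C a) := fun a => by simp [hΦ]
  refine ⟨Φ, u, v, w, hu1, hv1, hw1, hΦC, hΦ0, hΦ1, hΦ2, ?_⟩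
  obtain ⟨K, _, j, hj0⟩ := exists_injective_ringHom_field toricDVR
  obtain ⟨Θ, hΘ⟩ := Chart.exists_hom_of_injective hκ
    (μ := (j.comp al).comp blowupHom.toRingHom) (hj0.comp (hal0.comp blowupHom_injective))
  replace hΘ : ∀ p, Θ (Chart.c112.toLL p) = j (al (blowupHom p)) := hΘ
  have hX := toLL_chart_X 2
  have h0 : Θ (genCoord 0) = j u := by
    have h := hΘ (X 0)
    rw [show Chart.c112.toLL (X 0) = (genCoord 0)⁻¹ from congrFun hX 0, blowupHom_zero, map_inv₀] at h
    rw [← inv_inv (Θ (genCoord 0)), h]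
    refine inv_eq_of_mul_eq_one_right ?_
    rw [← map_mul, hu1, map_one]
  have hb1 : blowupHom (X 1) = b := by
    have h := blowupHom_sub_one
    rw [map_sub, blowupHom_zero] at h
    rw [hb]
    linear_combination -h
  have hc1 : blowupHom (X 2) = c := by
    have h := blowupHom_sub_two
    rw [map_sub, blowupHom_zero] at h
    rw [hc]
    linear_combination -h
  have h1 : Θ (genCoord 1) = j v := by
    have h := hΘ (X 1)
    rw [show Chart.c112.toLL (X 1) = (genCoord 1)⁻¹ from congrFun hX 1, hb1, map_inv₀] at h
    rw [← inv_inv (Θ (genCoord 1)), h]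
    refine inv_eq_of_mul_eq_one_right ?_
    rw [← map_mul, hv1, map_one]
  have jz0 : ∀ {x y}, al x * y = 1 → j (al x) ≠ 0 ∧ j y = (j (al x))⁻¹ := fun {x y} h => by
    have h2 : j (al x) * j y = 1 := by rw [← map_mul, h, map_one]
    exact ⟨left_ne_zero_of_mul_eq_one h2, (inv_eq_of_mul_eq_one_right h2).symm⟩
  obtain ⟨n0, e0⟩ := jz0 hu1
  obtain ⟨n1, e1⟩ := jz0 hv1
  obtain ⟨n2, e2⟩ := jz0 hw1
  have jz : j (al z) = j (al c) * (j (al (X 0)) + j (al b)) - j (al (X 0)) * j (al b) := by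
    rw [hz]
    simp only [map_sub, map_mul, map_add]
  have hq : Θ (genCoord 2) = j (al c) * Θ genZ := by
    have h := hΘ (X 2)
    rw [show Chart.c112.toLL (X 2) = genCoord 2 * genZ⁻¹ from congrFun hX 2, hc1, map_mul,
      map_inv₀, mul_inv_eq_iff_eq_mul₀ ((map_ne_zero Θ).2 genZ_ne_zero)] at h
    exact h
  have hZ : Θ genZ = j w := by
    have h : Θ genZ = (Θ (genCoord 0) + Θ (genCoord 1)) * Θ (genCoord 2) -
        Θ (genCoord 0) * Θ (genCoord 1) := by simp only [genZ, map_sub, map_mul, map_add]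
    rw [hq, h0, h1, e0, e1] at h
    rw [e2]
    refine eq_inv_of_mul_eq_one_left ?_
    rw [jz]
    field_simp at h
    linear_combination -h
  have h2 : Θ (genCoord 2) = j (al c * w) := by rw [hq, hZ, map_mul]
  have hP : ∀ P, Θ (algebraMap (MvPolynomial (Fin 3) ℂ) LL P) = j (Φ (blowupHom P)) := by
    refine RingHom.congr_fun (f := Θ.comp (algebraMap _ LL))
      (g := (j.comp Φ).comp blowupHom.toRingHom) (MvPolynomial.ringHom_ext (fun a => ?_) fun l => ?_)
    · have h3 : Θ (algebraMap (MvPolynomial (Fin 3) ℂ) LL (C a)) = j (al (blowupHom (C a))) := by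
        rw [← hΘ, toLL_eq_aeval, MvPolynomial.algHom_C]
        rfl
      have h4 : blowupHom (C a) = C a := MvPolynomial.algHom_C _ a
      refine h3.trans (congrArg j ?_)
      exact ((congrArg al h4).trans (hΦC a).symm).trans (congrArg Φ h4.symm)
    · have hb2 : j (al b) = j (al (X 0)) - j (al (X 2)) := by rw [hb]; simp only [map_sub]
      have hc2 : j (al c) = j (al (X 0)) - j (al (X 1)) * j (al (X 2)) := by
        rw [hc]; simp only [map_sub, map_mul]
      fin_cases l
      · exact h0.trans (congrArg j (hΦ0.symm.trans (congrArg Φ blowupHom_zero.symm)))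
      · refine h1.trans (congrArg j ((?_ : v = Φ b).trans (congrArg Φ hb1.symm)))
        refine hj0 ?_
        rw [hb, map_sub, hΦ0, hΦ2, map_sub, map_mul, map_neg, map_mul, e0, e1]
        field_simp
        rw [hb2]
        ring
      · refine h2.trans (congrArg j ((?_ : al c * w = Φ c).trans (congrArg Φ hc1.symm)))
        refine hj0 ?_
        rw [show Φ c = u - al (b ^ 2 * X 1) * w * (al (X 2) * -(u * v)) by
          rw [hc, map_sub, map_mul, hΦ0, hΦ1, hΦ2]]
        simp only [map_sub, map_mul, map_neg, map_pow]
        rw [e0, e1, e2]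
        field_simp
        rw [jz, hc2, hb2]
        ring
  intro P hPm
  obtain ⟨p, hp⟩ := hPm 2
  refine ⟨blowupHom p, hj0 ?_⟩
  rw [← hΘ]
  refine Eq.trans ?_ (congrArg Θ hp)
  rw [tauLL_c112, toLL_c000]
  simp only [map_mul, map_pow, map_inv₀]
  rw [hP, h0, h1, hZ, e0, e1, e2]
  simp only [mul_inv, inv_inv, inv_pow, mul_pow]

/-- Bound for the degree along `E` of the leading term of a section. -/
lemma natDegree_planeHom_add_le (hκ : IsLocalCoords Chart.c112.toLL) {m k : ℕ}
    {P R : MvPolynomial (Fin 3) ℂ} (hP : Chart.c000.toLL P ∈ antiCanSections m)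
    (hR : blowupHom P = X 2 ^ k * R) (hR0 : ¬ X 2 ∣ R) :
    (planeHom R).natDegree + 2 * k ≤ 6 * m := by
  obtain ⟨Φ, u, v, w, hu, hv, hw, hC, h0, h1, h2, h⟩ := exists_hom_of_mem_antiCanSections hκ (m := m)
  obtain ⟨p, hp⟩ := h P hP
  rw [hR] at hp
  obtain ⟨R', hR'⟩ := exists_mul_of_X_pow_dvd h2 hp
  obtain ⟨ρ, hρ⟩ := exists_residueHom
  obtain ⟨T, hT⟩ : ∃ T, T = algebraMap (Polynomial (Polynomial ℂ)) planeField Polynomial.X :=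
    ⟨_, rfl⟩
  have hb : planeHom (X 0 - X 2) = Polynomial.X := by simp [planeHom]
  have hx : planeHom (X 0) = Polynomial.X := by simp [planeHom]
  have hz : planeHom ((X 0 - X 1 * X 2) * (X 0 + (X 0 - X 2)) - X 0 * (X 0 - X 2)) =
      Polynomial.X ^ 2 := by
    simp [planeHom]
    ring
  have inv : ∀ {x y z}, algebraMap (MvPolynomial (Fin 3) ℂ) toricDVR x * y = 1 → planeHom x = z →
      ρ y = (algebraMap (Polynomial (Polynomial ℂ)) planeField z)⁻¹ := fun {x y z} h hz =>
    (inv_eq_of_mul_eq_one_right (by rw [← hz, ← hρ, ← map_mul, h, map_one])).symm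
  have hT0 : T ≠ 0 := hT ▸ (map_ne_zero_iff _ (IsFractionRing.injective _ planeField)).2
    Polynomial.X_ne_zero
  have eu := inv hu hx
  have ev := inv hv hb
  have ew := inv hw hz
  rw [← hT] at eu ev
  rw [map_pow, ← hT] at ew
  have e1 := eval₂_planeHom (ψ := ρ.comp Φ) (fun a => by
    rw [RingHom.comp_apply, hC, hρ]
    exact congrArg _ (MvPolynomial.algHom_C planeHom a)) (by
    rw [RingHom.comp_apply, h1, map_mul, ew, hρ, map_mul, map_pow, hb, map_mul, map_pow, ← hT,
      mul_right_comm, mul_inv_cancel₀ (pow_ne_zero 2 hT0), one_mul]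
    simp [planeHom]) (by
    rw [RingHom.comp_apply, h2, map_mul, hρ]
    simp [planeHom]) R
  rw [RingHom.comp_apply, RingHom.comp_apply, h0, eu, hT] at e1
  refine natDegree_add_le_of_eval₂_inv (mt dvd_of_planeHom_eq_zero hR0)
    (neg_one_pow_eq_or planeField k) (c' := planeHom R') ?_
  have e2 := congrArg ρ hR'
  rw [hρ, map_mul, map_mul, map_pow, map_pow, hρ, map_mul, map_mul, map_pow, hz, map_mul, hb, hx,
    map_mul, map_pow, map_pow, map_neg, map_mul, eu, ev, e1, ← hT] at e2
  have e3 : (-1 : planeField) ^ k * T ^ (2 * k) * (-(T⁻¹ * T⁻¹)) ^ k = 1 := by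
    rw [pow_mul, ← mul_pow, ← mul_pow, show -1 * T ^ 2 * -(T⁻¹ * T⁻¹) = 1 by field_simp,
      one_pow]
  rw [← hT, ← e2]
  linear_combination -(Polynomial.eval₂ planeC T⁻¹ (planeHom R) * T ^ (6 * m)) * e3

end LeadingTerms

end

section

section LeadingTerms

open MvPolynomial (X C)

lemma le_of_coeff_blowupHom_ne_zero {P : MvPolynomial (Fin 3) ℂ} {e : Fin 3 →₀ ℕ}
    (h : (blowupHom P).coeff e ≠ 0) : e 1 ≤ e 2 := by
  have key : ∀ Q : MvPolynomial (Fin 3) ℂ, (monoHom 0 1 1 1 Q).coeff e ≠ 0 → e 1 ≤ e 2 := by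
    intro Q hQ
    induction Q using MvPolynomial.induction_on' with
    | add p q hp hq =>
      rw [map_add, MvPolynomial.coeff_add] at hQ
      by_cases h0 : (monoHom 0 1 1 1 p).coeff e = 0
      · rw [h0, zero_add] at hQ
        exact hq hQ
      · exact hp h0
    | monomial u a =>
      rw [monoHom_monomial, MvPolynomial.coeff_monomial] at hQ
      obtain rfl := (ite_ne_right_iff.1 hQ).1
      simp [monoExp]
  exact key _ h

lemma eq_zero_of_coeff_eq_zero {f : Polynomial ℂ} {j m d : ℕ} (h0 : Polynomial.X ^ j ∣ f)
    (h1 : (1 - Polynomial.X) ^ j ∣ f) (hd : f.natDegree ≤ d) (hj : d ≤ 2 * j + m)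
    (h : ∀ β ≤ m, f.coeff (j + β) = 0) : f = 0 := by
  have h2 : Polynomial.X ^ (j + m + 1) ∣ f := Polynomial.X_pow_dvd_iff.2 fun n hn => by
    rcases lt_or_ge n j with hnj | hnj
    · exact Polynomial.X_pow_dvd_iff.1 h0 n hnj
    · have := h (n - j) (by omega)
      rwa [Nat.add_sub_cancel' hnj] at this
  have h3 : IsCoprime (Polynomial.X : Polynomial ℂ) (1 - Polynomial.X) := ⟨1, 1, by ring⟩
  have h4 := (h3.pow (m := j + m + 1) (n := j)).mul_dvd h2 h1
  by_contra hf
  have h5 := Polynomial.natDegree_le_of_dvd h4 hf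
  have h6 : (1 - Polynomial.X : Polynomial ℂ) = -(Polynomial.X - Polynomial.C 1) := by simp
  rw [Polynomial.natDegree_mul (pow_ne_zero _ Polynomial.X_ne_zero)
    (pow_ne_zero _ (by rw [h6]; exact neg_ne_zero.2 (Polynomial.X_sub_C_ne_zero 1))),
    Polynomial.natDegree_pow, Polynomial.natDegree_pow, h6, Polynomial.natDegree_neg,
    Polynomial.natDegree_X_sub_C, Polynomial.natDegree_X] at h5
  omega

/-- A section is determined by few coefficients. -/
lemma eq_zero_of_coeff_blowupHom_eq_zero (hκ : IsLocalCoords Chart.c112.toLL) {m k : ℕ}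
    {P : MvPolynomial (Fin 3) ℂ} (hP : Chart.c000.toLL P ∈ antiCanSections m)
    (hk : X 2 ^ k ∣ blowupHom P)
    (h : ∀ d, k ≤ d → d ≤ 3 * m → ∀ α ≤ 6 * m - 2 * d, ∀ β ≤ m, (blowupHom P).coeff
      (Finsupp.single 2 d + (Finsupp.single 0 α + Finsupp.single 1 ((d - m + 1) / 2 + β))) = 0) :
    P = 0 := by
  by_contra hP0
  have hX : Prime (X 2 : MvPolynomial (Fin 3) ℂ) := MvPolynomial.X_prime
  have hb0 : blowupHom P ≠ 0 := (map_ne_zero_iff _ blowupHom_injective).2 hP0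
  obtain ⟨d, R, hR0, hR⟩ := (FiniteMultiplicity.of_not_isUnit hX.not_isUnit
    hb0).exists_eq_pow_mul_and_not_dvd
    |> fun ⟨c, hc, h⟩ => (⟨_, c, h, hc⟩ : ∃ d R, ¬ X 2 ∣ R ∧ blowupHom P = X 2 ^ d * R)
  have hdeg := natDegree_planeHom_add_le hκ hP hR hR0
  have hkd : k ≤ d := by
    by_contra hlt
    refine hR0 ((mul_dvd_mul_iff_left (pow_ne_zero d hX.ne_zero)).1 ?_)
    rw [← pow_succ, ← hR]
    exact (pow_dvd_pow _ (by omega)).trans hk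
  obtain ⟨j, hj⟩ : ∃ j, j = (d - m + 1) / 2 := ⟨_, rfl⟩
  have hdvd : X 2 ^ d ∣ blowupHom P := ⟨R, hR⟩
  have key : ∀ {y z : MvPolynomial (Fin 3) ℂ}, blowupHom z = X 2 * y → ¬ X 2 ∣ y →
      z ^ j ∣ P → ∀ α, ∀ y', planeHom y = Polynomial.C y' → y' ^ j ∣ (planeHom R).coeff α := by
    intro y z hyz hy hz α y' hy'
    have h1 := map_dvd blowupHom hz
    rw [map_pow, hyz, mul_pow, hR] at h1
    have h2 : IsRelPrime (y ^ j) (X 2 ^ d) :=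
      ((hX.irreducible.isRelPrime_iff_not_dvd.2 hy).symm).pow
    have h3 := map_dvd planeHom (h2.dvd_of_dvd_mul_left ((Dvd.intro_left _ rfl).trans h1))
    rw [map_pow, hy', ← Polynomial.C_pow] at h3
    exact Polynomial.C_dvd_iff_dvd_coeff _ _ |>.1 h3 α
  have hcoeff : ∀ α γ, ((planeHom R).coeff α).coeff γ = (blowupHom P).coeff
      (Finsupp.single 2 d + (Finsupp.single 0 α + Finsupp.single 1 γ)) := fun α γ => by
    rw [coeff_planeHom, hR, MvPolynomial.X_pow_eq_monomial, MvPolynomial.coeff_monomial_mul,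
      one_mul]
  refine hR0 (dvd_of_planeHom_eq_zero (Polynomial.ext fun α => ?_))
  rw [Polynomial.coeff_zero]
  rcases le_or_gt α (6 * m - 2 * d) with hα | hα
  · refine eq_zero_of_coeff_eq_zero (j := j) (m := m) (d := d) ?_ ?_ ?_ (by omega) fun β hβ => ?_
    · refine (Dvd.intro_left ((-1) ^ j) (neg_pow (Polynomial.X : Polynomial ℂ) j).symm).trans
        (key (y := -X 1) (z := X 2 - X 0) ?_ ?_
          (pow_dvd_of_mem_antiCanSections' hP hdvd fun γ hγ => by omega) α (-Polynomial.X) ?_)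
      · rw [← neg_sub, map_neg, blowupHom_sub_two]
        ring
      · rw [dvd_neg, MvPolynomial.X_dvd_X]
        simp
      · simp [planeHom]
    · refine key (y := 1 - X 1) (z := X 2 - X 1) ?_ (fun h => ?_)
        (pow_dvd_of_mem_antiCanSections hP hdvd fun γ hγ => by omega) α _ ?_
      · rw [← sub_sub_sub_cancel_left _ _ (X 0), map_sub, blowupHom_sub_two, blowupHom_sub_one]
        ring
      · have h2 := map_dvd (MvPolynomial.eval (0 : Fin 3 → ℂ)) h
        simp at h2
      · simp [planeHom]
    · refine Polynomial.natDegree_le_iff_coeff_eq_zero.2 fun γ hγ => ?_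
      rw [hcoeff]
      by_contra h1
      have h2 := le_of_coeff_blowupHom_ne_zero h1
      simp at h2
      omega
    · rw [hcoeff, hj]
      exact h d hkd (by omega) α hα β hβ
  · exact Polynomial.coeff_eq_zero_of_natDegree_lt (by omega)

/-- The sections vanishing to order `k` along `E`. -/
def sectionsAlongE (m k : ℕ) : Submodule ℂ (MvPolynomial (Fin 3) ℂ) :=
  (antiCanSections m).comap (IsScalarTower.toAlgHom ℂ (MvPolynomial (Fin 3) ℂ) LL).toLinearMap ⊓
    ((Ideal.span {X 2 ^ k}).restrictScalars ℂ).comap blowupHom.toLinearMap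

lemma mem_sectionsAlongE {m k : ℕ} {P : MvPolynomial (Fin 3) ℂ} : P ∈ sectionsAlongE m k ↔
    Chart.c000.toLL P ∈ antiCanSections m ∧ X 2 ^ k ∣ blowupHom P := by
  rw [toLL_c000, ← Ideal.mem_span_singleton]
  rfl

lemma finrank_toricSections_le (hκ : IsLocalCoords Chart.c112.toLL) (m k : ℕ) :
    FiniteDimensional ℂ (Submodule.span ℂ (toricSections blowupHom m k)) ∧
    Set.finrank ℂ (toricSections blowupHom m k) ≤ (m + 1) * (3 * m + 1 - k) ^ 2 := by
  obtain ⟨ι, hι⟩ : ∃ ι, ι = (IsScalarTower.toAlgHom ℂ (MvPolynomial (Fin 3) ℂ) LL).toLinearMap :=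
    ⟨_, rfl⟩
  have hι0 : Function.Injective ι := hι ▸ IsFractionRing.injective _ LL
  have hs : toricSections blowupHom m k = (sectionsAlongE m k).map ι := by
    ext g
    constructor
    · rintro ⟨hg, P, rfl, hP⟩
      exact ⟨P, mem_sectionsAlongE.2 ⟨hg, hP⟩, by rw [hι, toLL_c000]; rfl⟩
    · rintro ⟨P, hP, rfl⟩
      have h := mem_sectionsAlongE.1 hP
      have h1 : Chart.c000.toLL P = ι P := by rw [hι, toLL_c000]; rfl
      rw [h1] at h
      exact ⟨h.1, P, h1.symm, h.2⟩
  let Idx := Σ e : Fin (3 * m + 1 - k), Fin (2 * e + 1) × Fin (m + 1)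
  let Λ : sectionsAlongE m k →ₗ[ℂ] Idx → ℂ := LinearMap.pi fun x =>
    (MvPolynomial.lcoeff ℂ (Finsupp.single 2 (3 * m - x.1) + (Finsupp.single 0 (x.2.1 : ℕ) +
      Finsupp.single 1 ((3 * m - x.1 - m + 1) / 2 + x.2.2)))).comp
        (blowupHom.toLinearMap.comp (sectionsAlongE m k).subtype)
  have hΛ : Function.Injective Λ := by
    refine (injective_iff_map_eq_zero _).2 fun P hP => Subtype.ext ?_
    have hP' := mem_sectionsAlongE.1 P.2
    refine eq_zero_of_coeff_blowupHom_eq_zero hκ hP'.1 hP'.2 fun d hkd hd α hα β hβ => ?_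
    have h := congrFun hP ⟨⟨3 * m - d, by omega⟩, ⟨α, by simp; omega⟩, ⟨β, by omega⟩⟩
    have h1 : 3 * m - (3 * m - d) = d := by omega
    change MvPolynomial.coeff _ (blowupHom P) = 0 at h
    simpa only [h1] using h
  have hfin : FiniteDimensional ℂ (sectionsAlongE m k) := .of_injective Λ hΛ
  have hle := LinearMap.finrank_le_finrank_of_injective hΛ
  rw [Set.finrank, hs, Submodule.span_eq]
  refine ⟨inferInstance, (Submodule.finrank_map_le _ _).trans (hle.trans (le_of_eq ?_))⟩
  rw [Module.finrank_fintype_fun_eq_card, Fintype.card_sigma]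
  simp only [Fintype.card_prod, Fintype.card_fin]
  rw [← Finset.sum_mul, Fin.sum_univ_eq_sum_range (fun e => 2 * e + 1), mul_comm]
  congr 1
  induction 3 * m + 1 - k with
  | zero => simp
  | succ n ih => rw [Finset.sum_range_succ, ih]; ring

end LeadingTerms

end

section

section MonomialSections

open MvPolynomial (X C)

/-- The restriction of a monomial to the affine chart. -/
def monomialSection (e : ℕ × ℕ × ℕ × ℕ) : MvPolynomial (Fin 3) ℂ :=
  X 2 ^ e.2.2.1 * (X 0 ^ e.1 * X 1 ^ e.2.1 * ((X 0 + X 1) * X 2 - X 0 * X 1) ^ e.2.2.2)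

lemma coeff_monomialSection (e : ℕ × ℕ × ℕ × ℕ) (α γ : ℕ) : (monomialSection e).coeff
    (Finsupp.single 2 e.2.2.1 + (Finsupp.single 0 α + Finsupp.single 1 γ)) =
      if α = e.1 + e.2.2.2 ∧ γ = e.2.1 + e.2.2.2 then (-1) ^ e.2.2.2 else 0 := by
  rw [monomialSection, MvPolynomial.X_pow_eq_monomial, MvPolynomial.coeff_monomial_mul, one_mul,
    ← coeff_planeHom]
  have h : planeHom (X 0 ^ e.1 * X 1 ^ e.2.1 * ((X 0 + X 1) * X 2 - X 0 * X 1) ^ e.2.2.2) =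
      Polynomial.monomial (e.1 + e.2.2.2)
        (Polynomial.monomial (e.2.1 + e.2.2.2) ((-1) ^ e.2.2.2)) := by
    rw [← Polynomial.C_mul_X_pow_eq_monomial, ← Polynomial.C_mul_X_pow_eq_monomial]
    simp [planeHom]
    rw [neg_pow (Polynomial.C Polynomial.X * Polynomial.X : Polynomial (Polynomial ℂ))]
    ring
  rw [h, Polynomial.coeff_monomial]
  split_ifs with h1 h2 h2
  · rw [Polynomial.coeff_monomial, if_pos h2.2.symm]
  · rw [Polynomial.coeff_monomial, if_neg fun h3 => h2 ⟨h1.symm, h3.symm⟩]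
  · exact (h1 h2.1.symm).elim
  · exact Polynomial.coeff_zero _

lemma linearIndependent_monomialSection {ι : Type} {e : ι → ℕ × ℕ × ℕ × ℕ}
    (he : Function.Injective fun x => ((e x).1 + (e x).2.2.2, (e x).2.1 + (e x).2.2.2, (e x).2.2.1)) :
    LinearIndependent ℂ fun x => monomialSection (e x) := by
  refine linearIndependent_iff'.2 fun s c hc x hx => ?_
  by_contra h0
  obtain ⟨y, hy, hmin⟩ := Finset.exists_min_image (s.filter (c · ≠ 0)) (fun x => (e x).2.2.1)
    ⟨x, Finset.mem_filter.2 ⟨hx, h0⟩⟩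
  rw [Finset.mem_filter] at hy
  have h1 := congrArg (MvPolynomial.coeff (Finsupp.single 2 (e y).2.2.1 + (Finsupp.single 0
    ((e y).1 + (e y).2.2.2) + Finsupp.single 1 ((e y).2.1 + (e y).2.2.2)))) hc
  rw [MvPolynomial.coeff_sum, Finset.sum_eq_single y, MvPolynomial.coeff_smul,
    coeff_monomialSection, if_pos ⟨rfl, rfl⟩] at h1
  · simp [hy.2] at h1
  · intro z hz hzy
    rw [MvPolynomial.coeff_smul]
    by_cases hz0 : c z = 0
    · rw [hz0, zero_smul]
    have h2 := hmin z (Finset.mem_filter.2 ⟨hz, hz0⟩)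
    rcases h2.lt_or_eq with h2 | h2
    · rw [monomialSection, MvPolynomial.X_pow_eq_monomial, MvPolynomial.coeff_monomial_mul',
        if_neg, smul_zero]
      intro h3
      have := h3 2
      simp at this
      omega
    · rw [h2, coeff_monomialSection, if_neg, smul_zero]
      exact fun h3 => hzy (he (Prod.ext h3.1.symm (Prod.ext h3.2.symm h2.symm)))
  · exact fun h => (h hy.1).elim

lemma toLL_monomialSection_mem {m : ℕ} {e : ℕ × ℕ × ℕ × ℕ} (h1 : e.1 ≤ m) (h2 : e.2.1 ≤ m)
    (h3 : e.2.2.1 + e.2.2.2 ≤ 2 * m) : Chart.c000.toLL (monomialSection e) ∈ antiCanSections m := by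
  intro a
  have key : ∀ h, ∃ p, (chart a).normalize genTuple h = (chart a).toLL p := fun h =>
    ⟨(chart a).tuple X h, by rw [← tuple_toLL, Chart.map_tuple]⟩
  choose p hp using key
  obtain ⟨x, hx⟩ : ∃ x, x = Ring.inverse (genTuple (.inl (chart a).i)) := ⟨_, rfl⟩
  obtain ⟨y, hy⟩ : ∃ y, y = Ring.inverse (genTuple (.inr (.inl (chart a).j))) := ⟨_, rfl⟩
  obtain ⟨z, hz⟩ : ∃ z, z = Ring.inverse (genTuple (.inr (.inr (chart a).k))) := ⟨_, rfl⟩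
  have hτ : tauLL a = x * y * z ^ 2 := by
    rw [hx, hy, hz, Ring.inverse_eq_inv', tauLL, Chart.tau, mul_inv, mul_inv, inv_pow]
  simp only [Chart.normalize, scaleTuple, ← hx, ← hy, ← hz] at hp
  obtain ⟨i', hi⟩ := Nat.exists_eq_add_of_le h1
  obtain ⟨j', hj⟩ := Nat.exists_eq_add_of_le h2
  obtain ⟨k', hk⟩ := Nat.exists_eq_add_of_le h3
  refine ⟨p (.inl 0) ^ i' * p (.inl 1) ^ e.1 * (p (.inr (.inl 0)) ^ j' * p (.inr (.inl 1)) ^ e.2.1) *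
    (p (.inr (.inr 0)) ^ k' * p (.inr (.inr 1)) ^ e.2.2.1 * p (.inr (.inr 2)) ^ e.2.2.2), ?_⟩
  simp only [map_mul, map_pow, ← hp]
  rw [hτ, genTuple_eq, monomialSection]
  simp only [map_mul, map_pow, map_sub, map_add, toLL_c000_X, mkTuple_x₀, mkTuple_x₁, mkTuple_y₀,
    mkTuple_y₁, mkTuple_z₀, mkTuple_z₁, mkTuple_z₂, mul_one]
  rw [mul_pow, mul_pow, ← pow_mul, hk]
  nth_rewrite 1 [hi]
  rw [hj]
  generalize (genCoord 0 + genCoord 1) * genCoord 2 - genCoord 0 * genCoord 1 = Z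
  ring

lemma le_finrank_antiCanSections (hκ : IsLocalCoords Chart.c112.toLL) (m : ℕ) :
    6 * m ^ 3 ≤ Module.finrank ℂ (antiCanSections m) := by
  have hfin := (finrank_toricSections_le hκ m 0).1
  have h0 : toricSections blowupHom m 0 = antiCanSections m :=
    Set.ext fun g => ⟨fun h => h.1, fun h => ⟨h, (exists_eq_toLL_c000 h).imp fun P hP =>
      ⟨hP, by rw [pow_zero]; exact one_dvd _⟩⟩⟩
  rw [h0, Submodule.span_eq] at hfin
  let e : Fin m × Fin m × Fin (2 * m) ⊕ Bool × Fin m × (Σ l : Fin (2 * m), Fin (2 * m - l)) →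
      ℕ × ℕ × ℕ × ℕ := Sum.elim (fun x => (x.1, x.2.1, x.2.2, 0)) fun x =>
    (bif x.1 then m else x.2.1, bif x.1 then x.2.1 else m, x.2.2.2, x.2.2.1 + 1)
  have hmem : ∀ x, Chart.c000.toLL (monomialSection (e x)) ∈ antiCanSections m := by
    rintro (⟨i, j, k⟩ | ⟨_ | _, c, l, k⟩) <;>
      exact toLL_monomialSection_mem (by simp [e]) (by simp [e])
        (by simp [e] <;> omega)
  have hinj : Function.Injective fun x =>
      ((e x).1 + (e x).2.2.2, (e x).2.1 + (e x).2.2.2, (e x).2.2.1) := by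
    rintro (⟨i, j, k⟩ | ⟨_ | _, c, l, k⟩) (⟨i', j', k'⟩ | ⟨_ | _, c', l', k'⟩) h <;>
      simp only [e, Sum.elim_inl, Sum.elim_inr, cond_true, cond_false, Prod.mk.injEq] at h
    all_goals first
      | exact absurd h (by have := c.2; have := c'.2; omega)
      | exact absurd h (by have := c.2; omega)
      | exact absurd h (by have := c'.2; omega)
      | skip
    · simp only [Sum.inl.injEq, Prod.mk.injEq, Fin.ext_iff]
      omega
    all_goals
      obtain rfl : l = l' := Fin.ext (by omega)
      obtain rfl : c = c' := Fin.ext (by omega)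
      obtain rfl : k = k' := Fin.ext h.2.2
      rfl
  have h1 : LinearIndependent ℂ fun x =>
      (⟨Chart.c000.toLL (monomialSection (e x)), hmem x⟩ : antiCanSections m) := by
    refine .of_comp (antiCanSections m).subtype ?_
    have h2 := (linearIndependent_monomialSection hinj).map'
      (IsScalarTower.toAlgHom ℂ (MvPolynomial (Fin 3) ℂ) LL).toLinearMap
      (LinearMap.ker_eq_bot.2 (IsFractionRing.injective _ LL))
    have h3 : (fun x => Chart.c000.toLL (monomialSection (e x))) =
        fun x => algebraMap (MvPolynomial (Fin 3) ℂ) LL (monomialSection (e x)) := by rw [toLL_c000]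
    change LinearIndependent ℂ fun x => Chart.c000.toLL (monomialSection (e x))
    rw [h3]
    exact h2
  refine le_trans ?_ h1.fintype_card_le_finrank
  have h3 : ∑ l : Fin (2 * m), (2 * m - l) = m * (2 * m + 1) := by
    have h4 : ∀ n : ℕ, 2 * ∑ l ∈ Finset.range n, (n - l) = n * (n + 1) := fun n => by
      induction n with
      | zero => simp
      | succ n ih =>
        rw [Finset.sum_range_succ']
        simp only [Nat.add_sub_add_right, Nat.sub_zero]
        linarith
    rw [Fin.sum_univ_eq_sum_range (fun l => 2 * m - l)]
    linarith [h4 (2 * m)]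
  simp only [Fintype.card_sum, Fintype.card_prod, Fintype.card_sigma, Fintype.card_fin,
    Fintype.card_bool, h3]
  nlinarith [Nat.zero_le (m ^ 2)]

end MonomialSections

end

section

section Volumes

open MeasureTheory Filter

lemma lintegral_comp_inv_mul (φ : ℝ → ℝ≥0∞) {N : ℕ} (hN : 1 ≤ N) :
    ∫⁻ x in Set.Ioi (0 : ℝ), φ ((N : ℝ)⁻¹ * x) = N * ∫⁻ x in Set.Ioi (0 : ℝ), φ x := by
  have hN0 : (0 : ℝ) < N := by exact_mod_cast hN
  have he := (Homeomorph.mulLeft₀ (N : ℝ)⁻¹ (inv_ne_zero hN0.ne')).measurableEmbedding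
  have h1 := he.lintegral_map φ (μ := volume.restrict (⇑(Homeomorph.mulLeft₀ (N : ℝ)⁻¹
    (inv_ne_zero hN0.ne')) ⁻¹' Set.Ioi 0))
  rw [← he.restrict_map] at h1
  have h2 : (⇑(Homeomorph.mulLeft₀ (N : ℝ)⁻¹ (inv_ne_zero hN0.ne')) : ℝ → ℝ) =
    fun x => (N : ℝ)⁻¹ * x := rfl
  rw [h2, Set.preimage_const_mul_Ioi₀ _ (inv_pos.2 hN0), zero_div,
    Real.map_volume_mul_left (inv_ne_zero hN0.ne'), inv_inv, abs_of_pos hN0,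
    ENNReal.ofReal_natCast, Measure.restrict_smul, lintegral_smul_measure] at h1
  exact h1.symm

lemma lintegral_parabola : ∫⁻ x in Set.Ioi (0 : ℝ), ENNReal.ofReal (6 * max (3 - x) 0 ^ 2) ≤ 54 := by
  rw [← Set.Ioc_union_Ioi_eq_Ioi (show (0 : ℝ) ≤ 3 by norm_num)]
  refine (lintegral_union_le _ _ _).trans ?_
  have h1 : ∫⁻ x in Set.Ioi (3 : ℝ), ENNReal.ofReal (6 * max (3 - x) 0 ^ 2) = 0 := by
    rw [setLIntegral_congr_fun measurableSet_Ioi (g := fun _ => 0) fun x hx => ?_, lintegral_zero]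
    have : max (3 - x) 0 = 0 := max_eq_right (by linarith [Set.mem_Ioi.1 hx])
    simp [this]
  have h2 : ∫⁻ x in Set.Ioc (0 : ℝ) 3, ENNReal.ofReal (6 * max (3 - x) 0 ^ 2) = 54 := by
    rw [setLIntegral_congr_fun measurableSet_Ioc (g := fun x => ENNReal.ofReal (6 * (3 - x) ^ 2))
      fun x hx => by simp only [max_eq_left (show (0 : ℝ) ≤ 3 - x by linarith [hx.2])],
      ← ofReal_integral_eq_lintegral_ofReal, ← intervalIntegral.integral_of_le (by norm_num)]
    · have h3 : ∫ x in (0 : ℝ)..3, 6 * (3 - x) ^ 2 = 54 := by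
        rw [intervalIntegral.integral_const_mul,
          intervalIntegral.integral_comp_sub_left (fun x => x ^ 2), integral_pow]
        norm_num
      rw [h3]
      norm_num
    · exact (Continuous.integrableOn_Icc (by fun_prop)).mono_set Set.Ioc_subset_Icc_self
    · exact Eventually.of_forall fun x => by positivity
  rw [h1, h2, add_zero]

variable {X : Scheme.{0}} [X.Over SpecC] [IsIntegral X] [IsLocallyNoetherian X]
  {i : X ⟶ PPP} [i.IsOver SpecC] [IsClosedImmersion i]
  {Z : Scheme.{0}} [Z.Over SpecC] [IsIntegral Z] [IsLocallyNoetherian Z]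
  {η : Z ⟶ X} [η.IsOver SpecC] {Q : Z}

lemma le_vol_antiCan (hX : i.ker = idealX) : 36 ≤ vol X (antiCan (𝟙 X)) := by
  obtain ⟨F⟩ := (isModel_id i).nonempty_fieldCoords hX
  refine le_limsup_of_frequently_le (Eventually.frequently ?_) (by isBoundedDefault)
  filter_upwards [eventually_ge_atTop 1] with m hm
  have h1 : h0 X (fun P => (m : ℝ) * antiCan (𝟙 X) P) =
      Module.finrank ℂ (antiCanSections m) := by
    have h2 := F.h0_eq hX m 0
    rw [sub_zero, F.sections_zero hX (isModel_id i) m, Set.finrank, Submodule.span_eq] at h2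
    exact h2
  have h3 : (6 * m ^ 3 : ℕ) ≤ Module.finrank ℂ (antiCanSections m) :=
    le_finrank_antiCanSections (isLocalCoords_toLL _ hX) m
  have hm0 : (m : ℝ≥0∞) ≠ 0 := by exact_mod_cast (by omega : m ≠ 0)
  rw [h1, ENNReal.le_div_iff_mul_le
    (.inl (ENNReal.div_ne_zero.2 ⟨pow_ne_zero 3 hm0, by norm_num⟩))
    (.inl (ENNReal.div_ne_top (ENNReal.pow_ne_top (ENNReal.natCast_ne_top m)) (by norm_num))),
    show (36 : ℝ≥0∞) = 6 * 6 by norm_num, mul_assoc,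
    ENNReal.mul_div_cancel (by norm_num) (by norm_num)]
  exact_mod_cast h3

lemma IsToricPoint.vol_le (hX : i.ker = idealX) (hη : IsModel i η)
    (hQ : IsToricPoint i η blowupHom Q) {x : ℝ} (hx : 0 ≤ x) :
    vol Z (antiCan η - x • primeDiv Q) ≤ ENNReal.ofReal (6 * max (3 - x) 0 ^ 2) := by
  obtain ⟨y, hy⟩ : ∃ y, y = max (3 - x) 0 := ⟨_, rfl⟩
  rw [← hy]
  have hlim : Tendsto (fun m : ℕ => ENNReal.ofReal (6 * (1 + 1 / (m : ℝ)) * (y + 1 / (m : ℝ)) ^ 2))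
      atTop (nhds (ENNReal.ofReal (6 * y ^ 2))) := by
    have h1 := tendsto_one_div_atTop_nhds_zero_nat (𝕜 := ℝ)
    have h2 := ((h1.const_add 1).const_mul 6).mul ((h1.const_add y).pow 2)
    rw [add_zero, add_zero, mul_one] at h2
    exact (ENNReal.continuous_ofReal.tendsto _).comp h2
  rw [← hlim.limsup_eq]
  refine limsup_le_limsup ?_
  filter_upwards [eventually_ge_atTop 1] with m hm
  have hm0 : (0 : ℝ) < m := by exact_mod_cast hm
  rw [hQ.h0_eq hX hη m hx]
  have h1 := (finrank_toricSections_le (isLocalCoords_toLL _ hX) m ⌈m * x⌉₊).2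
  have h2 : ((3 * m + 1 - ⌈m * x⌉₊ : ℕ) : ℝ) ≤ m * y + 1 := by
    have hy0 : 0 ≤ y := hy ▸ le_max_right _ _
    have hy3 : 3 - x ≤ y := hy ▸ le_max_left _ _
    rcases le_total ⌈m * x⌉₊ (3 * m + 1) with h | h
    · rw [Nat.cast_sub h]
      push_cast
      nlinarith [Nat.le_ceil (m * x)]
    · rw [Nat.sub_eq_zero_of_le h, Nat.cast_zero]
      positivity
  have h3 : (Set.finrank ℂ (toricSections blowupHom m ⌈m * x⌉₊) : ℝ) ≤
      (m + 1) * (m * y + 1) ^ 2 := by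
    refine (Nat.cast_le.2 h1).trans ?_
    push_cast
    gcongr
  have h4 : ((m : ℝ≥0∞) ^ 3 / 6) = ENNReal.ofReal ((m : ℝ) ^ 3 / 6) := by
    rw [ENNReal.ofReal_div_of_pos (by norm_num), ENNReal.ofReal_pow hm0.le, ENNReal.ofReal_natCast,
      ENNReal.ofReal_ofNat]
  rw [h4, ← ENNReal.ofReal_natCast, ← ENNReal.ofReal_div_of_pos (by positivity)]
  refine ENNReal.ofReal_le_ofReal ((div_le_div_of_nonneg_right h3 (by positivity)).trans
    (le_of_eq ?_))
  field_simp

lemma IsToricPoint.vol_le_vol {Z' : Scheme.{0}} [Z'.Over SpecC] [IsIntegral Z']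
    [IsLocallyNoetherian Z'] {η' : Z' ⟶ X} [η'.IsOver SpecC] {Q' : Z'}
    {M : Matrix (Fin 2) (Fin 2) ℂ} (hM : M.det ≠ 0) {k A l B : ℕ} (h : k * B ≠ l * A)
    (hA : 1 ≤ A) (hAB : A ≤ B) (hX : i.ker = idealX) (hη : IsModel i η)
    (hQ : IsToricPoint i η blowupHom Q) (hη' : IsModel i η')
    (hQ' : IsToricPoint i η' (toricHom M k A l B) Q') {x : ℝ} (hx : 0 ≤ x) :
    vol Z' (antiCan η' - x • primeDiv Q') ≤ vol Z (antiCan η - ((B : ℝ)⁻¹ * x) • primeDiv Q) := by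
  have hB0 : (0 : ℝ) < B := by exact_mod_cast hA.trans hAB
  refine limsup_le_limsup (Eventually.of_forall fun m => ?_)
  dsimp only
  rw [hQ'.h0_eq hX hη' m hx, hQ.h0_eq hX hη m (by positivity)]
  refine ENNReal.div_le_div_right (Nat.cast_le.2 ?_) _
  have hfin := (finrank_toricSections_le (isLocalCoords_toLL _ hX) m
    ⌈m * ((B : ℝ)⁻¹ * x)⌉₊).1
  refine Submodule.finrank_mono (Submodule.span_mono ?_)
  rintro g ⟨hg, P, hgP, hP⟩
  refine ⟨hg, P, hgP, X_pow_dvd_toricHom hM h hAB le_rfl (fun n hn => ?_) le_rfl le_rfl hP⟩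
  refine Nat.ceil_le.2 ?_
  have h1 : (m : ℝ) * x ≤ B * n := by exact_mod_cast Nat.ceil_le.1 hn
  rw [mul_left_comm, inv_mul_le_iff₀ hB0]
  exact h1

end Volumes

end

end

end Family317

theorem mainTheorem5
    -- the threefold
    (X : Scheme.{0}) [X.Over SpecC] [IsIntegral X] [IsLocallyNoetherian X]
    (i : X ⟶ PPP) [i.IsOver SpecC] [IsClosedImmersion i] (hX : i.ker = idealX)
    -- the blow-up of `C`, with exceptional surface `E`
    (X₁ : Scheme.{0}) [X₁.Over SpecC] [IsIntegral X₁] [IsLocallyNoetherian X₁]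
    (f : X₁ ⟶ X) [f.IsOver SpecC] (hf : IsBlowup f (idealC i))
    (ξE : X₁) (hξE : IsGenericPoint ξE (surfaceE i f : Set X₁))
    -- the blow-up of `C'`, with exceptional surface `R'`
    (C' : Closeds X₁) (hC' : IsCurveC' i f C')
    (X₂ : Scheme.{0}) (g : X₂ ⟶ X₁) (hg : IsBlowup g (idealC' C'))
    -- the weighted blow-up between `Ê` and `R'`, with exceptional surface `F`;
    -- the equation of `R'` has weight `a`, that of `Ê` has weight `b`
    (a b : ℕ) (ha : 0 < a) (hb : 0 < b)
    (Y : Scheme.{0}) [Y.Over SpecC] [IsIntegral Y] [IsLocallyNoetherian Y]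
    (ν : Y ⟶ X₂) [((ν ≫ g) ≫ f).IsOver SpecC]
    (hν : IsWeightedBlowup ν (idealR' C' g) (idealEhat i f C' g) a b)
    (ξF : Y) (hξF : IsGenericPoint ξF
      (ν ⁻¹' (((idealEhat i f C' g).support : Set X₂) ∩ (idealR' C' g).support))) :
    SInv ((ν ≫ g) ≫ f) ξF ≤ (2 * a + b : ℝ≥0∞) * SInv f ξE ∧
      0 < betaInv ((ν ≫ g) ≫ f) ξF := by
  have hηE : IsModel i f := hf.isModel
  have hE : IsToricPoint i f blowupHom ξE := hf.isToricPoint hX hξE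
  obtain ⟨M, k, A, l, B, hM, hF, h, hA, hAB, hBA, hB⟩ :=
    exists_isToricPoint hX hf hξE hC' hg ha hb hν hξF
  have hηF : IsModel i ((ν ≫ g) ≫ f) := hηE.comp_weightedBlowup hC'.1 hg hν
  have hint : ∫⁻ x in Set.Ioi (0 : ℝ), vol Y (antiCan ((ν ≫ g) ≫ f) - x • primeDiv ξF) ≤
      B * ∫⁻ x in Set.Ioi (0 : ℝ), vol X₁ (antiCan f - x • primeDiv ξE) := by
    rw [← lintegral_comp_inv_mul _ (hA.trans hAB)]
    exact MeasureTheory.setLIntegral_mono' measurableSet_Ioi fun x hx =>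
      hE.vol_le_vol hM h hA hAB hX hηE hηF hF (Set.mem_Ioi.1 hx).le
  have hSF : SInv ((ν ≫ g) ≫ f) ξF ≤ B * SInv f ξE :=
    (ENNReal.div_le_div_right hint _).trans_eq (mul_div_assoc _ _ _)
  have hSE : SInv f ξE ≤ ENNReal.ofReal (3 / 2) := by
    have h1 : ∫⁻ x in Set.Ioi (0 : ℝ), vol X₁ (antiCan f - x • primeDiv ξE) ≤ 54 :=
      (MeasureTheory.setLIntegral_mono' measurableSet_Ioi fun x hx =>
        hE.vol_le hX hηE (Set.mem_Ioi.1 hx).le).trans lintegral_parabola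
    refine (ENNReal.div_le_div h1 (le_vol_antiCan hX)).trans_eq ?_
    rw [show (3 / 2 : ℝ) = 54 / 36 by norm_num, ENNReal.ofReal_div_of_pos (by norm_num),
      ENNReal.ofReal_ofNat, ENNReal.ofReal_ofNat]
  refine ⟨hSF.trans (mul_le_mul_left ?_ _), ?_⟩
  · exact_mod_cast hB
  · rw [betaInv, EReal.sub_pos, hF.logDiscrepancy_eq hM h hX hηF]
    have h1 : SInv ((ν ≫ g) ≫ f) ξF ≤ ENNReal.ofReal (B * (3 / 2)) := by
      rw [ENNReal.ofReal_mul (Nat.cast_nonneg B), ENNReal.ofReal_natCast]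
      exact hSF.trans (mul_le_mul_right hSE _)
    refine (EReal.coe_ennreal_le_coe_ennreal_iff.2 h1).trans_lt ?_
    rw [EReal.coe_ennreal_ofReal, max_eq_left (by positivity), EReal.coe_lt_coe_iff]
    have h2 : (B : ℝ) < 2 * A := by exact_mod_cast hBA
    push_cast
    linarith
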